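/- Theorem 2.4. Let $T$ be the triangular grid of unit equilateral triangles in the plane, with some grid lines horizontal, viewed as a $2$-dimensional simplicial complex; its edges are called panes. A generalized grid polygon is a finite simply connected homogeneous simplicial complex $X$ of dimension $2$ together with a simplicial map $f\colon X\to T$ such that (1) $X$ is a wedge of (triangulated closed) disks along boundary points; (2) $f$ maps each simplex to a simplex of the same dimension; (3) each interior vertex is contained in exactly six $2$-simplices; (4) each $1$-simplex not on the boundary is contained in exactly two $2$-simplices, whose images under $f$ form a diamond (two distinct unit triangles sharing a pane). Orient each boundary $1$-simplex so that, under $f$, the interior of the polygon is on its right. A boundary loop $(b_1,\ldots,b_n)$ is an enumeration of all the oriented boundary $1$-simplices, each exactly once, in which the head of $b_i$ is the tail of $b_{i+1}$ (indices modulo $n$); we also write $b_i$ for the unit vector that is the image of $b_i$. The billiards permutation $\pi$ of $[n]$ is defined as follows: from the midpoint of $b_i$ a beam is emitted into the interior which, viewed under $f$, forms a $60^\circ$ angle with $b_i$ and travels in one of the directions $60^\circ$, $180^\circ$, $300^\circ$; it continues through the interior, with straight image under $f$, until it hits the midpoint of another boundary $1$-simplex, which is $b_{\pi(i)}$. Let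 $P$ be a generalized grid polygon with boundary loop $(b_1,\ldots,b_n)$ and billiards permutation $\pi$, and let $c=(i_1\;\cdots\;i_k)$ be a cycle of $\pi$ that is not the only cycle of $\pi$. Let $j_1<\cdots<j_m$ be the elements of $[n]\setminus\{i_1,\ldots,i_k\}$. Then there is a generalized grid polygon, denoted $P-c$, with a boundary loop $(b'_1,\ldots,b'_m)$ such that $b'_l=b_{j_l}$ as vectors for every $l\in[m]$, and whose billiards permutation is the restriction of $\pi$ to $[n]\setminus\{i_1,\ldots,i_k\}$, that is, the permutation $\pi'$ of $[m]$ with $j_{\pi'(l)}=\pi(j_l)$ for every $l\in[m]$. -/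

import Mathlib

namespace GridBilliards

/-! ### The triangular grid

The grid point `(a, b) : ℤ × ℤ` stands for the point `a + b * exp (i π / 3)` of the plane.  The unit
vectors of the grid in the directions `0°, 60°, 120°, 180°, 240°, 300°` are therefore
`(1, 0), (0, 1), (-1, 1), (-1, 0), (0, -1), (1, -1)`. -/

/-- The triangular grid `T` as a simplicial complex.  The maximal simplices are the upward-pointing
unit triangles `x, x + (1, 0), x + (0, 1)` and the downward-pointing unit triangles
`x, x + (1, 0), x + (1, -1)`. -/
def triangularGrid : AbstractSimplicialComplex (ℤ × ℤ) where
  faces := {s | s.Nonempty ∧ ∃ x : ℤ × ℤ,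
    s ⊆ {x, x + (1, 0), x + (0, 1)} ∨ s ⊆ {x, x + (1, 0), x + (1, -1)}}
  isRelLowerSet_faces := by
    rintro s ⟨hs, x, hx⟩
    exact ⟨hs, fun t hts ht => ⟨ht, x, hx.imp hts.trans hts.trans⟩⟩
  singleton_mem v := ⟨Finset.singleton_nonempty v, v, Or.inl (by simp)⟩

/-- Clockwise rotation of a vector of the grid by `60°`. -/
def rotateCW (d : ℤ × ℤ) : ℤ × ℤ := (d.1 + d.2, -d.1)

/-- The directions `60°`, `180°`, `300°` of the light beams. -/
def beamDirections : Set (ℤ × ℤ) := {(0, 1), (-1, 0), (1, -1)}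

section Complex

variable {V : Type*} [DecidableEq V]

/-! ### Simplicial complexes

Subcomplexes of a complex on `V` are `PreAbstractSimplicialComplex`es on `V`; the vertices of such
a complex `K` are the `v` with `{v} ∈ K.faces`. -/

/-- The set of `2`-simplices of `K`. -/
def triangles (K : PreAbstractSimplicialComplex V) : Set (Finset V) :=
  {t | t ∈ K.faces ∧ t.card = 3}

/-- The set of `1`-simplices of `K`. -/
def edges (K : PreAbstractSimplicialComplex V) : Set (Finset V) :=
  {e | e ∈ K.faces ∧ e.card = 2}

/-- `K` is homogeneous of dimension `2`: it has a simplex, and every simplex is a face of a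
`2`-simplex. -/
def IsHomogeneousDimTwo (K : PreAbstractSimplicialComplex V) : Prop :=
  K.faces.Nonempty ∧ ∀ s ∈ K.faces, ∃ t ∈ triangles K, s ⊆ t

/-- Edge paths: sequences of vertices of `K` in which consecutive vertices lie in a common
simplex. -/
def IsEdgePath (K : PreAbstractSimplicialComplex V) (p : List V) : Prop :=
  p.IsChain fun u v => ({u, v} : Finset V) ∈ K.faces

/-- Elementary homotopies of edge paths: `…, u, v, w, …` is replaced by `…, u, w, …` when `u, v, w`
(not necessarily distinct) are the vertices of a simplex. -/
inductive EdgePathMove (K : PreAbstractSimplicialComplex V) : List V → List V → Prop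
  | mk (p q : List V) (u v w : V) (h : ({u, v, w} : Finset V) ∈ K.faces) :
      EdgePathMove K (p ++ u :: v :: w :: q) (p ++ u :: w :: q)

/-- `K` is simply connected: it is nonempty and connected and its edge path group at every vertex
is trivial. -/
structure IsSimplyConnected (K : PreAbstractSimplicialComplex V) : Prop where
  nonempty : ∃ v, {v} ∈ K.faces
  connected : ∀ u v, {u} ∈ K.faces → {v} ∈ K.faces → ∃ l, IsEdgePath K (u :: (l ++ [v]))
  null_homotopic : ∀ v l, IsEdgePath K (v :: (l ++ [v])) →
    Relation.EqvGen (EdgePathMove K) (v :: (l ++ [v])) [v, v]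

/-- A `1`-simplex is on the boundary if it is contained in exactly one `2`-simplex. -/
def IsBoundaryEdge (K : PreAbstractSimplicialComplex V) (e : Finset V) : Prop :=
  e ∈ edges K ∧ ∃! t, t ∈ triangles K ∧ e ⊆ t

/-- A vertex is on the boundary if it is an endpoint of a `1`-simplex on the boundary. -/
def IsBoundaryVertex (K : PreAbstractSimplicialComplex V) (v : V) : Prop :=
  ∃ e, IsBoundaryEdge K e ∧ v ∈ e

/-- `K` is a triangulated closed disk: a finite simply connected triangulated surface with
nonempty boundary.  That `K` is a triangulated surface (possibly with boundary) means that every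
`1`-simplex lies in at most two `2`-simplices and that the link of every vertex is connected, so
that every link is a path (at a boundary point) or a cycle (at an interior point). -/
structure IsDisk (K : PreAbstractSimplicialComplex V) : Prop where
  finite : K.faces.Finite
  homogeneous : IsHomogeneousDimTwo K
  edge_le_two : ∀ e ∈ edges K, {t | t ∈ triangles K ∧ e ⊆ t}.encard ≤ 2
  link_connected : ∀ v a b, {v, a} ∈ edges K → {v, b} ∈ edges K →
    Relation.ReflTransGen (fun x y => {v, x, y} ∈ triangles K) a b
  simply_connected : IsSimplyConnected K
  boundary_nonempty : ∃ e, IsBoundaryEdge K e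

/-- Wedges of disks along boundary points: disks, and unions of two wedges of disks that have
exactly one vertex in common, which is a boundary vertex of both, and no other simplex. -/
inductive IsWedgeOfDisks : PreAbstractSimplicialComplex V → Prop
  | disk (K : PreAbstractSimplicialComplex V) (hK : IsDisk K) : IsWedgeOfDisks K
  | wedge (K L : PreAbstractSimplicialComplex V) (x : V)
      (hK : IsWedgeOfDisks K) (hL : IsWedgeOfDisks L) (hKL : K.faces ∩ L.faces = {{x}})
      (hxK : IsBoundaryVertex K x) (hxL : IsBoundaryVertex L x) : IsWedgeOfDisks (K ⊔ L)

end Complex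

/-! ### Generalized grid polygons -/

/-- A generalized grid polygon with vertex set `V`: a finite simply connected homogeneous simplicial
complex of dimension `2`, which is a wedge of disks along boundary points, with a simplicial map to
the triangular grid. -/
structure GeneralizedGridPolygon (V : Type*) [DecidableEq V] where
  /-- the simplicial complex -/
  complex : AbstractSimplicialComplex V
  /-- the map to the triangular grid -/
  toGrid : V → ℤ × ℤ
  finite : Finite V
  homogeneous : IsHomogeneousDimTwo complex.toPreAbstractSimplicialComplex
  simply_connected : IsSimplyConnected complex.toPreAbstractSimplicialComplex
  wedge_of_disks : IsWedgeOfDisks complex.toPreAbstractSimplicialComplex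
  /-- simplices are mapped to simplices of the same dimension -/
  map_simplex : ∀ s ∈ complex.faces,
    s.image toGrid ∈ triangularGrid.faces ∧ (s.image toGrid).card = s.card
  /-- each interior vertex is contained in exactly six `2`-simplices -/
  interior_vertex : ∀ v, ¬ IsBoundaryVertex complex.toPreAbstractSimplicialComplex v →
    {t | t ∈ triangles complex.toPreAbstractSimplicialComplex ∧ v ∈ t}.encard = 6
  /-- each interior `1`-simplex is contained in exactly two `2`-simplices, whose images form a
  diamond (they share a pane, and have four vertices altogether) -/
  interior_edge : ∀ e ∈ edges complex.toPreAbstractSimplicialComplex,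
    ¬ IsBoundaryEdge complex.toPreAbstractSimplicialComplex e →
    ∃ s t, s ≠ t ∧
      {r | r ∈ triangles complex.toPreAbstractSimplicialComplex ∧ e ⊆ r} = {s, t} ∧
      (s.image toGrid ∪ t.image toGrid).card = 4

namespace GeneralizedGridPolygon

variable {V : Type*} [DecidableEq V] (P : GeneralizedGridPolygon V)

/-- The set of `2`-simplices of a generalized grid polygon. -/
def triangles : Set (Finset V) :=
  GridBilliards.triangles P.complex.toPreAbstractSimplicialComplex

/-- The set of `1`-simplices of a generalized grid polygon. -/
def edges : Set (Finset V) :=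
  GridBilliards.edges P.complex.toPreAbstractSimplicialComplex

/-- The `1`-simplices on the boundary of a generalized grid polygon. -/
def IsBoundaryEdge (e : Finset V) : Prop :=
  GridBilliards.IsBoundaryEdge P.complex.toPreAbstractSimplicialComplex e

/-- The vector from the image of the vertex `u` to the image of the vertex `v`. -/
def vec (u v : V) : ℤ × ℤ := P.toGrid v - P.toGrid u

/-- `u, v` are the tail and the head of a `1`-simplex on the boundary, oriented so that the interior
of the polygon is on its right side: the third vertex `w` of the adjacent `2`-simplex is mapped to
the third vertex of the unit triangle on the right of the pane from the image of `u` to the image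
of `v`. -/
def IsBoundaryPane (u v : V) : Prop :=
  P.IsBoundaryEdge {u, v} ∧ ∃ w, {u, v, w} ∈ P.triangles ∧ P.vec u w = rotateCW (P.vec u v)

/-- `x` is the sequence of tails `x 0, …, x (n - 1)` of a boundary loop `(b₁, …, bₙ)` of `P`.  The
`i`-th boundary pane goes from `x i` to `x (i + 1)`, with `i + 1` taken modulo `n`, so that the head
of each boundary pane is the tail of the next one, and each `1`-simplex on the boundary of `P`,
oriented with the interior on its right side, occurs exactly once. -/
def IsBoundaryLoop {n : ℕ} (x : Fin n → V) : Prop :=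
  (∀ i, P.IsBoundaryPane (x i) (x (finRotate n i))) ∧
    ∀ u v, P.IsBoundaryPane u v → ∃! i, x i = u ∧ x (finRotate n i) = v

/-- Twice the midpoint of the image of a `1`-simplex. -/
def twiceMidpoint (e : Finset V) : ℤ × ℤ := ∑ v ∈ e, P.toGrid v

/-- A beam in direction `d` crosses a `2`-simplex, entering through the midpoint of its side `e` and
leaving through the midpoint of its side `e'`: the image of the beam inside the `2`-simplex is the
segment between these midpoints, which has length `1 / 2` and direction `d`. -/
def CrossesTriangle (d : ℤ × ℤ) (e e' : Finset V) : Prop :=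
  e ∈ P.edges ∧ e' ∈ P.edges ∧ (∃ t ∈ P.triangles, e ⊆ t ∧ e' ⊆ t) ∧
    P.twiceMidpoint e' - P.twiceMidpoint e = d

/-- The beam emitted from the midpoint of `e` in direction `d` reaches the midpoint of `e'`.  On its
way it passes only through `1`-simplices that are not on the boundary. -/
inductive Beam (d : ℤ × ℤ) (e : Finset V) : Finset V → Prop
  | start (e' : Finset V) (h : P.CrossesTriangle d e e') : Beam d e e'
  | next (e' e'' : Finset V) (h : Beam d e e') (hb : ¬ P.IsBoundaryEdge e')
      (h' : P.CrossesTriangle d e' e'') : Beam d e e''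

/-- The light emitted into the interior of `P` from the midpoint of the boundary `1`-simplex `e`, in
one of the directions `60°`, `180°`, `300°` and at an angle of `60°` with `e`, hits the boundary at
the midpoint of the `1`-simplex `e'`. -/
def LightHits (e e' : Finset V) : Prop :=
  P.IsBoundaryEdge e ∧ P.IsBoundaryEdge e' ∧ ∃ d ∈ beamDirections, P.Beam d e e'

/-- `π` is the billiards permutation of `P` with respect to the boundary loop `x`: the light from
the `i`-th boundary pane hits the `π i`-th boundary pane. -/
def IsBilliardsPermutation {n : ℕ} (x : Fin n → V) (π : Equiv.Perm (Fin n)) : Prop :=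
  ∀ i, P.LightHits {x i, x (finRotate n i)} {x (π i), x (finRotate n (π i))}

end GeneralizedGridPolygon

end GridBilliards

/-! ### Chord diagrams: axioms and innermost chords. -/

namespace GridBilliards

/-! Unroll the boundary loop to the integers, with period `n`, and lift the directions of the panes
(in units of `60°`) to integers `θ l` with `θ (l + n) = θ l - 6`. A beam becomes a chord `l ↦ π l`
with `l < π l < l + n`. The level `θ l / 2` fixes its direction `2 * (θ l / 2) - 1`; the pane it
hits, reversed, has the same level; and when two chords cross, the later one has level one less.
These conditions (`IsChordDiagram`) speak only of single chords and pairs of chords, so they survive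
the deletion of a cycle of `π` (`IsChordDiagram.restrict`). What remains is to pass from polygons to
chord diagrams and back.

Both passages go through a `Sheet`, a flat triangulated surface that may have pendant edges,
together with its closed boundary walk (`IsDiagram`). Both are inductions whose step attaches or
removes an ear: a vertex visited once by the walk, with zero, one or two triangles. On the chord
diagram this inserts two adjacent panes hitting each other, splits a pane, or interchanges two
adjacent panes.

From polygons to chords: the lift `θ` exists because the total turning is one full turn. This is a
discrete Gauss–Bonnet theorem (`Sheet.IsFlat.sum_deg`), resting on Euler characteristic one, which
is computed by cohomology over `ZMod 2` (`IsSimplyConnected.euler`). Summing the angle relation over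
all vertices also yields a tip to remove (`IsDiagram.exists_tip`), and
`IsDiagram.exists_chordDiagram` follows by induction on the number of vertices.

From chords to sheets: a chord that is shortest on one of its sides is innermost there, and next to
it one of the three moves can be undone (`IsChordDiagram.exists_peel`). The combinatorial core is
`IsChordDiagram.not_separated`, which determines how the two beams at a pane of odd direction lie.
The resulting `IsChordDiagram.induction_on` is turned into geometry by `IsChordDiagram.realize`,
each ear preserving simple connectivity.

From sheets to polygons: a pendant edge would give two panes whose beams hit each other. No beam of
the given polygon is sent back along itself (`GeneralizedGridPolygon.not_lightHits_symm`), so the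
new sheet is pure (`IsDiagram.isPure`). Splitting at vertices with disconnected link makes its
complex a wedge of disks (`IsPlanar.isWedgeOfDisks`). The boundary vectors persist because `θ` is
kept, and the permutation because the chords are. -/

/-- Combinatorial data of the light beams of a grid polygon.  The boundary panes are indexed by the
`N`-periodic set `S`; the pane `l` has direction `θ l` (in units of `60°`, lifted to `ℤ`), and its
beam hits the pane `π l`. -/
structure IsChordDiagram (N : ℤ) (S : Set ℤ) (θ π : ℤ → ℤ) : Prop where
  pos : 0 < N
  mem_add : ∀ l, l + N ∈ S ↔ l ∈ S
  dir_add : ∀ l ∈ S, θ (l + N) = θ l - 6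
  map_add : ∀ l ∈ S, π (l + N) = π l + N
  map_mem : ∀ l ∈ S, π l ∈ S
  inj : ∀ l ∈ S, ∀ m ∈ S, π l = π m → l = m
  surj : ∀ l ∈ S, ∃ m ∈ S, π m = l
  lt_map : ∀ l ∈ S, l < π l
  map_lt : ∀ l ∈ S, π l < l + N
  -- The reversed target pane has direction `θ (π l) + 3`; this says that its half, rounded down, is
  -- again `θ l / 2`. It is an equality of integers, finer than equality of directions modulo `6`.
  level : ∀ l ∈ S, (θ (π l) + 1) / 2 = θ l / 2 - 1
  cross : ∀ i ∈ S, ∀ j ∈ S, i < j → j < π i → π i < π j → π j < i + N → θ j / 2 = θ i / 2 - 1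

namespace IsChordDiagram

variable {N : ℤ} {S : Set ℤ} {θ π : ℤ → ℤ}

open Classical in
/-- The chords that leave an initial segment of a window, given that some chord enters it from the
rest of the window. -/
lemma exists_leaving (h : IsChordDiagram N S θ π) {c y : ℤ} (hy : y < c + N)
    (hin : ∃ l ∈ S, y < l ∧ l < c + N ∧ c + N ≤ π l ∧ π l ≤ y + N) :
    ∃ l ∈ S, c ≤ l ∧ l ≤ y ∧ y < π l ∧ π l < c + N := by
  by_contra! hcon
  -- If no chord leaves `[c, y]`, then `π`, reduced into the window, maps the finite set `L`
  -- injectively to itself, hence onto. But the entering chord already occupies a target in `L` and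
  -- starts outside.
  let L := (Finset.Icc c y).filter (· ∈ S)
  let g : ℤ → ℤ := fun l => if π l ≤ y then π l else π l - N
  have hmaps : ∀ l ∈ L, g l ∈ L := by
    intro l hl
    simp only [L, Finset.mem_filter, Finset.mem_Icc] at hl ⊢
    obtain ⟨⟨h1, h2⟩, hS⟩ := hl
    have h3 := h.lt_map l hS
    have h4 := h.map_lt l hS
    have h5 := h.map_mem l hS
    simp only [g]
    split_ifs with h6
    · exact ⟨⟨by omega, h6⟩, h5⟩
    · have := hcon l hS h1 h2 (by omega)
      refine ⟨⟨by omega, by omega⟩, ?_⟩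
      rw [← h.mem_add]; simpa using h5
  -- Here `m` ranges over the whole window, so that the source of the entering chord can be compared
  -- with a source in `L`.
  have hinj : ∀ l ∈ L, ∀ m ∈ S, c ≤ m → m < c + N → (g l = π m ∨ g l = π m - N) → l = m := by
    intro l hl m hm hm1 hm2 hg
    simp only [L, Finset.mem_filter, Finset.mem_Icc] at hl
    obtain ⟨⟨h1, h2⟩, hS⟩ := hl
    have e0 := h.map_add l hS
    have e1 := h.map_add m hm
    have a1 := (h.mem_add l).2 hS
    have a2 := (h.mem_add m).2 hm
    have h3 := h.lt_map l hS
    have h4 := h.map_lt l hS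
    have h5 := h.lt_map m hm
    have h6 := h.map_lt m hm
    have k0 := h.inj l hS m hm
    have k1 := h.inj (l + N) a1 m hm
    have k2 := h.inj l hS (m + N) a2
    have := h.pos
    simp only [g] at hg
    split_ifs at hg with h7
    · rcases hg with hg | hg
      · exact k0 hg
      · have := k1 (by omega); omega
    · rcases hg with hg | hg
      · have := k2 (by omega); omega
      · exact k0 (by omega)
  have hsurj := Finset.surj_on_of_inj_on_of_card_le (s := L) (t := L) (fun l _ => g l)
    (fun l hl => hmaps l hl) (by
      intro l m hl hm hlm
      have hm' := hm
      simp only [L, Finset.mem_filter, Finset.mem_Icc] at hm'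
      refine hinj l hl m hm'.2 (by omega) (by omega) ?_
      rw [show g l = g m from hlm]
      simp only [g]
      split_ifs <;> simp) le_rfl
  obtain ⟨r, hr, h1, h2, h3, h4⟩ := hin
  have hrL : π r - N ∈ L := by
    simp only [L, Finset.mem_filter, Finset.mem_Icc]
    refine ⟨⟨by omega, by omega⟩, ?_⟩
    rw [← h.mem_add]; simpa using h.map_mem r hr
  obtain ⟨l, hl, hlr⟩ := hsurj _ hrL
  have hl' := hl
  simp only [L, Finset.mem_filter, Finset.mem_Icc] at hl'
  have := hinj l hl r hr (by omega) h2 (Or.inr hlr.symm)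
  omega

/-- There is no window `[c, c + N)` with an initial segment `[c, y]` and a final segment
`[w, c + N)` such that some chord goes from the final to the initial segment, none goes directly
from the initial to the final one, and the chords from the initial segment to the middle have lower
levels than those from the middle to the final segment. -/
lemma not_separated (h : IsChordDiagram N S θ π) (c t : ℤ) (n : ℕ) : ∀ y w : ℤ, w - y ≤ n →
    c ≤ y → y < w → w < c + N →
    (∃ l ∈ S, w ≤ l ∧ l < c + N ∧ c + N ≤ π l ∧ π l ≤ y + N) →
    (∀ l ∈ S, c ≤ l → l ≤ y → w ≤ π l → π l < c + N → False) →
    (∀ l ∈ S, c ≤ l → l ≤ y → y < π l → π l < w → θ l / 2 ≤ t) →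
    (∀ l ∈ S, y < l → l < w → w ≤ π l → π l < c + N → t < θ l / 2) → False := by
  induction n with
  | zero => intro y w h1 h2 h3; omega
  | succ n ih =>
    intro y w hn hc hyw hw hRL hLR hLM hMR
    obtain ⟨r, hr, r1, r2, r3, r4⟩ := hRL
    -- The chord from the final to the initial segment forces compensating chords: `u` leaves the
    -- initial segment and `v` enters the final one. As nothing goes directly, `u` ends and `v`
    -- starts in the middle.
    obtain ⟨u, hu, u1, u2, u3, u4⟩ := h.exists_leaving (c := c) (y := y) (by omega)
      ⟨r, hr, by omega, r2, r3, r4⟩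
    obtain ⟨v, hv, v1, v2, v3, v4⟩ := h.exists_leaving (c := c) (y := w - 1) (by omega)
      ⟨r, hr, by omega, r2, r3, by omega⟩
    have u5 : π u < w := by by_contra; exact hLR u hu u1 u2 (by omega) u4
    have v5 : y < v := by by_contra; exact hLR v hv v1 (by omega) (by omega) v4
    have u6 := hLM u hu u1 u2 u3 u5
    have v6 := hMR v hv v5 (by omega) (by omega) v4
    have u7 := h.level u hu
    have v7 := h.level v hv
    -- Otherwise `u` ends where `v` starts, or the two cross; either way `v` would have lower level
    -- than `u`, against the separation by `t`.
    have hlt : π u < v := by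
      by_contra! hcon
      rcases hcon.eq_or_lt with he | hlt
      · rw [← he] at u7; omega
      · have := h.cross u hu v hv (by omega) hlt (by omega) (by omega)
        omega
    have key : ∀ l ∈ S, y < l → l ≤ π u → π u < π l → π l < c + N → θ l / 2 < t := by
      intro l hl l1 l2 l3 l4
      rcases l2.eq_or_lt with he | hlt'
      · rw [← he] at u7; omega
      · have := h.cross u hu l hl (by omega) hlt' l3 (by omega)
        omega
    have key' : ∀ l ∈ S, c ≤ l → l < v → v ≤ π l → π l < w → t < θ l / 2 := by
      intro l hl l1 l2 l3 l4
      have l7 := h.level l hl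
      rcases l3.eq_or_lt with he | hlt'
      · rw [← he] at l7; omega
      · have := h.cross l hl v hv l2 hlt' (by omega) (by omega)
        omega
    -- Enlarging the initial segment to `π u` and the final one to `v` shrinks the middle and
    -- preserves all hypotheses: chords passing `π u` from the new initial part have level below
    -- `t`, by crossing `u`, and those passing `v` into the new final part have level above `t`, by
    -- crossing `v`.
    refine ih (π u) v (by omega) (by omega) hlt (by omega)
      ⟨r, hr, by omega, r2, r3, by omega⟩ ?_ ?_ ?_
    · intro l hl l1 l2 l3 l4
      by_cases ly : l ≤ y
      · by_cases lw : π l < w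
        · have := hLM l hl l1 ly (by omega) lw
          have := key' l hl l1 (by omega) l3 lw
          omega
        · exact hLR l hl l1 ly (by omega) l4
      · have a := key l hl (by omega) l2 (by omega) l4
        by_cases lw : π l < w
        · have := key' l hl l1 (by omega) l3 lw
          omega
        · have := hMR l hl (by omega) (by omega) (by omega) l4
          omega
    · intro l hl l1 l2 l3 l4
      by_cases ly : l ≤ y
      · exact hLM l hl l1 ly (by omega) (by omega)
      · have := key l hl (by omega) l2 l3 (by omega)
        omega
    · intro l hl l1 l2 l3 l4
      by_cases lw : π l < w
      · exact key' l hl (by omega) l2 l3 lw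
      · exact hMR l hl (by omega) (by omega) (by omega) l4

/-- At a pane of odd direction the incoming beam comes from the left of the outgoing beam. -/
lemma le_map_of_odd (h : IsChordDiagram N S θ π) {j m : ℤ} (hj : j ∈ S) (hm : m ∈ S)
    (hodd : θ j % 2 = 1) (hmj : π m = j + N) : m ≤ π j := by
  by_contra! hlt
  have e1 := h.level j hj
  have e2 := h.level m hm
  have e3 := h.lt_map j hj
  have e4 := h.lt_map m hm
  rw [hmj, h.dir_add j hj] at e2
  have hq : ∀ u ∈ S, j ≤ u → u ≤ π j → π j < π u → π u < j + N → θ u / 2 ≤ θ j / 2 - 1 := by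
    intro u hu u1 u2 u3 u4
    rcases u2.eq_or_lt with he | u5
    · rw [← he] at e1; omega
    · rcases u1.eq_or_lt with he | u6
      · rw [he] at u3; omega
      · exact (h.cross j hj u hu u6 u5 u3 u4).le
  -- Oddness enters here: it makes the level of `m` equal to `θ j / 2 - 1`, so that whatever crosses
  -- `m` from before lies strictly above that value, while whatever crosses the chord of `j` lies at
  -- or below it.
  have hm' : ∀ u ∈ S, j ≤ u → u < m → m ≤ π u → π u < j + N → θ j / 2 - 1 < θ u / 2 := by
    intro u hu u0 u1 u2 u3
    have e5 := h.level u hu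
    rcases u2.eq_or_lt with he | u5
    · rw [← he] at e5; omega
    · have := h.cross u hu m hm u1 u5 (by omega) (by
        rcases u0.eq_or_lt with he | u6
        · rw [← he] at u2; omega
        · omega)
      omega
  refine h.not_separated j (θ j / 2 - 1) (m - π j).toNat (π j) m (by omega) (by omega) hlt
    (by omega) ⟨m, hm, le_rfl, by omega, by omega, by omega⟩ ?_ ?_ ?_
  · intro l hl l1 l2 l3 l4
    have := hq l hl l1 l2 (by omega) l4
    have := hm' l hl l1 (by omega) l3 l4
    omega
  · intro l hl l1 l2 l3 l4
    exact hq l hl l1 l2 (by omega) (by omega)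
  · intro l hl l1 l2 l3 l4
    exact hm' l hl (by omega) l2 l3 l4

/-- `j` is the element of `S` following `i`. -/
def IsNext (S : Set ℤ) (i j : ℤ) : Prop := j ∈ S ∧ i < j ∧ ∀ x ∈ S, i < x → j ≤ x

lemma exists_isNext (h : IsChordDiagram N S θ π) {i : ℤ} (hi : i ∈ S) : ∃ j, IsNext S i j := by
  obtain ⟨j, ⟨h1, h2⟩, h3⟩ := Int.exists_least_of_bdd (P := fun x => x ∈ S ∧ i < x)
    ⟨i, fun z hz => hz.2.le⟩ ⟨i + N, (h.mem_add i).2 hi, by have := h.pos; omega⟩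
  exact ⟨j, h1, h2, fun x hx hix => h3 x ⟨hx, hix⟩⟩

/-- No chord has both ends on the left side of the chord `i`. -/
def IsInnermost (N : ℤ) (S : Set ℤ) (π : ℤ → ℤ) (i : ℤ) : Prop :=
  ∀ x ∈ S, i < x → x < π i → π i < π x ∧ π x ≤ i + N

/-- The level of the incoming beam at a pane on the left of an innermost chord. -/
lemma level_of_isInnermost (h : IsChordDiagram N S θ π) {i : ℤ} (hi : i ∈ S)
    (hin : IsInnermost N S π i) {x : ℤ} (hx : x ∈ S) (hix : i < x) (hxi : x < π i) :
    (θ x + 1) / 2 = θ i / 2 ∨ (θ x + 1) / 2 = θ (π i) / 2 + 2 := by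
  obtain ⟨k, hk, hkx⟩ := h.surj x hx
  have k1 := h.lt_map k hk
  have k2 := h.map_lt k hk
  have k3 := h.map_add k hk
  have k4 := (h.mem_add k).2 hk
  have k5 := h.level k hk
  have k6 := h.dir_add k hk
  have i2 := h.map_lt i hi
  rw [hkx] at k5
  by_cases c1 : i ≤ k
  · rcases c1.eq_or_lt with he | c1
    · rw [← he] at hkx; omega
    · have := hin k hk c1 (by omega); omega
  · by_cases c2 : k + N < π i
    · have := hin (k + N) k4 (by omega) c2; omega
    · rcases (not_lt.1 c2).eq_or_lt with he | c3
      · right; rw [he, k6]; omega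
      · left
        have := h.cross k hk i hi (by omega) (by omega) (by omega) (by omega)
        omega

/-- The possible shapes of the boundary next to an innermost chord. -/
lemma exists_peel (h : IsChordDiagram N S θ π) {i : ℤ} (hi : i ∈ S)
    (hin : IsInnermost N S π i) : ∃ j, IsNext S i j ∧ j < i + N ∧
      ((θ i % 2 = 0 ∧ π i = j ∧ θ j = θ i - 2) ∨
      (π i = j ∧ π j = i + N ∧ θ j = θ i - 3) ∨
      (θ i % 2 = 0 ∧ j < π i ∧ θ j = θ i - 1 ∧ π i < π j ∧ π j < i + N ∧
        ∀ m ∈ S, i < m → m < π i → π m ≠ i + N) ∨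
      (θ i % 2 = 1 ∧ j < π i ∧ θ j = θ i - 2 ∧ π j = i + N)) := by
  obtain ⟨j, hj⟩ := h.exists_isNext hi
  obtain ⟨hjS, hij, hnext⟩ := id hj
  have i1 := h.lt_map i hi
  have i2 := h.map_lt i hi
  have i3 := h.map_mem i hi
  have i4 := h.level i hi
  have i5 := (h.mem_add i).2 hi
  have i6 := h.dir_add i hi
  have jp : j ≤ π i := hnext _ i3 i1
  refine ⟨j, hj, by omega, ?_⟩
  -- In the order of the statement, the corner between `i` and `j` will hold one, zero, two and one
  -- triangles. If `j = π i`, an odd direction at `i` or `j` makes `le_map_of_odd` force the return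
  -- chord `π j = i + N`. If `j < π i`, the levels of the beams leaving and reaching `j` pin down `θ
  -- j`.
  rcases jp.eq_or_lt with he | jp
  · rw [← he] at i4
    rcases Int.emod_two_eq_zero_or_one (θ i) with par | par
    · rcases Int.emod_two_eq_zero_or_one (θ j) with par' | par'
      · left; exact ⟨par, he.symm, by omega⟩
      · right; left
        have a := h.le_map_of_odd (j := j) (m := i + N) hjS i5 par' (by rw [h.map_add i hi, he])
        have b := h.map_lt j hjS
        have c : π j = i + N := by
          by_contra hne
          have := hnext (π j - N) (by rw [← h.mem_add]; simpa using h.map_mem j hjS) (by omega)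
          omega
        have d := h.level j hjS
        rw [c, i6] at d
        exact ⟨he.symm, c, by omega⟩
    · right; left
      obtain ⟨m, hm, hmi⟩ := h.surj (i + N) i5
      have m1 := h.lt_map m hm
      have m2 := h.map_lt m hm
      have a := h.le_map_of_odd hi hm par hmi
      have b := hnext m hm (by omega)
      have c : m = j := by omega
      subst c
      have d := h.level m hm
      rw [hmi, i6] at d
      exact ⟨he.symm, hmi, by omega⟩
  · right; right
    have key : ∀ x ∈ S, i < x → x < π i → π x ≠ i + N → θ x / 2 = θ i / 2 - 1 := by
      intro x hx x1 x2 x3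
      have := hin x hx x1 x2
      exact h.cross i hi x hx x1 x2 this.1 (by omega)
    have lev := h.level_of_isInnermost hi hin hjS hij jp
    rcases Int.emod_two_eq_zero_or_one (θ i) with par | par
    · left
      have nok : ∀ m ∈ S, i < m → m < π i → π m ≠ i + N := by
        intro m hm m1 m2 hmi
        have a := h.level m hm
        have b := h.level_of_isInnermost hi hin hm m1 m2
        rw [hmi, i6] at a
        omega
      have b := nok j hjS hij jp
      have a := key j hjS hij jp b
      have c := hin j hjS hij jp
      exact ⟨par, jp, by omega, c.1, by omega, nok⟩
    · right
      obtain ⟨m, hm, hmi⟩ := h.surj (i + N) i5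
      have m1 := h.lt_map m hm
      have m2 := h.map_lt m hm
      have m3 := h.level m hm
      have a := h.le_map_of_odd hi hm par hmi
      have m4 := hnext m hm (by omega)
      have jin := hin j hjS hij jp
      rw [hmi, i6] at m3
      rcases m4.eq_or_lt with he | m5
      · subst he
        exact ⟨par, jp, by omega, hmi⟩
      · exfalso
        have nj : π j ≠ i + N := fun e => by
          have := h.inj j hjS m hm (by omega); omega
        have jl := key j hjS hij jp nj
        have := h.cross j hjS m hm m5 (by omega) (by omega) (by omega)
        omega

end IsChordDiagram
end GridBilliards

/-! ### Moves that simplify a chord diagram. -/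

namespace GridBilliards

namespace IsChordDiagram

variable {N : ℤ} {S : Set ℤ} {θ π : ℤ → ℤ}

/-- The axioms constrain at most two chords at a time, and only surjectivity asks for an element,
which invariance supplies. This is where a cycle of the billiards permutation gets deleted. -/
lemma restrict (h : IsChordDiagram N S θ π) {S' : Set ℤ} (hS : S' ⊆ S)
    (hadd : ∀ l, l + N ∈ S' ↔ l ∈ S') (hmap : ∀ l ∈ S, π l ∈ S' ↔ l ∈ S') :
    IsChordDiagram N S' θ π where
  pos := h.pos
  mem_add := hadd
  dir_add l hl := h.dir_add l (hS hl)
  map_add l hl := h.map_add l (hS hl)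
  map_mem l hl := (hmap l (hS hl)).2 hl
  inj l hl m hm := h.inj l (hS hl) m (hS hm)
  surj l hl := by
    obtain ⟨m, hm, rfl⟩ := h.surj l (hS hl)
    exact ⟨m, (hmap m hm).1 hl, rfl⟩
  lt_map l hl := h.lt_map l (hS hl)
  map_lt l hl := h.map_lt l (hS hl)
  level l hl := h.level l (hS hl)
  cross i hi j hj := h.cross i (hS hi) j (hS hj)

/-- Rotating the grid by `180°` and reversing the beams. -/
lemma exists_reverse (h : IsChordDiagram N S θ π) : ∃ g : ℤ → ℤ,
    (∀ l ∈ S, g (π l) = l + N) ∧ (∀ l ∈ S, g l - N ∈ S ∧ π (g l - N) = l) ∧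
    IsChordDiagram N S (fun l => θ l + 3) g := by
  choose! g0 hg0 hg1 using h.surj
  have e1 : ∀ l ∈ S, g0 (π l) = l := fun l hl =>
    h.inj _ (hg0 _ (h.map_mem l hl)) _ hl (hg1 _ (h.map_mem l hl))
  have e2 : ∀ l ∈ S, g0 (l + N) = g0 l + N := fun l hl => by
    apply h.inj _ (hg0 _ ((h.mem_add l).2 hl)) _ ((h.mem_add _).2 (hg0 l hl))
    rw [hg1 _ ((h.mem_add l).2 hl), h.map_add _ (hg0 l hl), hg1 l hl]
  have lt1 : ∀ l ∈ S, g0 l < l := fun l hl => by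
    have := h.lt_map _ (hg0 l hl); rwa [hg1 l hl] at this
  have lt2 : ∀ l ∈ S, l < g0 l + N := fun l hl => by
    have := h.map_lt _ (hg0 l hl); rwa [hg1 l hl] at this
  -- The inverse of `π` points backwards; adding a period makes its chords point forwards again. The
  -- shift of `θ` by `3` is the rotation by `180°`.
  refine ⟨fun l => g0 l + N, fun l hl => by simp [e1 l hl], fun l hl => by
    simpa using ⟨hg0 l hl, hg1 l hl⟩, ?_⟩
  exact {
    pos := h.pos
    mem_add := h.mem_add
    dir_add l hl := by simp only [h.dir_add l hl]; ring
    map_add l hl := by simp [e2 l hl]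
    map_mem l hl := (h.mem_add _).2 (hg0 l hl)
    inj l hl m hm hlm := by
      have : g0 l = g0 m := by simpa using hlm
      rw [← hg1 l hl, this, hg1 m hm]
    surj l hl := ⟨π l - N, by rw [← h.mem_add]; simpa using h.map_mem l hl, by
      have := e2 (π l - N) (by rw [← h.mem_add]; simpa using h.map_mem l hl)
      simp only [sub_add_cancel, e1 l hl] at this
      exact this.symm⟩
    lt_map := lt2
    map_lt l hl := by have := lt1 l hl; omega
    level l hl := by
      have a := h.level _ (hg0 l hl)
      have b := h.dir_add _ (hg0 l hl)
      rw [hg1 l hl] at a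
      simp only [b]; omega
    cross i hi j hj hij h1 h2 h3 := by
      have a := lt1 i hi
      have b := lt1 j hj
      have := h.cross _ (hg0 i hi) _ (hg0 j hj) (by omega) (by rw [hg1 i hi]; omega)
        (by rw [hg1 i hi, hg1 j hj]; omega) (by rw [hg1 j hj]; omega)
      have a := h.level _ (hg0 i hi)
      have b := h.level _ (hg0 j hj)
      rw [hg1 i hi] at a
      rw [hg1 j hj] at b
      omega }

/-- The translates of `i` by multiples of `N`. -/
def Cls (N i l : ℤ) : Prop := ∃ t : ℤ, l = i + t * N

lemma cls_self (N i : ℤ) : Cls N i i := ⟨0, by simp⟩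

lemma cls_add {i l : ℤ} : Cls N i (l + N) ↔ Cls N i l :=
  ⟨fun ⟨t, ht⟩ => ⟨t - 1, by linear_combination ht⟩, fun ⟨t, ht⟩ => ⟨t + 1, by linear_combination ht⟩⟩

lemma cls_eq {i a b : ℤ} (ha : Cls N i a) (hb : Cls N i b) (h1 : a - b < N)
    (h2 : b - a < N) : a = b := by
  obtain ⟨t, rfl⟩ := ha
  obtain ⟨u, rfl⟩ := hb
  have h3 : (t - u) * N < 1 * N := by linarith
  have h4 : (u - t) * N < 1 * N := by linarith
  have hN : 0 < N := by linarith
  have h5 := lt_of_mul_lt_mul_right h3 hN.le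
  have h6 := lt_of_mul_lt_mul_right h4 hN.le
  have : t = u := by omega
  rw [this]

lemma add_mul (h : IsChordDiagram N S θ π) {l : ℤ} (hl : l ∈ S) (t : ℤ) :
    l + t * N ∈ S ∧ π (l + t * N) = π l + t * N ∧ θ (l + t * N) = θ l - 6 * t := by
  induction t using Int.induction_on with
  | zero => simpa using hl
  | succ t ih =>
    have e : l + ((t : ℤ) + 1) * N = (l + t * N) + N := by ring
    rw [e, h.mem_add, h.map_add _ ih.1, h.dir_add _ ih.1, ih.2.1, ih.2.2]
    exact ⟨ih.1, by ring, by ring⟩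
  | pred t ih =>
    have e : l + (-(t : ℤ) - 1) * N + N = l + (-t) * N := by ring
    have m : l + (-(t : ℤ) - 1) * N ∈ S := by rw [← h.mem_add, e]; exact ih.1
    have a := h.map_add _ m
    have b := h.dir_add _ m
    rw [e, ih.2.1] at a
    rw [e, ih.2.2] at b
    exact ⟨m, by linear_combination -a, by linear_combination -b⟩

/-- By periodicity all that is known about the adjacent pair `i`, `j` holds for each translate of
the pair, including that no pane lies strictly in between. -/
lemma cls_facts (h : IsChordDiagram N S θ π) {i j : ℤ} (hi : i ∈ S) (hij : IsNext S i j) {a : ℤ}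
    (ha : Cls N i a) : a ∈ S ∧ a + (j - i) ∈ S ∧ π a = π i + (a - i) ∧
      π (a + (j - i)) = π j + (a - i) ∧ (∃ t, θ a = θ i - 6 * t ∧ θ (a + (j - i)) = θ j - 6 * t) ∧
      (∀ x ∈ S, x ≤ a ∨ a + (j - i) ≤ x) := by
  obtain ⟨t, rfl⟩ := ha
  have e : i + t * N + (j - i) = j + t * N := by ring
  have hi' := h.add_mul hi t
  have hj' := h.add_mul hij.1 t
  rw [e]
  refine ⟨hi'.1, hj'.1, by rw [hi'.2.1]; ring, by rw [hj'.2.1]; ring, ⟨t, hi'.2.2, hj'.2.2⟩, ?_⟩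
  intro x hx
  by_contra! hcon
  have := hij.2.2 (x + (-t) * N) (h.add_mul hx _).1 (by linarith [hcon.1])
  linarith [hcon.2]

/-- Removing a pair of adjacent panes whose beams hit each other. -/
lemma erase_pair (h : IsChordDiagram N S θ π) {i j : ℤ} (hi : i ∈ S) (hij : IsNext S i j)
    (hji : π i = j) (hjN : π j = i + N) :
    IsChordDiagram N {l ∈ S | ¬ Cls N i l ∧ ¬ Cls N i (l - (j - i))} θ π := by
  refine h.restrict (fun l hl => hl.1) (fun l => ?_) (fun l hl => ?_)
  · have e : l + N - (j - i) = l - (j - i) + N := by ring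
    simp only [Set.mem_ofPred_eq, h.mem_add, e, cls_add]
  · have key : Cls N i (π l) ↔ Cls N i (l - (j - i)) := by
      constructor
      · intro hc
        obtain ⟨a1, a2, a3, a4, -⟩ := h.cls_facts hi hij ((cls_add (l := π l - N)).1 (by simpa using hc))
        have := h.inj _ a2 l hl (by omega)
        rw [← this, ← cls_add]; simpa using hc
      · intro hc
        obtain ⟨a1, a2, a3, a4, -⟩ := h.cls_facts hi hij hc
        rw [sub_add_cancel] at a4
        rw [a4, hjN, show i + N + (l - (j - i) - i) = l - (j - i) + N by ring, cls_add]
        exact hc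
    have key' : Cls N i (π l - (j - i)) ↔ Cls N i l := by
      constructor
      · intro hc
        obtain ⟨a1, a2, a3, a4, -⟩ := h.cls_facts hi hij hc
        have := h.inj _ a1 l hl (by omega)
        rw [← this]; exact hc
      · intro hc
        obtain ⟨a1, a2, a3, a4, -⟩ := h.cls_facts hi hij hc
        rw [show π l - (j - i) = l by omega]; exact hc
    simp only [Set.mem_ofPred_eq, key, key', h.map_mem l hl, hl, true_and, and_comm]

open Classical in
/-- Merging two adjacent panes, the first of which emits a beam that hits the second. -/
lemma merge_even (h : IsChordDiagram N S θ π) {i j : ℤ} (hi : i ∈ S) (hij : IsNext S i j)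
    (hjN : j < i + N) (heven : θ i % 2 = 0) (hji : π i = j) (hθ : θ j = θ i - 2) :
    IsChordDiagram N {l ∈ S | ¬ Cls N i (l - (j - i))}
      (fun l => if Cls N i l then θ l - 1 else θ l)
      (fun l => if Cls N i l then π (l + (j - i)) else π l) := by
  have hlt := hij.2.1
  have facts : ∀ a, Cls N i a → a ∈ S ∧ a + (j - i) ∈ S ∧ π a = a + (j - i) ∧ a < π (a + (j - i)) ∧
      π (a + (j - i)) < a + N ∧ (∀ x ∈ S, x ≤ a ∨ a + (j - i) ≤ x) ∧ θ a % 2 = 0 ∧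
      θ (a + (j - i)) = θ a - 2 := by
    intro a ha
    obtain ⟨a1, a2, a3, a4, ⟨t, a5, a5'⟩, a6⟩ := h.cls_facts hi hij ha
    obtain ⟨b1, b2, b3, b4, ⟨u, b5, b5'⟩, b6⟩ := h.cls_facts hi hij (cls_add.2 ha)
    have c1 := h.lt_map _ a2
    have c2 := h.map_lt _ a2
    refine ⟨a1, a2, by omega, by omega, ?_, a6, by omega, by omega⟩
    have c3 := b6 _ (h.map_mem _ a2)
    -- With `θ i` even and `θ j = θ i - 2`, the axiom `level` forbids the second pane from hitting
    -- the first, so its chord really leaves the pair.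
    have c4 : π (a + (j - i)) ≠ a + N := by
      intro e
      have c5 := h.level _ a2
      rw [e, h.dir_add a a1] at c5
      omega
    omega
  have cases : ∀ x ∈ S, ¬ Cls N i (x - (j - i)) → Cls N i x ∨ ¬ Cls N i x ∧ ∀ a, Cls N i a →
      (x ≤ a ∧ x ≠ a ∨ a + (j - i) < x) ∧ π x ≠ a + (j - i) := by
    intro x hx hx'
    by_cases hc : Cls N i x
    · exact Or.inl hc
    · refine Or.inr ⟨hc, fun a ha => ?_⟩
      obtain ⟨a1, a2, a3, -, -, a6, -⟩ := facts a ha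
      have n1 : x ≠ a := fun e => hc (e ▸ ha)
      have n2 : x ≠ a + (j - i) := fun e => hx' (by rw [e]; simpa using ha)
      refine ⟨by have := a6 x hx; omega, fun e => n1 (h.inj x hx a a1 (by omega))⟩
  have addc : ∀ l, Cls N i (l + N - (j - i)) ↔ Cls N i (l - (j - i)) := fun l => by
    rw [show l + N - (j - i) = l - (j - i) + N by ring, cls_add]
  -- The merged pane keeps the incoming chord of `i` and takes the outgoing chord of `j`. As `θ i`
  -- is even, lowering it by one leaves the incoming level `(θ i + 1) / 2` alone and turns the
  -- outgoing level into that of `j`.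
  have level' : ∀ x ∈ S, ((if Cls N i x then θ x - 1 else θ x) + 1) / 2 = (θ x + 1) / 2 := by
    intro x hx
    split_ifs with hc
    · have := (facts x hc).2.2.2.2.2.2.1; omega
    · rfl
  constructor
  · exact h.pos
  · intro l; simp only [Set.mem_ofPred_eq, h.mem_add, addc]
  · intro l hl
    simp only [cls_add]
    have := h.dir_add l hl.1
    split_ifs <;> omega
  · intro l hl
    simp only [cls_add]
    split_ifs with hc
    · rw [show l + N + (j - i) = l + (j - i) + N by ring, h.map_add _ (facts l hc).2.1]
    · exact h.map_add l hl.1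
  · intro l hl
    simp only [Set.mem_ofPred_eq]
    split_ifs with hc
    · obtain ⟨a1, a2, a3, -⟩ := facts l hc
      refine ⟨h.map_mem _ a2, fun hc' => ?_⟩
      have b := facts _ hc'
      have := h.inj _ a2 _ b.1 (by omega)
      have := cls_eq hc (this ▸ hc') (by omega) (by omega)
      omega
    · refine ⟨h.map_mem _ hl.1, fun hc' => hc ?_⟩
      have b := facts _ hc'
      rw [h.inj _ hl.1 _ b.1 (by omega)]; exact hc'
  · intro l hl m hm
    rcases cases l hl.1 hl.2 with c | ⟨c, d⟩ <;> rcases cases m hm.1 hm.2 with c' | ⟨c', d'⟩ <;>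
      simp only [c, c', if_true, if_false] <;> intro e
    · have := h.inj _ (facts l c).2.1 _ (facts m c').2.1 e; omega
    · have := h.inj _ (facts l c).2.1 _ hm.1 e
      have := d' l c; omega
    · have := h.inj _ hl.1 _ (facts m c').2.1 e
      have := d m c'; omega
    · exact h.inj _ hl.1 _ hm.1 e
  · intro l hl
    obtain ⟨m, hm, hml⟩ := h.surj l hl.1
    by_cases c : Cls N i (m - (j - i))
    · have b := facts _ c
      refine ⟨m - (j - i), ⟨b.1, fun hc => ?_⟩, by simpa [c] using hml⟩
      have := cls_eq hc c (by omega) (by omega)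
      omega
    · refine ⟨m, ⟨hm, c⟩, ?_⟩
      have : ¬ Cls N i m := fun hc => hl.2 (by
        rw [← hml, (facts m hc).2.2.1]; simpa using hc)
      simpa [this] using hml
  · intro l hl
    split_ifs with hc
    · exact (facts l hc).2.2.2.1
    · exact h.lt_map l hl.1
  · intro l hl
    split_ifs with hc
    · exact (facts l hc).2.2.2.2.1
    · exact h.map_lt l hl.1
  · intro l hl
    rcases cases l hl.1 hl.2 with c | ⟨c, d⟩
    · obtain ⟨a1, a2, a3, a4, a5, a6, a7, a8⟩ := facts l c
      simp only [c, if_true]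
      rw [level' _ (h.map_mem _ a2), h.level _ a2]; omega
    · simp only [c, if_false]
      rw [level' _ (h.map_mem _ hl.1), h.level _ hl.1]
  · intro x hx y hy
    rcases cases x hx.1 hx.2 with c | ⟨c, d⟩ <;> rcases cases y hy.1 hy.2 with c' | ⟨c', d'⟩ <;>
      simp only [c, c', if_true, if_false] <;> intro e1 e2 e3 e4
    · have := facts x c
      have := cls_eq c c' (by omega) (by omega); omega
    · have a := facts x c
      have := d' x c
      have := h.cross _ a.2.1 y hy.1 (by omega) e2 e3 (by omega)
      omega
    · have a := facts y c'
      have := d y c'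
      have := a.2.2.2.2.2.1 _ (h.map_mem _ hx.1)
      have := h.cross _ hx.1 _ a.2.1 (by omega) (by omega) e3 (by omega)
      omega
    · exact h.cross x hx.1 y hy.1 e1 e2 e3 e4

open Classical in
/-- Merging two adjacent panes, the second of which emits a beam that hits the first. -/
lemma merge_odd (h : IsChordDiagram N S θ π) {i j : ℤ} (hi : i ∈ S) (hij : IsNext S i j)
    (hjN : j < i + N) (hodd : θ i % 2 = 1) (hji : π j = i + N) (hjlt : j < π i)
    (hθ : θ j = θ i - 2) :
    IsChordDiagram N {l ∈ S | ¬ Cls N i (l - (j - i))}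
      (fun l => if Cls N i l then θ l - 1 else θ l)
      (fun l => if Cls N i (π l - (j - i)) then π l - (j - i) else π l) := by
  have hlt := hij.2.1
  have facts : ∀ a, Cls N i a → a ∈ S ∧ a + (j - i) ∈ S ∧ π (a + (j - i)) = a + N ∧
      a + (j - i) < π a ∧ (∀ x ∈ S, x ≤ a ∨ a + (j - i) ≤ x) ∧ θ a % 2 = 1 ∧
      θ (a + (j - i)) = θ a - 2 := by
    intro a ha
    obtain ⟨a1, a2, a3, a4, ⟨t, a5, a5'⟩, a6⟩ := h.cls_facts hi hij ha
    exact ⟨a1, a2, by omega, by omega, a6, by omega, by omega⟩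
  have addc : ∀ l, Cls N i (l + N - (j - i)) ↔ Cls N i (l - (j - i)) := fun l => by
    rw [show l + N - (j - i) = l - (j - i) + N by ring, cls_add]
  -- the target of a chord
  have tgt : ∀ l ∈ S, ¬ Cls N i (l - (j - i)) → ∃ b, (if Cls N i (π l - (j - i)) then π l - (j - i)
      else π l) = b ∧ ((Cls N i b ∧ π l = b + (j - i)) ∨ (¬ Cls N i b ∧ π l = b ∧
      ∀ a, Cls N i a → (b < a ∨ a + (j - i) < b))) := by
    intro l hl hl'
    refine ⟨_, rfl, ?_⟩
    split_ifs with hc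
    · exact Or.inl ⟨hc, by ring⟩
    · have hc' : ¬ Cls N i (π l) := by
        intro hc'
        have hc2 : Cls N i (π l - N) := (cls_add (l := π l - N)).1 (by simpa using hc')
        obtain ⟨a1, a2, a3, -⟩ := facts _ hc2
        have := h.inj _ a2 _ hl (by omega)
        exact hl' (by rw [← this]; simpa using hc2)
      refine Or.inr ⟨hc', rfl, fun a ha => ?_⟩
      have n1 : π l ≠ a := fun e => hc' (e ▸ ha)
      have n2 : π l ≠ a + (j - i) := fun e => hc (by rw [e]; simpa using ha)
      have := (facts a ha).2.2.2.2.1 _ (h.map_mem l hl)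
      omega
  -- Dually to the even case, the merged pane keeps the outgoing chord of `i` and receives the
  -- incoming chord of `j`; for odd `θ i` it is the outgoing level that survives the change of
  -- direction.
  have emit : ∀ x ∈ S, (if Cls N i x then θ x - 1 else θ x) / 2 = θ x / 2 := by
    intro x hx
    split_ifs with hc
    · have := (facts x hc).2.2.2.2.2.1; omega
    · rfl
  constructor
  · exact h.pos
  · intro l; simp only [Set.mem_ofPred_eq, h.mem_add, addc]
  · intro l hl
    simp only [cls_add]
    have := h.dir_add l hl.1
    split_ifs <;> omega
  · intro l hl
    rw [h.map_add l hl.1]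
    simp only [addc]
    split_ifs <;> ring
  · intro l hl
    obtain ⟨b, hb, ⟨c, e⟩ | ⟨c, e, hne⟩⟩ := tgt l hl.1 hl.2
    · rw [hb]
      refine ⟨(facts b c).1, fun hc => ?_⟩
      have := cls_eq c hc (by omega) (by omega); omega
    · rw [hb, ← e]
      refine ⟨h.map_mem _ hl.1, fun hc => ?_⟩
      have := hne _ hc
      omega
  · intro l hl m hm
    obtain ⟨b, hb, ⟨c, e⟩ | ⟨c, e, hne⟩⟩ := tgt l hl.1 hl.2 <;>
    obtain ⟨b', hb', ⟨c', e'⟩ | ⟨c', e', hne'⟩⟩ := tgt m hm.1 hm.2 <;> rw [hb, hb'] <;> intro he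
    · exact h.inj l hl.1 m hm.1 (by omega)
    · exact absurd (he ▸ c) c'
    · exact absurd (he ▸ c') c
    · exact h.inj l hl.1 m hm.1 (by omega)
  · intro l hl
    by_cases c : Cls N i l
    · obtain ⟨a1, a2, a3, -⟩ := facts l c
      obtain ⟨m, hm, hml⟩ := h.surj _ a2
      refine ⟨m, ⟨hm, fun hc => ?_⟩, ?_⟩
      · have b := facts _ hc
        rw [sub_add_cancel] at b
        have := cls_eq (a := l) c (cls_add.2 hc) (by omega) (by omega)
        omega
      · rw [hml]; simp [c]
    · obtain ⟨m, hm, hml⟩ := h.surj l hl.1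
      refine ⟨m, ⟨hm, fun hc => c ?_⟩, ?_⟩
      · have b := facts _ hc
        rw [sub_add_cancel] at b
        rw [show l = m - (j - i) + N by omega, cls_add]; exact hc
      · rw [hml]; simp [hl.2]
  · intro l hl
    have := h.lt_map l hl.1
    obtain ⟨b, hb, ⟨c, e⟩ | ⟨c, e, hne⟩⟩ := tgt l hl.1 hl.2 <;> rw [hb]
    · have b1 := facts b c
      have := b1.2.2.2.2.1 l hl.1
      have : l ≠ b := by rintro rfl; omega
      omega
    · omega
  · intro l hl
    have := h.map_lt l hl.1
    obtain ⟨b, hb, ⟨c, e⟩ | ⟨c, e, hne⟩⟩ := tgt l hl.1 hl.2 <;> rw [hb] <;> omega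
  · intro l hl
    rw [emit l hl.1, ← h.level l hl.1]
    obtain ⟨b, hb, ⟨c, e⟩ | ⟨c, e, hne⟩⟩ := tgt l hl.1 hl.2 <;> rw [hb, e]
    · have b1 := facts b c
      simp only [c, if_true]; omega
    · simp only [c, if_false]
  · intro x hx y hy
    rw [emit x hx.1, emit y hy.1]
    obtain ⟨b, hb, ⟨c, e⟩ | ⟨c, e, hne⟩⟩ := tgt x hx.1 hx.2 <;>
    obtain ⟨b', hb', ⟨c', e'⟩ | ⟨c', e', hne'⟩⟩ := tgt y hy.1 hy.2 <;> simp only [hb, hb'] <;>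
      intro e1 e2 e3 e4
    · have b1 := (facts b' c').2.2.2.2.1 _ ((h.mem_add x).2 hx.1)
      have b2 : x + N ≠ b' + (j - i) := fun h0 => hx.2 (by
        rw [← cls_add, show x - (j - i) + N = b' by omega]; exact c')
      exact h.cross x hx.1 y hy.1 e1 (by omega) (by omega) (by omega)
    · have := hne' b c
      exact h.cross x hx.1 y hy.1 e1 (by omega) (by omega) (by omega)
    · have b1 := (facts b' c').2.2.2.2.1 _ ((h.mem_add x).2 hx.1)
      have b2 : x + N ≠ b' + (j - i) := fun h0 => hx.2 (by
        rw [← cls_add, show x - (j - i) + N = b' by omega]; exact c')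
      exact h.cross x hx.1 y hy.1 e1 (by omega) (by omega) (by omega)
    · exact h.cross x hx.1 y hy.1 e1 (by omega) (by omega) (by omega)

open Classical in
/-- Interchanging two adjacent panes whose outgoing beams cross. -/
lemma swap (h : IsChordDiagram N S θ π) {i j : ℤ} (hi : i ∈ S) (hij : IsNext S i j)
    (hjN : j < i + N) (heven : θ i % 2 = 0) (hjlt : j < π i) (hθ : θ j = θ i - 1)
    (hπ : π i < π j) (hπj : π j < i + N) (hno : ∀ m ∈ S, i < m → m < π i → π m ≠ i + N) :
    IsChordDiagram N S
      (fun l => if Cls N i l then θ l - 1 else if Cls N i (l - (j - i)) then θ l + 1 else θ l)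
      (fun l => if Cls N i l then π (l + (j - i)) else
        if Cls N i (l - (j - i)) then π (l - (j - i)) else π l) := by
  have hlt := hij.2.1
  have facts : ∀ a, Cls N i a → a ∈ S ∧ a + (j - i) ∈ S ∧ a + (j - i) < π a ∧
      π a < π (a + (j - i)) ∧ π (a + (j - i)) < a + N ∧
      (∀ x ∈ S, x ≤ a ∨ a + (j - i) ≤ x) ∧ θ a % 2 = 0 ∧ θ (a + (j - i)) = θ a - 1 := by
    intro a ha
    obtain ⟨a1, a2, a3, a4, ⟨t, a5, a5'⟩, a6⟩ := h.cls_facts hi hij ha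
    exact ⟨a1, a2, by omega, by omega, by omega, a6, by omega, by omega⟩
  have hno' : ∀ a, Cls N i a → ∀ m ∈ S, a < m → m < π a → π m ≠ a + N := by
    intro a ha m hm m1 m2 m3
    have a3 := (h.cls_facts hi hij ha).2.2.1
    obtain ⟨t, ht⟩ := ha
    have b := h.add_mul hm (-t)
    have e : a - i = t * N := by rw [ht]; ring
    rw [neg_mul, ← e] at b
    exact hno _ b.1 (by omega) (by omega) (by rw [b.2.1]; omega)
  have addc : ∀ l, Cls N i (l + N - (j - i)) ↔ Cls N i (l - (j - i)) := fun l => by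
    rw [show l + N - (j - i) = l - (j - i) + N by ring, cls_add]
  have notboth : ∀ l, Cls N i l → ¬ Cls N i (l - (j - i)) := fun l hl hl' => by
    have := cls_eq hl hl' (by omega) (by omega); omega
  -- the source of a chord
  have src : ∀ x ∈ S, ∃ z ∈ S, (if Cls N i x then π (x + (j - i)) else
        if Cls N i (x - (j - i)) then π (x - (j - i)) else π x) = π z ∧
      (if Cls N i x then θ x - 1 else if Cls N i (x - (j - i)) then θ x + 1 else θ x) / 2
        = θ z / 2 ∧
      (Cls N i x ∧ z = x + (j - i) ∨ (∃ b, Cls N i b ∧ z = b ∧ x = b + (j - i)) ∨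
        z = x ∧ ∀ a, Cls N i a → (x < a ∨ a + (j - i) < x)) := by
    intro x hx
    by_cases c : Cls N i x
    · have a := facts x c
      exact ⟨_, a.2.1, by simp only [c, if_true], by simp only [c, if_true]; omega,
        Or.inl ⟨c, rfl⟩⟩
    · by_cases c' : Cls N i (x - (j - i))
      · have a := facts _ c'
        refine ⟨_, a.1, by simp only [c, c', if_true, if_false], ?_, Or.inr (Or.inl ⟨_, c', rfl, by ring⟩)⟩
        simp only [c, c', if_true, if_false]
        rw [sub_add_cancel] at a
        omega
      · refine ⟨x, hx, by simp only [c, c', if_false], by simp only [c, c', if_false],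
          Or.inr (Or.inr ⟨rfl, fun a ha => ?_⟩)⟩
        have n1 : x ≠ a := fun e => c (e ▸ ha)
        have n2 : x ≠ a + (j - i) := fun e => c' (by rw [e]; simpa using ha)
        have := (facts a ha).2.2.2.2.2.1 x hx
        omega
  -- Outgoing chords move together with the directions, incoming chords stay in place. This is
  -- consistent because, for `θ i` even and `θ j = θ i - 1`, both panes receive light at the same
  -- level.
  have level' : ∀ x ∈ S, ((if Cls N i x then θ x - 1 else if Cls N i (x - (j - i)) then θ x + 1
      else θ x) + 1) / 2 = (θ x + 1) / 2 := by
    intro x hx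
    split_ifs with c c'
    · have := facts x c; omega
    · have := facts _ c'
      rw [sub_add_cancel] at this
      omega
    · rfl
  constructor
  · exact h.pos
  · exact h.mem_add
  · intro l hl
    simp only [cls_add, addc]
    have := h.dir_add l hl
    split_ifs <;> omega
  · intro l hl
    simp only [cls_add, addc]
    split_ifs with c c'
    · rw [show l + N + (j - i) = l + (j - i) + N by ring, h.map_add _ (facts l c).2.1]
    · rw [show l + N - (j - i) = l - (j - i) + N by ring, h.map_add _ (facts _ c').1]
    · exact h.map_add l hl
  · intro l hl
    obtain ⟨z, hz, e, -⟩ := src l hl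
    rw [e]; exact h.map_mem z hz
  · intro l hl m hm
    obtain ⟨z, hz, e, -, c⟩ := src l hl
    obtain ⟨z', hz', e', -, c'⟩ := src m hm
    rw [e, e']
    intro he
    have := h.inj z hz z' hz' he
    subst this
    rcases c with ⟨c, d⟩ | ⟨b, c, d, d'⟩ | ⟨d, c⟩ <;>
      rcases c' with ⟨c', f⟩ | ⟨b', c', f, f'⟩ | ⟨f, c'⟩
    · omega
    · exact absurd (by rw [← f, d]; simpa using c) (notboth b' c')
    · have := c' l c; omega
    · exact absurd (by rw [← d, f]; simpa using c') (notboth b c)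
    · omega
    · have := c' b c; omega
    · have := c m c'; omega
    · have := c b' c'; omega
    · omega
  · intro l hl
    obtain ⟨m, hm, hml⟩ := h.surj l hl
    by_cases c : Cls N i m
    · have a := facts m c
      refine ⟨m + (j - i), a.2.1, ?_⟩
      have : ¬ Cls N i (m + (j - i)) := fun c' => notboth _ c' (by simpa using c)
      simp [this, c, hml]
    · by_cases c' : Cls N i (m - (j - i))
      · exact ⟨m - (j - i), (facts _ c').1, by simp [c', hml]⟩
      · exact ⟨m, hm, by simp [c, c', hml]⟩
  · intro l hl
    obtain ⟨z, hz, e, -, c⟩ := src l hl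
    rw [e]
    have := h.lt_map z hz
    rcases c with ⟨c, d⟩ | ⟨b, c, d, d'⟩ | ⟨d, c⟩
    · omega
    · have := facts b c; subst d; omega
    · omega
  · intro l hl
    obtain ⟨z, hz, e, -, c⟩ := src l hl
    rw [e]
    have := h.map_lt z hz
    rcases c with ⟨c, d⟩ | ⟨b, c, d, d'⟩ | ⟨d, c⟩
    · have := facts l c; subst d; omega
    · omega
    · omega
  · intro l hl
    obtain ⟨z, hz, e, e2, c⟩ := src l hl
    rw [e, e2, level' _ (h.map_mem z hz), h.level z hz]
  · intro x hx y hy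
    obtain ⟨z, hz, e, e2, c⟩ := src x hx
    obtain ⟨z', hz', e', e2', c'⟩ := src y hy
    simp only [e, e', e2, e2']
    intro e1 e3 e4 e5
    rcases c with ⟨c, d⟩ | ⟨b, c, d, d'⟩ | ⟨d, c⟩ <;>
      rcases c' with ⟨c', f⟩ | ⟨b', c', f, f'⟩ | ⟨f, c'⟩
    · have := cls_eq c c' (by have := facts x c; subst d; omega)
        (by have := facts x c; subst d; omega)
      omega
    · have a := facts x c
      have a' := facts b' c'
      subst d f
      have := cls_eq c c' (by omega) (by omega)
      subst this
      omega
    · have a := facts x c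
      have := c' x c
      subst d f
      exact h.cross _ hz _ hz' (by omega) e3 e4 (by omega)
    · have a := facts b c
      subst d
      have := cls_eq c c' (by have := h.map_lt z hz; omega) (by have := h.map_lt z hz; omega)
      omega
    · subst d f
      have := cls_eq c c' (by have := h.map_lt z hz; omega) (by have := h.map_lt z hz; omega)
      omega
    · have a := facts b c
      have := c' b c
      subst d f
      have b1 := (facts _ (cls_add.2 c)).2.2.2.2.2.1 _ (h.map_mem _ hz')
      -- A chord ending at the next translate of `i` would cross the moved chord without having
      -- crossed the old one; the hypothesis `hno` excludes it.
      have b2 := hno' _ c _ hz' (by omega) e3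
      exact h.cross _ hz _ hz' (by omega) e3 e4 (by omega)
    · have a := facts y c'
      have := c y c'
      subst d f
      have b1 := a.2.2.2.2.2.1 _ (h.map_mem _ hz)
      -- A chord ending exactly at the second pane would be a new crossing; at this pane, which has
      -- odd direction, `le_map_of_odd` puts its source on the wrong side.
      have b2 : π z ≠ y + (j - i) := by
        intro h0
        have b3 := h.map_add z hz
        have b4 := h.le_map_of_odd (j := y + (j - i)) (m := z + N) hz' ((h.mem_add z).2 hz)
          (by omega) (by omega)
        omega
      exact h.cross _ hz _ hz' (by omega) (by omega) e4 e5
    · have a := facts b' c'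
      have := c b' c'
      subst d f
      exact h.cross _ hz _ hz' (by omega) (by omega) e4 e5
    · subst d f
      exact h.cross _ hz _ hz' e1 e3 e4 e5

end IsChordDiagram
end GridBilliards

/-! ### An induction principle for chord diagrams. -/

namespace GridBilliards

namespace IsChordDiagram

variable {N : ℤ} {S : Set ℤ} {θ π : ℤ → ℤ}

lemma ncard_lt (h : IsChordDiagram N S θ π) {S' : Set ℤ} (hS : S' ⊆ S) {j : ℤ} (hj : j ∈ S)
    (hj' : ∀ l, Cls N j l → l ∉ S') : (S' ∩ Set.Ico 0 N).ncard < (S ∩ Set.Ico 0 N).ncard := by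
  apply Set.ncard_lt_ncard _ ((Set.finite_Ico 0 N).subset Set.inter_subset_right)
  refine ⟨Set.inter_subset_inter_left _ hS, fun hsub => ?_⟩
  have e : j % N = j + (-(j / N)) * N := by rw [Int.emod_def]; ring
  have hc : Cls N j (j % N) := ⟨_, e⟩
  have hm : j % N ∈ S := by rw [e]; exact (h.add_mul hj _).1
  exact hj' _ hc (hsub ⟨hm, Int.emod_nonneg _ h.pos.ne', Int.emod_lt_of_pos _ h.pos⟩).1

/-- Take a chord whose shorter side, of length `π i - i` or `i + N - π i`, is as short as possible.
A chord with both ends on that side would have a shorter one. If the side in question is the right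
one, it becomes the left one after reversal. -/
lemma isInnermost_or (h : IsChordDiagram N S θ π) (hne : S.Nonempty) :
    ∃ i ∈ S, IsInnermost N S π i ∨
      ∀ g : ℤ → ℤ, (∀ l ∈ S, g (π l) = l + N) → (∀ l ∈ S, g l - N ∈ S ∧ π (g l - N) = l) →
        IsInnermost N S g (π i) := by
  obtain ⟨l0, h0⟩ := hne
  obtain ⟨m, ⟨i, hi, him⟩, hmin⟩ := Int.exists_least_of_bdd
    (P := fun m => ∃ i ∈ S, m = π i - i ∨ m = i + N - π i)
    ⟨0, by
      rintro z ⟨i, hi, hz⟩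
      have := h.lt_map i hi
      have := h.map_lt i hi
      omega⟩ ⟨_, l0, h0, Or.inl rfl⟩
  refine ⟨i, hi, ?_⟩
  rcases him with him | him
  · left
    intro x hx x1 x2
    have a1 := hmin _ ⟨x, hx, Or.inl rfl⟩
    have a2 := hmin _ ⟨x, hx, Or.inr rfl⟩
    have : π x ≠ π i := fun e => by have := h.inj x hx i hi e; omega
    omega
  · right
    intro g g1 g2 x hx x1 x2
    obtain ⟨b1, b2⟩ := g2 x hx
    have a1 := hmin _ ⟨_, b1, Or.inl rfl⟩
    have a2 := hmin _ ⟨_, b1, Or.inr rfl⟩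
    rw [g1 i hi] at x2 ⊢
    have : g x - N ≠ i := fun e => by rw [e] at b2; omega
    omega

open Classical in
/-- Chord diagrams are built from the empty one by inserting pairs of adjacent opposite panes,
splitting panes and interchanging adjacent panes. -/
theorem induction_on {N : ℤ} {R : Set ℤ → (ℤ → ℤ) → (ℤ → ℤ) → Prop}
    (empty : ∀ θ π, R ∅ θ π)
    (reverse : ∀ S θ π g, IsChordDiagram N S θ π → (∀ l ∈ S, g (π l) = l + N) →
      R S (fun l => θ l + 3) g → R S θ π)
    (erase_pair : ∀ S θ π i j, IsChordDiagram N S θ π → i ∈ S → IsNext S i j → j < i + N →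
      π i = j → π j = i + N → θ j = θ i - 3 →
      R {l ∈ S | ¬ Cls N i l ∧ ¬ Cls N i (l - (j - i))} θ π → R S θ π)
    (merge_even : ∀ S θ π i j, IsChordDiagram N S θ π → i ∈ S → IsNext S i j → j < i + N →
      θ i % 2 = 0 → π i = j → θ j = θ i - 2 →
      R {l ∈ S | ¬ Cls N i (l - (j - i))} (fun l => if Cls N i l then θ l - 1 else θ l)
        (fun l => if Cls N i l then π (l + (j - i)) else π l) → R S θ π)
    (merge_odd : ∀ S θ π i j, IsChordDiagram N S θ π → i ∈ S → IsNext S i j → j < i + N →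
      θ i % 2 = 1 → j < π i → π j = i + N → θ j = θ i - 2 →
      R {l ∈ S | ¬ Cls N i (l - (j - i))} (fun l => if Cls N i l then θ l - 1 else θ l)
        (fun l => if Cls N i (π l - (j - i)) then π l - (j - i) else π l) → R S θ π)
    (swap : ∀ S θ π i j, IsChordDiagram N S θ π → i ∈ S → IsNext S i j → j < i + N →
      θ i % 2 = 0 → j < π i → θ j = θ i - 1 →
      R S (fun l => if Cls N i l then θ l - 1 else if Cls N i (l - (j - i)) then θ l + 1 else θ l)
        (fun l => if Cls N i l then π (l + (j - i)) else
          if Cls N i (l - (j - i)) then π (l - (j - i)) else π l) → R S θ π)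
    (h : IsChordDiagram N S θ π) : R S θ π := by
  induction hn : (S ∩ Set.Ico 0 N).ncard using Nat.strong_induction_on generalizing S θ π with
  | _ n ih =>
  -- Merging and erasing lower the number of panes per period, handled by the outer induction. An
  -- interchange keeps the panes, but it moves the start of the innermost chord from `i` to `j`; the
  -- chord stays innermost and gets shorter.
  have inner : ∀ d : ℕ, ∀ (θ π : ℤ → ℤ) (i : ℤ), IsChordDiagram N S θ π → i ∈ S →
      IsInnermost N S π i → π i - i ≤ d → R S θ π := by
    intro d
    induction d with
    | zero => intro θ π i h hi _ hd; have := h.lt_map i hi; omega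
    | succ d ihd =>
      intro θ π i h hi hin hd
      obtain ⟨j, hij, hjN, ⟨c1, c2, c3⟩ | ⟨c1, c2, c3⟩ | ⟨c1, c2, c3, c4, c5, c6⟩ |
        ⟨c1, c2, c3, c4⟩⟩ := h.exists_peel hi hin
      · exact merge_even S θ π i j h hi hij hjN c1 c2 c3
          (ih _ (hn ▸ h.ncard_lt (fun l hl => hl.1) hij.1 (by
            rintro l ⟨t, ht⟩ hl
            exact hl.2 ⟨t, by rw [ht]; ring⟩)) (h.merge_even hi hij hjN c1 c2 c3) rfl)
      · exact erase_pair S θ π i j h hi hij hjN c1 c2 c3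
          (ih _ (hn ▸ h.ncard_lt (fun l hl => hl.1) hi (fun l hc hl => hl.2.1 hc))
            (h.erase_pair hi hij c1 c2) rfl)
      · have hlt := hij.2.1
        have n1 : ∀ x, i < x → x < i + N → ¬ Cls N i x := fun x h1 h2 hc => by
          have := cls_eq (cls_self N i) hc (by omega) (by omega); omega
        have ej : (if Cls N i j then π (j + (j - i)) else
          if Cls N i (j - (j - i)) then π (j - (j - i)) else π j) = π i := by
          rw [if_neg (n1 j hlt hjN), sub_sub_cancel, if_pos (cls_self N i)]
        refine swap S θ π i j h hi hij hjN c1 c2 c3 (ihd _ _ j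
          (h.swap hi hij hjN c1 c2 c3 c4 c5 c6) hij.1 ?_ ?_)
        · intro x hx x1 x2
          beta_reduce at x2 ⊢
          rw [ej] at x2 ⊢
          have := h.map_lt i hi
          rw [if_neg (n1 x (by omega) (by omega)), if_neg (n1 _ (by omega) (by omega))]
          have := hin x hx (by omega) x2
          omega
        · rw [ej]; omega
      · exact merge_odd S θ π i j h hi hij hjN c1 c2 c4 c3
          (ih _ (hn ▸ h.ncard_lt (fun l hl => hl.1) hij.1 (by
            rintro l ⟨t, ht⟩ hl
            exact hl.2 ⟨t, by rw [ht]; ring⟩)) (h.merge_odd hi hij hjN c1 c4 c2 c3) rfl)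
  rcases S.eq_empty_or_nonempty with rfl | hne
  · exact empty θ π
  obtain ⟨i, hi, hin | hin⟩ := h.isInnermost_or hne
  · exact inner (π i - i).toNat θ π i h hi hin (by omega)
  · obtain ⟨g, g1, g2, hg⟩ := h.exists_reverse
    exact reverse S θ π g h g1 (inner (g (π i) - π i).toNat _ _ _ hg (h.map_mem i hi)
      (hin g g1 g2) (by omega))

end IsChordDiagram
end GridBilliards

/-! ### Unit directions, flat sheets and ears. -/

namespace GridBilliards

/-! ### Directions of the grid -/

/-- The unit vector of the grid in the direction `k * 60°`. -/
def dirVec (k : ℤ) : ℤ × ℤ :=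
  if k % 6 = 0 then (1, 0) else if k % 6 = 1 then (0, 1) else if k % 6 = 2 then (-1, 1)
  else if k % 6 = 3 then (-1, 0) else if k % 6 = 4 then (0, -1) else (1, -1)

theorem dirVec_cases (k : ℤ) :
    (k % 6 = 0 ∧ dirVec k = (1, 0)) ∨ (k % 6 = 1 ∧ dirVec k = (0, 1)) ∨
    (k % 6 = 2 ∧ dirVec k = (-1, 1)) ∨ (k % 6 = 3 ∧ dirVec k = (-1, 0)) ∨
    (k % 6 = 4 ∧ dirVec k = (0, -1)) ∨ (k % 6 = 5 ∧ dirVec k = (1, -1)) := by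
  have h0 : k % 6 = 0 ∨ k % 6 = 1 ∨ k % 6 = 2 ∨ k % 6 = 3 ∨ k % 6 = 4 ∨ k % 6 = 5 := by omega
  rcases h0 with h | h | h | h | h | h <;> simp [dirVec, h]

theorem dirVec_congr {k m : ℤ} (h : k % 6 = m % 6) : dirVec k = dirVec m := by
  simp [dirVec, h]

theorem dirVec_inj {k m : ℤ} : dirVec k = dirVec m ↔ k % 6 = m % 6 := by
  refine ⟨fun h => ?_, dirVec_congr⟩
  rcases dirVec_cases k with ⟨a, b⟩ | ⟨a, b⟩ | ⟨a, b⟩ | ⟨a, b⟩ | ⟨a, b⟩ | ⟨a, b⟩ <;>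
  rcases dirVec_cases m with ⟨c, d⟩ | ⟨c, d⟩ | ⟨c, d⟩ | ⟨c, d⟩ | ⟨c, d⟩ | ⟨c, d⟩ <;>
  rw [b, d] at h <;> simp at h <;> rw [a, c]

theorem dirVec_ne_zero (k : ℤ) : dirVec k ≠ 0 := by
  rcases dirVec_cases k with ⟨a, b⟩ | ⟨a, b⟩ | ⟨a, b⟩ | ⟨a, b⟩ | ⟨a, b⟩ | ⟨a, b⟩ <;> simp [b]

theorem rotateCW_dirVec (k : ℤ) : rotateCW (dirVec k) = dirVec (k - 1) := by
  rcases dirVec_cases k with ⟨a, b⟩ | ⟨a, b⟩ | ⟨a, b⟩ | ⟨a, b⟩ | ⟨a, b⟩ | ⟨a, b⟩ <;>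
  rcases dirVec_cases (k - 1) with ⟨c, d⟩ | ⟨c, d⟩ | ⟨c, d⟩ | ⟨c, d⟩ | ⟨c, d⟩ | ⟨c, d⟩ <;>
  first
  | (exfalso; omega)
  | (rw [b, d]; rfl)

theorem dirVec_add_three (k : ℤ) : dirVec (k + 3) = -dirVec k := by
  rcases dirVec_cases k with ⟨a, b⟩ | ⟨a, b⟩ | ⟨a, b⟩ | ⟨a, b⟩ | ⟨a, b⟩ | ⟨a, b⟩ <;>
  rcases dirVec_cases (k + 3) with ⟨c, d⟩ | ⟨c, d⟩ | ⟨c, d⟩ | ⟨c, d⟩ | ⟨c, d⟩ | ⟨c, d⟩ <;>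
  first
  | (exfalso; omega)
  | (rw [b, d]; rfl)

theorem dirVec_sub (k : ℤ) : dirVec k - dirVec (k - 1) = dirVec (k + 1) := by
  rcases dirVec_cases k with ⟨a, b⟩ | ⟨a, b⟩ | ⟨a, b⟩ | ⟨a, b⟩ | ⟨a, b⟩ | ⟨a, b⟩ <;>
  rcases dirVec_cases (k - 1) with ⟨c, d⟩ | ⟨c, d⟩ | ⟨c, d⟩ | ⟨c, d⟩ | ⟨c, d⟩ | ⟨c, d⟩ <;>
  rcases dirVec_cases (k + 1) with ⟨e, g⟩ | ⟨e, g⟩ | ⟨e, g⟩ | ⟨e, g⟩ | ⟨e, g⟩ | ⟨e, g⟩ <;>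
  first
  | (exfalso; omega)
  | (rw [b, d, g]; rfl)

/-! ### Flat sheets -/

/-- A triangulated surface over the grid, possibly with degenerate parts: `Tri x y w` says that
`w` is the third vertex of the triangle on the right of the edge from `x` to `y`. -/
structure Sheet (W : Type*) where
  verts : Finset W
  Edge : W → W → Prop
  Tri : W → W → W → Prop
  pos : W → ℤ × ℤ

namespace Sheet

variable {W : Type*}

/-- An edge may lie in no triangle at all; the intermediate stages of the inductions have such
pendant edges. Every triangle has the orientation of its image, and `tri_unique` allows at most one
triangle on each side of an edge. -/
structure IsFlat (X : Sheet W) : Prop where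
  mem : ∀ {x y}, X.Edge x y → x ∈ X.verts
  symm : ∀ {x y}, X.Edge x y → X.Edge y x
  dir : ∀ {x y}, X.Edge x y → ∃ k, X.pos y - X.pos x = dirVec k
  tri_edge : ∀ {x y w}, X.Tri x y w → X.Edge x y
  tri_rot : ∀ {x y w}, X.Tri x y w → X.Tri y w x
  tri_pos : ∀ {x y w}, X.Tri x y w → X.pos w - X.pos x = rotateCW (X.pos y - X.pos x)
  tri_unique : ∀ {x y w w'}, X.Tri x y w → X.Tri x y w' → w = w'

/-- The edge from `x` to `y` has no triangle on its left. -/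
def Bdry (X : Sheet W) (x y : W) : Prop := X.Edge x y ∧ ∀ w, ¬ X.Tri y x w

open Classical in
/-- The number of triangles at a vertex. -/
noncomputable def deg (X : Sheet W) (x : W) : ℤ :=
  ∑ a ∈ X.verts, if ∃ b, X.Tri x a b then 1 else 0

/-- A light beam in the direction `2a - 1` crosses only edges in the directions `2a`, `2a + 1`
(when these are oriented with the beam passing to their right).  `Step` maps such an edge to the
next one. -/
def Step (X : Sheet W) (d e : W × W) : Prop :=
  ∃ w k, X.Tri d.1 d.2 w ∧ X.pos d.2 - X.pos d.1 = dirVec k ∧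
    ((k % 2 = 0 ∧ e = (w, d.2)) ∨ (k % 2 = 1 ∧ e = (d.1, w)))

def Reach (X : Sheet W) : W × W → W × W → Prop := Relation.ReflTransGen X.Step

theorem IsFlat.ne {X : Sheet W} (h : X.IsFlat) {x y : W} (e : X.Edge x y) : x ≠ y := by
  rintro rfl
  obtain ⟨k, hk⟩ := h.dir e
  rw [sub_self] at hk
  exact dirVec_ne_zero k hk.symm

theorem IsFlat.mem' {X : Sheet W} (h : X.IsFlat) {x y : W} (e : X.Edge x y) : y ∈ X.verts :=
  h.mem (h.symm e)

/-- `X` arises from `X'` by adding the vertex `v` together with the edges to `u, z, w` and the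
triangles `v, z, u` and `v, w, z`, as far as these are not degenerate. -/
structure IsEar (X X' : Sheet W) (v u z w : W) : Prop where
  notMem : v ∉ X'.verts
  verts : ∀ x, x ∈ X.verts ↔ x = v ∨ x ∈ X'.verts
  mem_u : u ∈ X'.verts
  mem_z : z ∈ X'.verts
  mem_w : w ∈ X'.verts
  pos : ∀ x ∈ X'.verts, X.pos x = X'.pos x
  edge : ∀ x y, X.Edge x y ↔ X'.Edge x y ∨ (x = v ∧ (y = u ∨ y = z ∨ y = w)) ∨
    (y = v ∧ (x = u ∨ x = z ∨ x = w))
  tri : ∀ x y t, X.Tri x y t ↔ X'.Tri x y t ∨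
    (u ≠ z ∧ ((x = v ∧ y = z ∧ t = u) ∨ (x = z ∧ y = u ∧ t = v) ∨ (x = u ∧ y = v ∧ t = z))) ∨
    (w ≠ z ∧ ((x = v ∧ y = w ∧ t = z) ∨ (x = w ∧ y = z ∧ t = v) ∨ (x = z ∧ y = v ∧ t = w)))
  eq_of_eq : w = u → u = z
  bdry_u : u ≠ z → X'.Bdry u z
  bdry_w : w ≠ z → X'.Bdry z w

namespace IsEar

variable {X X' : Sheet W} {v u z w : W}

/-- The ear covers the free sides of `u, z` and `z, w`, where these are edges, and its own free
sides are `u, v` and `v, w`. The boundary is thus rerouted through `v` instead of `z`. -/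
theorem bdry_iff (h : IsEar X X' v u z w) (h' : X'.IsFlat) (x y : W) :
    X.Bdry x y ↔ (X'.Bdry x y ∧ ¬ (u ≠ z ∧ x = u ∧ y = z) ∧ ¬ (w ≠ z ∧ x = z ∧ y = w)) ∨
      (x = u ∧ y = v) ∨ (x = v ∧ y = w) := by
  have hu : u ≠ v := fun e => h.notMem (e ▸ h.mem_u)
  have hz : z ≠ v := fun e => h.notMem (e ▸ h.mem_z)
  have hw : w ≠ v := fun e => h.notMem (e ▸ h.mem_w)
  have hE : ∀ x, ¬ X'.Edge v x := fun x e => h.notMem (h'.mem e)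
  have hE' : ∀ x, ¬ X'.Edge x v := fun x e => h.notMem (h'.mem' e)
  have hT1 : ∀ x y, ¬ X'.Tri v x y := fun x y e => hE _ (h'.tri_edge e)
  have hT2 : ∀ x y, ¬ X'.Tri x v y := fun x y e => hE' _ (h'.tri_edge e)
  simp only [Bdry, h.edge, h.tri]
  constructor
  · rintro ⟨h1 | ⟨rfl, h1⟩ | ⟨rfl, h1⟩, h2⟩
    · left
      refine ⟨⟨h1, fun t ht => h2 t (Or.inl ht)⟩, ?_, ?_⟩
      · rintro ⟨a, rfl, rfl⟩
        exact h2 v (by simp [a])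
      · rintro ⟨a, rfl, rfl⟩
        exact h2 v (by simp [a])
    · right; right
      refine ⟨rfl, ?_⟩
      by_contra hyw
      rcases h1 with rfl | rfl | rfl
      · by_cases e : y = z
        · subst e
          exact h2 w (by simp [Ne.symm hyw])
        · exact h2 z (by simp [e])
      · exact h2 w (by simp [Ne.symm hyw])
      · exact hyw rfl
    · right; left
      refine ⟨?_, rfl⟩
      by_contra hyw
      rcases h1 with rfl | rfl | rfl
      · exact hyw rfl
      · exact h2 u (by simp [Ne.symm hyw])
      · by_cases e : x = z
        · subst e
          exact h2 u (by simp [Ne.symm hyw])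
        · exact h2 z (by simp [e])
  · rintro (⟨⟨h1, h2⟩, h3, h4⟩ | ⟨rfl, rfl⟩ | ⟨rfl, rfl⟩)
    · refine ⟨Or.inl h1, ?_⟩
      have hx : x ≠ v := fun e => hE _ (e ▸ h1)
      have hy : y ≠ v := fun e => hE' _ (e ▸ h1)
      rintro t (ht | ⟨a, ht⟩ | ⟨a, ht⟩)
      · exact h2 t ht
      · rcases ht with ⟨rfl, -⟩ | ⟨rfl, rfl, -⟩ | ⟨-, rfl, -⟩
        · exact hy rfl
        · exact h3 ⟨a, rfl, rfl⟩
        · exact hx rfl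
      · rcases ht with ⟨rfl, -⟩ | ⟨rfl, rfl, -⟩ | ⟨-, rfl, -⟩
        · exact hy rfl
        · exact h4 ⟨a, rfl, rfl⟩
        · exact hx rfl
    · refine ⟨by simp, ?_⟩
      rintro t (ht | ⟨a, ht⟩ | ⟨a, ht⟩)
      · exact hT1 _ _ ht
      · rcases ht with ⟨-, e, -⟩ | ⟨e, -⟩ | ⟨e, -⟩
        · exact a e
        · exact hz e.symm
        · exact hu e.symm
      · rcases ht with ⟨-, e, -⟩ | ⟨e, -⟩ | ⟨e, -⟩
        · exact a (e ▸ h.eq_of_eq e.symm)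
        · exact hw e.symm
        · exact hz e.symm
    · refine ⟨by simp, ?_⟩
      rintro t (ht | ⟨a, ht⟩ | ⟨a, ht⟩)
      · exact hT2 _ _ ht
      · rcases ht with ⟨e, -⟩ | ⟨-, e, -⟩ | ⟨e, -⟩
        · exact hw e
        · exact hu e.symm
        · exact a (h.eq_of_eq e)
      · rcases ht with ⟨e, -⟩ | ⟨-, e, -⟩ | ⟨e, -⟩
        · exact hw e
        · exact hz e.symm
        · exact a e

/-- The prescribed directions make each new triangle a unit triangle. Uniqueness of triangles is
preserved because the ear is glued to sides that were free. -/
theorem flat_new (h : IsEar X X' v u z w) (h' : X'.IsFlat) {k m : ℤ}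
    (hk : X.pos v - X.pos u = dirVec k) (hm : X.pos w - X.pos v = dirVec m)
    (hku : u ≠ z → X.pos z - X.pos u = dirVec (k - 1))
    (hmw : w ≠ z → X.pos w - X.pos z = dirVec (m + 1)) : X.IsFlat := by
  have hu : u ≠ v := fun e => h.notMem (e ▸ h.mem_u)
  have hz : z ≠ v := fun e => h.notMem (e ▸ h.mem_z)
  have hw : w ≠ v := fun e => h.notMem (e ▸ h.mem_w)
  have hE : ∀ x, ¬ X'.Edge v x := fun x e => h.notMem (h'.mem e)
  have hE' : ∀ x, ¬ X'.Edge x v := fun x e => h.notMem (h'.mem' e)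
  have hT1 : ∀ x y, ¬ X'.Tri v x y := fun x y e => hE _ (h'.tri_edge e)
  have hT2 : ∀ x y, ¬ X'.Tri x v y := fun x y e => hE' _ (h'.tri_edge e)
  have ezv : u ≠ z → X.pos z - X.pos v = dirVec (k - 2) := fun e => by
    have e1 : X.pos z - X.pos v = dirVec (k - 1) - dirVec k := by rw [← hku e, ← hk]; abel
    have e2 := dirVec_sub k
    have e3 := dirVec_add_three (k - 2)
    rw [show k - 2 + 3 = k + 1 by ring] at e3
    rw [e1, ← neg_sub, e2, e3, neg_neg]
  have ezv' : w ≠ z → X.pos z - X.pos v = dirVec (m - 1) := fun e => by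
    have e1 : X.pos z - X.pos v = dirVec m - dirVec (m + 1) := by rw [← hmw e, ← hm]; abel
    rw [e1, ← dirVec_sub m]; abel
  have symm' : ∀ {x y : W} {k : ℤ}, X.pos y - X.pos x = dirVec k → X.pos x - X.pos y = dirVec (k + 3) := by
    intro x y k e
    rw [dirVec_add_three, ← e]; abel
  refine ⟨?_, ?_, ?_, ?_, ?_, ?_, ?_⟩
  · intro x y e
    rw [h.verts]
    rcases (h.edge x y).1 e with e | ⟨rfl, -⟩ | ⟨-, rfl | rfl | rfl⟩
    · exact Or.inr (h'.mem e)
    · exact Or.inl rfl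
    · exact Or.inr h.mem_u
    · exact Or.inr h.mem_z
    · exact Or.inr h.mem_w
  · intro x y e
    rw [h.edge] at e ⊢
    rcases e with e | e | e
    · exact Or.inl (h'.symm e)
    · exact Or.inr (Or.inr e)
    · exact Or.inr (Or.inl e)
  · have key : ∀ y, (y = u ∨ y = z ∨ y = w) → ∃ k, X.pos y - X.pos v = dirVec k := by
      rintro y (rfl | rfl | rfl)
      · exact ⟨_, symm' hk⟩
      · by_cases e : u = y
        · subst e; exact ⟨_, symm' hk⟩
        · exact ⟨_, ezv e⟩
      · exact ⟨_, hm⟩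
    intro x y e
    rcases (h.edge x y).1 e with e | ⟨rfl, e⟩ | ⟨rfl, e⟩
    · rw [h.pos _ (h'.mem e), h.pos _ (h'.mem' e)]
      exact h'.dir e
    · exact key y e
    · obtain ⟨k, hk⟩ := key x e
      exact ⟨_, symm' hk⟩
  · intro x y t e
    rw [h.edge]
    rcases (h.tri x y t).1 e with e | ⟨a, e⟩ | ⟨a, e⟩
    · exact Or.inl (h'.tri_edge e)
    · rcases e with ⟨rfl, rfl, rfl⟩ | ⟨rfl, rfl, rfl⟩ | ⟨rfl, rfl, rfl⟩
      · simp
      · exact Or.inl (h'.symm (h.bdry_u a).1)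
      · simp
    · rcases e with ⟨rfl, rfl, rfl⟩ | ⟨rfl, rfl, rfl⟩ | ⟨rfl, rfl, rfl⟩
      · simp
      · exact Or.inl (h'.symm (h.bdry_w a).1)
      · simp
  · intro x y t e
    rw [h.tri] at e ⊢
    rcases e with e | ⟨a, e⟩ | ⟨a, e⟩
    · exact Or.inl (h'.tri_rot e)
    · right; left; refine ⟨a, ?_⟩; tauto
    · right; right; refine ⟨a, ?_⟩; tauto
  · intro x y t e
    rcases (h.tri x y t).1 e with e | ⟨a, e⟩ | ⟨a, e⟩
    · have h1 := h'.tri_edge e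
      have h2 := h'.tri_edge (h'.tri_rot e)
      rw [h.pos _ (h'.mem h1), h.pos _ (h'.mem h2), h.pos _ (h'.mem' h2)]
      exact h'.tri_pos e
    · have e1 := hku a
      have e2 := ezv a
      have e3 := symm' hk
      have e4 := symm' e1
      have e5 := symm' e2
      rcases e with ⟨rfl, rfl, rfl⟩ | ⟨rfl, rfl, rfl⟩ | ⟨rfl, rfl, rfl⟩
      · rw [e2, e3, rotateCW_dirVec]; exact dirVec_congr (by omega)
      · rw [e4, e5, rotateCW_dirVec]; exact dirVec_congr (by omega)
      · rw [hk, e1, rotateCW_dirVec]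
    · have e1 := hmw a
      have e2 := ezv' a
      have e3 := symm' hm
      have e4 := symm' e1
      have e5 := symm' e2
      rcases e with ⟨rfl, rfl, rfl⟩ | ⟨rfl, rfl, rfl⟩ | ⟨rfl, rfl, rfl⟩
      · rw [e2, hm, rotateCW_dirVec]
      · rw [e3, e4, rotateCW_dirVec]; exact dirVec_congr (by omega)
      · rw [e1, e5, rotateCW_dirVec]; exact dirVec_congr (by omega)
  · intro x y t t' e e'
    rw [h.tri] at e e'
    have b1 : u ≠ z → ∀ t, ¬ X'.Tri z u t := fun a => (h.bdry_u a).2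
    have b2 : w ≠ z → ∀ t, ¬ X'.Tri w z t := fun a => (h.bdry_w a).2
    have b3 := h.eq_of_eq
    have b4 := @h'.tri_unique x y t t'
    clear hku hmw ezv ezv' symm' hk hm
    grind

-- Each of the two possible triangles of the ear counts once at `z`; the first also counts at `u`
-- and the second at `w`.
open Classical in
theorem deg_new (h : IsEar X X' v u z w) (h' : X'.IsFlat) {x : W} (hx : x ∈ X'.verts) :
    X.deg x = X'.deg x + (if u ≠ z ∧ x = z then 1 else 0) + (if w ≠ z ∧ x = z then 1 else 0) +
      (if u ≠ z ∧ x = u then 1 else 0) + (if w ≠ z ∧ x = w then 1 else 0) := by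
  have hu : u ≠ v := fun e => h.notMem (e ▸ h.mem_u)
  have hz : z ≠ v := fun e => h.notMem (e ▸ h.mem_z)
  have hw : w ≠ v := fun e => h.notMem (e ▸ h.mem_w)
  have hxv : x ≠ v := fun e => h.notMem (e ▸ hx)
  have hE : ∀ x, ¬ X'.Edge v x := fun x e => h.notMem (h'.mem e)
  have hE' : ∀ x, ¬ X'.Edge x v := fun x e => h.notMem (h'.mem' e)
  have hT2 : ∀ x y, ¬ X'.Tri x v y := fun x y e => hE' _ (h'.tri_edge e)
  have b1 : u ≠ z → ∀ t, ¬ X'.Tri z u t := fun a => (h.bdry_u a).2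
  have b2 : w ≠ z → ∀ t, ¬ X'.Tri w z t := fun a => (h.bdry_w a).2
  have hv : X.verts = insert v X'.verts := by
    ext a; simp [h.verts]
  have key : ∀ a, (if ∃ b, X.Tri x a b then (1:ℤ) else 0) =
      (if ∃ b, X'.Tri x a b then 1 else 0) + (if a = u then (if u ≠ z ∧ x = z then 1 else 0) else 0)
      + (if a = v then (if w ≠ z ∧ x = z then 1 else 0) else 0)
      + (if a = v then (if u ≠ z ∧ x = u then 1 else 0) else 0)
      + (if a = z then (if w ≠ z ∧ x = w then 1 else 0) else 0) := by
    intro a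
    have : (∃ b, X.Tri x a b) ↔ (∃ b, X'.Tri x a b) ∨ (u ≠ z ∧ ((x = z ∧ a = u) ∨ (x = u ∧ a = v)))
        ∨ (w ≠ z ∧ ((x = w ∧ a = z) ∨ (x = z ∧ a = v))) := by
      simp only [h.tri]
      grind
    rw [if_congr this rfl rfl]
    clear this
    grind
  rw [deg, Finset.sum_congr rfl (fun a _ => key a)]
  simp only [Finset.sum_add_distrib, Finset.sum_ite_eq', deg]
  rw [hv, Finset.sum_insert h.notMem]
  simp [h.mem_u, h.mem_z, hT2]

open Classical in
theorem deg_tip (h : IsEar X X' v u z w) (h' : X'.IsFlat) :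
    X.deg v = (if u ≠ z then 1 else 0) + (if w ≠ z then 1 else 0) := by
  have hE : ∀ x, ¬ X'.Edge v x := fun x e => h.notMem (h'.mem e)
  have hT1 : ∀ x y, ¬ X'.Tri v x y := fun x y e => hE _ (h'.tri_edge e)
  have hu : u ≠ v := fun e => h.notMem (e ▸ h.mem_u)
  have hz : z ≠ v := fun e => h.notMem (e ▸ h.mem_z)
  have hw : w ≠ v := fun e => h.notMem (e ▸ h.mem_w)
  have key : ∀ a, (if ∃ b, X.Tri v a b then (1:ℤ) else 0) =
      (if a = z then (if u ≠ z then 1 else 0) else 0)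
      + (if a = w then (if w ≠ z then 1 else 0) else 0) := by
    intro a
    have : (∃ b, X.Tri v a b) ↔ (u ≠ z ∧ a = z) ∨ (w ≠ z ∧ a = w) := by
      simp only [h.tri]
      grind
    rw [if_congr this rfl rfl]
    clear this
    grind
  have e1 : z ∈ X.verts := (h.verts z).2 (Or.inr h.mem_z)
  have e2 : w ∈ X.verts := (h.verts w).2 (Or.inr h.mem_w)
  rw [deg, Finset.sum_congr rfl (fun a _ => key a)]
  simp only [Finset.sum_add_distrib, Finset.sum_ite_eq', if_pos e1, if_pos e2]

end IsEar

/-- Removal of a vertex. -/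
def remove [DecidableEq W] (X : Sheet W) (v : W) : Sheet W where
  verts := X.verts.erase v
  Edge x y := X.Edge x y ∧ x ≠ v ∧ y ≠ v
  Tri x y t := X.Tri x y t ∧ x ≠ v ∧ y ≠ v ∧ t ≠ v
  pos := X.pos

theorem IsFlat.remove [DecidableEq W] {X : Sheet W} (h : X.IsFlat) (v : W) :
    (X.remove v).IsFlat where
  mem e := Finset.mem_erase.2 ⟨e.2.1, h.mem e.1⟩
  symm e := ⟨h.symm e.1, e.2.2, e.2.1⟩
  dir e := h.dir e.1
  tri_edge e := ⟨h.tri_edge e.1, e.2.1, e.2.2.1⟩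
  tri_rot e := ⟨h.tri_rot e.1, e.2.2.1, e.2.2.2, e.2.1⟩
  tri_pos e := h.tri_pos e.1
  tri_unique e e' := h.tri_unique e.1 e'.1

end Sheet
end GridBilliards

/-! ### Boundary walks and exterior angles. -/

namespace GridBilliards

open IsChordDiagram (Cls cls_self cls_add cls_eq)

variable {W : Type*}

open Classical in
/-- The contribution of the pane `l` to the exterior angle at `x`, see `IsDiagram.vertex`. -/
noncomputable def cornerTerm (S : Set ℤ) (θ : ℤ → ℤ) (p : ℤ → W) (x : W) (l : ℤ) : ℤ :=
  if l ∈ S then (if p (l + 1) = x then θ l + 3 else 0) - (if p l = x then θ l else 0) else 0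

structure IsPeriodic (N : ℤ) (S : Set ℤ) (θ : ℤ → ℤ) (p : ℤ → W) : Prop where
  pos : 0 < N
  mem_add : ∀ l, l + N ∈ S ↔ l ∈ S
  dir_add : ∀ l ∈ S, θ (l + N) = θ l - 6
  p_add : ∀ l, p (l + N) = p l

namespace IsPeriodic

variable {N : ℤ} {S : Set ℤ} {θ : ℤ → ℤ} {p : ℤ → W}

theorem add_mul (h : IsPeriodic N S θ p) (l t : ℤ) :
    (l + t * N ∈ S ↔ l ∈ S) ∧ p (l + t * N) = p l ∧ (l ∈ S → θ (l + t * N) = θ l - 6 * t) := by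
  induction t using Int.induction_on with
  | zero => simp
  | succ t ih =>
    have e : l + ((t : ℤ) + 1) * N = (l + t * N) + N := by ring
    rw [e, h.mem_add, h.p_add]
    refine ⟨ih.1, ih.2.1, fun hl => ?_⟩
    rw [h.dir_add _ (ih.1.2 hl), ih.2.2 hl]; ring
  | pred t ih =>
    have e : l + (-(t : ℤ) - 1) * N + N = l + (-t) * N := by ring
    have m : l + (-(t : ℤ) - 1) * N ∈ S ↔ l ∈ S := by rw [← h.mem_add, e]; exact ih.1
    refine ⟨m, by rw [← h.p_add, e]; exact ih.2.1, fun hl => ?_⟩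
    have b := h.dir_add _ (m.2 hl)
    rw [e, ih.2.2 hl] at b
    linear_combination -b

theorem p_succ (h : IsPeriodic N S θ p) (l t : ℤ) : p (l + t * N + 1) = p (l + 1) := by
  rw [show l + t * N + 1 = l + 1 + t * N by ring]; exact (h.add_mul _ _).2.1

theorem exists_window (h : 0 < N) (c l : ℤ) : ∃ m t, l = m + t * N ∧ c ≤ m ∧ m < c + N :=
  ⟨c + (l - c) % N, (l - c) / N, by have := Int.mul_ediv_add_emod (l - c) N; linarith,
    by have := Int.emod_nonneg (l - c) h.ne'; linarith,
    by have := Int.emod_lt_of_pos (l - c) h; linarith⟩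

end IsPeriodic

/-- The boundary of the sheet `X` is the closed walk `p`; the step from `p l` to `p (l + 1)` is a
pane in the direction `θ l` if `l ∈ S`, and it is trivial otherwise. -/
structure IsDiagram (X : Sheet W) (N : ℤ) (S : Set ℤ) (θ : ℤ → ℤ) (p : ℤ → W) : Prop
    extends IsPeriodic N S θ p where
  flat : X.IsFlat
  p_mem : ∀ l, p l ∈ X.verts
  stay : ∀ l, l ∉ S → p (l + 1) = p l
  bdry : ∀ l ∈ S, X.Bdry (p l) (p (l + 1))
  dir : ∀ l ∈ S, X.pos (p (l + 1)) - X.pos (p l) = dirVec (θ l)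
  surj : ∀ x y, X.Bdry x y → ∃ l ∈ S, p l = x ∧ p (l + 1) = y
  inj : ∀ l ∈ S, ∀ m ∈ S, p l = p m → p (l + 1) = p (m + 1) → Cls N l m
  -- A visit of the walk to `x` leaves an exterior sector of angle `θ + 3 - θ'`, where `θ` and `θ'`
  -- are the incoming and outgoing directions. Triangles and sectors together fill the six units
  -- around `x`. At the base point the window pairs values of `θ` one period apart, whence the
  -- correction by `6`.
  vertex : ∀ c, ∀ x ∈ X.verts, X.deg x + ∑ l ∈ Finset.Ico c (c + N), cornerTerm S θ p x l =
    open Classical in 6 - if p c = x then 6 else 0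

-- Shifting the window by one trades the term at `c` for that at `c + N`. The drop of `θ` by `6` is
-- exactly matched by the moving base-point correction, so the angle relation needs to be checked at
-- a single base point.
open Classical in
theorem vertex_of_one {N : ℤ} {S : Set ℤ} {θ : ℤ → ℤ} {p : ℤ → W} (h : IsPeriodic N S θ p)
    (hst : ∀ l, l ∉ S → p (l + 1) = p l) {x : W} {d : ℤ} {c : ℤ}
    (hc : d + ∑ l ∈ Finset.Ico c (c + N), cornerTerm S θ p x l = 6 - if p c = x then 6 else 0)
    (c' : ℤ) :
    d + ∑ l ∈ Finset.Ico c' (c' + N), cornerTerm S θ p x l = 6 - if p c' = x then 6 else 0 := by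
  have step : ∀ c, (d + ∑ l ∈ Finset.Ico c (c + N), cornerTerm S θ p x l =
      6 - if p c = x then 6 else 0) ↔
      (d + ∑ l ∈ Finset.Ico (c + 1) (c + 1 + N), cornerTerm S θ p x l =
      6 - if p (c + 1) = x then 6 else 0) := by
    intro c
    have hN := h.pos
    have e1 : Finset.Ico c (c + N) = insert c (Finset.Ico (c + 1) (c + N)) := by
      ext l; simp only [Finset.mem_insert, Finset.mem_Ico]; omega
    have e2 : Finset.Ico (c + 1) (c + 1 + N) = insert (c + N) (Finset.Ico (c + 1) (c + N)) := by
      ext l; simp only [Finset.mem_insert, Finset.mem_Ico]; omega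
    rw [e1, e2, Finset.sum_insert (by simp), Finset.sum_insert (by simp)]
    have e3 : p (c + N + 1) = p (c + 1) := by
      rw [show c + N + 1 = c + 1 + N by ring]; exact h.p_add _
    by_cases hS : c ∈ S
    · have e4 := h.dir_add c hS
      simp only [cornerTerm, h.mem_add, hS, if_true, h.p_add, e3, e4]
      split_ifs <;> constructor <;> intro <;> linarith
    · rw [hst c hS]
      simp only [cornerTerm, h.mem_add, hS, if_false]
  have up : ∀ n : ℕ, ∀ c, (d + ∑ l ∈ Finset.Ico c (c + N), cornerTerm S θ p x l =
      6 - if p c = x then 6 else 0) ↔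
      (d + ∑ l ∈ Finset.Ico (c + n) (c + n + N), cornerTerm S θ p x l =
      6 - if p (c + n) = x then 6 else 0) := by
    intro n
    induction n with
    | zero => simp
    | succ n ih =>
      intro c
      rw [ih c, step]
      push_cast
      rw [show c + (n + 1 : ℤ) = c + n + 1 by ring]
  rcases le_total c c' with hcc | hcc
  · have := (up (c' - c).toNat c).1 hc
    rwa [show c + ((c' - c).toNat : ℤ) = c' by omega] at this
  · have := up (c - c').toNat c'
    rw [show c' + ((c - c').toNat : ℤ) = c by omega] at this
    exact this.2 hc

/-- The boundary walk `p'` passes through `u, z, w` in the steps `i` and `j`, where `p` passes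
through `u, v, w`; steps from `u` to `z` or from `z` to `w` that are trivial are not panes. -/
structure IsLabelEar (X' : Sheet W) (N : ℤ) (S S' : Set ℤ) (θ θ' : ℤ → ℤ) (p p' : ℤ → W)
    (i j : ℤ) (v u z w : W) : Prop where
  lt : i < j
  lt_add : j < i + N
  gap : ∀ l, i < l → l ≤ j → p l = v
  gap' : ∀ l, i < l → l ≤ j → p' l = z
  off : ∀ l, j < l → l ≤ i + N → p l = p' l
  hu : p' i = u
  hw : p' (j + 1) = w
  mem' : ∀ l, p' l ∈ X'.verts
  hS : ∀ l, j < l → l < i + N → (l ∈ S ↔ l ∈ S')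
  gapS : ∀ l, i < l → l < j → l ∉ S
  gapS' : ∀ l, i < l → l < j → l ∉ S'
  iS : i ∈ S
  jS : j ∈ S
  iS' : i ∈ S' ↔ u ≠ z
  jS' : j ∈ S' ↔ w ≠ z
  dir_i : u ≠ z → θ i = θ' i + 1
  dir_j : w ≠ z → θ j = θ' j - 1
  dir_off : ∀ l, j < l → l < i + N → l ∈ S → θ l = θ' l
  -- This is the angle relation at the tip `v`: the turn `θ i - θ j` is three minus the number of
  -- triangles of the ear.
  angle : open Classical in
    θ i - θ j + (if u ≠ z then 1 else 0) + (if w ≠ z then 1 else 0) = 3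

section
variable {X X' : Sheet W} {N : ℤ} {S S' : Set ℤ} {θ θ' : ℤ → ℤ} {p p' : ℤ → W}
    {i j : ℤ} {v u z w : W}

-- At an old vertex, what the ear adds to the number of triangles is taken away from the exterior
-- sectors through the changed directions at `i` and `j`.
open Classical in
theorem IsLabelEar.sum (L : IsLabelEar X' N S S' θ θ' p p' i j v u z w) (h : X.IsEar X' v u z w)
    (h' : X'.IsFlat) (hP : IsPeriodic N S θ p) (hP' : IsPeriodic N S' θ' p')
    {x : W} (hx : x ∈ X'.verts) :
    X.deg x + ∑ l ∈ Finset.Ico i (i + N), cornerTerm S θ p x l =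
    X'.deg x + ∑ l ∈ Finset.Ico i (i + N), cornerTerm S' θ' p' x l := by
  have lt := L.lt
  have ltN := L.lt_add
  have hxv : x ≠ v := fun e => h.notMem (e ▸ hx)
  have e1 : Finset.Ico i (i + N) = insert i (insert j ((Finset.Ico i (i + N)).filter
      fun l => l ≠ i ∧ l ≠ j)) := by
    ext l; simp only [Finset.mem_insert, Finset.mem_Ico, Finset.mem_filter]; omega
  have e2 : ∀ f : ℤ → ℤ, ∑ l ∈ Finset.Ico i (i + N), f l = f i + (f j +
      ∑ l ∈ (Finset.Ico i (i + N)).filter (fun l => l ≠ i ∧ l ≠ j), f l) := by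
    intro f
    conv_lhs => rw [e1]
    rw [Finset.sum_insert, Finset.sum_insert]
    · simp
    · simp [lt.ne]
  have e3 : ∑ l ∈ (Finset.Ico i (i + N)).filter (fun l => l ≠ i ∧ l ≠ j), cornerTerm S θ p x l =
      ∑ l ∈ (Finset.Ico i (i + N)).filter (fun l => l ≠ i ∧ l ≠ j), cornerTerm S' θ' p' x l := by
    refine Finset.sum_congr rfl fun l hl => ?_
    simp only [Finset.mem_filter, Finset.mem_Ico] at hl
    rcases lt_trichotomy l j with hlj | hlj | hlj
    · simp [cornerTerm, L.gapS l (by omega) hlj, L.gapS' l (by omega) hlj]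
    · omega
    · have a := L.hS l hlj (by omega)
      by_cases hl' : l ∈ S
      · simp only [cornerTerm, ← a, hl', if_true, L.off l hlj (by omega),
          L.off (l + 1) (by omega) (by omega), L.dir_off l hlj (by omega) hl']
      · simp only [cornerTerm, ← a, hl', if_false]
  rw [e2, e2, e3, h.deg_new h' hx]
  have pi : p i = u := by
    have := L.off (i + N) (by omega) le_rfl
    rwa [hP.p_add, hP'.p_add, L.hu] at this
  have pi1 := L.gap (i + 1) (by omega) (by omega)
  have pi1' := L.gap' (i + 1) (by omega) (by omega)
  have pj := L.gap j (by omega) (by omega)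
  have pj' := L.gap' j (by omega) (by omega)
  have pj1 := L.off (j + 1) (by omega) (by omega)
  rw [L.hw] at pj1
  simp only [cornerTerm, L.iS, L.jS, L.iS', L.jS', if_true, pi, pi1, pi1', pj, pj', pj1, L.hw, L.hu,
    Ne.symm hxv, if_false]
  have d1 := L.dir_i
  have d2 := L.dir_j
  have d3 := L.angle
  have := h.eq_of_eq
  clear e1 e2 e3
  by_cases a : u = z <;> by_cases b : w = z <;>
    simp only [a, b, ne_eq, not_true_eq_false, not_false_eq_true, if_true, if_false, true_and,
      false_and, add_zero, zero_add, forall_const] at d1 d2 d3 ⊢ <;> grind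

theorem IsLabelEar.p_i (L : IsLabelEar X' N S S' θ θ' p p' i j v u z w)
    (hP : IsPeriodic N S θ p) (hP' : IsPeriodic N S' θ' p') : p i = u := by
  have := L.off (i + N) (by have := L.lt_add; omega) le_rfl
  rwa [hP.p_add, hP'.p_add, L.hu] at this

theorem IsLabelEar.p_j1 (L : IsLabelEar X' N S S' θ θ' p p' i j v u z w) : p (j + 1) = w := by
  rw [L.off (j + 1) (by omega) (by have := L.lt_add; omega), L.hw]

/-- The walks differ only between the steps `i` and `j`, so each field is checked on representatives
in `[i, i + N)`: the two new panes by hand, all others by inheritance. The angle relation at `v` is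
the one recorded in the label data. -/
theorem IsDiagram.up (D : IsDiagram X' N S' θ' p') (h : X.IsEar X' v u z w)
    (L : IsLabelEar X' N S S' θ θ' p p' i j v u z w) (hP : IsPeriodic N S θ p)
    (hk : X.pos v - X.pos u = dirVec (θ i)) (hm : X.pos w - X.pos v = dirVec (θ j)) :
    IsDiagram X N S θ p := by
  have lt := L.lt
  have ltN := L.lt_add
  have hP' := D.toIsPeriodic
  have pi := L.p_i hP hP'
  have pi1 := L.gap (i + 1) (by omega) (by omega)
  have pi1' := L.gap' (i + 1) (by omega) (by omega)
  have pj := L.gap j (by omega) (by omega)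
  have pj' := L.gap' j (by omega) (by omega)
  have pj1 := L.p_j1
  have hnv : ∀ l, p' l ≠ v := fun l e => h.notMem (e ▸ D.p_mem l)
  have hu : u ≠ v := fun e => h.notMem (e ▸ h.mem_u)
  have hz : z ≠ v := fun e => h.notMem (e ▸ h.mem_z)
  have hw : w ≠ v := fun e => h.notMem (e ▸ h.mem_w)
  have flat : X.IsFlat := by
    refine h.flat_new D.flat hk hm (fun a => ?_) (fun a => ?_)
    · have := D.dir i (L.iS'.2 a)
      rw [pi1', L.hu, ← h.pos _ h.mem_z, ← h.pos _ h.mem_u] at this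
      rw [this, L.dir_i a]; simp
    · have := D.dir j (L.jS'.2 a)
      rw [pj', L.hw, ← h.pos _ h.mem_z, ← h.pos _ h.mem_w] at this
      rw [this, L.dir_j a]; simp
  have tri : ∀ l, i ≤ l → l < i + N → l ∈ S → l = i ∨ l = j ∨ (j < l ∧ l ∈ S') := by
    intro l h1 h2 h3
    rcases lt_trichotomy l j with hlj | hlj | hlj
    · by_contra hcon
      exact L.gapS l (by omega) hlj h3
    · exact Or.inr (Or.inl hlj)
    · exact Or.inr (Or.inr ⟨hlj, (L.hS l hlj h2).1 h3⟩)
  refine { hP with flat := flat, p_mem := ?_, stay := ?_, bdry := ?_, dir := ?_, surj := ?_, inj := ?_, vertex := ?_ }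
  · intro l
    obtain ⟨m, t, rfl, h1, h2⟩ := IsPeriodic.exists_window hP.pos i l
    rw [(hP.add_mul m t).2.1, h.verts]
    rcases eq_or_lt_of_le h1 with rfl | h1
    · rw [pi]; exact Or.inr h.mem_u
    · by_cases hmj : m ≤ j
      · exact Or.inl (L.gap m h1 hmj)
      · rw [L.off m (by omega) h2.le]; exact Or.inr (D.p_mem m)
  · intro l hl
    obtain ⟨m, t, rfl, h1, h2⟩ := IsPeriodic.exists_window hP.pos i l
    rw [hP.p_succ, (hP.add_mul m t).2.1]
    rw [(hP.add_mul m t).1] at hl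
    have : m ≠ i := fun e => hl (e ▸ L.iS)
    have : m ≠ j := fun e => hl (e ▸ L.jS)
    by_cases hmj : m ≤ j
    · rw [L.gap m (by omega) hmj, L.gap _ (by omega) (by omega)]
    · rw [L.off m (by omega) (by omega), L.off _ (by omega) (by omega)]
      exact D.stay m (fun e => hl ((L.hS m (by omega) h2).2 e))
  · intro l hl
    obtain ⟨m, t, rfl, h1, h2⟩ := IsPeriodic.exists_window hP.pos i l
    rw [hP.p_succ, (hP.add_mul m t).2.1, h.bdry_iff D.flat]
    rw [(hP.add_mul m t).1] at hl
    rcases tri m h1 h2 hl with rfl | rfl | ⟨h3, h4⟩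
    · exact Or.inr (Or.inl ⟨pi, pi1⟩)
    · exact Or.inr (Or.inr ⟨pj, pj1⟩)
    · left
      rw [L.off m (by omega) (by omega), L.off _ (by omega) (by omega)]
      refine ⟨D.bdry m h4, ?_, ?_⟩
      · rintro ⟨a, b, c⟩
        have := D.inj _ h4 _ (L.iS'.2 a) (by rw [b, L.hu]) (by rw [c, pi1'])
        have := cls_eq (cls_self N m) this (by omega) (by omega)
        omega
      · rintro ⟨a, b, c⟩
        have := D.inj _ h4 _ (L.jS'.2 a) (by rw [b, pj']) (by rw [c, L.hw])
        have := cls_eq (cls_self N m) this (by omega) (by omega)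
        omega
  · intro l hl
    obtain ⟨m, t, rfl, h1, h2⟩ := IsPeriodic.exists_window hP.pos i l
    rw [hP.p_succ, (hP.add_mul m t).2.1]
    rw [(hP.add_mul m t).1] at hl
    rw [(hP.add_mul m t).2.2 hl, dirVec_congr (k := θ m - 6 * t) (m := θ m) (by omega)]
    rcases tri m h1 h2 hl with rfl | rfl | ⟨h3, h4⟩
    · rw [pi, pi1, hk]
    · rw [pj, pj1, hm]
    · rw [L.off m (by omega) (by omega), L.off _ (by omega) (by omega), h.pos _ (D.p_mem _),
        h.pos _ (D.p_mem _), L.dir_off m h3 h2 hl]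
      exact D.dir m h4
  · intro x y hxy
    rcases (h.bdry_iff D.flat x y).1 hxy with ⟨hxy, h1, h2⟩ | ⟨rfl, rfl⟩ | ⟨rfl, rfl⟩
    · obtain ⟨l, hl, rfl, rfl⟩ := D.surj x y hxy
      obtain ⟨m, t, rfl, h3, h4⟩ := IsPeriodic.exists_window hP.pos i l
      rw [hP'.p_succ, (hP'.add_mul m t).2.1] at h1 h2 ⊢
      rw [(hP'.add_mul m t).1] at hl
      have a1 : m ≠ i := by
        rintro rfl
        exact h1 ⟨L.iS'.1 hl, L.hu, pi1'⟩
      have a2 : m ≠ j := by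
        rintro rfl
        exact h2 ⟨L.jS'.1 hl, pj', L.hw⟩
      have a3 : j < m := by
        by_contra hcon
        exact L.gapS' m (by omega) (by omega) hl
      exact ⟨m, (L.hS m a3 h4).2 hl, L.off _ (by omega) (by omega), L.off _ (by omega) (by omega)⟩
    · exact ⟨i, L.iS, pi, pi1⟩
    · exact ⟨j, L.jS, pj, pj1⟩
  · intro l hl m hmS e1 e2
    obtain ⟨l, t, rfl, h1, h2⟩ := IsPeriodic.exists_window hP.pos i l
    obtain ⟨m, t', rfl, h3, h4⟩ := IsPeriodic.exists_window hP.pos i m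
    rw [hP.p_succ, hP.p_succ] at e2
    rw [(hP.add_mul _ _).2.1, (hP.add_mul _ _).2.1] at e1
    rw [(hP.add_mul _ _).1] at hl hmS
    suffices hs : Cls N l m by
      obtain ⟨r, hr⟩ := hs
      exact ⟨r + t' - t, by rw [hr]; ring⟩
    rcases tri l h1 h2 hl with rfl | rfl | ⟨a1, a2⟩ <;>
      rcases tri m h3 h4 hmS with rfl | rfl | ⟨a3, a4⟩
    · exact cls_self _ _
    · rw [pi, pj] at e1; exact absurd e1 hu
    · rw [pi1, L.off _ (by omega) (by omega)] at e2; exact absurd e2.symm (hnv _)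
    · rw [pi, pj] at e1; exact absurd e1.symm hu
    · exact cls_self _ _
    · rw [pj, L.off _ (by omega) (by omega)] at e1; exact absurd e1.symm (hnv _)
    · rw [pi1, L.off _ (by omega) (by omega)] at e2; exact absurd e2 (hnv _)
    · rw [pj, L.off _ (by omega) (by omega)] at e1; exact absurd e1 (hnv _)
    · rw [L.off _ (by omega) (by omega), L.off m (by omega) (by omega)] at e1
      rw [L.off _ (by omega) (by omega), L.off (m + 1) (by omega) (by omega)] at e2
      exact D.inj _ a2 _ a4 e1 e2
  · have hst : ∀ l, l ∉ S → p (l + 1) = p l := by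
      intro l hl
      obtain ⟨m, t, rfl, h1, h2⟩ := IsPeriodic.exists_window hP.pos i l
      rw [hP.p_succ, (hP.add_mul m t).2.1]
      rw [(hP.add_mul m t).1] at hl
      have : m ≠ i := fun e => hl (e ▸ L.iS)
      have : m ≠ j := fun e => hl (e ▸ L.jS)
      by_cases hmj : m ≤ j
      · rw [L.gap m (by omega) hmj, L.gap _ (by omega) (by omega)]
      · rw [L.off m (by omega) (by omega), L.off _ (by omega) (by omega)]
        exact D.stay m (fun e => hl ((L.hS m (by omega) h2).2 e))
    intro c x hx
    refine vertex_of_one hP hst (c := i) ?_ c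
    rcases (h.verts x).1 hx with rfl | hx
    · classical
      rw [h.deg_tip D.flat, pi, if_neg hu]
      have : ∑ l ∈ Finset.Ico i (i + N), cornerTerm S θ p x l = (θ i + 3) - θ j := by
        rw [Finset.sum_eq_add_of_mem i j (by simp; omega) (by simp; omega) lt.ne]
        · simp [cornerTerm, L.iS, L.jS, pi, pi1, pj, pj1, hu, hw]
          ring
        · intro l hl hne
          rw [Finset.mem_Ico] at hl
          by_cases hlS : l ∈ S
          · rcases tri l hl.1 hl.2 hlS with rfl | rfl | ⟨a1, a2⟩
            · exact absurd rfl hne.1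
            · exact absurd rfl hne.2
            · rw [cornerTerm, L.off _ (by omega) (by omega), L.off l (by omega) (by omega)]
              simp [hnv]
          · simp [cornerTerm, hlS]
      rw [this]
      have := L.angle
      linarith
    · rw [L.sum h D.flat hP hP' hx, D.vertex i x hx, pi, L.hu]

/-- The same comparison read backwards. The panes uncovered by the removal are the inner sides of
the ear, and their directions come from the unit triangles `u, v, z` and `v, w, z`. -/
theorem IsDiagram.down (D : IsDiagram X N S θ p) (h : X.IsEar X' v u z w) (hX' : X'.IsFlat)
    (L : IsLabelEar X' N S S' θ θ' p p' i j v u z w) (hP' : IsPeriodic N S' θ' p') :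
    IsDiagram X' N S' θ' p' := by
  have lt := L.lt
  have ltN := L.lt_add
  have hP := D.toIsPeriodic
  have pi := L.p_i hP hP'
  have pi1 := L.gap (i + 1) (by omega) (by omega)
  have pi1' := L.gap' (i + 1) (by omega) (by omega)
  have pj := L.gap j (by omega) (by omega)
  have pj' := L.gap' j (by omega) (by omega)
  have pj1 := L.p_j1
  have hnv : ∀ l, p' l ≠ v := fun l e => h.notMem (e ▸ L.mem' l)
  have hu : u ≠ v := fun e => h.notMem (e ▸ h.mem_u)
  have hz : z ≠ v := fun e => h.notMem (e ▸ h.mem_z)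
  have hw : w ≠ v := fun e => h.notMem (e ▸ h.mem_w)
  have tri : ∀ l, i ≤ l → l < i + N → l ∈ S' →
      (l = i ∧ u ≠ z) ∨ (l = j ∧ w ≠ z) ∨ (j < l ∧ l ∈ S) := by
    intro l h1 h2 h3
    rcases lt_trichotomy l j with hlj | rfl | hlj
    · rcases eq_or_lt_of_le h1 with rfl | h1
      · exact Or.inl ⟨rfl, L.iS'.1 h3⟩
      · exact absurd h3 (L.gapS' l h1 hlj)
    · exact Or.inr (Or.inl ⟨rfl, L.jS'.1 h3⟩)
    · exact Or.inr (Or.inr ⟨hlj, (L.hS l hlj h2).2 h3⟩)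
  have bd : ∀ l, j < l → l < i + N → l ∈ S → X'.Bdry (p' l) (p' (l + 1)) ∧
      ¬ (u ≠ z ∧ p' l = u ∧ p' (l + 1) = z) ∧ ¬ (w ≠ z ∧ p' l = z ∧ p' (l + 1) = w) := by
    intro l h1 h2 h3
    have := D.bdry l h3
    rw [L.off l (by omega) (by omega), L.off _ (by omega) (by omega), h.bdry_iff hX'] at this
    rcases this with h | h | h
    · exact h
    · exact absurd h.2 (hnv _)
    · exact absurd h.1 (hnv _)
  have hst : ∀ l, l ∉ S' → p' (l + 1) = p' l := by
    intro l hl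
    obtain ⟨m, t, rfl, h1, h2⟩ := IsPeriodic.exists_window hP.pos i l
    rw [hP'.p_succ, (hP'.add_mul m t).2.1]
    rw [(hP'.add_mul m t).1] at hl
    rcases eq_or_lt_of_le h1 with rfl | h1
    · rw [L.hu, pi1']
      by_contra hne
      exact hl (L.iS'.2 (Ne.symm hne))
    rcases lt_trichotomy m j with hmj | rfl | hmj
    · rw [L.gap' m (by omega) (by omega), L.gap' _ (by omega) (by omega)]
    · rw [pj', L.hw]
      by_contra hne
      exact hl (L.jS'.2 hne)
    · rw [← L.off m (by omega) (by omega), ← L.off _ (by omega) (by omega)]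
      exact D.stay m (fun e => hl ((L.hS m (by omega) h2).1 e))
  refine { hP' with flat := hX', p_mem := L.mem', stay := hst, bdry := ?_, dir := ?_, surj := ?_, inj := ?_, vertex := ?_ }
  · intro l hl
    obtain ⟨m, t, rfl, h1, h2⟩ := IsPeriodic.exists_window hP.pos i l
    rw [hP'.p_succ, (hP'.add_mul m t).2.1]
    rw [(hP'.add_mul m t).1] at hl
    rcases tri m h1 h2 hl with ⟨rfl, a⟩ | ⟨rfl, a⟩ | ⟨h3, h4⟩
    · rw [L.hu, pi1']; exact h.bdry_u a
    · rw [L.hw, pj']; exact h.bdry_w a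
    · exact (bd m h3 h2 h4).1
  · intro l hl
    obtain ⟨m, t, rfl, h1, h2⟩ := IsPeriodic.exists_window hP.pos i l
    rw [hP'.p_succ, (hP'.add_mul m t).2.1]
    rw [(hP'.add_mul m t).1] at hl
    rw [(hP'.add_mul m t).2.2 hl, dirVec_congr (k := θ' m - 6 * t) (m := θ' m) (by omega)]
    have tpos : ∀ {x y t}, X.Tri x y t → ∀ k, X.pos y - X.pos x = dirVec k →
        X.pos t - X.pos x = dirVec (k - 1) := by
      intro x y t ht k hk
      rw [D.flat.tri_pos ht, hk, rotateCW_dirVec]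
    rcases tri m h1 h2 hl with ⟨rfl, a⟩ | ⟨rfl, a⟩ | ⟨h3, h4⟩
    · have ht : X.Tri u v z := (h.tri _ _ _).2 (by simp [a])
      have := D.dir m L.iS
      rw [pi, pi1] at this
      rw [L.hu, pi1', ← h.pos _ h.mem_u, ← h.pos _ h.mem_z, tpos ht _ this, L.dir_i a]
      simp
    · have ht : X.Tri w z v := (h.tri _ _ _).2 (by simp [a])
      have e1 := D.dir m L.jS
      rw [pj, pj1] at e1
      have e2 := tpos (D.flat.tri_rot (D.flat.tri_rot ht)) _ e1
      rw [L.hw, pj', ← h.pos _ h.mem_w, ← h.pos _ h.mem_z,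
        ← sub_sub_sub_cancel_right _ _ (X.pos v), e1, e2, dirVec_sub, L.dir_j a]
      simp
    · rw [← h.pos _ (L.mem' _), ← h.pos _ (L.mem' _), ← L.off m (by omega) (by omega),
        ← L.off _ (by omega) (by omega), ← L.dir_off m h3 h2 h4]
      exact D.dir m h4
  · intro x y hxy
    by_cases a : u ≠ z ∧ x = u ∧ y = z
    · obtain ⟨a, rfl, rfl⟩ := a
      exact ⟨i, L.iS'.2 a, L.hu, pi1'⟩
    by_cases b : w ≠ z ∧ x = z ∧ y = w
    · obtain ⟨b, rfl, rfl⟩ := b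
      exact ⟨j, L.jS'.2 b, pj', L.hw⟩
    have hx : x ≠ v := fun e => h.notMem (e ▸ hX'.mem hxy.1)
    have hy : y ≠ v := fun e => h.notMem (e ▸ hX'.mem' hxy.1)
    obtain ⟨l, hl, rfl, rfl⟩ := D.surj x y ((h.bdry_iff hX' x y).2 (Or.inl ⟨hxy, a, b⟩))
    obtain ⟨m, t, rfl, h3, h4⟩ := IsPeriodic.exists_window hP.pos i l
    rw [hP.p_succ] at hy ⊢
    rw [(hP.add_mul m t).2.1] at hx ⊢
    rw [(hP.add_mul m t).1] at hl
    have a1 : m ≠ i := by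
      rintro rfl
      exact hy pi1
    have a2 : j < m := by
      by_contra hcon
      exact hx (L.gap m (by omega) (by omega))
    exact ⟨m, (L.hS m a2 h4).1 hl, (L.off _ (by omega) (by omega)).symm,
      (L.off _ (by omega) (by omega)).symm⟩
  · intro l hl m hm e1 e2
    obtain ⟨l, t, rfl, h1, h2⟩ := IsPeriodic.exists_window hP.pos i l
    obtain ⟨m, t', rfl, h3, h4⟩ := IsPeriodic.exists_window hP.pos i m
    rw [hP'.p_succ, hP'.p_succ] at e2
    rw [(hP'.add_mul _ _).2.1, (hP'.add_mul _ _).2.1] at e1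
    rw [(hP'.add_mul _ _).1] at hl hm
    suffices hs : Cls N l m by
      obtain ⟨r, hr⟩ := hs
      exact ⟨r + t' - t, by rw [hr]; ring⟩
    rcases tri l h1 h2 hl with ⟨rfl, a⟩ | ⟨rfl, a⟩ | ⟨a1, a2⟩ <;>
      rcases tri m h3 h4 hm with ⟨rfl, b⟩ | ⟨rfl, b⟩ | ⟨a3, a4⟩
    · exact cls_self _ _
    · rw [pj', L.hu] at e1; exact absurd e1 a
    · exact absurd ⟨a, by rw [← e1, L.hu], by rw [← e2, pi1']⟩ (bd m a3 h4 a4).2.1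
    · rw [pj', L.hu] at e1; exact absurd e1.symm b
    · exact cls_self _ _
    · exact absurd ⟨a, by rw [← e1, pj'], by rw [← e2, L.hw]⟩ (bd m a3 h4 a4).2.2
    · exact absurd ⟨b, by rw [e1, L.hu], by rw [e2, pi1']⟩ (bd l a1 h2 a2).2.1
    · exact absurd ⟨b, by rw [e1, pj'], by rw [e2, L.hw]⟩ (bd l a1 h2 a2).2.2
    · rw [← L.off _ (by omega) (by omega), ← L.off m (by omega) (by omega)] at e1
      rw [← L.off _ (by omega) (by omega), ← L.off (m + 1) (by omega) (by omega)] at e2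
      exact D.inj _ a2 _ a4 e1 e2
  · intro c x hx
    refine vertex_of_one hP' hst (c := i) ?_ c
    rw [← L.sum h hX' hP hP' hx, D.vertex i x ((h.verts x).2 (Or.inr hx)), pi, L.hu]
end
end GridBilliards

/-! ### Beams through an ear. -/

namespace GridBilliards

open IsChordDiagram (Cls cls_self cls_add cls_eq)

variable {W : Type*}

/-- The beam that leaves the boundary walk `p` at the pane `l` hits the pane `π l`. -/
def Strands (X : Sheet W) (S : Set ℤ) (p : ℤ → W) (π : ℤ → ℤ) : Prop :=
  ∀ l ∈ S, X.Reach (p l, p (l + 1)) (p (π l + 1), p (π l))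

namespace Sheet

variable {X X' : Sheet W}

theorem reach_even {x y t : W} {k : ℤ} (h : X.Tri x y t) (hk : X.pos y - X.pos x = dirVec k)
    (hk2 : k % 2 = 0) : X.Reach (x, y) (t, y) :=
  Relation.ReflTransGen.single ⟨t, k, h, hk, Or.inl ⟨hk2, rfl⟩⟩

theorem reach_odd {x y t : W} {k : ℤ} (h : X.Tri x y t) (hk : X.pos y - X.pos x = dirVec k)
    (hk2 : k % 2 = 1) : X.Reach (x, y) (x, t) :=
  Relation.ReflTransGen.single ⟨t, k, h, hk, Or.inr ⟨hk2, rfl⟩⟩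

theorem IsEar.reach {v u z w : W} (h : X.IsEar X' v u z w) (h' : X'.IsFlat) {d e : W × W}
    (hr : X'.Reach d e) : X.Reach d e := by
  refine Relation.ReflTransGen.mono (r := X'.Step) (p := X.Step) ?_ _ _ hr
  rintro ⟨x, y⟩ e ⟨t, k, h1, h2, h3⟩
  refine ⟨t, k, (h.tri _ _ _).2 (Or.inl h1), ?_, h3⟩
  have := h'.tri_edge h1
  rw [h.pos _ (h'.mem this), h.pos _ (h'.mem' this)]
  exact h2

end Sheet

section
variable {X X' : Sheet W} {N : ℤ} {S S' : Set ℤ} {θ θ' : ℤ → ℤ} {p p' : ℤ → W} {π π' : ℤ → ℤ}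
    {i j : ℤ} {v u z w : W}

theorem IsPeriodic.p_cls (h : IsPeriodic N S θ p) {l m : ℤ} (hl : Cls N l m) :
    p m = p l ∧ p (m + 1) = p (l + 1) := by
  obtain ⟨t, rfl⟩ := hl
  exact ⟨(h.add_mul l t).2.1, h.p_succ l t⟩

theorem IsLabelEar.p_eq (L : IsLabelEar X' N S S' θ θ' p p' i j v u z w)
    (hP : IsPeriodic N S θ p) (hP' : IsPeriodic N S' θ' p') {m : ℤ} (hm : m ∈ S')
    (h1 : ¬ Cls N i m) (h2 : ¬ Cls N j m) : p' m = p m ∧ p' (m + 1) = p (m + 1) := by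
  obtain ⟨m, t, rfl, h3, h4⟩ := IsPeriodic.exists_window hP.pos i m
  rw [hP.p_succ, hP'.p_succ, (hP.add_mul m t).2.1, (hP'.add_mul m t).2.1]
  have e1 : m ≠ i := by rintro rfl; exact h1 ⟨t, rfl⟩
  have e2 : m ≠ j := by rintro rfl; exact h2 ⟨t, rfl⟩
  have e3 : j < m := by
    by_contra hcon
    exact L.gapS' m (by omega) (by omega) ((hP'.add_mul m t).1.1 hm)
  rw [L.off m (by omega) (by omega), L.off _ (by omega) (by omega)]
  exact ⟨rfl, rfl⟩

theorem IsLabelEar.values (L : IsLabelEar X' N S S' θ θ' p p' i j v u z w)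
    (hP : IsPeriodic N S θ p) (hP' : IsPeriodic N S' θ' p') {m : ℤ} :
    (Cls N i m → p m = u ∧ p (m + 1) = v ∧ p' m = u ∧ p' (m + 1) = z) ∧
    (Cls N j m → p m = v ∧ p (m + 1) = w ∧ p' m = z ∧ p' (m + 1) = w) := by
  have lt := L.lt
  constructor
  · intro h
    rw [(hP.p_cls h).1, (hP.p_cls h).2, (hP'.p_cls h).1, (hP'.p_cls h).2]
    exact ⟨L.p_i hP hP', L.gap _ (by omega) (by omega), L.hu, L.gap' _ (by omega) (by omega)⟩
  · intro h
    rw [(hP.p_cls h).1, (hP.p_cls h).2, (hP'.p_cls h).1, (hP'.p_cls h).2]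
    exact ⟨L.gap _ (by omega) le_rfl, L.p_j1, L.gap' _ (by omega) le_rfl, L.hw⟩

theorem IsLabelEar.not_cls (L : IsLabelEar X' N S S' θ θ' p p' i j v u z w) {m : ℤ}
    (h1 : Cls N i m) (h2 : Cls N j m) : False := by
  obtain ⟨t, ht⟩ := h1
  obtain ⟨t', ht'⟩ := h2
  have := cls_eq (cls_self N i) (⟨t - t', by rw [ht] at ht'; linear_combination -ht'⟩ : Cls N i j)
    (by have := L.lt; have := L.lt_add; omega) (by have := L.lt_add; omega)
  have := L.lt
  omega

/-- The directions of the panes of an ear. -/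
structure IsEarDirs (X : Sheet W) (v u z w : W) (a b : ℤ) : Prop where
  uv : X.pos v - X.pos u = dirVec a
  vw : X.pos w - X.pos v = dirVec b
  zu : u ≠ z → X.pos u - X.pos z = dirVec (a + 2)
  wz : w ≠ z → X.pos z - X.pos w = dirVec (b + 4)

theorem IsDiagram.earDirs (D : IsDiagram X N S θ p) (h : X.IsEar X' v u z w)
    (L : IsLabelEar X' N S S' θ θ' p p' i j v u z w) (hP' : IsPeriodic N S' θ' p') :
    IsEarDirs X v u z w (θ i) (θ j) := by
  have hP := D.toIsPeriodic
  have v1 := (L.values hP hP' (m := i)).1 (cls_self _ _)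
  have v2 := (L.values hP hP' (m := j)).2 (cls_self _ _)
  have e1 := D.dir i L.iS
  have e2 := D.dir j L.jS
  rw [v1.1, v1.2.1] at e1
  rw [v2.1, v2.2.1] at e2
  have neg : ∀ {x y : W} {k : ℤ}, X.pos y - X.pos x = dirVec k → X.pos x - X.pos y = dirVec (k + 3) := by
    intro x y k e
    rw [dirVec_add_three, ← e]; abel
  refine ⟨e1, e2, fun a => ?_, fun a => ?_⟩
  · have ht : X.Tri u v z := (h.tri _ _ _).2 (by simp [a])
    have := D.flat.tri_pos ht
    rw [e1, rotateCW_dirVec] at this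
    rw [neg this]; ring_nf
  · have ht : X.Tri v w z := (h.tri _ _ _).2 (by simp [a])
    have := D.flat.tri_pos ht
    rw [e2, rotateCW_dirVec] at this
    have e3 : X.pos w - X.pos z = dirVec (θ j + 1) := by
      rw [← dirVec_sub, ← e2, ← this]; abel
    rw [neg e3]; ring_nf

/-- With these parities a beam leaving through the old pane `u, z` or `z, w` is carried by the new
triangle to the new pane with the same index, so targets keep their labels. -/
theorem IsLabelEar.target_even (L : IsLabelEar X' N S S' θ θ' p p' i j v u z w)
    (h : X.IsEar X' v u z w) (hP : IsPeriodic N S θ p) (hP' : IsPeriodic N S' θ' p')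
    (E : IsEarDirs X v u z w (θ i) (θ j)) (hi : u ≠ z → θ i % 2 = 0) (hj : w ≠ z → θ j % 2 = 1)
    {m : ℤ} (hm : m ∈ S') : X.Reach (p' (m + 1), p' m) (p (m + 1), p m) := by
  by_cases h1 : Cls N i m
  · obtain ⟨a1, a2, a3, a4⟩ := (L.values hP hP').1 h1
    have huz : u ≠ z := by
      obtain ⟨t, rfl⟩ := h1
      exact L.iS'.1 ((hP'.add_mul i t).1.1 hm)
    rw [a1, a2, a3, a4]
    exact X.reach_even ((h.tri _ _ _).2 (by simp [huz])) (E.zu huz) (by have := hi huz; omega)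
  by_cases h2 : Cls N j m
  · obtain ⟨a1, a2, a3, a4⟩ := (L.values hP hP').2 h2
    have hwz : w ≠ z := by
      obtain ⟨t, rfl⟩ := h2
      exact L.jS'.1 ((hP'.add_mul j t).1.1 hm)
    rw [a1, a2, a3, a4]
    exact X.reach_odd ((h.tri _ _ _).2 (by simp [hwz])) (E.wz hwz) (by have := hj hwz; omega)
  · rw [(L.p_eq hP hP' hm h1 h2).1, (L.p_eq hP hP' hm h1 h2).2]
    exact Relation.ReflTransGen.refl

theorem IsLabelEar.mem_old (L : IsLabelEar X' N S S' θ θ' p p' i j v u z w)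
    (hP : IsPeriodic N S θ p) (hP' : IsPeriodic N S' θ' p') {l : ℤ} (hl : l ∈ S)
    (h1 : ¬ Cls N i l) (h2 : ¬ Cls N j l) : l ∈ S' ∧ p' l = p l ∧ p' (l + 1) = p (l + 1) := by
  suffices hs : l ∈ S' from ⟨hs, L.p_eq hP hP' hs h1 h2⟩
  obtain ⟨m, t, rfl, h3, h4⟩ := IsPeriodic.exists_window hP.pos i l
  rw [(hP.add_mul m t).1] at hl
  rw [(hP'.add_mul m t).1]
  have e1 : m ≠ i := by rintro rfl; exact h1 ⟨t, rfl⟩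
  have e2 : m ≠ j := by rintro rfl; exact h2 ⟨t, rfl⟩
  have e3 : j < m := by
    by_contra hcon
    exact L.gapS m (by omega) (by omega) hl
  exact (L.hS m e3 h4).1 hl

/-- The ear is a pendant edge: its two sides hit each other by a beam of no steps, and no other beam
meets it. -/
theorem Strands.erase_pair (hs : Strands X' S' p' π') (hπ' : ∀ l ∈ S', π' l ∈ S')
    (h : X.IsEar X' v u z w) (h' : X'.IsFlat)
    (L : IsLabelEar X' N S S' θ θ' p p' i j v u z w) (hP : IsPeriodic N S θ p)
    (hP' : IsPeriodic N S' θ' p') (huz : u = z) (hwz : w = z)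
    (h1 : ∀ l ∈ S, Cls N i l → Cls N j (π l)) (h2 : ∀ l ∈ S, Cls N j l → Cls N i (π l))
    (h3 : ∀ l ∈ S, ¬ Cls N i l → ¬ Cls N j l → π l = π' l) : Strands X S p π := by
  subst huz hwz
  intro l hl
  by_cases c1 : Cls N i l
  · obtain ⟨a1, a2, a3, a4⟩ := (L.values hP hP').1 c1
    obtain ⟨b1, b2, b3, b4⟩ := (L.values hP hP').2 (h1 l hl c1)
    rw [a1, a2, b1, b2]; exact Relation.ReflTransGen.refl
  by_cases c2 : Cls N j l
  · obtain ⟨a1, a2, a3, a4⟩ := (L.values hP hP').2 c2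
    obtain ⟨b1, b2, b3, b4⟩ := (L.values hP hP').1 (h2 l hl c2)
    rw [a1, a2, b1, b2]; exact Relation.ReflTransGen.refl
  obtain ⟨hl', e1, e2⟩ := L.mem_old hP hP' hl c1 c2
  have hm := hπ' l hl'
  obtain ⟨f1, f2⟩ := L.p_eq hP hP' hm
    (by rintro ⟨t, e⟩; rw [e, (hP'.add_mul i t).1] at hm; exact L.iS'.1 hm rfl)
    (by rintro ⟨t, e⟩; rw [e, (hP'.add_mul j t).1] at hm; exact L.jS'.1 hm rfl)
  have := h.reach h' (hs l hl')
  rwa [e1, e2, f1, f2, ← h3 l hl c1 c2] at this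

/-- The ear is one triangle. Light from `u, v` leaves it at once through `v, w`; light from `v, w`
crosses it and continues as the beam of the merged pane, whose incoming beam exits through `u, v`.
-/
theorem Strands.merge_even (hs : Strands X' S' p' π') (hπ' : ∀ l ∈ S', π' l ∈ S')
    (h : X.IsEar X' v u z w) (h' : X'.IsFlat)
    (L : IsLabelEar X' N S S' θ θ' p p' i j v u z w) (hP : IsPeriodic N S θ p)
    (hP' : IsPeriodic N S' θ' p') (E : IsEarDirs X v u z w (θ i) (θ j)) (huz : u ≠ z) (hwz : w = z)
    (hi : θ i % 2 = 0) (hj : θ j % 2 = 0)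
    (h1 : ∀ l ∈ S, Cls N i l → Cls N j (π l))
    (h2 : ∀ l ∈ S, Cls N j l → ∃ l', Cls N i l' ∧ π l = π' l')
    (h3 : ∀ l ∈ S, ¬ Cls N i l → ¬ Cls N j l → π l = π' l) : Strands X S p π := by
  subst hwz
  have T : ∀ {m}, m ∈ S' → X.Reach (p' (m + 1), p' m) (p (m + 1), p m) := fun hm =>
    L.target_even h hP hP' E (fun _ => hi) (fun a => absurd rfl a) hm
  intro l hl
  by_cases c1 : Cls N i l
  · obtain ⟨a1, a2, a3, a4⟩ := (L.values hP hP').1 c1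
    obtain ⟨b1, b2, b3, b4⟩ := (L.values hP hP').2 (h1 l hl c1)
    rw [a1, a2, b1, b2]
    exact X.reach_even ((h.tri _ _ _).2 (by simp [huz])) E.uv hi
  by_cases c2 : Cls N j l
  · obtain ⟨a1, a2, a3, a4⟩ := (L.values hP hP').2 c2
    obtain ⟨l', hc, hl'⟩ := h2 l hl c2
    obtain ⟨b1, b2, b3, b4⟩ := (L.values hP hP').1 hc
    have hm : l' ∈ S' := by
      obtain ⟨t, rfl⟩ := hc
      exact (hP'.add_mul i t).1.2 (L.iS'.2 huz)
    have e1 := h.reach h' (hs l' hm)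
    have e2 := T (hπ' _ hm)
    rw [a1, a2, hl']
    rw [b3, b4] at e1
    exact (X.reach_even ((h.tri _ _ _).2 (by simp [huz])) E.vw hj).trans (e1.trans e2)
  obtain ⟨hl', e1, e2⟩ := L.mem_old hP hP' hl c1 c2
  have := (h.reach h' (hs l hl')).trans (T (hπ' _ hl'))
  rwa [e1, e2, ← h3 l hl c1 c2] at this

/-- Again one triangle, but with the roles exchanged: light from `v, w` exits at `u, v`, light from
`u, v` becomes the beam of the merged pane, and beams ending at the merged pane now exit at `v, w`.
-/
theorem Strands.merge_odd (hs : Strands X' S' p' π') (hπ' : ∀ l ∈ S', π' l ∈ S')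
    (h : X.IsEar X' v u z w) (h' : X'.IsFlat)
    (L : IsLabelEar X' N S S' θ θ' p p' i j v u z w) (hP : IsPeriodic N S θ p)
    (hP' : IsPeriodic N S' θ' p') (E : IsEarDirs X v u z w (θ i) (θ j)) (huz : u ≠ z) (hwz : w = z)
    (hi : θ i % 2 = 1) (hj : θ j % 2 = 1)
    (h1 : ∀ l ∈ S, Cls N j l → Cls N i (π l))
    (h2 : ∀ l ∈ S', Cls N i (π' l) → Cls N j (π l))
    (h3 : ∀ l ∈ S', ¬ Cls N i (π' l) → π l = π' l) : Strands X S p π := by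
  subst hwz
  have T : ∀ {l}, l ∈ S' → X.Reach (p' (π' l + 1), p' (π' l)) (p (π l + 1), p (π l)) := by
    intro l hl
    by_cases c1 : Cls N i (π' l)
    · obtain ⟨a1, a2, a3, a4⟩ := (L.values hP hP').1 c1
      obtain ⟨b1, b2, b3, b4⟩ := (L.values hP hP').2 (h2 l hl c1)
      rw [a3, a4, b1, b2]
      exact X.reach_odd ((h.tri _ _ _).2 (by simp [huz])) (E.zu huz) (by omega)
    · have hm := hπ' l hl
      obtain ⟨f1, f2⟩ := L.p_eq hP hP' hm c1
        (by rintro ⟨t, e⟩; rw [e, (hP'.add_mul j t).1] at hm; exact L.jS'.1 hm rfl)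
      rw [h3 l hl c1, f1, f2]
      exact Relation.ReflTransGen.refl
  intro l hl
  by_cases c2 : Cls N j l
  · obtain ⟨a1, a2, a3, a4⟩ := (L.values hP hP').2 c2
    obtain ⟨b1, b2, b3, b4⟩ := (L.values hP hP').1 (h1 l hl c2)
    rw [a1, a2, b1, b2]
    exact X.reach_odd ((h.tri _ _ _).2 (by simp [huz])) E.vw hj
  by_cases c1 : Cls N i l
  · obtain ⟨a1, a2, a3, a4⟩ := (L.values hP hP').1 c1
    have hm : l ∈ S' := by
      obtain ⟨t, rfl⟩ := c1
      exact (hP'.add_mul i t).1.2 (L.iS'.2 huz)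
    have e1 := (h.reach h' (hs l hm)).trans (T hm)
    rw [a3, a4] at e1
    rw [a1, a2]
    exact (X.reach_odd ((h.tri _ _ _).2 (by simp [huz])) E.uv hi).trans e1
  obtain ⟨hl', e1, e2⟩ := L.mem_old hP hP' hl c1 c2
  have := (h.reach h' (hs l hl')).trans (T hl')
  rwa [e1, e2] at this

/-- In the diamond of two triangles the emitted beams cross: light from `u, v` enters the old sheet
at `z, w`, and light from `v, w` enters it at `u, z`. Incoming beams pass through one triangle each
and do not change place. -/
theorem Strands.swap_even (hs : Strands X' S' p' π') (hπ' : ∀ l ∈ S', π' l ∈ S')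
    (h : X.IsEar X' v u z w) (h' : X'.IsFlat)
    (L : IsLabelEar X' N S S' θ θ' p p' i j v u z w) (hP : IsPeriodic N S θ p)
    (hP' : IsPeriodic N S' θ' p') (E : IsEarDirs X v u z w (θ i) (θ j)) (huz : u ≠ z) (hwz : w ≠ z)
    (hi : θ i % 2 = 0) (hj : θ j = θ i - 1)
    (h1 : ∀ l ∈ S, Cls N i l → ∃ l', Cls N j l' ∧ π l = π' l')
    (h2 : ∀ l ∈ S, Cls N j l → ∃ l', Cls N i l' ∧ π l = π' l')
    (h3 : ∀ l ∈ S, ¬ Cls N i l → ¬ Cls N j l → π l = π' l) : Strands X S p π := by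
  have T : ∀ {m}, m ∈ S' → X.Reach (p' (m + 1), p' m) (p (m + 1), p m) := fun hm =>
    L.target_even h hP hP' E (fun _ => hi) (fun a => by omega) hm
  have ezv : X.pos v - X.pos z = dirVec (θ j + 2) := by
    have := dirVec_sub (θ i + 2)
    have e0 := dirVec_add_three (θ i)
    have e1 : X.pos v - X.pos z = dirVec (θ i + 2) + dirVec (θ i) := by
      rw [← E.uv, ← E.zu huz]; abel
    rw [e1, ← neg_neg (dirVec (θ i)), ← e0, show θ i + 3 = θ i + 2 + 1 by ring, ← this, hj,
      show θ i - 1 + 2 = θ i + 2 - 1 by ring]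
    abel
  have evz : X.pos z - X.pos v = dirVec (θ j + 5) := by
    rw [show θ j + 5 = θ j + 2 + 3 by ring, dirVec_add_three, ← ezv]; abel
  intro l hl
  by_cases c1 : Cls N i l
  · obtain ⟨a1, a2, a3, a4⟩ := (L.values hP hP').1 c1
    obtain ⟨l', hc, hl'⟩ := h1 l hl c1
    obtain ⟨b1, b2, b3, b4⟩ := (L.values hP hP').2 hc
    have hm : l' ∈ S' := by
      obtain ⟨t, rfl⟩ := hc
      exact (hP'.add_mul j t).1.2 (L.jS'.2 hwz)
    have e1 := h.reach h' (hs l' hm)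
    have e2 := T (hπ' _ hm)
    rw [a1, a2, hl']
    rw [b3, b4] at e1
    exact (X.reach_even (t := z) ((h.tri _ _ _).2 (by simp [huz])) E.uv hi).trans
      ((X.reach_odd ((h.tri _ _ _).2 (by simp [hwz])) ezv (by omega)).trans (e1.trans e2))
  by_cases c2 : Cls N j l
  · obtain ⟨a1, a2, a3, a4⟩ := (L.values hP hP').2 c2
    obtain ⟨l', hc, hl'⟩ := h2 l hl c2
    obtain ⟨b1, b2, b3, b4⟩ := (L.values hP hP').1 hc
    have hm : l' ∈ S' := by
      obtain ⟨t, rfl⟩ := hc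
      exact (hP'.add_mul i t).1.2 (L.iS'.2 huz)
    have e1 := h.reach h' (hs l' hm)
    have e2 := T (hπ' _ hm)
    rw [a1, a2, hl']
    rw [b3, b4] at e1
    exact (X.reach_odd (t := z) ((h.tri _ _ _).2 (by simp [hwz])) E.vw (by omega)).trans
      ((X.reach_even ((h.tri _ _ _).2 (by simp [huz])) evz (by omega)).trans (e1.trans e2))
  obtain ⟨hl', e1, e2⟩ := L.mem_old hP hP' hl c1 c2
  have := (h.reach h' (hs l hl')).trans (T (hπ' _ hl'))
  rwa [e1, e2, ← h3 l hl c1 c2] at this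

/-- For the other parity it is the incoming beams that cross in the diamond, while emitted beams
keep their places. -/
theorem Strands.swap_odd (hs : Strands X' S' p' π') (hπ' : ∀ l ∈ S', π' l ∈ S')
    (h : X.IsEar X' v u z w) (h' : X'.IsFlat)
    (L : IsLabelEar X' N S S' θ θ' p p' i j v u z w) (hP : IsPeriodic N S θ p)
    (hP' : IsPeriodic N S' θ' p') (E : IsEarDirs X v u z w (θ i) (θ j)) (huz : u ≠ z) (hwz : w ≠ z)
    (hi : θ i % 2 = 1) (hj : θ j = θ i - 1)
    (h1 : ∀ l ∈ S', Cls N i (π' l) → Cls N j (π l))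
    (h2 : ∀ l ∈ S', Cls N j (π' l) → Cls N i (π l))
    (h3 : ∀ l ∈ S', ¬ Cls N i (π' l) → ¬ Cls N j (π' l) → π l = π' l) : Strands X S p π := by
  have ezv : X.pos v - X.pos z = dirVec (θ j + 2) := by
    have := dirVec_sub (θ i + 2)
    have e0 := dirVec_add_three (θ i)
    have e1 : X.pos v - X.pos z = dirVec (θ i + 2) + dirVec (θ i) := by
      rw [← E.uv, ← E.zu huz]; abel
    rw [e1, ← neg_neg (dirVec (θ i)), ← e0, show θ i + 3 = θ i + 2 + 1 by ring, ← this, hj,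
      show θ i - 1 + 2 = θ i + 2 - 1 by ring]
    abel
  have evz : X.pos z - X.pos v = dirVec (θ j + 5) := by
    rw [show θ j + 5 = θ j + 2 + 3 by ring, dirVec_add_three, ← ezv]; abel
  have T : ∀ {l}, l ∈ S' → X.Reach (p' (π' l + 1), p' (π' l)) (p (π l + 1), p (π l)) := by
    intro l hl
    by_cases c1 : Cls N i (π' l)
    · obtain ⟨a1, a2, a3, a4⟩ := (L.values hP hP').1 c1
      obtain ⟨b1, b2, b3, b4⟩ := (L.values hP hP').2 (h1 l hl c1)
      rw [a3, a4, b1, b2]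
      exact (X.reach_odd (t := v) ((h.tri _ _ _).2 (by simp [huz])) (E.zu huz) (by omega)).trans
        (X.reach_even ((h.tri _ _ _).2 (by simp [hwz])) ezv (by omega))
    by_cases c2 : Cls N j (π' l)
    · obtain ⟨a1, a2, a3, a4⟩ := (L.values hP hP').2 c2
      obtain ⟨b1, b2, b3, b4⟩ := (L.values hP hP').1 (h2 l hl c2)
      rw [a3, a4, b1, b2]
      exact (X.reach_even (t := v) ((h.tri _ _ _).2 (by simp [hwz])) (E.wz hwz) (by omega)).trans
        (X.reach_odd ((h.tri _ _ _).2 (by simp [huz])) evz (by omega))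
    · obtain ⟨f1, f2⟩ := L.p_eq hP hP' (hπ' l hl) c1 c2
      rw [h3 l hl c1 c2, f1, f2]
      exact Relation.ReflTransGen.refl
  intro l hl
  by_cases c1 : Cls N i l
  · obtain ⟨a1, a2, a3, a4⟩ := (L.values hP hP').1 c1
    have hm : l ∈ S' := by
      obtain ⟨t, rfl⟩ := c1
      exact (hP'.add_mul i t).1.2 (L.iS'.2 huz)
    have e1 := (h.reach h' (hs l hm)).trans (T hm)
    rw [a3, a4] at e1
    rw [a1, a2]
    exact (X.reach_odd ((h.tri _ _ _).2 (by simp [huz])) E.uv hi).trans e1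
  by_cases c2 : Cls N j l
  · obtain ⟨a1, a2, a3, a4⟩ := (L.values hP hP').2 c2
    have hm : l ∈ S' := by
      obtain ⟨t, rfl⟩ := c2
      exact (hP'.add_mul j t).1.2 (L.jS'.2 hwz)
    have e1 := (h.reach h' (hs l hm)).trans (T hm)
    rw [a3, a4] at e1
    rw [a1, a2]
    exact (X.reach_even ((h.tri _ _ _).2 (by simp [hwz])) E.vw (by omega)).trans e1
  obtain ⟨hl', e1, e2⟩ := L.mem_old hP hP' hl c1 c2
  have := (h.reach h' (hs l hl')).trans (T hl')
  rwa [e1, e2] at this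
end
end GridBilliards

/-! ### Simple connectivity is preserved by ears. -/

namespace GridBilliards

open IsChordDiagram (Cls cls_self cls_add cls_eq IsNext)

theorem face_mono {V : Type*} {K : PreAbstractSimplicialComplex V} {s t : Finset V} (h : s ∈ K.faces)
    (hts : t ⊆ s) (ht : t.Nonempty) : t ∈ K.faces :=
  (K.isRelLowerSet_faces h).2 hts ht

section SimplyConnected

variable {V W : Type*} [DecidableEq V] [DecidableEq W]

theorem EdgePathMove.congr {K : PreAbstractSimplicialComplex V} {l l' : List V}
    (h : Relation.EqvGen (EdgePathMove K) l l') (p q : List V) :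
    Relation.EqvGen (EdgePathMove K) (p ++ l ++ q) (p ++ l' ++ q) := by
  induction h with
  | rel l l' h =>
    obtain ⟨p', q', u, v, w, h⟩ := h
    refine Relation.EqvGen.rel _ _ ?_
    have := EdgePathMove.mk (K := K) (p ++ p') (q' ++ q) u v w h
    simpa using this
  | refl => exact Relation.EqvGen.refl _
  | symm _ _ _ ih => exact ih.symm
  | trans _ _ _ _ _ ih1 ih2 => exact ih1.trans _ _ _ ih2

theorem EdgePathMove.map {K : PreAbstractSimplicialComplex V} {L : PreAbstractSimplicialComplex W}
    (r : V → W) (hr : ∀ s ∈ K.faces, s.image r ∈ L.faces) {l l' : List V}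
    (h : Relation.EqvGen (EdgePathMove K) l l') :
    Relation.EqvGen (EdgePathMove L) (l.map r) (l'.map r) := by
  induction h with
  | rel l l' h =>
    obtain ⟨p', q', u, v, w, h⟩ := h
    refine Relation.EqvGen.rel _ _ ?_
    have h1 := hr _ h
    simp only [Finset.image_insert, Finset.image_singleton] at h1
    have := EdgePathMove.mk (K := L) (p'.map r) (q'.map r) (r u) (r v) (r w) h1
    simpa using this
  | refl => exact Relation.EqvGen.refl _
  | symm _ _ _ ih => exact ih.symm
  | trans _ _ _ _ _ ih1 ih2 => exact ih1.trans _ _ _ ih2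

theorem IsEdgePath.map {K : PreAbstractSimplicialComplex V} {L : PreAbstractSimplicialComplex W}
    (r : V → W) (hr : ∀ s ∈ K.faces, s.image r ∈ L.faces) {l : List V} (h : IsEdgePath K l) :
    IsEdgePath L (l.map r) := by
  rw [IsEdgePath, List.isChain_map]
  refine List.IsChain.imp (fun a b hab => ?_) h
  simpa [Finset.image_insert] using hr _ hab

/-- If `K` retracts to a simply connected subcomplex along simplices, then it is simply
connected. -/
theorem IsSimplyConnected.of_deformation {K K' : PreAbstractSimplicialComplex V}
    (h : IsSimplyConnected K') (r : V → V) (hsub : K'.faces ⊆ K.faces)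
    (hr : ∀ s ∈ K.faces, s.image r ∈ K'.faces) (hdef : ∀ s ∈ K.faces, s ∪ s.image r ∈ K.faces) :
    IsSimplyConnected K := by
  have tri : ∀ {x y : V} {t : Finset V}, {x, y} ∈ K.faces → t ⊆ {x, y, r x, r y} → t.Nonempty →
      t ∈ K.faces := by
    intro x y t hxy ht hn
    refine face_mono (hdef _ hxy) (ht.trans ?_) hn
    intro a
    simp only [Finset.mem_insert, Finset.mem_singleton, Finset.mem_union, Finset.image_insert,
      Finset.image_singleton]
    tauto
  have drop : ∀ (p q : List V) (a b c : V), {a, b, c} ∈ K.faces →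
      Relation.EqvGen (EdgePathMove K) (p ++ a :: b :: c :: q) (p ++ a :: c :: q) :=
    fun p q a b c habc => Relation.EqvGen.rel _ _ ⟨p, q, a, b, c, habc⟩
  -- A path is homotopic to its retraction, joined to the original end points. The induction sweeps
  -- the path across the squares `a, b, r b, r a`, all of whose vertices lie in one simplex.
  have key : ∀ (l : List V) (x y : V), IsEdgePath K (x :: (l ++ [y])) →
      Relation.EqvGen (EdgePathMove K) (x :: (l ++ [y])) (x :: r x :: (l.map r ++ [r y, y])) := by
    intro l
    induction l with
    | nil =>
      intro x y hp
      have hxy : {x, y} ∈ K.faces := by simpa [IsEdgePath] using hp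
      have e1 := drop [] [] x (r y) y (tri hxy (by intro a; simp; tauto) (by simp))
      have e2 := drop [] [y] x (r x) (r y) (tri hxy (by intro a; simp; tauto) (by simp))
      exact (e1.symm).trans _ _ _ e2.symm
    | cons a l ih =>
      intro x y hp
      have hp2 : {x, a} ∈ K.faces ∧ IsEdgePath K (a :: (l ++ [y])) := by
        simpa [IsEdgePath] using hp
      have e0 := EdgePathMove.congr (ih a y hp2.2) [x] []
      have e1 := drop [] (l.map r ++ [r y, y]) x a (r a)
        (tri hp2.1 (by intro a; simp; tauto) (by simp))
      have e2 := drop [] (l.map r ++ [r y, y]) x (r x) (r a)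
        (tri hp2.1 (by intro a; simp; tauto) (by simp))
      simp only [List.append_nil, List.singleton_append, List.nil_append] at e0 e1 e2
      exact e0.trans _ _ _ (e1.trans _ _ _ e2.symm)
  have sing : ∀ {x : V}, {x} ∈ K.faces → {x, r x} ∈ K.faces := fun {x} hx =>
    tri (x := x) (y := x) (by simpa using hx) (by intro a; simp) (by simp)
  refine ⟨?_, ?_, ?_⟩
  · obtain ⟨v, hv⟩ := h.nonempty
    exact ⟨v, hsub hv⟩
  · intro u w hu hw
    obtain ⟨l, hl⟩ := h.connected (r u) (r w) (by simpa using hr _ hu) (by simpa using hr _ hw)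
    have hl' : IsEdgePath K (r u :: (l ++ [r w])) := hl.imp fun a b hab => hsub hab
    refine ⟨r u :: (l ++ [r w]), ?_⟩
    have e : {r w, w} ∈ K.faces := by rw [Finset.pair_comm]; exact sing hw
    have : IsEdgePath K ((r u :: (l ++ [r w])) ++ [w]) := by
      rw [IsEdgePath, List.isChain_append]
      refine ⟨hl', by simp, ?_⟩
      intro a ha b hb
      have e1 : a = r w := by
        rw [show r u :: (l ++ [r w]) = (r u :: l) ++ [r w] by simp, List.getLast?_append] at ha
        simpa using ha.symm
      have e2 : b = w := by simpa using hb.symm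
      rw [e1, e2]; exact e
    rw [IsEdgePath, List.cons_append, List.isChain_cons_cons]
    exact ⟨sing hu, this⟩
  · intro x l hp
    have hx : {x} ∈ K.faces := by
      cases l with
      | nil => simpa [IsEdgePath] using hp
      | cons a l =>
        have : {x, a} ∈ K.faces := by
          have : {x, a} ∈ K.faces ∧ IsEdgePath K (a :: (l ++ [x])) := by simpa [IsEdgePath] using hp
          exact this.1
        exact face_mono this (by simp) (by simp)
    have e1 := key l x x hp
    have hp' := hp.map r hr
    have e2 := h.null_homotopic (r x) (l.map r) (by simpa using hp')
    have e3 := EdgePathMove.map (K := K') (L := K) id (by simpa using fun s hs => hsub hs) e2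
    have e4 := EdgePathMove.congr e3 [x] [x]
    have e5 := drop [] [x] x (r x) (r x) (by simpa using sing hx)
    have e6 := drop [] [] x (r x) x (face_mono (sing hx) (by intro a; simp [or_comm]) (by simp))
    simp at e4 e5 e6
    have e7 := e4.trans _ _ _ (e5.trans _ _ _ e6)
    simpa using e1.trans _ _ _ e7

end SimplyConnected

namespace Sheet

variable {W : Type*} [DecidableEq W]

/-- The simplicial complex of a sheet. -/
def complex (X : Sheet W) (h : X.IsFlat) : PreAbstractSimplicialComplex W where
  faces := {s | (∃ x ∈ X.verts, s = {x}) ∨ (∃ x y, X.Edge x y ∧ s = {x, y}) ∨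
    ∃ x y w, X.Tri x y w ∧ s = {x, y, w}}
  isRelLowerSet_faces := by
    have edge : ∀ {x y : W} {t : Finset W}, X.Edge x y → t ⊆ {x, y} → t.Nonempty →
        (∃ x ∈ X.verts, t = {x}) ∨ (∃ x y, X.Edge x y ∧ t = {x, y}) := by
      intro x y t e ht hn
      by_cases hx : x ∈ t <;> by_cases hy : y ∈ t
      · right; refine ⟨x, y, e, Finset.Subset.antisymm ht ?_⟩
        intro a; simp; rintro (rfl | rfl) <;> assumption
      · left; refine ⟨x, h.mem e, Finset.Subset.antisymm ?_ (by simpa using hx)⟩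
        intro a ha
        rcases Finset.mem_insert.1 (ht ha) with rfl | h1
        · simp
        · rw [Finset.mem_singleton] at h1; subst h1; exact absurd ha hy
      · left; refine ⟨y, h.mem' e, Finset.Subset.antisymm ?_ (by simpa using hy)⟩
        intro a ha
        rcases Finset.mem_insert.1 (ht ha) with rfl | h1
        · exact absurd ha hx
        · exact h1
      · obtain ⟨a, ha⟩ := hn
        rcases Finset.mem_insert.1 (ht ha) with rfl | h1
        · exact absurd ha hx
        · rw [Finset.mem_singleton] at h1; subst h1; exact absurd ha hy
    rintro s (⟨x, hx, rfl⟩ | ⟨x, y, e, rfl⟩ | ⟨x, y, w, ht, rfl⟩)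
    · refine ⟨by simp, fun t ht hn => Or.inl ⟨x, hx, ?_⟩⟩
      exact (Finset.subset_singleton_iff.1 ht).resolve_left hn.ne_empty
    · refine ⟨by simp, fun t ht hn => ?_⟩
      rcases edge e ht hn with h | h
      · exact Or.inl h
      · exact Or.inr (Or.inl h)
    · refine ⟨by simp, fun t ht' hn => ?_⟩
      by_cases hx : x ∈ t
      · by_cases hy : y ∈ t
        · by_cases hw : w ∈ t
          · refine Or.inr (Or.inr ⟨x, y, w, ht, Finset.Subset.antisymm ht' ?_⟩)
            intro a; simp; rintro (rfl | rfl | rfl) <;> assumption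
          · rcases edge (h.tri_edge ht) (t := t) (fun a ha => by
              have := ht' ha
              have : a ≠ w := fun e => hw (e ▸ ha)
              simp_all) hn with h | h
            · exact Or.inl h
            · exact Or.inr (Or.inl h)
        · rcases edge (h.tri_edge (h.tri_rot (h.tri_rot ht))) (t := t) (fun a ha => by
              have := ht' ha
              have : a ≠ y := fun e => hy (e ▸ ha)
              simp_all [or_comm]) hn with h | h
          · exact Or.inl h
          · exact Or.inr (Or.inl h)
      · rcases edge (h.tri_edge (h.tri_rot ht)) (t := t) (fun a ha => by
              have := ht' ha
              have : a ≠ x := fun e => hx (e ▸ ha)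
              simp_all) hn with h | h
        · exact Or.inl h
        · exact Or.inr (Or.inl h)

/-- The ear collapses by moving `v` to `z`: every simplex containing `v` lies in the possibly
degenerate triangle `v, z, u` or `v, w, z`, and its image lies in `u, z` or `z, w`. -/
theorem IsEar.simplyConnected {X X' : Sheet W} {v u z w : W} (h : X.IsEar X' v u z w)
    (h1 : X.IsFlat) (h2 : X'.IsFlat) (hs : IsSimplyConnected (X'.complex h2)) :
    IsSimplyConnected (X.complex h1) := by
  have hu : u ≠ v := fun e => h.notMem (e ▸ h.mem_u)
  have hz : z ≠ v := fun e => h.notMem (e ▸ h.mem_z)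
  have hw : w ≠ v := fun e => h.notMem (e ▸ h.mem_w)
  let r : W → W := fun x => if x = v then z else x
  have rv : r v = z := by simp [r]
  have ro : ∀ x ∈ X'.verts, r x = x := fun x hx => by
    have : x ≠ v := fun e => h.notMem (e ▸ hx)
    simp [r, this]
  have ru := ro u h.mem_u
  have rz := ro z h.mem_z
  have rw' := ro w h.mem_w
  have fv : ∀ {x}, x ∈ X'.verts → ({x} : Finset W) ∈ (X'.complex h2).faces := fun hx =>
    Or.inl ⟨_, hx, rfl⟩
  have fe : ∀ {x y}, X'.Edge x y → ({x, y} : Finset W) ∈ (X'.complex h2).faces := fun e =>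
    Or.inr (Or.inl ⟨_, _, e, rfl⟩)
  have gv : ∀ {x}, x ∈ X.verts → ({x} : Finset W) ∈ (X.complex h1).faces := fun hx =>
    Or.inl ⟨_, hx, rfl⟩
  have ge : ∀ {x y}, X.Edge x y → ({x, y} : Finset W) ∈ (X.complex h1).faces := fun e =>
    Or.inr (Or.inl ⟨_, _, e, rfl⟩)
  have gt : ∀ {x y t}, X.Tri x y t → ({x, y, t} : Finset W) ∈ (X.complex h1).faces := fun e =>
    Or.inr (Or.inr ⟨_, _, _, e, rfl⟩)
  have fuz : ({u, z} : Finset W) ∈ (X'.complex h2).faces := by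
    by_cases a : u = z
    · subst a; simpa using fv h.mem_u
    · exact fe (h.bdry_u a).1
  have fzw : ({z, w} : Finset W) ∈ (X'.complex h2).faces := by
    by_cases a : w = z
    · subst a; simpa using fv h.mem_w
    · exact fe (h.bdry_w a).1
  have gvz : ({v, z} : Finset W) ∈ (X.complex h1).faces := ge ((h.edge _ _).2 (by simp))
  have gvuz : ({v, z, u} : Finset W) ∈ (X.complex h1).faces := by
    by_cases a : u = z
    · subst a; simpa using gvz
    · exact gt ((h.tri _ _ _).2 (by simp [a]))
  have gvzw : ({v, w, z} : Finset W) ∈ (X.complex h1).faces := by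
    by_cases a : w = z
    · subst a; simpa using gvz
    · exact gt ((h.tri _ _ _).2 (by simp [a]))
  have hsub : (X'.complex h2).faces ⊆ (X.complex h1).faces := by
    rintro s (⟨x, hx, rfl⟩ | ⟨x, y, e, rfl⟩ | ⟨x, y, t, e, rfl⟩)
    · exact gv ((h.verts x).2 (Or.inr hx))
    · exact ge ((h.edge _ _).2 (Or.inl e))
    · exact gt ((h.tri _ _ _).2 (Or.inl e))
  have old : ∀ s ∈ (X'.complex h2).faces, s.image r = s := by
    intro s hs
    have : ∀ x ∈ s, r x = x := by
      rcases hs with ⟨x, hx, rfl⟩ | ⟨x, y, e, rfl⟩ | ⟨x, y, t, e, rfl⟩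
      · simpa using ro x hx
      · simpa using ⟨ro x (h2.mem e), ro y (h2.mem' e)⟩
      · simpa using ⟨ro x (h2.mem (h2.tri_edge e)), ro y (h2.mem' (h2.tri_edge e)),
          ro t (h2.mem' (h2.tri_edge (h2.tri_rot e)))⟩
    rw [Finset.image_congr (fun x hx => this x hx)]
    simp
  have dich : ∀ s ∈ (X.complex h1).faces, s ∈ (X'.complex h2).faces ∨
      (v ∈ s ∧ s ⊆ {v, z, u}) ∨ (v ∈ s ∧ s ⊆ {v, w, z}) := by
    rintro s (⟨x, hx, rfl⟩ | ⟨x, y, e, rfl⟩ | ⟨x, y, t, e, rfl⟩)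
    · rcases (h.verts x).1 hx with rfl | hx
      · right; left; simp
      · left; exact fv hx
    · rcases (h.edge x y).1 e with e | ⟨rfl, rfl | rfl | rfl⟩ | ⟨rfl, rfl | rfl | rfl⟩
      · exact Or.inl (fe e)
      all_goals first
        | (right; left; refine ⟨by simp, ?_⟩; intro a; simp; tauto)
        | (right; right; refine ⟨by simp, ?_⟩; intro a; simp; tauto)
    · rcases (h.tri x y t).1 e with e | ⟨-, ⟨rfl, rfl, rfl⟩ | ⟨rfl, rfl, rfl⟩ | ⟨rfl, rfl, rfl⟩⟩ |
        ⟨-, ⟨rfl, rfl, rfl⟩ | ⟨rfl, rfl, rfl⟩ | ⟨rfl, rfl, rfl⟩⟩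
      · exact Or.inl (Or.inr (Or.inr ⟨_, _, _, e, rfl⟩))
      all_goals first
        | (right; left; refine ⟨by simp, ?_⟩; intro a; simp <;> tauto)
        | (right; right; refine ⟨by simp, ?_⟩; intro a; simp <;> tauto)
  refine hs.of_deformation r hsub (fun s hs => ?_) (fun s hs => ?_)
  · rcases dich s hs with h3 | ⟨h3, h4⟩ | ⟨h3, h4⟩
    · rw [old s h3]; exact h3
    · refine face_mono fuz ((Finset.image_subset_image h4).trans ?_) (Finset.image_nonempty.2 ⟨v, h3⟩)
      intro a; simp [rv, rz, ru, or_comm]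
    · refine face_mono fzw ((Finset.image_subset_image h4).trans ?_) (Finset.image_nonempty.2 ⟨v, h3⟩)
      intro a; simp [rv, rz, rw', or_comm]
  · rcases dich s hs with h3 | ⟨h3, h4⟩ | ⟨h3, h4⟩
    · rw [old s h3, Finset.union_self]; exact hsub h3
    · refine face_mono gvuz (Finset.union_subset h4 ((Finset.image_subset_image h4).trans ?_))
        ⟨v, Finset.mem_union_left _ h3⟩
      intro a; simp [rv, rz, ru] <;> tauto
    · refine face_mono gvzw (Finset.union_subset h4 ((Finset.image_subset_image h4).trans ?_))
        ⟨v, Finset.mem_union_left _ h3⟩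
      intro a; simp [rv, rz, rw'] <;> tauto

/-- The sheet `X` with an additional ear. -/
def addEar (X : Sheet W) (v u z w : W) (q : ℤ × ℤ) : Sheet W where
  verts := insert v X.verts
  Edge x y := X.Edge x y ∨ (x = v ∧ (y = u ∨ y = z ∨ y = w)) ∨ (y = v ∧ (x = u ∨ x = z ∨ x = w))
  Tri x y t := X.Tri x y t ∨
    (u ≠ z ∧ ((x = v ∧ y = z ∧ t = u) ∨ (x = z ∧ y = u ∧ t = v) ∨ (x = u ∧ y = v ∧ t = z))) ∨
    (w ≠ z ∧ ((x = v ∧ y = w ∧ t = z) ∨ (x = w ∧ y = z ∧ t = v) ∨ (x = z ∧ y = v ∧ t = w)))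
  pos := Function.update X.pos v q

end Sheet
end GridBilliards

/-! ### Realizing chord diagrams by sheets. -/

namespace GridBilliards

open IsChordDiagram (Cls cls_self cls_add cls_eq IsNext)

theorem dirVec_add_ne_zero {a b : ℤ} (h : (a - b) % 6 ≠ 3) : dirVec a + dirVec b ≠ 0 := by
  intro e
  have e1 : dirVec a = dirVec (b + 3) := by
    rw [dirVec_add_three]; exact eq_neg_of_add_eq_zero_left e
  rw [dirVec_inj] at e1
  omega

theorem IsDiagram.const {W : Type*} {X : Sheet W} {N : ℤ} {S : Set ℤ} {θ : ℤ → ℤ} {p : ℤ → W}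
    (D : IsDiagram X N S θ p) {a b : ℤ} (h : ∀ l, a ≤ l → l < b → l ∉ S) :
    ∀ l, a ≤ l → l ≤ b → p l = p a := by
  intro l hal
  induction l, hal using Int.leInduction with
  | base => intro; rfl
  | succ l hl ih =>
    intro hlb
    rw [D.stay l (h l hl (by omega)), ih (by omega)]

section
variable {W : Type*} [DecidableEq W]

open Classical in
/-- Attaching an ear along the panes `i` and `j` of a diagram. -/
theorem IsDiagram.exists_ear [Infinite W] {X' : Sheet W} {N : ℤ} {S S' : Set ℤ} {θ θ' : ℤ → ℤ}
    {p' : ℤ → W} {i j : ℤ} (D : IsDiagram X' N S' θ' p') (lt : i < j) (ltN : j < i + N)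
    (mem_add : ∀ l, l + N ∈ S ↔ l ∈ S) (dir_add : ∀ l ∈ S, θ (l + N) = θ l - 6)
    (hS : ∀ l, j < l → l < i + N → (l ∈ S ↔ l ∈ S')) (gapS : ∀ l, i < l → l < j → l ∉ S)
    (gapS' : ∀ l, i < l → l < j → l ∉ S') (iS : i ∈ S) (jS : j ∈ S)
    (dir_i : i ∈ S' → θ i = θ' i + 1) (dir_j : j ∈ S' → θ j = θ' j - 1)
    (dir_off : ∀ l, j < l → l < i + N → l ∈ S → θ l = θ' l)
    (angle : θ i - θ j + (if i ∈ S' then 1 else 0) + (if j ∈ S' then 1 else 0) = 3) :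
    ∃ (X : Sheet W) (p : ℤ → W) (v u z w : W), X.IsEar X' v u z w ∧ IsDiagram X N S θ p ∧
      IsLabelEar X' N S S' θ θ' p p' i j v u z w := by
  obtain ⟨v, hv⟩ := Infinite.exists_notMem_finset X'.verts
  have hpv : ∀ l, p' l ≠ v := fun l e => hv (e ▸ D.p_mem l)
  set u := p' i with hu
  set z := p' (i + 1) with hz
  set w := p' (j + 1) with hw
  have gap' : ∀ l, i < l → l ≤ j → p' l = z := fun l h1 h2 =>
    D.const (a := i + 1) (b := j) (fun l h1 h2 => gapS' l (by omega) h2) l (by omega) h2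
  have pj := gap' j lt le_rfl
  have iS' : i ∈ S' ↔ u ≠ z := ⟨fun h => D.flat.ne (D.bdry i h).1, fun h => by
    by_contra hcon; exact h (D.stay i hcon).symm⟩
  have jS' : j ∈ S' ↔ w ≠ z := ⟨fun h => by
      have := D.flat.ne (D.bdry j h).1
      rw [pj] at this; exact this.symm, fun h => by
    by_contra hcon; exact h ((D.stay j hcon).trans pj)⟩
  have hdi : u ≠ z → X'.pos z - X'.pos u = dirVec (θ i - 1) := fun h => by
    have := D.dir i (iS'.2 h)
    rw [this, dir_i (iS'.2 h)]; ring_nf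
  have hdj : w ≠ z → X'.pos w - X'.pos z = dirVec (θ j + 1) := fun h => by
    have := D.dir j (jS'.2 h)
    rw [pj] at this
    rw [this, dir_j (jS'.2 h)]; ring_nf
  simp only [iS', jS'] at angle
  -- The angle condition makes the ear close up: from `u`, the steps in the directions `θ i` and `θ
  -- j` lead to `w`. The four cases are pendant edge, the two single triangles, and diamond.
  have hq : X'.pos w - (X'.pos u + dirVec (θ i)) = dirVec (θ j) := by
    by_cases a : u = z <;> by_cases b : w = z <;> simp only [a, b, ne_eq, not_true_eq_false, not_false_eq_true, if_true, if_false] at angle ⊢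
    · rw [show θ i = θ j + 3 by linarith, dirVec_add_three]; abel
    · have e1 := hdj b
      have e2 := dirVec_sub (θ j + 1)
      rw [show θ i = θ j + 1 + 1 by linarith, ← e2, sub_add_eq_sub_sub, e1]
      simp
    · have e1 := hdi a
      have e2 := dirVec_sub (θ i)
      have e3 := dirVec_add_three (θ j)
      rw [show θ j + 3 = θ i + 1 by linarith] at e3
      rw [sub_add_eq_sub_sub, e1, ← neg_sub, e2, e3, neg_neg]
    · have e1 := hdi a
      have e2 := hdj b
      rw [show θ i = θ j + 1 by linarith] at e1 ⊢
      rw [show θ j + 1 - 1 = θ j by ring] at e1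
      linear_combination e1 + e2
  -- If both inner sides are genuine edges, then `θ i - θ j = 1`, and the walk `u, z, w` turns too
  -- little to backtrack.
  have hne : w = u → u = z := by
    intro e
    by_contra a
    have b : w ≠ z := e ▸ a
    have e1 := hdi a
    have e2 := hdj b
    simp only [a, b, ne_eq, not_false_eq_true, if_true] at angle
    refine dirVec_add_ne_zero (a := θ i - 1) (b := θ j + 1) (by omega) ?_
    rw [← e1, ← e2, e]; abel
  have hX : Sheet.IsEar (X'.addEar v u z w (X'.pos u + dirVec (θ i))) X' v u z w := by
    refine ⟨hv, fun x => by simp [Sheet.addEar], D.p_mem _, D.p_mem _, D.p_mem _, fun x hx => ?_,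
      fun x y => Iff.rfl, fun x y t => Iff.rfl, hne, fun a => ?_, fun a => ?_⟩
    · exact Function.update_of_ne (fun e : x = v => hv (e ▸ hx)) _ _
    · exact D.bdry i (iS'.2 a)
    · have := D.bdry j (jS'.2 a)
      rwa [pj] at this
  -- The indices in the translates of `(i, j]`, where the new walk stays at the tip `v`.
  let G : ℤ → Prop := fun l => ∃ t : ℤ, i < l + t * N ∧ l + t * N ≤ j
  have G_add : ∀ l, G (l + N) ↔ G l := fun l => by
    constructor
    · rintro ⟨t, h1, h2⟩
      exact ⟨t + 1, by linarith, by linarith⟩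
    · rintro ⟨t, h1, h2⟩
      exact ⟨t - 1, by linarith, by linarith⟩
  have hN := D.pos
  have G_not : ∀ l, j < l → l ≤ i + N → ¬ G l := by
    rintro l h1 h2 ⟨t, h3, h4⟩
    have h5 : -1 < t := by
      by_contra hcon
      have : t * N ≤ -1 * N := mul_le_mul_of_nonneg_right (by omega) hN.le
      linarith
    have : 0 * N ≤ t * N := mul_le_mul_of_nonneg_right (by omega) hN.le
    linarith
  let p : ℤ → W := fun l => if G l then v else p' l
  have hP : IsPeriodic N S θ p := ⟨hN, mem_add, dir_add, fun l => by simp [p, G_add, D.p_add]⟩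
  have hL : IsLabelEar X' N S S' θ θ' p p' i j v u z w := {
    lt := lt, lt_add := ltN
    gap := fun l h1 h2 => if_pos ⟨0, by linarith, by linarith⟩
    gap' := gap'
    off := fun l h1 h2 => if_neg (G_not l h1 h2)
    hu := rfl, hw := rfl, mem' := D.p_mem, hS := hS, gapS := gapS, gapS' := gapS', iS := iS, jS := jS
    iS' := iS', jS' := jS', dir_i := fun h => dir_i (iS'.2 h), dir_j := fun h => dir_j (jS'.2 h)
    dir_off := dir_off, angle := by convert angle }
  refine ⟨_, p, v, u, z, w, hX, D.up hX hL hP ?_ ?_, hL⟩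
  · rw [hX.pos u (D.p_mem _)]
    simp [Sheet.addEar]
  · rw [hX.pos w (D.p_mem _), ← hq]
    simp [Sheet.addEar]

end

section
variable {W : Type*}

/-- The point reflection of a sheet. -/
def Sheet.neg (X : Sheet W) : Sheet W := { X with pos := fun x => -X.pos x }

theorem rotateCW_neg (d : ℤ × ℤ) : rotateCW (-d) = -rotateCW d := by
  simp [rotateCW]; ring

theorem Sheet.IsFlat.neg {X : Sheet W} (h : X.IsFlat) : X.neg.IsFlat where
  mem := h.mem
  symm := h.symm
  dir {x y} e := by
    obtain ⟨k, hk⟩ := h.dir e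
    refine ⟨k + 3, ?_⟩
    rw [dirVec_add_three, ← hk]; simp only [Sheet.neg]; abel
  tri_edge := h.tri_edge
  tri_rot := h.tri_rot
  tri_pos {x y w} e := by
    have := h.tri_pos e
    simp only [Sheet.neg, neg_sub_neg]
    rw [← neg_sub, ← neg_sub (X.pos y), rotateCW_neg, this]
  tri_unique := h.tri_unique

theorem Sheet.IsFlat.reach_neg {X : Sheet W} (h : X.IsFlat) {d e : W × W} (hr : X.Reach d e) :
    X.neg.Reach e.swap d.swap := by
  induction hr with
  | refl => exact Relation.ReflTransGen.refl
  | @tail e f _ hs ih =>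
    refine Relation.ReflTransGen.trans ?_ ih
    obtain ⟨a, b⟩ := e
    obtain ⟨t, k, h1, h2, ⟨h3, rfl⟩ | ⟨h3, rfl⟩⟩ := hs
    · have e1 := h.tri_pos h1
      rw [h2, rotateCW_dirVec] at e1
      dsimp only at e1 h2
      refine Sheet.reach_odd (X := X.neg) (k := k + 1) (h.tri_rot h1) ?_ (by omega)
      simp only [Sheet.neg]
      rw [← dirVec_sub, ← h2, ← e1]; abel
    · have e1 := h.tri_pos h1
      rw [h2, rotateCW_dirVec] at e1
      dsimp only at e1 h2
      refine Sheet.reach_even (X := X.neg) (k := k - 1) (h.tri_rot (h.tri_rot h1)) ?_ (by omega)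
      simp only [Sheet.neg]
      rw [← e1]; abel

-- Compare the angle relations of two consecutive windows: the walk repeats while `θ` drops by `6`,
-- so six times the difference of entries and exits vanishes. This makes the angle relation
-- insensitive to adding a constant to `θ`, as the point reflection does.
open Classical in
theorem IsDiagram.sum_heads {X : Sheet W} {N : ℤ} {S : Set ℤ} {θ : ℤ → ℤ} {p : ℤ → W}
    (D : IsDiagram X N S θ p) (c : ℤ) {x : W} (hx : x ∈ X.verts) :
    ∑ l ∈ Finset.Ico c (c + N), (if l ∈ S then (if p (l + 1) = x then (1 : ℤ) else 0) -
      (if p l = x then 1 else 0) else 0) = 0 := by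
  have h1 := D.vertex c x hx
  have h2 := D.vertex (c + N) x hx
  rw [D.p_add] at h2
  have h3 : ∑ l ∈ Finset.Ico (c + N) (c + N + N), cornerTerm S θ p x l =
      ∑ l ∈ Finset.Ico c (c + N), cornerTerm S θ p x (l + N) := by
    exact (Finset.sum_Ico_add' (cornerTerm S θ p x) c (c + N) N).symm
  have h4 : ∑ l ∈ Finset.Ico c (c + N), (cornerTerm S θ p x l - cornerTerm S θ p x (l + N)) = 0 := by
    rw [Finset.sum_sub_distrib, ← h3]; linarith
  have h5 : ∀ l ∈ Finset.Ico c (c + N), cornerTerm S θ p x l - cornerTerm S θ p x (l + N) =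
      6 * (if l ∈ S then (if p (l + 1) = x then (1 : ℤ) else 0) -
      (if p l = x then 1 else 0) else 0) := by
    intro l _
    have e : p (l + N + 1) = p (l + 1) := by
      rw [show l + N + 1 = l + 1 + N by ring]; exact D.p_add _
    by_cases hl : l ∈ S
    · simp only [cornerTerm, D.mem_add, hl, if_true, D.p_add, e, D.dir_add l hl]
      split_ifs <;> ring
    · simp [cornerTerm, D.mem_add, hl]
  rw [Finset.sum_congr rfl h5, ← Finset.mul_sum] at h4
  linarith

theorem IsDiagram.neg {X : Sheet W} {N : ℤ} {S : Set ℤ} {θ : ℤ → ℤ} {p : ℤ → W}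
    (D : IsDiagram X N S (fun l => θ l + 3) p) : IsDiagram X.neg N S θ p where
  pos := D.pos
  mem_add := D.mem_add
  dir_add l hl := by have := D.dir_add l hl; linarith
  p_add := D.p_add
  flat := D.flat.neg
  p_mem := D.p_mem
  stay := D.stay
  bdry := D.bdry
  dir l hl := by
    have := D.dir l hl
    rw [dirVec_add_three] at this
    rw [← neg_neg (dirVec (θ l)), ← this]
    simp only [Sheet.neg]; abel
  surj := D.surj
  inj := D.inj
  vertex c x hx := by
    classical
    have h1 := D.vertex c x hx
    have h2 := D.sum_heads c hx
    have h3 : ∑ l ∈ Finset.Ico c (c + N), cornerTerm S (fun l => θ l + 3) p x l =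
      ∑ l ∈ Finset.Ico c (c + N), cornerTerm S θ p x l + 3 * ∑ l ∈ Finset.Ico c (c + N),
        (if l ∈ S then (if p (l + 1) = x then (1 : ℤ) else 0) - (if p l = x then 1 else 0) else 0) := by
      rw [Finset.mul_sum, ← Finset.sum_add_distrib]
      refine Finset.sum_congr rfl fun l _ => ?_
      simp only [cornerTerm]
      split_ifs <;> ring
    rw [h3, h2] at h1
    have : X.neg.deg x = X.deg x := rfl
    rw [this]
    linarith

end

/-- Every chord diagram is the diagram of a simply connected sheet. -/
theorem IsChordDiagram.realize {N : ℤ} {S : Set ℤ} {θ π : ℤ → ℤ} (h : IsChordDiagram N S θ π) :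
    ∃ (X : Sheet ℕ) (p : ℤ → ℕ) (D : IsDiagram X N S θ p), Strands X S p π ∧
      IsSimplyConnected (X.complex D.flat) := by
  have hN := h.pos
  refine IsChordDiagram.induction_on (N := N) (R := fun S θ π => ∃ (X : Sheet ℕ) (p : ℤ → ℕ)
    (D : IsDiagram X N S θ p), Strands X S p π ∧ IsSimplyConnected (X.complex D.flat))
    ?_ ?_ ?_ ?_ ?_ ?_ h
  · intro θ π
    -- The empty chord diagram is realized by a single point. Vertices are taken in `ℕ` so that a
    -- new one is always available.
    let X : Sheet ℕ := ⟨{0}, fun _ _ => False, fun _ _ _ => False, fun _ => 0⟩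
    have hX : X.IsFlat := ⟨fun e => e.elim, fun e => e.elim, fun e => e.elim, fun e => e.elim,
      fun e => e.elim, fun e => e.elim, fun e => e.elim⟩
    refine ⟨X, fun _ => 0, ?_, ?_, ?_⟩
    · refine { pos := hN, mem_add := by simp, dir_add := by simp, p_add := by simp, flat := hX, p_mem := by simp [X], stay := by simp, bdry := by simp, dir := by simp, surj := fun x y e => e.1.elim, inj := by simp, vertex := ?_ }
      intro c x hx
      have : x = 0 := by simpa [X] using hx
      subst this
      simp [Sheet.deg, X, cornerTerm]
    · intro l hl; exact hl.elim
    · have hf : ∀ s ∈ (X.complex hX).faces, s = {0} := by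
        rintro s (⟨x, hx, rfl⟩ | ⟨x, y, e, rfl⟩ | ⟨x, y, t, e, rfl⟩)
        · have : x = 0 := by simpa [X] using hx
          rw [this]
        · exact e.elim
        · exact e.elim
      have h0 : ({0} : Finset ℕ) ∈ (X.complex hX).faces := Or.inl ⟨0, by simp [X], rfl⟩
      refine ⟨⟨0, h0⟩, fun u v hu hv => ⟨[], ?_⟩, fun v l hl => ?_⟩
      · have e1 := hf _ hu
        have e2 := hf _ hv
        simp only [Finset.singleton_inj] at e1 e2
        subst e1 e2
        simpa [IsEdgePath] using h0
      · induction l with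
        | nil => exact Relation.EqvGen.refl _
        | cons a l ih =>
          have h1 : {v, a} ∈ (X.complex hX).faces ∧ IsEdgePath (X.complex hX) (a :: (l ++ [v])) := by
            simpa [IsEdgePath] using hl
          have e := hf _ h1.1
          have ev : v = 0 := by
            have : v ∈ ({v, a} : Finset ℕ) := by simp
            rw [e] at this; simpa using this
          have ea : a = 0 := by
            have : a ∈ ({v, a} : Finset ℕ) := by simp
            rw [e] at this; simpa using this
          subst ev ea
          refine Relation.EqvGen.trans _ _ _ ?_ (ih h1.2)
          cases l with
          | nil => exact Relation.EqvGen.rel _ _ ⟨[], [], 0, 0, 0, by simpa using h0⟩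
          | cons b l =>
            have h2 : {0, b} ∈ (X.complex hX).faces ∧ IsEdgePath (X.complex hX) (b :: (l ++ [0])) := by
              simpa [IsEdgePath] using h1.2
            exact Relation.EqvGen.rel _ _ ⟨[], l ++ [0], 0, 0, b, by simpa using h2.1⟩
  · rintro S θ π g hc hg ⟨X, p, D, hs, hsc⟩
    -- Reversal is the point reflection: every step of a beam runs backwards in the reflected sheet.
    refine ⟨X.neg, p, D.neg, fun l hl => ?_, hsc⟩
    have := D.flat.reach_neg (hs (π l) (hc.map_mem l hl))
    rw [hg l hl, show l + N + 1 = l + 1 + N by ring, D.p_add, D.p_add] at this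
    exact this
  all_goals
    intro S θ π i j hc hi hij hjN
    have lt := hij.2.1
    have n1 : ∀ l, j < l → l < i + N → ¬ Cls N i l := fun l h1 h2 hc => by
      have := cls_eq (cls_self N i) hc (by omega) (by omega); omega
    have n2 : ∀ l, j < l → l < i + N → ¬ Cls N i (l - (j - i)) := fun l h1 h2 hc => by
      have := cls_eq (cls_self N i) hc (by omega) (by omega); omega
    have n3 : ¬ Cls N i (i - (j - i)) := fun hc => by
      have := cls_eq (cls_self N i) hc (by omega) (by omega); omega
    have n4 : ¬ Cls N i j := fun hc => by
      have := cls_eq (cls_self N i) hc (by omega) (by omega); omega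
    have c1 : Cls N i (j - (j - i)) := by rw [sub_sub_cancel]; exact cls_self _ _
    have c2 : ∀ l, Cls N j l ↔ Cls N i (l - (j - i)) := fun l =>
      ⟨fun ⟨t, ht⟩ => ⟨t, by rw [ht]; ring⟩, fun ⟨t, ht⟩ => ⟨t, by linear_combination ht⟩⟩
    have gapS : ∀ l, i < l → l < j → l ∉ S := fun l h1 h2 h3 => by
      have := hij.2.2 l h3 h1; omega
    have πcls : ∀ {l m : ℤ}, m ∈ S → Cls N m l → Cls N (π m) (π l) := by
      rintro l m hm ⟨t, rfl⟩
      exact ⟨t, (hc.add_mul hm t).2.1⟩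
  · intro hπi hπj hθ ⟨X', p', D, hs, hsc⟩
    have hi' : i ∉ {l ∈ S | ¬ Cls N i l ∧ ¬ Cls N i (l - (j - i))} := fun h => h.2.1 (cls_self _ _)
    have hj' : j ∉ {l ∈ S | ¬ Cls N i l ∧ ¬ Cls N i (l - (j - i))} := fun h => h.2.2 c1
    obtain ⟨X, p, v, u, z, w, hX, D', L⟩ := D.exists_ear (S := S) (θ := θ) lt hjN hc.mem_add hc.dir_add
      (fun l h1 h2 => ⟨fun h => ⟨h, n1 l h1 h2, n2 l h1 h2⟩, fun h => h.1⟩) gapS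
      (fun l h1 h2 h => gapS l h1 h2 h.1) hi hij.1 (fun h => absurd h hi') (fun h => absurd h hj')
      (fun _ _ _ _ => rfl) (by rw [if_neg hi', if_neg hj', hθ]; ring)
    refine ⟨X, p, D', ?_, hX.simplyConnected _ D.flat hsc⟩
    refine hs.erase_pair (hc.erase_pair hi hij hπi hπj).map_mem hX D.flat L D'.toIsPeriodic
      D.toIsPeriodic (not_not.1 fun h => hi' (L.iS'.2 h)) (not_not.1 fun h => hj' (L.jS'.2 h))
      ?_ ?_ ?_
    · intro l hl h1
      have := πcls hi h1
      rwa [hπi] at this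
    · intro l hl h1
      obtain ⟨t, ht⟩ := πcls hij.1 h1
      exact ⟨t + 1, by rw [ht, hπj]; ring⟩
    · intro l _ _ _; rfl
  · intro hθi hπi hθ ⟨X', p', D, hs, hsc⟩
    have hi' : i ∈ {l ∈ S | ¬ Cls N i (l - (j - i))} := ⟨hi, n3⟩
    have hj' : j ∉ {l ∈ S | ¬ Cls N i (l - (j - i))} := fun h => h.2 c1
    obtain ⟨X, p, v, u, z, w, hX, D', L⟩ := D.exists_ear (S := S) (θ := θ) lt hjN hc.mem_add hc.dir_add
      (fun l h1 h2 => ⟨fun h => ⟨h, n2 l h1 h2⟩, fun h => h.1⟩) gapS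
      (fun l h1 h2 h => gapS l h1 h2 h.1) hi hij.1
      (fun h => by rw [if_pos (cls_self N i)]; ring) (fun h => absurd h hj')
      (fun l h1 h2 _ => by rw [if_neg (n1 l h1 h2)]) (by rw [if_pos hi', if_neg hj', hθ]; ring)
    refine ⟨X, p, D', ?_, hX.simplyConnected _ D.flat hsc⟩
    refine hs.merge_even (hc.merge_even hi hij hjN hθi hπi hθ).map_mem hX D.flat L D'.toIsPeriodic
      D.toIsPeriodic (D'.earDirs hX L D.toIsPeriodic) (L.iS'.1 hi')
      (not_not.1 fun h => hj' (L.jS'.2 h)) hθi (by omega) ?_ ?_ ?_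
    · intro l hl h1
      have := πcls hi h1
      rwa [hπi] at this
    · intro l hl h1
      refine ⟨l - (j - i), (c2 l).1 h1, ?_⟩
      rw [if_pos ((c2 l).1 h1), sub_add_cancel]
    · intro l _ h1 _
      rw [if_neg h1]
  · intro hθi hji hπj hθ ⟨X', p', D, hs, hsc⟩
    have hi' : i ∈ {l ∈ S | ¬ Cls N i (l - (j - i))} := ⟨hi, n3⟩
    have hj' : j ∉ {l ∈ S | ¬ Cls N i (l - (j - i))} := fun h => h.2 c1
    obtain ⟨X, p, v, u, z, w, hX, D', L⟩ := D.exists_ear (S := S) (θ := θ) lt hjN hc.mem_add hc.dir_add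
      (fun l h1 h2 => ⟨fun h => ⟨h, n2 l h1 h2⟩, fun h => h.1⟩) gapS
      (fun l h1 h2 h => gapS l h1 h2 h.1) hi hij.1
      (fun h => by rw [if_pos (cls_self N i)]; ring) (fun h => absurd h hj')
      (fun l h1 h2 _ => by rw [if_neg (n1 l h1 h2)]) (by rw [if_pos hi', if_neg hj', hθ]; ring)
    refine ⟨X, p, D', ?_, hX.simplyConnected _ D.flat hsc⟩
    have hc' := hc.merge_odd hi hij hjN hθi hπj hji hθ
    refine hs.merge_odd hc'.map_mem hX D.flat L D'.toIsPeriodic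
      D.toIsPeriodic (D'.earDirs hX L D.toIsPeriodic) (L.iS'.1 hi')
      (not_not.1 fun h => hj' (L.jS'.2 h)) hθi (by omega) ?_ ?_ ?_
    · intro l hl h1
      obtain ⟨t, ht⟩ := πcls hij.1 h1
      exact ⟨t + 1, by rw [ht, hπj]; ring⟩
    · intro l hl h1
      by_cases h2 : Cls N i (π l - (j - i))
      · exact (c2 _).2 h2
      -- A chord ending at the first pane itself must be the deleted chord of the second pane, whose
      -- source is not in the smaller set.
      · rw [if_neg h2] at h1
        obtain ⟨t, ht⟩ := h1
        have e := hc.add_mul hij.1 (t - 1)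
        have := hc.inj _ hl.1 _ e.1 (by rw [e.2.1, hπj, ht]; ring)
        exact absurd ⟨t - 1, by rw [this]; ring⟩ hl.2
    · intro l hl h1
      by_cases h2 : Cls N i (π l - (j - i))
      · rw [if_pos h2] at h1; exact absurd h2 h1
      · rw [if_neg h2]
  · intro hθi hji hθ ⟨X', p', D, hs, hsc⟩
    obtain ⟨X, p, v, u, z, w, hX, D', L⟩ := D.exists_ear (S := S) (θ := θ) lt hjN hc.mem_add hc.dir_add
      (fun l h1 h2 => Iff.rfl) gapS gapS hi hij.1
      (fun h => by rw [if_pos (cls_self N i)]; ring)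
      (fun h => by rw [if_neg n4, if_pos c1]; ring)
      (fun l h1 h2 _ => by rw [if_neg (n1 l h1 h2), if_neg (n2 l h1 h2)])
      (by rw [if_pos hi, if_pos hij.1, hθ]; ring)
    refine ⟨X, p, D', ?_, hX.simplyConnected _ D.flat hsc⟩
    refine hs.swap_even ?_ hX D.flat L D'.toIsPeriodic
      D.toIsPeriodic (D'.earDirs hX L D.toIsPeriodic) (L.iS'.1 hi) (L.jS'.1 hij.1) hθi hθ ?_ ?_ ?_
    · intro l hl
      split_ifs with h1 h2
      · exact hc.map_mem _ (hc.cls_facts hi hij h1).2.1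
      · exact hc.map_mem _ (hc.cls_facts hi hij h2).1
      · exact hc.map_mem _ hl
    · intro l hl h1
      refine ⟨l + (j - i), (c2 _).2 (by simpa using h1), ?_⟩
      rw [if_neg (fun h => L.not_cls h ((c2 _).2 (by simpa using h1))), if_pos (by simpa using h1)]
      simp
    · intro l hl h1
      refine ⟨l - (j - i), (c2 _).1 h1, ?_⟩
      rw [if_pos ((c2 _).1 h1)]
      simp
    · intro l _ h1 h2
      rw [if_neg h1, if_neg (fun h => h2 ((c2 l).2 h))]

end GridBilliards

/-! ### The inverse moves on chord diagrams. -/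

namespace GridBilliards
namespace IsChordDiagram

variable {N : ℤ} {S S' : Set ℤ} {θ θ' π π' : ℤ → ℤ} {i j : ℤ}

lemma cls_dich {a x : ℤ} (ha : Cls N i a) (hx : Cls N i x) :
    x = a ∨ x ≤ a - N ∨ a + N ≤ x := by
  by_contra! h
  exact h.1 (cls_eq hx ha (by omega) (by omega))

lemma cls_sub_iff {x : ℤ} : Cls N j x ↔ Cls N i (x - (j - i)) :=
  ⟨fun ⟨t, ht⟩ => ⟨t, by rw [ht]; ring⟩, fun ⟨t, ht⟩ => ⟨t, by linear_combination ht⟩⟩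

lemma pane_facts (hN : 0 < N) (mem_add : ∀ l, l + N ∈ S ↔ l ∈ S)
    (dir_add : ∀ l ∈ S, θ (l + N) = θ l - 6) (hi : i ∈ S) (hij : IsNext S i j) {a : ℤ}
    (ha : Cls N i a) : a ∈ S ∧ a + (j - i) ∈ S ∧
      (∃ t, θ a = θ i - 6 * t ∧ θ (a + (j - i)) = θ j - 6 * t) ∧
      (∀ x ∈ S, x ≤ a ∨ a + (j - i) ≤ x) := by
  obtain ⟨t, rfl⟩ := ha
  have hP : IsPeriodic N S θ (fun _ => ()) := ⟨hN, mem_add, dir_add, fun _ => rfl⟩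
  have e : i + t * N + (j - i) = j + t * N := by ring
  have hi' := hP.add_mul i t
  have hj' := hP.add_mul j t
  rw [e]
  refine ⟨hi'.1.2 hi, hj'.1.2 hij.1, ⟨t, hi'.2.2 hi, hj'.2.2 hij.1⟩, ?_⟩
  intro x hx
  by_contra! hcon
  have := hij.2.2 (x + (-t) * N) ((hP.add_mul x _).1.2 hx) (by linarith [hcon.1])
  linarith [hcon.2]

open Classical in
/-- Adding a pair of adjacent panes whose beams hit each other. -/
lemma insert_pair (h : IsChordDiagram N S' θ' π') (mem_add : ∀ l, l + N ∈ S ↔ l ∈ S)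
    (dir_add : ∀ l ∈ S, θ (l + N) = θ l - 6) (hi : i ∈ S) (hij : IsNext S i j) (hjN : j < i + N)
    (hS : ∀ l, l ∈ S' ↔ l ∈ S ∧ ¬ Cls N i l ∧ ¬ Cls N j l) (hθ' : ∀ l ∈ S', θ' l = θ l)
    (hθ : θ j = θ i - 3) :
    IsChordDiagram N S θ (fun l => if Cls N i l then l + (j - i) else
      if Cls N j l then l - (j - i) + N else π' l) := by
  have hN := h.pos
  have lt := hij.2.1
  set π : ℤ → ℤ := fun l => if Cls N i l then l + (j - i) else
      if Cls N j l then l - (j - i) + N else π' l with hπ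
  have facts := fun {a} (ha : Cls N i a) => pane_facts hN mem_add dir_add hi hij ha
  have nij : ∀ {x}, Cls N i x → ¬ Cls N j x := fun {x} h1 h2 => by
    have := cls_dich h1 (cls_sub_iff.1 h2); omega
  have πi : ∀ {a}, Cls N i a → π a = a + (j - i) := fun ha => if_pos ha
  have πj : ∀ {a}, Cls N i a → π (a + (j - i)) = a + N := fun {a} ha => by
    have h1 : Cls N j (a + (j - i)) := (cls_sub_iff (i := i)).2 (by simpa using ha)
    simp only [hπ]
    rw [if_neg (fun h => nij h h1), if_pos h1]; ring
  have πo : ∀ {a}, a ∈ S' → π a = π' a := fun {a} ha => by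
    obtain ⟨-, h1, h2⟩ := (hS a).1 ha
    simp only [hπ]
    rw [if_neg h1, if_neg h2]
  have cases : ∀ {x}, x ∈ S → Cls N i x ∨ (∃ a, Cls N i a ∧ x = a + (j - i)) ∨ x ∈ S' := by
    intro x hx
    by_cases h1 : Cls N i x
    · exact Or.inl h1
    by_cases h2 : Cls N j x
    · exact Or.inr (Or.inl ⟨_, cls_sub_iff.1 h2, by ring⟩)
    · exact Or.inr (Or.inr ((hS x).2 ⟨hx, h1, h2⟩))
  have hsub : ∀ {x}, x ∈ S' → x ∈ S := fun hx => ((hS _).1 hx).1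
  have hne : ∀ {x a}, x ∈ S' → Cls N i a → x ≠ a ∧ x ≠ a + (j - i) := fun {x a} hx ha => by
    obtain ⟨-, h1, h2⟩ := (hS x).1 hx
    refine ⟨fun e => h1 (e ▸ ha), fun e => h2 ((cls_sub_iff (i := i)).2 (by rw [e]; simpa using ha))⟩
  have caddN : ∀ {a}, Cls N i a → Cls N i (a + N) := fun h => cls_add.2 h
  refine ⟨hN, mem_add, dir_add, ?_, ?_, ?_, ?_, ?_, ?_, ?_, ?_⟩
  · intro l hl
    rcases cases hl with hc | ⟨a, ha, rfl⟩ | hl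
    · rw [πi hc, πi (caddN hc)]; ring
    · rw [πj ha, show a + (j - i) + N = a + N + (j - i) by ring, πj (caddN ha)]
    · rw [πo hl, πo ((h.mem_add l).2 hl), h.map_add l hl]
  · intro l hl
    rcases cases hl with hc | ⟨a, ha, rfl⟩ | hl
    · rw [πi hc]; exact (facts hc).2.1
    · rw [πj ha]; exact (facts (caddN ha)).1
    · rw [πo hl]; exact hsub (h.map_mem l hl)
  · intro l hl m hm e
    rcases cases hl with hc | ⟨a, ha, rfl⟩ | hl <;> rcases cases hm with hd | ⟨b, hb, rfl⟩ | hm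
    · rw [πi hc, πi hd] at e; omega
    · rw [πi hc, πj hb] at e
      exact absurd ((cls_sub_iff (i := i)).2 (by rw [e.symm]; simpa using hc)) (nij (caddN hb))
    · rw [πi hc, πo hm] at e
      exact absurd e.symm (hne (h.map_mem m hm) hc).2
    · rw [πi hd, πj ha] at e
      exact absurd ((cls_sub_iff (i := i)).2 (by rw [e]; simpa using hd)) (nij (caddN ha))
    · rw [πj ha, πj hb] at e; omega
    · rw [πj ha, πo hm] at e
      exact absurd e.symm (hne (h.map_mem m hm) (caddN ha)).1
    · rw [πi hd, πo hl] at e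
      exact absurd e (hne (h.map_mem l hl) hd).2
    · rw [πj hb, πo hl] at e
      exact absurd e (hne (h.map_mem l hl) (caddN hb)).1
    · rw [πo hl, πo hm] at e
      exact h.inj l hl m hm e
  · intro l hl
    rcases cases hl with hc | ⟨a, ha, rfl⟩ | hl
    · have : Cls N i (l - N) := by rw [← cls_add]; simpa using hc
      exact ⟨_, (facts this).2.1, by rw [πj this]; ring⟩
    · exact ⟨a, (facts ha).1, πi ha⟩
    · obtain ⟨m, hm, e⟩ := h.surj l hl
      exact ⟨m, hsub hm, by rw [πo hm, e]⟩
  · intro l hl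
    rcases cases hl with hc | ⟨a, ha, rfl⟩ | hl
    · rw [πi hc]; omega
    · rw [πj ha]; omega
    · rw [πo hl]; exact h.lt_map l hl
  · intro l hl
    rcases cases hl with hc | ⟨a, ha, rfl⟩ | hl
    · rw [πi hc]; omega
    · rw [πj ha]; omega
    · rw [πo hl]; exact h.map_lt l hl
  · intro l hl
    rcases cases hl with hc | ⟨a, ha, rfl⟩ | hl
    · obtain ⟨-, -, ⟨t, h1, h2⟩, -⟩ := facts hc
      rw [πi hc]; omega
    · obtain ⟨h0, -, ⟨t, h1, h2⟩, -⟩ := facts ha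
      rw [πj ha, dir_add a h0]; omega
    · have := h.level l hl
      rwa [πo hl, ← hθ' _ hl, ← hθ' _ (h.map_mem l hl)]
  · intro x hx y hy h1 h2 h3 h4
    have hpx : ∀ {x}, x ∈ S → π x ∈ S := by
      intro l hl
      rcases cases hl with hc | ⟨a, ha, rfl⟩ | hl
      · rw [πi hc]; exact (facts hc).2.1
      · rw [πj ha]; exact (facts (caddN ha)).1
      · rw [πo hl]; exact hsub (h.map_mem l hl)
    have m1 := hpx hx
    have m2 := hpx hy
    rcases cases hx with hc | ⟨a, ha, rfl⟩ | hx'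
    · rw [πi hc] at h2
      have := (facts hc).2.2.2 y hy
      omega
    · rw [πj ha] at h2 h3
      have := (facts (caddN ha)).2.2.2 _ m2
      omega
    rcases cases hy with hc | ⟨a, ha, rfl⟩ | hy'
    · rw [πi hc] at h3
      have := (facts hc).2.2.2 _ m1
      omega
    · rw [πj ha] at h3 h4
      have := (facts ha).2.2.2 _ hx
      omega
    · rw [πo hx'] at h2 h3
      rw [πo hy'] at h3 h4
      rw [← hθ' _ hx', ← hθ' _ hy']
      exact h.cross x hx' y hy' h1 h2 h3 h4

open Classical in
/-- Splitting a pane into two panes with directions that differ by `60°` from the direction of the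
original pane. -/
lemma split (h : IsChordDiagram N S' θ' π') (mem_add : ∀ l, l + N ∈ S ↔ l ∈ S)
    (dir_add : ∀ l ∈ S, θ (l + N) = θ l - 6) (hi : i ∈ S) (hij : IsNext S i j) (hjN : j < i + N)
    (hS : ∀ l, l ∈ S' ↔ l ∈ S ∧ ¬ Cls N j l) (hθ' : ∀ l ∈ S', ¬ Cls N i l → θ' l = θ l)
    (hθi : ∀ l, Cls N i l → θ' l = θ l - 1) (hθ : θ j = θ i - 2) (heven : θ i % 2 = 0) :
    IsChordDiagram N S θ (fun l => if Cls N i l then l + (j - i) else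
      if Cls N j l then π' (l - (j - i)) else π' l) := by
  have hN := h.pos
  have lt := hij.2.1
  set π : ℤ → ℤ := fun l => if Cls N i l then l + (j - i) else
      if Cls N j l then π' (l - (j - i)) else π' l with hπ
  have nij : ∀ {x}, Cls N i x → ¬ Cls N j x := fun {x} h1 h2 => by
    have := cls_dich h1 (cls_sub_iff.1 h2); omega
  have hne : ∀ {x a}, x ∈ S' → Cls N i a → x ≠ a + (j - i) := fun {x a} hx ha e =>
    ((hS x).1 hx).2 ((cls_sub_iff (i := i)).2 (by rw [e]; simpa using ha))
  have hsub : ∀ {x}, x ∈ S' → x ∈ S := fun hx => ((hS _).1 hx).1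
  have facts : ∀ {a}, Cls N i a → a ∈ S ∧ a + (j - i) ∈ S ∧ a ∈ S' ∧ θ a % 2 = 0 ∧
      θ (a + (j - i)) = θ a - 2 ∧ θ' a = θ a - 1 ∧ (∀ x ∈ S, x ≤ a ∨ a + (j - i) ≤ x) := by
    intro a ha
    obtain ⟨h1, h2, ⟨t, h3, h4⟩, h5⟩ := pane_facts hN mem_add dir_add hi hij ha
    exact ⟨h1, h2, (hS a).2 ⟨h1, nij ha⟩, by omega, by omega, hθi a ha, h5⟩
  have facts' : ∀ {a}, Cls N i a → a + (j - i) < π' a ∧ π' a < a + N ∧ π' a ∈ S' ∧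
      (θ' (π' a) + 1) / 2 = θ' a / 2 - 1 := by
    intro a ha
    obtain ⟨h1, h2, h3, h4, h5, h6, h7⟩ := facts ha
    have e1 := h.lt_map a h3
    have e2 := h.map_lt a h3
    have e3 := h.map_mem a h3
    have e4 := hne e3 ha
    have e5 := h7 _ (hsub e3)
    exact ⟨by omega, e2, e3, h.level a h3⟩
  have πi : ∀ {a}, Cls N i a → π a = a + (j - i) := fun ha => if_pos ha
  have πj : ∀ {a}, Cls N i a → π (a + (j - i)) = π' a := fun {a} ha => by
    have h1 : Cls N j (a + (j - i)) := (cls_sub_iff (i := i)).2 (by simpa using ha)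
    simp only [hπ]
    rw [if_neg (fun h => nij h h1), if_pos h1]; ring_nf
  have πo : ∀ {a}, a ∈ S' → ¬ Cls N i a → π a = π' a := fun {a} ha h1 => by
    obtain ⟨-, h2⟩ := (hS a).1 ha
    simp only [hπ]
    rw [if_neg h1, if_neg h2]
  have cases : ∀ {x}, x ∈ S → Cls N i x ∨ (∃ a, Cls N i a ∧ x = a + (j - i)) ∨
      (x ∈ S' ∧ ¬ Cls N i x) := by
    intro x hx
    by_cases h1 : Cls N i x
    · exact Or.inl h1
    by_cases h2 : Cls N j x
    · exact Or.inr (Or.inl ⟨_, cls_sub_iff.1 h2, by ring⟩)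
    · exact Or.inr (Or.inr ⟨(hS x).2 ⟨hx, h2⟩, h1⟩)
  -- As `θ i` is even, restoring its direction does not change the level at which light arrives
  -- there.
  have half : ∀ {x}, x ∈ S' → (θ x + 1) / 2 = (θ' x + 1) / 2 := by
    intro x hx
    by_cases h1 : Cls N i x
    · have := facts h1; omega
    · rw [hθ' x hx h1]
  have caddN : ∀ {a}, Cls N i a → Cls N i (a + N) := fun h => cls_add.2 h
  have hmem : ∀ {x}, x ∈ S → π x ∈ S := by
    intro l hl
    rcases cases hl with hc | ⟨a, ha, rfl⟩ | ⟨hl, hc⟩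
    · rw [πi hc]; exact (facts hc).2.1
    · rw [πj ha]; exact hsub (facts' ha).2.2.1
    · rw [πo hl hc]; exact hsub (h.map_mem l hl)
  refine ⟨hN, mem_add, dir_add, ?_, fun l hl => hmem hl, ?_, ?_, ?_, ?_, ?_, ?_⟩
  · intro l hl
    rcases cases hl with hc | ⟨a, ha, rfl⟩ | ⟨hl, hc⟩
    · rw [πi hc, πi (caddN hc)]; ring
    · rw [πj ha, show a + (j - i) + N = a + N + (j - i) by ring, πj (caddN ha),
        h.map_add a (facts ha).2.2.1]
    · rw [πo hl hc, πo ((h.mem_add l).2 hl) (fun h => hc (cls_add.1 h)), h.map_add l hl]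
  · intro l hl m hm e
    rcases cases hl with hc | ⟨a, ha, rfl⟩ | ⟨hl, hc⟩ <;>
      rcases cases hm with hd | ⟨b, hb, rfl⟩ | ⟨hm, hd⟩
    · rw [πi hc, πi hd] at e; omega
    · rw [πi hc, πj hb] at e
      exact absurd e.symm (hne (facts' hb).2.2.1 hc)
    · rw [πi hc, πo hm hd] at e
      exact absurd e.symm (hne (h.map_mem m hm) hc)
    · rw [πi hd, πj ha] at e
      exact absurd e (hne (facts' ha).2.2.1 hd)
    · rw [πj ha, πj hb] at e
      rw [h.inj _ (facts ha).2.2.1 _ (facts hb).2.2.1 e]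
    · rw [πj ha, πo hm hd] at e
      exact absurd (h.inj _ (facts ha).2.2.1 _ hm e ▸ ha) hd
    · rw [πi hd, πo hl hc] at e
      exact absurd e (hne (h.map_mem l hl) hd)
    · rw [πj hb, πo hl hc] at e
      exact absurd (h.inj _ (facts hb).2.2.1 _ hl e.symm ▸ hb) hc
    · rw [πo hl hc, πo hm hd] at e
      exact h.inj l hl m hm e
  · intro l hl
    by_cases h2 : Cls N j l
    · exact ⟨l - (j - i), (facts (cls_sub_iff.1 h2)).1, by rw [πi (cls_sub_iff.1 h2)]; ring⟩
    · obtain ⟨m, hm, e⟩ := h.surj l ((hS l).2 ⟨hl, h2⟩)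
      by_cases hc : Cls N i m
      · exact ⟨m + (j - i), (facts hc).2.1, by rw [πj hc, e]⟩
      · exact ⟨m, hsub hm, by rw [πo hm hc, e]⟩
  · intro l hl
    rcases cases hl with hc | ⟨a, ha, rfl⟩ | ⟨hl, hc⟩
    · rw [πi hc]; omega
    · rw [πj ha]; exact (facts' ha).1
    · rw [πo hl hc]; exact h.lt_map l hl
  · intro l hl
    rcases cases hl with hc | ⟨a, ha, rfl⟩ | ⟨hl, hc⟩
    · rw [πi hc]; omega
    · rw [πj ha]; have := (facts' ha).2.1; omega
    · rw [πo hl hc]; exact h.map_lt l hl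
  · intro l hl
    rcases cases hl with hc | ⟨a, ha, rfl⟩ | ⟨hl, hc⟩
    · have := facts hc
      rw [πi hc]; omega
    · have := facts ha
      have := facts' ha
      rw [πj ha, half (facts' ha).2.2.1]; omega
    · have := h.level l hl
      rw [πo hl hc, half (h.map_mem l hl), this, hθ' l hl hc]
  · intro x hx y hy h1 h2 h3 h4
    have m1 := hmem hx
    have m2 := hmem hy
    rcases cases hx with hc | ⟨a, ha, rfl⟩ | ⟨hx', hcx⟩
    · rw [πi hc] at h2
      have := (facts hc).2.2.2.2.2.2 y hy
      omega
    · obtain ⟨a1, a2, a3, a4, a5, a6, a7⟩ := facts ha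
      obtain ⟨b1, b2, b3, b4⟩ := facts' ha
      rw [πj ha] at h2 h3
      rcases cases hy with hd | ⟨b, hb, rfl⟩ | ⟨hy', hd⟩
      · have := cls_dich ha hd; omega
      · have := cls_dich ha hb; omega
      · rw [πo hy' hd] at h3 h4 m2
        have c1 := (facts (caddN ha)).2.2.2.2.2.2 _ m2
        have c2 := hθ' y hy' hd
        -- A chord ending at the next translate of the split pane did not cross that pane's chord
        -- before, but it crosses it now that the chord starts at the second half. The required
        -- difference of levels then comes from `level` instead of `cross`.
        rcases eq_or_lt_of_le (show π' y ≤ a + N by omega) with e | e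
        · have c3 := h.level y hy'
          rw [e] at c3
          have c4 := h.dir_add a a3
          omega
        · have c3 := h.cross a a3 y hy' (by omega) h2 h3 e
          omega
    rw [πo hx' hcx] at h2 h3 m1
    rcases cases hy with hc | ⟨a, ha, rfl⟩ | ⟨hy', hd⟩
    · rw [πi hc] at h3
      have := (facts hc).2.2.2.2.2.2 _ m1
      omega
    · obtain ⟨a1, a2, a3, a4, a5, a6, a7⟩ := facts ha
      obtain ⟨b1, b2, b3, b4⟩ := facts' ha
      rw [πj ha] at h3 h4
      have c0 := a7 x hx
      have c1 : x ≠ a := fun e => hcx (e ▸ ha)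
      have c3 := h.cross x hx' a a3 (by omega) (by omega) h3 h4
      have c2 := hθ' x hx' hcx
      omega
    · rw [πo hy' hd] at h3 h4
      rw [← hθ' _ hx' hcx, ← hθ' _ hy' hd]
      exact h.cross x hx' y hy' h1 h2 h3 h4

open Classical in
/-- Exchanging the directions of two adjacent panes. -/
lemma unswap (h : IsChordDiagram N S θ' π')
    (dir_add : ∀ l ∈ S, θ (l + N) = θ l - 6) (hi : i ∈ S) (hij : IsNext S i j) (hjN : j < i + N)
    (hθ' : ∀ l ∈ S, ¬ Cls N i l → ¬ Cls N j l → θ' l = θ l)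
    (hθi : ∀ l, Cls N i l → θ' l = θ l - 1) (hθj : ∀ l, Cls N j l → θ' l = θ l + 1)
    (hθ : θ j = θ i - 1) (heven : θ i % 2 = 0) :
    IsChordDiagram N S θ (fun l => if Cls N i l then π' (l + (j - i)) else
      if Cls N j l then π' (l - (j - i)) else π' l) := by
  have hN := h.pos
  have mem_add := h.mem_add
  have lt := hij.2.1
  set π : ℤ → ℤ := fun l => if Cls N i l then π' (l + (j - i)) else
      if Cls N j l then π' (l - (j - i)) else π' l with hπ
  have nij : ∀ {x}, Cls N i x → ¬ Cls N j x := fun {x} h1 h2 => by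
    have := cls_dich h1 (cls_sub_iff.1 h2); omega
  have cj : ∀ {a}, Cls N i a → Cls N j (a + (j - i)) := fun ha =>
    (cls_sub_iff (i := i)).2 (by simpa using ha)
  have caddN : ∀ {a}, Cls N i a → Cls N i (a + N) := fun h => cls_add.2 h
  have facts : ∀ {a}, Cls N i a → a ∈ S ∧ a + (j - i) ∈ S ∧ θ a % 2 = 0 ∧
      θ (a + (j - i)) = θ a - 1 ∧ θ' a = θ a - 1 ∧ θ' (a + (j - i)) = θ a ∧
      (∀ x ∈ S, x ≤ a ∨ a + (j - i) ≤ x) := by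
    intro a ha
    obtain ⟨h1, h2, ⟨t, h3, h4⟩, h5⟩ := pane_facts hN mem_add dir_add hi hij ha
    have := hθj _ (cj ha)
    exact ⟨h1, h2, by omega, by omega, hθi a ha, by omega, h5⟩
  have facts' : ∀ {a}, Cls N i a → a + (j - i) < π' a ∧ π' a < a + N ∧
      a + (j - i) < π' (a + (j - i)) ∧ π' (a + (j - i)) < a + N := by
    intro a ha
    obtain ⟨h1, h2, h3, h4, h5, h6, h7⟩ := facts ha
    have f7 := (facts (caddN ha)).2.2.2.2.2.2 _ (h.map_mem _ h2)
    have e1 := h.lt_map a h1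
    have e2 := h.map_lt a h1
    have e3 := h.lt_map _ h2
    have e4 := h.map_lt _ h2
    have e5 := h7 _ (h.map_mem a h1)
    have l1 := h.level a h1
    have l2 := h.level _ h2
    -- By `level` neither pane of the pair hits the other, so both chords leave the pair and can be
    -- exchanged.
    have n1 : π' a ≠ a + (j - i) := fun e => by rw [e] at l1; omega
    have n2 : π' (a + (j - i)) ≠ a + N := fun e => by
      rw [e, h.dir_add a h1] at l2; omega
    omega
  have πi : ∀ {a}, Cls N i a → π a = π' (a + (j - i)) := fun ha => if_pos ha
  have πj : ∀ {a}, Cls N i a → π (a + (j - i)) = π' a := fun {a} ha => by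
    simp only [hπ]
    rw [if_neg (fun h => nij h (cj ha)), if_pos (cj ha)]; ring_nf
  have πo : ∀ {a}, ¬ Cls N i a → ¬ Cls N j a → π a = π' a := fun {a} h1 h2 => by
    simp only [hπ]
    rw [if_neg h1, if_neg h2]
  have cases : ∀ x, Cls N i x ∨ (∃ a, Cls N i a ∧ x = a + (j - i)) ∨
      (¬ Cls N i x ∧ ¬ Cls N j x) := by
    intro x
    by_cases h1 : Cls N i x
    · exact Or.inl h1
    by_cases h2 : Cls N j x
    · exact Or.inr (Or.inl ⟨_, cls_sub_iff.1 h2, by ring⟩)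
    · exact Or.inr (Or.inr ⟨h1, h2⟩)
  have half : ∀ {x}, x ∈ S → (θ x + 1) / 2 = (θ' x + 1) / 2 := by
    intro x hx
    rcases cases x with hc | ⟨a, ha, rfl⟩ | ⟨h1, h2⟩
    · have := facts hc; omega
    · have := facts ha; omega
    · rw [hθ' x hx h1 h2]
  have hmem : ∀ {x}, x ∈ S → π x ∈ S := by
    intro l hl
    rcases cases l with hc | ⟨a, ha, rfl⟩ | ⟨h1, h2⟩
    · rw [πi hc]; exact h.map_mem _ (facts hc).2.1
    · rw [πj ha]; exact h.map_mem _ (facts ha).1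
    · rw [πo h1 h2]; exact h.map_mem l hl
  refine ⟨hN, mem_add, dir_add, ?_, fun l hl => hmem hl, ?_, ?_, ?_, ?_, ?_, ?_⟩
  · intro l hl
    rcases cases l with hc | ⟨a, ha, rfl⟩ | ⟨h1, h2⟩
    · rw [πi hc, πi (caddN hc), show l + N + (j - i) = l + (j - i) + N by ring,
        h.map_add _ (facts hc).2.1]
    · rw [πj ha, show a + (j - i) + N = a + N + (j - i) by ring, πj (caddN ha),
        h.map_add a (facts ha).1]
    · rw [πo h1 h2, πo (fun h => h1 (cls_add.1 h)) (fun h => h2 (cls_add.1 h)), h.map_add l hl]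
  · intro l hl m hm e
    rcases cases l with hc | ⟨a, ha, rfl⟩ | ⟨h1, h2⟩ <;>
      rcases cases m with hd | ⟨b, hb, rfl⟩ | ⟨h3, h4⟩
    · rw [πi hc, πi hd] at e
      have := h.inj _ (facts hc).2.1 _ (facts hd).2.1 e; omega
    · rw [πi hc, πj hb] at e
      have := h.inj _ (facts hc).2.1 _ (facts hb).1 e
      exact absurd (this ▸ cj hc) (nij hb)
    · rw [πi hc, πo h3 h4] at e
      have := h.inj _ (facts hc).2.1 _ hm e
      exact absurd (this ▸ cj hc) h4
    · rw [πi hd, πj ha] at e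
      have := h.inj _ (facts ha).1 _ (facts hd).2.1 e
      exact absurd (this.symm ▸ cj hd) (nij ha)
    · rw [πj ha, πj hb] at e
      rw [h.inj _ (facts ha).1 _ (facts hb).1 e]
    · rw [πj ha, πo h3 h4] at e
      exact absurd (h.inj _ (facts ha).1 _ hm e ▸ ha) h3
    · rw [πi hd, πo h1 h2] at e
      have := h.inj _ hl _ (facts hd).2.1 e
      exact absurd (this.symm ▸ cj hd) h2
    · rw [πj hb, πo h1 h2] at e
      exact absurd (h.inj _ (facts hb).1 _ hl e.symm ▸ hb) h1
    · rw [πo h1 h2, πo h3 h4] at e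
      exact h.inj l hl m hm e
  · intro l hl
    obtain ⟨m, hm, e⟩ := h.surj l hl
    rcases cases m with hc | ⟨a, ha, rfl⟩ | ⟨h1, h2⟩
    · exact ⟨m + (j - i), (facts hc).2.1, by rw [πj hc, e]⟩
    · exact ⟨a, (facts ha).1, by rw [πi ha, e]⟩
    · exact ⟨m, hm, by rw [πo h1 h2, e]⟩
  · intro l hl
    rcases cases l with hc | ⟨a, ha, rfl⟩ | ⟨h1, h2⟩
    · rw [πi hc]; have := facts' hc; omega
    · rw [πj ha]; exact (facts' ha).1
    · rw [πo h1 h2]; exact h.lt_map l hl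
  · intro l hl
    rcases cases l with hc | ⟨a, ha, rfl⟩ | ⟨h1, h2⟩
    · rw [πi hc]; exact (facts' hc).2.2.2
    · rw [πj ha]; have := (facts' ha).2.1; omega
    · rw [πo h1 h2]; exact h.map_lt l hl
  · intro l hl
    rw [half (hmem hl)]
    rcases cases l with hc | ⟨a, ha, rfl⟩ | ⟨h1, h2⟩
    · have := facts hc
      have := h.level _ (facts hc).2.1
      rw [πi hc]; omega
    · have := facts ha
      have := h.level _ (facts ha).1
      rw [πj ha]; omega
    · have := h.level l hl
      rw [πo h1 h2, this, hθ' l hl h1 h2]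
  · intro x hx y hy h1 h2 h3 h4
    have m1 := hmem hx
    have m2 := hmem hy
    rcases cases x with ha | ⟨a, ha, rfl⟩ | ⟨hx1, hx2⟩
    · obtain ⟨a1, a2, a3, a4, a5, a6, a7⟩ := facts ha
      obtain ⟨b1, b2, b3, b4⟩ := facts' ha
      rw [πi ha] at h2 h3
      rcases cases y with hd | ⟨b, hb, rfl⟩ | ⟨hy1, hy2⟩
      · have := cls_dich ha hd; omega
      · have := cls_dich ha hb
        have : b = x := by omega
        subst this; omega
      · rw [πo hy1 hy2] at h3 h4
        have c1 := a7 y hy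
        have c3 : y ≠ x + (j - i) := fun e => hy2 (e ▸ cj ha)
        have c4 := h.cross _ a2 y hy (by omega) h2 h3 (by omega)
        have c2 := hθ' y hy hy1 hy2
        omega
    · obtain ⟨a1, a2, a3, a4, a5, a6, a7⟩ := facts ha
      obtain ⟨b1, b2, b3, b4⟩ := facts' ha
      rw [πj ha] at h2 h3
      rcases cases y with hd | ⟨b, hb, rfl⟩ | ⟨hy1, hy2⟩
      · have := cls_dich ha hd; omega
      · have := cls_dich ha hb; omega
      · rw [πo hy1 hy2] at h3 h4 m2
        have c1 := (facts (caddN ha)).2.2.2.2.2.2 _ m2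
        have c2 := hθ' y hy hy1 hy2
        rcases eq_or_lt_of_le (show π' y ≤ a + N by omega) with e | e
        · have c3 := h.level y hy
          rw [e] at c3
          have c4 := h.dir_add a a1
          omega
        · have c3 := h.cross a a1 y hy (by omega) h2 h3 e
          omega
    rw [πo hx1 hx2] at h2 h3 m1
    have c2 := hθ' x hx hx1 hx2
    rcases cases y with ha | ⟨a, ha, rfl⟩ | ⟨hy1, hy2⟩
    · obtain ⟨a1, a2, a3, a4, a5, a6, a7⟩ := facts ha
      rw [πi ha] at h3 h4
      have c0 := a7 _ m1
      -- If `x` ends at the second pane, its crossing with the chord now leaving the first pane is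
      -- new, and again `level` at the shared pane gives the relation.
      rcases eq_or_lt_of_le (show y + (j - i) ≤ π' x by omega) with e | e
      · have c3 := h.level x hx
        rw [← e] at c3
        omega
      · have c3 := h.cross x hx _ a2 (by omega) e h3 h4
        omega
    · obtain ⟨a1, a2, a3, a4, a5, a6, a7⟩ := facts ha
      rw [πj ha] at h3 h4
      have c0 := a7 x hx
      have c1 : x ≠ a := fun e => hx1 (e ▸ ha)
      have c3 := h.cross x hx a a1 (by omega) (by omega) h3 h4
      omega
    · rw [πo hy1 hy2] at h3 h4
      rw [← c2, ← hθ' _ hy hy1 hy2]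
      exact h.cross x hx y hy h1 h2 h3 h4

/-- Reversing twice raises all directions by `6`; shifting by a full turn changes every level by
`3`, which the axioms do not see. -/
lemma congr_dir (h : IsChordDiagram N S θ π) (e : ∀ l ∈ S, θ' l = θ l - 6) :
    IsChordDiagram N S θ' π := by
  refine { h with dir_add := ?_, level := ?_, cross := ?_ }
  · intro l hl
    rw [e _ ((h.mem_add l).2 hl), e l hl, h.dir_add l hl]
  · intro l hl
    have := h.level l hl
    rw [e l hl, e _ (h.map_mem l hl)]; omega
  · intro x hx y hy h1 h2 h3 h4
    have := h.cross x hx y hy h1 h2 h3 h4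
    rw [e x hx, e y hy]; omega

end IsChordDiagram
end GridBilliards

namespace GridBilliards
namespace IsChordDiagram

variable {N : ℤ} {S S' : Set ℤ} {θ θ' π π' : ℤ → ℤ} {i j : ℤ}

/-- Reversal adds `3` to the directions and so exchanges the parities: reverse, split in the even
case, reverse back. Outgoing chords of the reversed diagram are incoming ones of the original, hence
the conclusions in terms of targets. -/
lemma split_odd (h : IsChordDiagram N S' θ' π') (mem_add : ∀ l, l + N ∈ S ↔ l ∈ S)
    (dir_add : ∀ l ∈ S, θ (l + N) = θ l - 6) (hi : i ∈ S) (hij : IsNext S i j) (hjN : j < i + N)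
    (hS : ∀ l, l ∈ S' ↔ l ∈ S ∧ ¬ Cls N j l) (hθ' : ∀ l ∈ S', ¬ Cls N i l → θ' l = θ l)
    (hθi : ∀ l, Cls N i l → θ' l = θ l - 1) (hθ : θ j = θ i - 2) (hodd : θ i % 2 = 1) :
    ∃ π, IsChordDiagram N S θ π ∧ (∀ l ∈ S, Cls N j l → Cls N i (π l)) ∧
      (∀ l ∈ S', Cls N i (π' l) → Cls N j (π l)) ∧
      (∀ l ∈ S', ¬ Cls N i (π' l) → π l = π' l) := by
  obtain ⟨g', g1, g2, hg⟩ := h.exists_reverse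
  have K := hg.split (θ := fun l => θ l + 3) (i := i) (j := j) mem_add
    (fun l hl => by rw [dir_add l hl]; ring) hi hij hjN hS
    (fun l hl h1 => by rw [hθ' l hl h1]) (fun l hl => by rw [hθi l hl]; ring) (by rw [hθ]; ring)
    (by omega)
  obtain ⟨π, p1, p2, hp⟩ := K.exists_reverse
  have hp' := hp.congr_dir (θ' := θ) (fun l _ => by ring)
  have facts := fun {a} (ha : Cls N i a) => pane_facts h.pos mem_add dir_add hi hij ha
  have lt := hij.2.1
  have nij : ∀ {x}, Cls N i x → ¬ Cls N j x := fun {x} h1 h2 => by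
    have := cls_dich h1 (cls_sub_iff.1 h2); omega
  have sub : ∀ {l}, l ∈ S' → l ∈ S := fun hl => ((hS _).1 hl).1
  have back : ∀ {l m}, l ∈ S → π (l + N) = m + N → π l = m := fun {l m} hl e => by
    have := hp'.map_add l hl; omega
  refine ⟨π, hp', ?_, ?_, ?_⟩
  · intro l hl hc
    have ha := (cls_sub_iff (i := i)).1 hc
    have := p1 _ (facts ha).1
    rw [if_pos ha, sub_add_cancel] at this
    rw [this]; exact cls_add.2 ha
  · intro l hl hc
    have hb : Cls N j (π' l + (j - i)) := (cls_sub_iff (i := i)).2 (by simpa using hc)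
    have := p1 _ (facts hc).2.1
    rw [if_neg (fun h => nij h hb), if_pos hb, add_sub_cancel_right, g1 l hl] at this
    rwa [back (sub hl) this]
  · intro l hl hc
    have hm := h.map_mem l hl
    have := p1 _ (sub hm)
    rw [if_neg hc, if_neg ((hS _).1 hm).2, g1 l hl] at this
    exact back (sub hl) this

/-- Obtained from the even case by two reversals, so that the incoming chords are exchanged and not
the outgoing ones. -/
lemma unswap_odd (h : IsChordDiagram N S θ' π')
    (dir_add : ∀ l ∈ S, θ (l + N) = θ l - 6) (hi : i ∈ S) (hij : IsNext S i j) (hjN : j < i + N)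
    (hθ' : ∀ l ∈ S, ¬ Cls N i l → ¬ Cls N j l → θ' l = θ l)
    (hθi : ∀ l, Cls N i l → θ' l = θ l - 1) (hθj : ∀ l, Cls N j l → θ' l = θ l + 1)
    (hθ : θ j = θ i - 1) (hodd : θ i % 2 = 1) :
    ∃ π, IsChordDiagram N S θ π ∧ (∀ l ∈ S, Cls N i (π' l) → Cls N j (π l)) ∧
      (∀ l ∈ S, Cls N j (π' l) → Cls N i (π l)) ∧
      (∀ l ∈ S, ¬ Cls N i (π' l) → ¬ Cls N j (π' l) → π l = π' l) := by
  obtain ⟨g', g1, g2, hg⟩ := h.exists_reverse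
  have K := hg.unswap (θ := fun l => θ l + 3) (i := i) (j := j)
    (fun l hl => by rw [dir_add l hl]; ring) hi hij hjN
    (fun l hl h1 h2 => by rw [hθ' l hl h1 h2]) (fun l hl => by rw [hθi l hl]; ring)
    (fun l hl => by rw [hθj l hl]; ring) (by rw [hθ]; ring) (by omega)
  obtain ⟨π, p1, p2, hp⟩ := K.exists_reverse
  have hp' := hp.congr_dir (θ' := θ) (fun l _ => by ring)
  have facts := fun {a} (ha : Cls N i a) => pane_facts h.pos h.mem_add dir_add hi hij ha
  have lt := hij.2.1
  have nij : ∀ {x}, Cls N i x → ¬ Cls N j x := fun {x} h1 h2 => by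
    have := cls_dich h1 (cls_sub_iff.1 h2); omega
  have back : ∀ {l m}, l ∈ S → π (l + N) = m + N → π l = m := fun {l m} hl e => by
    have := hp'.map_add l hl; omega
  refine ⟨π, hp', ?_, ?_, ?_⟩
  · intro l hl hc
    have hb : Cls N j (π' l + (j - i)) := (cls_sub_iff (i := i)).2 (by simpa using hc)
    have := p1 _ (facts hc).2.1
    rw [if_neg (fun h => nij h hb), if_pos hb, add_sub_cancel_right, g1 l hl] at this
    rwa [back hl this]
  · intro l hl hc
    have ha := (cls_sub_iff (i := i)).1 hc
    have := p1 _ (facts ha).1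
    rw [if_pos ha, sub_add_cancel, g1 l hl] at this
    rwa [back hl this]
  · intro l hl h1 h2
    have := p1 _ (h.map_mem l hl)
    rw [if_neg h1, if_neg h2, g1 l hl] at this
    exact back hl this

end IsChordDiagram

/-! ### Tips of a diagram. -/

open IsChordDiagram (Cls cls_self cls_add cls_eq IsNext cls_sub_iff cls_dich)

section
variable {W : Type*} {X : Sheet W} {N : ℤ} {S : Set ℤ} {θ : ℤ → ℤ} {p : ℤ → W}

theorem IsPeriodic.exists_next (h : IsPeriodic N S θ p) {i : ℤ} (hi : i ∈ S) :
    ∃ j, IsNext S i j ∧ j ≤ i + N := by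
  have hN := h.pos
  have hex : ∃ d : ℕ, i + 1 + d ∈ S :=
    ⟨(N - 1).toNat, by rw [show i + 1 + ((N - 1).toNat : ℤ) = i + N by omega]; exact (h.mem_add i).2 hi⟩
  classical
  refine ⟨i + 1 + Nat.find hex, ⟨Nat.find_spec hex, by omega, fun x hx hix => ?_⟩, ?_⟩
  · have := Nat.find_min' hex (m := (x - i - 1).toNat)
      (by rwa [show i + 1 + ((x - i - 1).toNat : ℤ) = x by omega])
    omega
  · have := Nat.find_min' hex (m := (N - 1).toNat)
      (by rw [show i + 1 + ((N - 1).toNat : ℤ) = i + N by omega]; exact (h.mem_add i).2 hi)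
    omega

/-- A vertex of the boundary walk that is visited only once and has at most two triangles. -/
theorem IsDiagram.exists_tip (D : IsDiagram X N S θ p) (hne : S.Nonempty) :
    ∃ i ∈ S, ∃ j, IsNext S i j ∧ j < i + N ∧ (∀ l ∈ S, p (l + 1) = p (i + 1) → Cls N i l) ∧
      (∀ l ∈ S, p l = p (i + 1) → Cls N j l) ∧ θ i - θ j = 3 - X.deg (p (i + 1)) ∧
      X.deg (p (i + 1)) ≤ 2 := by
  classical
  obtain ⟨c, hc⟩ := hne
  have hN := D.pos
  let H : W → ℤ := fun x => ∑ l ∈ Finset.Ico c (c + N), if l ∈ S ∧ p (l + 1) = x then 1 else 0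
  -- Summed over all vertices, each pane contributes `θ + 3` at its head and `-θ` at its tail, so
  -- the directions cancel. The base point leaves a total of `6`, and some vertex has a positive
  -- summand.
  have sum1 : ∑ x ∈ X.verts, (6 - X.deg x - 3 * H x) = 6 := by
    have h1 : ∑ x ∈ X.verts, (X.deg x + ∑ l ∈ Finset.Ico c (c + N), cornerTerm S θ p x l) =
        ∑ x ∈ X.verts, (6 - if p c = x then 6 else 0) :=
      Finset.sum_congr rfl fun x hx => D.vertex c x hx
    have h2 : ∑ x ∈ X.verts, ∑ l ∈ Finset.Ico c (c + N), cornerTerm S θ p x l =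
        ∑ x ∈ X.verts, 3 * H x := by
      rw [Finset.sum_comm]
      simp only [H, Finset.mul_sum]
      rw [Finset.sum_comm (s := X.verts)]
      refine Finset.sum_congr rfl fun l _ => ?_
      by_cases hl : l ∈ S
      · simp only [cornerTerm, hl, if_true, true_and, Finset.sum_sub_distrib, Finset.sum_ite_eq,
          D.p_mem, mul_ite, mul_one, mul_zero]
        ring
      · simp [cornerTerm, hl]
    simp only [Finset.sum_add_distrib, Finset.sum_sub_distrib, Finset.sum_ite_eq, D.p_mem,
      if_true] at h1 h2 ⊢
    rw [h2] at h1
    linarith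
  obtain ⟨x, hx, hx0⟩ : ∃ x ∈ X.verts, 0 < 6 - X.deg x - 3 * H x := by
    by_contra! hcon
    have := Finset.sum_nonpos hcon
    omega
  have hdeg : 0 ≤ X.deg x := Finset.sum_nonneg fun a _ => by split_ifs <;> simp
  have hH0 : 0 ≤ H x := Finset.sum_nonneg fun a _ => by split_ifs <;> simp
  have htail : ∑ l ∈ Finset.Ico c (c + N), (if l ∈ S ∧ p l = x then (1 : ℤ) else 0) = H x := by
    have := D.sum_heads c hx
    have e : ∀ l ∈ Finset.Ico c (c + N), (if l ∈ S then (if p (l + 1) = x then (1 : ℤ) else 0) -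
      (if p l = x then 1 else 0) else 0) = (if l ∈ S ∧ p (l + 1) = x then (1 : ℤ) else 0) -
        if l ∈ S ∧ p l = x then (1 : ℤ) else 0 := by
      intro l _
      by_cases hl : l ∈ S <;> simp [hl]
    rw [Finset.sum_congr rfl e, Finset.sum_sub_distrib] at this
    linarith
  -- An unvisited vertex has six triangles by the angle relation, which contradicts positivity.
  -- Hence `x` is visited, and `3 * H x < 6 - X.deg x` leaves only one visit and at most two
  -- triangles.
  have hHne : H x ≠ 0 := by
    intro h0
    have t1 : ∀ l ∈ Finset.Ico c (c + N), ¬ (l ∈ S ∧ p (l + 1) = x) := fun l hl h => by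
      have := (Finset.sum_eq_zero_iff_of_nonneg (fun a _ => by split_ifs <;> simp)).1 h0 l hl
      rw [if_pos h] at this; omega
    have t2 : ∀ l ∈ Finset.Ico c (c + N), ¬ (l ∈ S ∧ p l = x) := fun l hl h => by
      rw [h0] at htail
      have := (Finset.sum_eq_zero_iff_of_nonneg (fun a _ => by split_ifs <;> simp)).1 htail l hl
      rw [if_pos h] at this; omega
    have h1 := D.vertex c x hx
    rw [if_neg (fun e => t2 c (by simp [hN]) ⟨hc, e⟩), Finset.sum_eq_zero] at h1
    · omega
    · intro l hl
      have a1 := t1 l hl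
      have a2 := t2 l hl
      by_cases hl : l ∈ S
      · simp only [cornerTerm, if_pos hl, if_neg (fun e => a1 ⟨hl, e⟩), if_neg (fun e => a2 ⟨hl, e⟩)]
        rfl
      · simp [cornerTerm, hl]
  have hH1 : H x = 1 := by omega
  have uniq : ∀ (Q : ℤ → Prop) [DecidablePred Q] (s : ℤ), (∀ l t : ℤ, Q (l + t * N) ↔ Q l) →
      ∑ l ∈ Finset.Ico c (c + N), (if Q l then (1 : ℤ) else 0) = 1 → Q s → ∀ l, Q l → Cls N s l := by
    intro Q _ s hper hsum hs l hl
    obtain ⟨s, t, rfl, h1, h2⟩ := IsPeriodic.exists_window hN c s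
    obtain ⟨l, t', rfl, h3, h4⟩ := IsPeriodic.exists_window hN c l
    rw [hper] at hs hl
    have e : s = l := by
      by_contra hne
      have := Finset.sum_le_sum_of_subset_of_nonneg (f := fun l => if Q l then (1 : ℤ) else 0)
        (s := {s, l}) (t := Finset.Ico c (c + N))
        (by intro a; simp; rintro (rfl | rfl) <;> omega) (fun a _ _ => by split_ifs <;> simp)
      rw [Finset.sum_pair hne, hsum, if_pos hs, if_pos hl] at this
      omega
    exact ⟨t' - t, by rw [e]; ring⟩
  obtain ⟨i, hi, hix⟩ : ∃ l ∈ S, p (l + 1) = x := by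
    by_contra! hcon
    exact hHne (Finset.sum_eq_zero fun l _ => if_neg fun h => hcon l h.1 h.2)
  have hu := uniq (fun l => l ∈ S ∧ p (l + 1) = x) i
    (fun l t => by rw [(D.add_mul l t).1, D.p_succ]) hH1 ⟨hi, hix⟩
  obtain ⟨j, hij, hjN⟩ := D.exists_next hi
  have hpj : p j = x := by
    rw [← hix]
    exact D.const (a := i + 1) (b := j) (fun l h1 h2 h3 => by have := hij.2.2 l h3 (by omega); omega)
      j (by have := hij.2.1; omega) le_rfl
  have ht := uniq (fun l => l ∈ S ∧ p l = x) j
    (fun l t => by rw [(D.add_mul l t).1, (D.add_mul l t).2.1]) (htail.trans hH1) ⟨hij.1, hpj⟩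
  have hpi : p i ≠ x := by rw [← hix]; exact D.flat.ne (D.bdry i hi).1
  have hjN' : j < i + N := lt_of_le_of_ne hjN fun e => hpi (by rw [← hpj, e, D.p_add])
  have hlt := hij.2.1
  refine ⟨i, hi, j, hij, hjN', fun l hl e => hu l ⟨hl, by rw [e, hix]⟩,
    fun l hl e => ht l ⟨hl, by rw [e, hix]⟩, ?_, by rw [hix]; omega⟩
  have hv := D.vertex i x hx
  rw [if_neg hpi, Finset.sum_eq_add_of_mem i j (by simp [hN]) (by simp; omega) hlt.ne] at hv
  · have hpj1 : p (j + 1) ≠ x := by rw [← hpj]; exact (D.flat.ne (D.bdry j hij.1).1).symm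
    simp only [cornerTerm, hi, hij.1, if_true, hix, hpi, hpj, hpj1, if_false] at hv
    rw [hix]
    linarith
  · intro l hl hne
    rw [Finset.mem_Ico] at hl
    by_cases hlS : l ∈ S
    · have a1 : p (l + 1) ≠ x := fun e => hne.1 (cls_eq (hu l ⟨hlS, e⟩) (cls_self N i) (by omega) (by omega))
      have a2 : p l ≠ x := fun e => hne.2 (cls_eq (ht l ⟨hlS, e⟩) (cls_self N j) (by omega) (by omega))
      simp [cornerTerm, hlS, a1, a2]
    · simp [cornerTerm, hlS]

open Classical in
/-- The surroundings of a tip of the diagram. -/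
theorem IsDiagram.tip_structure (D : IsDiagram X N S θ p) {i j : ℤ} (hi : i ∈ S) (hij : IsNext S i j)
    (hu : ∀ l ∈ S, p (l + 1) = p (i + 1) → Cls N i l) (ht : ∀ l ∈ S, p l = p (i + 1) → Cls N j l)
    (hθ : θ i - θ j = 3 - X.deg (p (i + 1))) (hdeg : X.deg (p (i + 1)) ≤ 2) :
    ∃ z, (∀ a, X.Edge (p (i + 1)) a ↔ a = p i ∨ a = z ∨ a = p (j + 1)) ∧
      (∀ a b, X.Tri (p (i + 1)) a b ↔ (p i ≠ z ∧ a = z ∧ b = p i) ∨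
        (p (j + 1) ≠ z ∧ a = p (j + 1) ∧ b = z)) ∧ (p (j + 1) = p i → p i = z) ∧
      θ i - θ j + (if p i ≠ z then 1 else 0) + (if p (j + 1) ≠ z then 1 else 0) = 3 ∧
      (p i = z → p (j + 1) = z) := by
  have hlt := hij.2.1
  have hpj : p j = p (i + 1) :=
    D.const (a := i + 1) (b := j) (fun l h1 h2 h3 => by have := hij.2.2 l h3 (by omega); omega)
      j (by omega) le_rfl
  have bi := D.bdry i hi
  have bj := D.bdry j hij.1
  have di := D.dir i hi
  have dj := D.dir j hij.1
  rw [hpj] at bj dj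
  set v := p (i + 1)
  set u := p i with hu_def
  set w := p (j + 1) with hw_def
  -- An edge at `v` without a triangle on the given side is a boundary edge, and the walk enters `v`
  -- only from `u`. The next fact says the same for `w`, the only exit.
  have hin : ∀ a, X.Edge v a → (∃ b, X.Tri v a b) ∨ a = u := by
    intro a ha
    by_contra! h
    obtain ⟨l, hl, h1, h2⟩ := D.surj a v ⟨D.flat.symm ha, h.1⟩
    exact h.2 (by rw [← h1, (D.toIsPeriodic.p_cls (hu l hl h2)).1])
  have hout : ∀ a, X.Edge v a → (∃ b, X.Tri v b a) ∨ a = w := by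
    intro a ha
    by_contra! h
    obtain ⟨l, hl, h1, h2⟩ := D.surj v a ⟨ha, fun b hb => h.1 b (D.flat.tri_rot hb)⟩
    exact h.2 (by rw [← h2, (D.toIsPeriodic.p_cls (ht l hl h1)).2])
  have hu' : ∀ b, ¬ X.Tri v u b := bi.2
  have hw' : ∀ b, ¬ X.Tri v b w := fun b hb => bj.2 b (D.flat.tri_rot (D.flat.tri_rot hb))
  have eu : X.Edge v u := D.flat.symm bi.1
  have ew : X.Edge v w := bj.1
  have huw : w = u → (θ i - θ j) % 6 = 3 := by
    intro e
    have : dirVec (θ j) = dirVec (θ i + 3) := by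
      rw [dirVec_add_three, ← di, ← dj, e]; abel
    rw [dirVec_inj] at this
    omega
  have e1 : ∀ {a b}, X.Tri v a b → X.Edge v a ∧ X.Edge v b ∧ a ≠ b := fun hab =>
    ⟨D.flat.tri_edge hab, D.flat.symm (D.flat.tri_edge (D.flat.tri_rot (D.flat.tri_rot hab))),
      D.flat.ne (D.flat.tri_edge (D.flat.tri_rot hab))⟩
  have uniq : ∀ {a a' b}, X.Tri v a b → X.Tri v a' b → a = a' := fun h h' =>
    D.flat.tri_unique (D.flat.tri_rot (D.flat.tri_rot h)) (D.flat.tri_rot (D.flat.tri_rot h'))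
  have uniq' : ∀ {a b b'}, X.Tri v a b → X.Tri v a b' → b = b' := fun h h' =>
    D.flat.tri_unique h h'
  have hcard : X.deg v = ((X.verts.filter fun a => ∃ b, X.Tri v a b).card : ℤ) := by
    rw [Sheet.deg, Finset.card_filter]; push_cast; rfl
  have hmem : ∀ a, a ∈ X.verts.filter (fun a => ∃ b, X.Tri v a b) ↔ ∃ b, X.Tri v a b := by
    intro a
    simp only [Finset.mem_filter, and_iff_right_iff_imp]
    rintro ⟨b, hb⟩
    exact D.flat.mem' (D.flat.tri_edge hb)
  set T := X.verts.filter fun a => ∃ b, X.Tri v a b with hT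
  -- The triangles at `v` form a fan from `w` to `u`. With none, `w = u` and one takes `z = u`; with
  -- one, `z = w`; with two, `z` is the vertex between them.
  have hc : T.card = 0 ∨ T.card = 1 ∨ T.card = 2 := by omega
  rcases hc with hc | hc | hc
  · have hno : ∀ a b, ¬ X.Tri v a b := fun a b hab => by
      have := (hmem a).2 ⟨b, hab⟩
      rw [Finset.card_eq_zero.1 hc] at this; simp at this
    have hwu : w = u := by
      rcases hin w ew with ⟨b, hb⟩ | h
      · exact absurd hb (hno _ _)
      · exact h
    refine ⟨u, fun a => ⟨fun ha => ?_, ?_⟩, fun a b => ?_, fun _ => rfl, ?_, fun _ => hwu⟩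
    · rcases hin a ha with ⟨b, hb⟩ | h
      · exact absurd hb (hno _ _)
      · exact Or.inl h
    · rintro (rfl | rfl | rfl) <;> assumption
    · simp [hno, hwu]
    · simp only [hwu, ne_eq, not_true_eq_false, if_false]
      omega
  · have hne : w ≠ u := fun e => by have := huw e; omega
    have wT : ∃ b, X.Tri v w b := (hin w ew).resolve_right hne
    obtain ⟨b, hb⟩ := wT
    have hTw : ∀ a, (∃ b, X.Tri v a b) → a = w := fun a ha =>
      Finset.card_le_one.1 hc.le a ((hmem a).2 ha) w ((hmem w).2 ⟨b, hb⟩)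
    have hbu : b = u := by
      rcases hin b (e1 hb).2.1 with h | h
      · exact absurd (hTw b h) (e1 hb).2.2.symm
      · exact h
    rw [hbu] at hb
    refine ⟨w, fun a => ⟨fun ha => ?_, ?_⟩, fun a b => ⟨fun hab => ?_, ?_⟩, fun e => absurd e hne, ?_,
      fun e => absurd e.symm hne⟩
    · rcases hin a ha with h | h
      · exact Or.inr (Or.inl (hTw a h))
      · exact Or.inl h
    · rintro (rfl | rfl | rfl) <;> assumption
    · have := hTw a ⟨b, hab⟩
      subst this
      exact Or.inl ⟨hne.symm, rfl, uniq' hab hb⟩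
    · rintro (⟨-, rfl, rfl⟩ | ⟨h, -⟩)
      · exact hb
      · exact absurd rfl h
    · simp only [ne_eq, hne.symm, not_false_eq_true, if_true, not_true_eq_false, if_false]
      omega
  · have hne : w ≠ u := fun e => by have := huw e; omega
    obtain ⟨b, hb⟩ : ∃ b, X.Tri v w b := (hin w ew).resolve_right hne
    obtain ⟨z, hz, hzw⟩ : ∃ z ∈ T, z ≠ w := Finset.exists_mem_ne (by omega) w
    obtain ⟨b', hb'⟩ := (hmem z).1 hz
    have hTw : ∀ a, (∃ b, X.Tri v a b) → a = w ∨ a = z := by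
      intro a ha
      by_contra! h
      have : ({a, w, z} : Finset W).card ≤ T.card := Finset.card_le_card (by
        intro c; simp only [Finset.mem_insert, Finset.mem_singleton]
        rintro (rfl | rfl | rfl)
        · exact (hmem _).2 ha
        · exact (hmem _).2 ⟨b, hb⟩
        · exact hz)
      rw [Finset.card_eq_three.2 ⟨a, w, z, h.1, h.2, hzw.symm, rfl⟩] at this
      omega
    have hzu : z ≠ u := fun e => hu' _ (e ▸ hb')
    have hb'u : b' = u := by
      rcases hin b' (e1 hb').2.1 with h | h
      · rcases hTw b' h with h | h
        · exact absurd (h ▸ hb') (hw' _)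
        · exact absurd h (e1 hb').2.2.symm
      · exact h
    have hbz : b = z := by
      rcases hin b (e1 hb).2.1 with h | h
      · rcases hTw b h with h | h
        · exact absurd h (e1 hb).2.2.symm
        · exact h
      · exact absurd (uniq hb' (by rw [hb'u, ← h]; exact hb)) hzw
    rw [hb'u] at hb'
    rw [hbz] at hb
    refine ⟨z, fun a => ⟨fun ha => ?_, ?_⟩, fun a b => ⟨fun hab => ?_, ?_⟩, fun e => absurd e hne, ?_,
      fun e => absurd e.symm hzu⟩
    · rcases hin a ha with h | h
      · exact Or.inr ((hTw a h).symm)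
      · exact Or.inl h
    · rintro (rfl | rfl | rfl)
      · exact eu
      · exact (e1 hb').1
      · exact ew
    · rcases hTw a ⟨b, hab⟩ with rfl | rfl
      · exact Or.inr ⟨hzw.symm, rfl, uniq' hab hb⟩
      · exact Or.inl ⟨hzu.symm, rfl, uniq' hab hb'⟩
    · rintro (⟨-, rfl, rfl⟩ | ⟨-, rfl, rfl⟩) <;> assumption
    · simp only [ne_eq, hzu.symm, hzw.symm, not_false_eq_true, if_true]
      omega

theorem Sheet.isEar_remove [DecidableEq W] (hX : X.IsFlat) {v u z w : W} (hv : v ∈ X.verts)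
    (hE : ∀ a, X.Edge v a ↔ a = u ∨ a = z ∨ a = w)
    (hT : ∀ a b, X.Tri v a b ↔ (u ≠ z ∧ a = z ∧ b = u) ∨ (w ≠ z ∧ a = w ∧ b = z))
    (huw : w = u → u = z) : X.IsEar (X.remove v) v u z w := by
  have ne : ∀ {a}, X.Edge v a → a ≠ v := fun ha => (hX.ne ha).symm
  have eu : X.Edge v u := (hE u).2 (by simp)
  have ez : X.Edge v z := (hE z).2 (by simp)
  have ew : X.Edge v w := (hE w).2 (by simp)
  have mem : ∀ {a}, X.Edge v a → a ∈ (X.remove v).verts := fun ha =>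
    Finset.mem_erase.2 ⟨ne ha, hX.mem' ha⟩
  refine ⟨by simp [remove], fun x => ?_, mem eu, mem ez, mem ew, fun _ _ => rfl, fun x y => ?_,
    fun x y t => ?_, huw, fun a => ?_, fun a => ?_⟩
  · by_cases h : x = v
    · simp [h, hv]
    · simp [h, remove]
  · by_cases hx : x = v
    · subst hx
      have n1 := (ne eu).symm
      have n2 := (ne ez).symm
      have n3 := (ne ew).symm
      simp [remove, hE, n1, n2, n3]
    · by_cases hy : y = v
      · subst hy
        rw [show X.Edge x y ↔ X.Edge y x from ⟨hX.symm, hX.symm⟩, hE]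
        simp [remove, hx]
      · simp [remove, hx, hy]
  · have n1 := ne eu
    have n2 := ne ez
    have n3 := ne ew
    have r1 : X.Tri x y t ↔ X.Tri y t x := ⟨hX.tri_rot, fun h => hX.tri_rot (hX.tri_rot h)⟩
    have r2 : X.Tri x y t ↔ X.Tri t x y := ⟨fun h => hX.tri_rot (hX.tri_rot h), hX.tri_rot⟩
    by_cases hx : x = v
    · subst hx
      simp only [remove, hT]; grind
    by_cases hy : y = v
    · subst hy
      rw [r1, hT]; simp only [remove]; grind
    by_cases ht : t = v
    · subst ht
      rw [r2, hT]; simp only [remove]; grind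
    · simp [remove, hx, hy, ht]
  · have h1 : X.Tri v z u := (hT _ _).2 (Or.inl ⟨a, rfl, rfl⟩)
    have h2 := hX.tri_rot h1
    exact ⟨⟨hX.symm (hX.tri_edge h2), ne eu, ne ez⟩, fun b hb => hb.2.2.2 (hX.tri_unique hb.1 h2)⟩
  · have h1 : X.Tri v w z := (hT _ _).2 (Or.inr ⟨a, rfl, rfl⟩)
    have h2 := hX.tri_rot h1
    exact ⟨⟨hX.symm (hX.tri_edge h2), ne ez, ne ew⟩, fun b hb => hb.2.2.2 (hX.tri_unique hb.1 h2)⟩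
end
end GridBilliards

/-! ### From diagrams to chord diagrams. -/

namespace GridBilliards

open IsChordDiagram (Cls cls_self cls_add cls_eq IsNext cls_sub_iff cls_dich)

section
variable {W : Type*} [DecidableEq W] {X : Sheet W} {N : ℤ} {S : Set ℤ} {θ : ℤ → ℤ} {p : ℤ → W}

open Classical in
/-- Removing a tip of a diagram. -/
theorem IsDiagram.exists_removal (D : IsDiagram X N S θ p) {i j : ℤ} (hi : i ∈ S)
    (hij : IsNext S i j) (hjN : j < i + N)
    (hu : ∀ l ∈ S, p (l + 1) = p (i + 1) → Cls N i l) (ht : ∀ l ∈ S, p l = p (i + 1) → Cls N j l)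
    (hθ : θ i - θ j = 3 - X.deg (p (i + 1))) (hdeg : X.deg (p (i + 1)) ≤ 2) :
    ∃ (z : W) (θ' : ℤ → ℤ) (p' : ℤ → W),
      X.IsEar (X.remove (p (i + 1))) (p (i + 1)) (p i) z (p (j + 1)) ∧
      IsDiagram (X.remove (p (i + 1))) N
        {l | l ∈ S ∧ (Cls N i l → p i ≠ z) ∧ (Cls N j l → p (j + 1) ≠ z)} θ' p' ∧
      IsLabelEar (X.remove (p (i + 1))) N S
        {l | l ∈ S ∧ (Cls N i l → p i ≠ z) ∧ (Cls N j l → p (j + 1) ≠ z)} θ θ' p p' i j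
        (p (i + 1)) (p i) z (p (j + 1)) ∧
      (∀ l, Cls N i l → θ' l = θ l - 1) ∧ (∀ l, Cls N j l → θ' l = θ l + 1) ∧
      (∀ l, ¬ Cls N i l → ¬ Cls N j l → θ' l = θ l) ∧ (p i = z → p (j + 1) = z) := by
  obtain ⟨z, hE, hT, huw, hang, hzz⟩ := D.tip_structure hi hij hu ht hθ hdeg
  have hX := Sheet.isEar_remove D.flat (D.p_mem (i + 1)) hE hT huw
  have hN := D.pos
  have lt := hij.2.1
  have hpv : ∀ l, i < l → l ≤ j → p l = p (i + 1) := fun l h1 h2 =>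
    D.const (a := i + 1) (b := j) (fun l h1 h2 h3 => by have := hij.2.2 l h3 (by omega); omega)
      l (by omega) h2
  have nij : ∀ {x}, Cls N i x → ¬ Cls N j x := fun {x} h1 h2 => by
    have := cls_dich h1 (cls_sub_iff.1 h2); omega
  let G : ℤ → Prop := fun l => ∃ t : ℤ, i < l + t * N ∧ l + t * N ≤ j
  have G_add : ∀ l, G (l + N) ↔ G l := fun l => by
    constructor
    · rintro ⟨t, h1, h2⟩
      exact ⟨t + 1, by linarith, by linarith⟩
    · rintro ⟨t, h1, h2⟩
      exact ⟨t - 1, by linarith, by linarith⟩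
  have G_not : ∀ l, j < l → l ≤ i + N → ¬ G l := by
    rintro l h1 h2 ⟨t, h3, h4⟩
    have h5 : -1 < t := by
      by_contra hcon
      have : t * N ≤ -1 * N := mul_le_mul_of_nonneg_right (by omega) hN.le
      linarith
    have : 0 * N ≤ t * N := mul_le_mul_of_nonneg_right (by omega) hN.le
    linarith
  let p' : ℤ → W := fun l => if G l then z else p l
  let θ' : ℤ → ℤ := fun l => if Cls N i l then θ l - 1 else if Cls N j l then θ l + 1 else θ l
  have ti : ∀ l, Cls N i l → θ' l = θ l - 1 := fun l h => if_pos h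
  have tj : ∀ l, Cls N j l → θ' l = θ l + 1 := fun l h => by
    simp only [θ']; rw [if_neg (fun h' => nij h' h), if_pos h]
  have tk : ∀ l, ¬ Cls N i l → ¬ Cls N j l → θ' l = θ l := fun l h1 h2 => by
    simp only [θ']; rw [if_neg h1, if_neg h2]
  have ci := cls_self N i
  have cj := cls_self N j
  have hP' : IsPeriodic N {l | l ∈ S ∧ (Cls N i l → p i ≠ z) ∧ (Cls N j l → p (j + 1) ≠ z)} θ' p' := by
    refine ⟨hN, fun l => ?_, fun l hl => ?_, fun l => ?_⟩
    · simp only [Set.mem_ofPred_eq, D.mem_add, cls_add]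
    · simp only [θ', cls_add, D.dir_add l hl.1]
      split_ifs <;> ring
    · simp [p', G_add, D.p_add]
  have off : ∀ l, j < l → l < i + N → ¬ Cls N i l ∧ ¬ Cls N j l := fun l h1 h2 => by
    refine ⟨fun h => ?_, fun h => ?_⟩
    · have := cls_dich ci h; omega
    · have := cls_dich cj h; omega
  have hL : IsLabelEar (X.remove (p (i + 1))) N S
        {l | l ∈ S ∧ (Cls N i l → p i ≠ z) ∧ (Cls N j l → p (j + 1) ≠ z)} θ θ' p p' i j
        (p (i + 1)) (p i) z (p (j + 1)) := {
    lt := lt, lt_add := hjN, gap := hpv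
    gap' := fun l h1 h2 => if_pos ⟨0, by linarith, by linarith⟩
    off := fun l h1 h2 => (if_neg (G_not l h1 h2)).symm
    hu := by
      have := G_not (i + N) (by omega) le_rfl
      rw [G_add] at this
      exact if_neg this
    hw := if_neg (G_not _ (by omega) (by omega))
    mem' := fun l => by
      by_cases hG : G l
      · simp only [p', if_pos hG]; exact hX.mem_z
      · simp only [p', if_neg hG]
        refine Finset.mem_erase.2 ⟨fun e => hG ?_, D.p_mem l⟩
        obtain ⟨m, t, rfl, h1, h2⟩ := IsPeriodic.exists_window hN (i + 1) l
        refine ⟨-t, by linarith, ?_⟩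
        rw [(D.add_mul m t).2.1] at e
        by_contra hmj
        have hmj : j < m := by linarith
        -- The walk could rest at the tip on indices that are not panes. The first pane after such
        -- an index would start at the tip, hence be a translate of `j`, but it lies strictly
        -- between two translates.
        have : ∃ y ∈ S, m ≤ y ∧ y ≤ i + N ∧ p y = p m := by
          have hmem : (i + N) ∈ S := (D.mem_add i).2 hi
          have hex : ∃ d : ℕ, m + d ∈ S :=
            ⟨(i + N - m).toNat, by rw [show m + ((i + N - m).toNat : ℤ) = i + N by omega]; exact hmem⟩
          refine ⟨m + Nat.find hex, Nat.find_spec hex, by omega, ?_, ?_⟩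
          · have := Nat.find_min' hex (m := (i + N - m).toNat)
              (by rw [show m + ((i + N - m).toNat : ℤ) = i + N by omega]; exact hmem)
            omega
          · refine D.const (a := m) (b := m + Nat.find hex) (fun l h3 h4 h5 => ?_) _ (by omega) le_rfl
            exact Nat.find_min hex (m := (l - m).toNat) (by omega)
              (by rwa [show m + ((l - m).toNat : ℤ) = l by omega])
        obtain ⟨y, hy, y1, y2, y3⟩ := this
        have := cls_dich cj (ht y hy (y3.trans e))
        omega
    hS := fun l h1 h2 => ⟨fun h => ⟨h, fun h' => absurd h' (off l h1 h2).1,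
      fun h' => absurd h' (off l h1 h2).2⟩, fun h => h.1⟩
    gapS := fun l h1 h2 h3 => by have := hij.2.2 l h3 h1; omega
    gapS' := fun l h1 h2 h3 => by have := hij.2.2 l h3.1 h1; omega
    iS := hi, jS := hij.1
    iS' := ⟨fun h => h.2.1 ci, fun h => ⟨hi, fun _ => h, fun h' => absurd h' (nij ci)⟩⟩
    jS' := ⟨fun h => h.2.2 cj, fun h => ⟨hij.1, fun h' => absurd cj (nij h'), fun _ => h⟩⟩
    dir_i := fun _ => by rw [ti i ci]; ring
    dir_j := fun _ => by rw [tj j cj]; ring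
    dir_off := fun l h1 h2 _ => (tk l (off l h1 h2).1 (off l h1 h2).2).symm
    angle := by convert hang }
  exact ⟨z, θ', p', hX, D.down hX (D.flat.remove _) hL hP', hL, ti, tj, tk, hzz⟩

/-- The light beams of a diagram form a chord diagram. -/
theorem IsDiagram.exists_chordDiagram (D : IsDiagram X N S θ p) :
    ∃ π, IsChordDiagram N S θ π ∧ Strands X S p π := by
  induction hn : X.verts.card using Nat.strong_induction_on generalizing X S θ p with
  | _ n ih =>
  rcases S.eq_empty_or_nonempty with rfl | hne
  · exact ⟨id, ⟨D.pos, by simp, by simp, by simp, by simp, by simp, by simp, by simp, by simp,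
      by simp, by simp⟩, fun l hl => hl.elim⟩
  obtain ⟨i, hi, j, hij, hjN, hu, ht, hθ, hdeg⟩ := D.exists_tip hne
  obtain ⟨z, θ', p', hX, D', L, ti, tj, tk, huzwz⟩ := D.exists_removal hi hij hjN hu ht hθ hdeg
  obtain ⟨π', hc, hs⟩ := ih _ (by
    rw [← hn]; exact Finset.card_lt_card (Finset.erase_ssubset (D.p_mem _))) D' rfl
  have E := D.earDirs hX L D'.toIsPeriodic
  have hang := L.angle
  have ci := cls_self N i
  have cj := cls_self N j
  have nij : ∀ {x}, Cls N i x → ¬ Cls N j x := fun {x} h1 h2 => L.not_cls h1 h2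
  have hij_sub : ∀ {l}, Cls N i l → Cls N j (l + (j - i)) := fun h =>
    (cls_sub_iff (i := i)).2 (by simpa using h)
  -- The shape of the ear decides which inverse move restores the chord diagram: a pendant edge
  -- inserts a pair, one triangle splits a pane, two triangles interchange panes. The parity of `θ
  -- i` decides whether outgoing or incoming chords are affected.
  by_cases huz : p i = z
  · have hwz := huzwz huz
    simp only [huz, hwz, ne_eq, not_true_eq_false, if_false] at hang
    refine ⟨_, hc.insert_pair D.mem_add D.dir_add hi hij hjN (fun l => ?_) (fun l hl => ?_) (by linarith), ?_⟩
    · simp [huz, hwz]; tauto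
    · exact tk l (fun h => hl.2.1 h huz) (fun h => hl.2.2 h hwz)
    · refine hs.erase_pair hc.map_mem hX D'.flat L D.toIsPeriodic D'.toIsPeriodic huz hwz ?_ ?_ ?_
      · intro l _ h; rw [if_pos h]; exact hij_sub h
      · intro l _ h
        rw [if_neg (fun h' => nij h' h), if_pos h]; exact cls_add.2 (cls_sub_iff.1 h)
      · intro l _ h1 h2; rw [if_neg h1, if_neg h2]
  by_cases hwz : p (j + 1) = z
  · simp only [huz, hwz, ne_eq, not_true_eq_false, not_false_eq_true, if_true, if_false] at hang
    have hS : ∀ l, l ∈ {l | l ∈ S ∧ (Cls N i l → p i ≠ z) ∧ (Cls N j l → p (j + 1) ≠ z)} ↔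
        l ∈ S ∧ ¬ Cls N j l := fun l => by simp [huz, hwz]
    have ht' : ∀ l ∈ {l | l ∈ S ∧ (Cls N i l → p i ≠ z) ∧ (Cls N j l → p (j + 1) ≠ z)},
        ¬ Cls N i l → θ' l = θ l := fun l hl h => tk l h ((hS l).1 hl).2
    rcases Int.emod_two_eq_zero_or_one (θ i) with hpar | hpar
    · refine ⟨_, hc.split D.mem_add D.dir_add hi hij hjN hS ht' ti (by linarith) hpar, ?_⟩
      refine hs.merge_even hc.map_mem hX D'.flat L D.toIsPeriodic D'.toIsPeriodic E huz hwz hpar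
        (by omega) ?_ ?_ ?_
      · intro l _ h; rw [if_pos h]; exact hij_sub h
      · intro l _ h
        exact ⟨l - (j - i), cls_sub_iff.1 h, by rw [if_neg (fun h' => nij h' h), if_pos h]⟩
      · intro l _ h1 h2; rw [if_neg h1, if_neg h2]
    · obtain ⟨π, hπ, h1, h2, h3⟩ :=
        hc.split_odd D.mem_add D.dir_add hi hij hjN hS ht' ti (by linarith) hpar
      exact ⟨π, hπ, hs.merge_odd hc.map_mem hX D'.flat L D.toIsPeriodic D'.toIsPeriodic E huz hwz
        hpar (by omega) h1 h2 h3⟩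
  · simp only [huz, hwz, ne_eq, not_false_eq_true, if_true] at hang
    have hS : {l | l ∈ S ∧ (Cls N i l → p i ≠ z) ∧ (Cls N j l → p (j + 1) ≠ z)} = S := by
      ext l; simp [huz, hwz]
    rw [hS] at hc hs L
    rcases Int.emod_two_eq_zero_or_one (θ i) with hpar | hpar
    · refine ⟨_, hc.unswap D.dir_add hi hij hjN (fun l _ => tk l) ti tj (by linarith) hpar, ?_⟩
      refine hs.swap_even hc.map_mem hX D'.flat L D.toIsPeriodic (hS ▸ D'.toIsPeriodic) E huz hwz
        hpar (by omega) ?_ ?_ ?_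
      · intro l _ h; exact ⟨l + (j - i), hij_sub h, by rw [if_pos h]⟩
      · intro l _ h
        exact ⟨l - (j - i), cls_sub_iff.1 h, by rw [if_neg (fun h' => nij h' h), if_pos h]⟩
      · intro l _ h1 h2; rw [if_neg h1, if_neg h2]
    · obtain ⟨π, hπ, h1, h2, h3⟩ :=
        hc.unswap_odd D.dir_add hi hij hjN (fun l _ => tk l) ti tj (by linarith) hpar
      exact ⟨π, hπ, hs.swap_odd hc.map_mem hX D'.flat L D.toIsPeriodic (hS ▸ D'.toIsPeriodic) E
        huz hwz hpar (by omega) h1 h2 h3⟩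

end
end GridBilliards

/-! ### The sheet of a generalized grid polygon. -/

namespace GridBilliards

theorem rotateCW_sub (d : ℤ × ℤ) : rotateCW (rotateCW d - d) = -d := by
  ext <;> simp [rotateCW]

theorem exists_dirVec_of_mem {d : ℤ × ℤ}
    (h : d ∈ ({(1, 0), (0, 1), (-1, 1), (-1, 0), (0, -1), (1, -1)} : Set (ℤ × ℤ))) :
    ∃ k, d = dirVec k := by
  simp only [Set.mem_insert_iff, Set.mem_singleton_iff] at h
  rcases h with rfl | rfl | rfl | rfl | rfl | rfl
  exacts [⟨0, rfl⟩, ⟨1, rfl⟩, ⟨2, rfl⟩, ⟨3, rfl⟩, ⟨4, rfl⟩, ⟨5, rfl⟩]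

theorem grid_edge {a b : ℤ × ℤ} (h : {a, b} ∈ triangularGrid.faces) (hab : a ≠ b) :
    ∃ k, b - a = dirVec k := by
  apply exists_dirVec_of_mem
  obtain ⟨-, x, h | h⟩ := h <;>
  · have ha := h (Finset.mem_insert_self a _)
    have hb := h (Finset.mem_insert_of_mem (Finset.mem_singleton_self b))
    simp only [Finset.mem_insert, Finset.mem_singleton] at ha hb
    rcases ha with rfl | rfl | rfl <;> rcases hb with rfl | rfl | rfl <;> simp_all

theorem grid_triangle {a b c : ℤ × ℤ} (h : {a, b, c} ∈ triangularGrid.faces) (hab : a ≠ b)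
    (hac : a ≠ c) (hbc : b ≠ c) : c - a = rotateCW (b - a) ∨ c - b = rotateCW (a - b) := by
  obtain ⟨-, x, h | h⟩ := h <;>
  · have ha := h (Finset.mem_insert_self a _)
    have hb := h (Finset.mem_insert_of_mem (Finset.mem_insert_self b _))
    have hc := h (Finset.mem_insert_of_mem (Finset.mem_insert_of_mem (Finset.mem_singleton_self c)))
    simp only [Finset.mem_insert, Finset.mem_singleton] at ha hb hc
    rcases ha with rfl | rfl | rfl <;> rcases hb with rfl | rfl | rfl <;>
      rcases hc with rfl | rfl | rfl <;> simp_all [rotateCW]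

theorem dirVec_grid (x : ℤ × ℤ) (k : ℤ) :
    ({x, x + dirVec k, x + dirVec (k - 1)} : Finset (ℤ × ℤ)) ∈ triangularGrid.faces := by
  refine ⟨by simp, ?_⟩
  rcases dirVec_cases k with ⟨a, b⟩ | ⟨a, b⟩ | ⟨a, b⟩ | ⟨a, b⟩ | ⟨a, b⟩ | ⟨a, b⟩
  · refine ⟨x, Or.inr ?_⟩
    rw [b, show dirVec (k - 1) = (1, -1) from dirVec_congr (m := 5) (by omega)]
  · refine ⟨x, Or.inl ?_⟩
    rw [b, show dirVec (k - 1) = (1, 0) from dirVec_congr (m := 0) (by omega)]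
    intro y; simp only [Finset.mem_insert, Finset.mem_singleton]; tauto
  · refine ⟨x + (-1, 1), Or.inr ?_⟩
    rw [b, show dirVec (k - 1) = (0, 1) from dirVec_congr (m := 1) (by omega)]
    intro y; simp only [Finset.mem_insert, Finset.mem_singleton, add_assoc, Prod.mk_add_mk]; norm_num
    rintro (rfl | rfl | rfl) <;> simp [← Prod.zero_eq_mk]
  · refine ⟨x + (-1, 0), Or.inl ?_⟩
    rw [b, show dirVec (k - 1) = (-1, 1) from dirVec_congr (m := 2) (by omega)]
    intro y; simp only [Finset.mem_insert, Finset.mem_singleton, add_assoc, Prod.mk_add_mk]; norm_num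
    rintro (rfl | rfl | rfl) <;> simp [← Prod.zero_eq_mk]
  · refine ⟨x + (-1, 0), Or.inr ?_⟩
    rw [b, show dirVec (k - 1) = (-1, 0) from dirVec_congr (m := 3) (by omega)]
    intro y; simp only [Finset.mem_insert, Finset.mem_singleton, add_assoc, Prod.mk_add_mk]; norm_num
    rintro (rfl | rfl | rfl) <;> simp [← Prod.zero_eq_mk]
  · refine ⟨x + (0, -1), Or.inl ?_⟩
    rw [b, show dirVec (k - 1) = (0, -1) from dirVec_congr (m := 4) (by omega)]
    intro y; simp only [Finset.mem_insert, Finset.mem_singleton, add_assoc, Prod.mk_add_mk]; norm_num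
    rintro (rfl | rfl | rfl) <;> simp [← Prod.zero_eq_mk]

namespace GeneralizedGridPolygon

variable {V : Type*} [DecidableEq V] (P : GeneralizedGridPolygon V)

/-- The sheet of a generalized grid polygon. -/
noncomputable def sheet : Sheet V where
  verts := haveI := P.finite; (Set.toFinite (Set.univ : Set V)).toFinset
  Edge u v := u ≠ v ∧ {u, v} ∈ P.complex.faces
  Tri u v w := u ≠ v ∧ {u, v, w} ∈ P.complex.faces ∧ P.vec u w = rotateCW (P.vec u v)
  pos := P.toGrid

theorem mem_verts (x : V) : x ∈ P.sheet.verts := by simp [sheet]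

theorem face_sub {s t : Finset V} (h : s ∈ P.complex.faces) (hts : t ⊆ s) (ht : t.Nonempty) :
    t ∈ P.complex.faces := face_mono (K := P.complex.toPreAbstractSimplicialComplex) h hts ht

theorem toGrid_inj {s : Finset V} (h : s ∈ P.complex.faces) {a b : V} (ha : a ∈ s) (hb : b ∈ s)
    (hab : P.toGrid a = P.toGrid b) : a = b :=
  Finset.card_image_iff.1 (P.map_simplex s h).2 ha hb hab

theorem sheet_dir {u v : V} (h : P.sheet.Edge u v) : ∃ k, P.vec u v = dirVec k := by
  refine grid_edge ?_ (fun e => h.1 (P.toGrid_inj h.2 (by simp) (by simp) e))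
  simpa [Finset.image_insert] using (P.map_simplex _ h.2).1

theorem tri_or {u v w : V} (h : {u, v, w} ∈ P.complex.faces) (huv : u ≠ v) (huw : u ≠ w)
    (hvw : v ≠ w) : P.sheet.Tri u v w ∨ P.sheet.Tri v u w := by
  have inj : ∀ {a b : V}, a ∈ ({u, v, w} : Finset V) → b ∈ ({u, v, w} : Finset V) → a ≠ b →
      P.toGrid a ≠ P.toGrid b := fun ha hb hab e => hab (P.toGrid_inj h ha hb e)
  have := (P.map_simplex _ h).1
  simp only [Finset.image_insert, Finset.image_singleton] at this
  rcases grid_triangle this (inj (by simp) (by simp) huv) (inj (by simp) (by simp) huw)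
    (inj (by simp) (by simp) hvw) with e | e
  · exact Or.inl ⟨huv, h, e⟩
  · exact Or.inr ⟨huv.symm, by rwa [Finset.insert_comm], e⟩

theorem tri_ne {u v w : V} (h : P.sheet.Tri u v w) : u ≠ v ∧ v ≠ w ∧ u ≠ w := by
  obtain ⟨h1, h2, h3⟩ := h
  obtain ⟨k, hk⟩ := P.sheet_dir ⟨h1, P.face_sub h2 (by intro a; simp; tauto) (by simp)⟩
  refine ⟨h1, fun e => ?_, fun e => ?_⟩
  · subst e
    rw [hk, rotateCW_dirVec, dirVec_inj] at h3
    omega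
  · subst e
    rw [hk, rotateCW_dirVec, vec, sub_self] at h3
    exact dirVec_ne_zero _ h3.symm

theorem tri_mem {u v w : V} (h : P.sheet.Tri u v w) : {u, v, w} ∈ P.triangles := by
  obtain ⟨h1, h2, h3⟩ := P.tri_ne h
  exact ⟨h.2.1, Finset.card_eq_three.2 ⟨u, v, w, h1, h3, h2, rfl⟩⟩

/-- All but `tri_unique` is local. Two triangles on the same side of an edge would have equal
images, while the two triangles at an interior edge have four image vertices. -/
theorem sheet_flat : P.sheet.IsFlat where
  mem _ := P.mem_verts _
  symm h := ⟨h.1.symm, by rw [Finset.pair_comm]; exact h.2⟩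
  dir h := P.sheet_dir h
  tri_edge h := ⟨h.1, P.face_sub h.2.1 (by intro a; simp; tauto) (by simp)⟩
  tri_rot {u v w} h := by
    refine ⟨(P.tri_ne h).2.1, ?_, ?_⟩
    · convert h.2.1 using 1
      ext a; simp; tauto
    · have e := h.2.2
      have e1 : P.vec v w = rotateCW (P.vec u v) - P.vec u v := by rw [← e]; simp [vec]
      rw [e1, rotateCW_sub]; simp [vec]
  tri_pos h := h.2.2
  tri_unique {u v w w'} h h' := by
    by_contra hne
    obtain ⟨h1, h2, h3⟩ := P.tri_ne h
    obtain ⟨h1', h2', h3'⟩ := P.tri_ne h'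
    have t1 := P.tri_mem h
    have t2 := P.tri_mem h'
    have sub : ∀ w : V, ({u, v} : Finset V) ⊆ {u, v, w} := fun w a => by simp; tauto
    have hdiff : ({u, v, w} : Finset V) ≠ {u, v, w'} := fun e => by
      have : w ∈ ({u, v, w'} : Finset V) := by rw [← e]; simp
      simp [h2.symm, h3.symm, hne] at this
    have he : ({u, v} : Finset V) ∈ P.edges :=
      ⟨P.face_sub h.2.1 (sub w) (by simp), Finset.card_pair h1⟩
    obtain ⟨s, t, hst, hset, hcard⟩ := P.interior_edge _ he (fun hb => hdiff
      (hb.2.unique ⟨t1, sub w⟩ ⟨t2, sub w'⟩))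
    have m1 : ({u, v, w} : Finset V) ∈ ({s, t} : Set (Finset V)) := hset ▸ ⟨t1, sub w⟩
    have m2 : ({u, v, w'} : Finset V) ∈ ({s, t} : Set (Finset V)) := hset ▸ ⟨t2, sub w'⟩
    have hw : P.toGrid w = P.toGrid w' := by
      have := h.2.2.trans h'.2.2.symm
      simpa [vec] using this
    have him : ({u, v, w} : Finset V).image P.toGrid = ({u, v, w'} : Finset V).image P.toGrid := by
      simp [Finset.image_insert, hw]
    have c3 : (({u, v, w} : Finset V).image P.toGrid).card = 3 :=
      (P.map_simplex _ t1.1).2.trans t1.2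
    rcases m1 with rfl | rfl <;> rcases m2 with m2 | m2
    · exact hdiff m2.symm
    · rw [← Set.mem_singleton_iff.1 m2, ← him, Finset.union_self, c3] at hcard; omega
    · rw [← m2, ← him, Finset.union_self, c3] at hcard; omega
    · exact hdiff m2.symm

theorem exists_third {u v : V} (h : P.sheet.Edge u v) {t : Finset V} (ht : t ∈ P.triangles)
    (hsub : {u, v} ⊆ t) : ∃ w, t = {u, v, w} ∧ (P.sheet.Tri u v w ∨ P.sheet.Tri v u w) := by
  have hc : (t \ {u, v}).card = 1 := by
    rw [Finset.card_sdiff_of_subset hsub, ht.2, Finset.card_pair h.1]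
  obtain ⟨w, hw⟩ := Finset.card_eq_one.1 hc
  have e : t = {u, v, w} := by
    rw [← Finset.union_sdiff_of_subset hsub, hw]
    ext a; simp
  have hwm : w ∈ t \ {u, v} := by rw [hw]; simp
  simp only [Finset.mem_sdiff, Finset.mem_insert, Finset.mem_singleton, not_or] at hwm
  exact ⟨w, e, P.tri_or (e ▸ ht.1) h.1 (Ne.symm hwm.2.1) (Ne.symm hwm.2.2)⟩

theorem tri_asymm {u v w w' : V} (h : P.sheet.Tri u v w) (h' : P.sheet.Tri v u w')
    (hw : ({u, v, w} : Finset V) = {v, u, w'}) : False := by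
  have e : w = w' := by
    have : w ∈ ({v, u, w'} : Finset V) := by rw [← hw]; simp
    simpa [(P.tri_ne h).2.1.symm, (P.tri_ne h).2.2.symm] using this
  subst e
  obtain ⟨k, hk⟩ := P.sheet_flat.dir (P.sheet_flat.tri_edge h)
  have e1 := P.sheet_flat.tri_pos h
  have e2 := P.sheet_flat.tri_pos h'
  rw [← neg_sub (P.sheet.pos v) (P.sheet.pos u), rotateCW_neg, hk, rotateCW_dirVec] at e2
  rw [hk, rotateCW_dirVec] at e1
  have e3 : dirVec (k - 1) + dirVec (k - 1) = dirVec k := by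
    rw [← hk]; nth_rw 1 [← e1]; rw [← neg_neg (dirVec (k - 1)), ← e2]; abel
  have e4 := dirVec_sub k
  rw [← e3, add_sub_cancel_right, dirVec_inj] at e4
  omega

/-- Homogeneity puts some triangle at the edge. If there is none on the left, all lie on the right,
and there only one fits. -/
theorem bdry_iff (u v : V) : P.sheet.Bdry u v ↔ P.IsBoundaryPane u v := by
  constructor
  · rintro ⟨h1, h2⟩
    obtain ⟨t, ht, hsub⟩ := P.homogeneous.2 _ h1.2
    have key : ∀ t ∈ P.triangles, {u, v} ⊆ t → ∃ w, t = {u, v, w} ∧ P.sheet.Tri u v w := by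
      intro t ht hsub
      obtain ⟨w, hw, h | h⟩ := P.exists_third h1 ht hsub
      · exact ⟨w, hw, h⟩
      · exact absurd h (h2 w)
    obtain ⟨w, rfl, hw⟩ := key t ht hsub
    refine ⟨⟨⟨h1.2, Finset.card_pair h1.1⟩, _, ⟨ht, hsub⟩, ?_⟩, w, ht, hw.2.2⟩
    rintro t' ⟨ht', hsub'⟩
    obtain ⟨w', rfl, hw'⟩ := key t' ht' hsub'
    rw [P.sheet_flat.tri_unique hw hw']
  · rintro ⟨hb, w, ht, hw⟩
    have huv : u ≠ v := fun e => by
      have := hb.1.2; rw [e] at this; simp at this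
    have hT : P.sheet.Tri u v w := ⟨huv, ht.1, hw⟩
    refine ⟨⟨huv, hb.1.1⟩, fun w' h' => ?_⟩
    refine P.tri_asymm hT h' (hb.2.unique ⟨ht, fun a => by simp; tauto⟩
      ⟨P.tri_mem h', fun a => by simp; tauto⟩)

theorem sheet_complex : P.sheet.complex P.sheet_flat = P.complex.toPreAbstractSimplicialComplex := by
  have : (P.sheet.complex P.sheet_flat).faces = P.complex.faces := by
    ext s
    constructor
    · rintro (⟨x, hx, rfl⟩ | ⟨x, y, e, rfl⟩ | ⟨x, y, w, e, rfl⟩)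
      · exact P.complex.singleton_mem x
      · exact e.2
      · exact e.2.1
    · intro hs
      obtain ⟨t, ht, hst⟩ := P.homogeneous.2 s hs
      obtain ⟨u, v, w, h1, h2, h3, rfl⟩ := Finset.card_eq_three.1 ht.2
      have hne : s.Nonempty := (P.complex.isRelLowerSet_faces hs).1
      have ht' : ({u, v, w} : Finset V) ∈ (P.sheet.complex P.sheet_flat).faces := by
        rcases P.tri_or ht.1 h1 h2 h3 with h | h
        · exact Or.inr (Or.inr ⟨u, v, w, h, rfl⟩)
        · exact Or.inr (Or.inr ⟨v, u, w, h, by rw [Finset.insert_comm]⟩)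
      exact face_mono ht' hst hne
  cases h1 : P.sheet.complex P.sheet_flat
  cases h2 : P.complex.toPreAbstractSimplicialComplex
  congr
  have h3 := congrArg PreAbstractSimplicialComplex.faces h1
  have h4 := congrArg PreAbstractSimplicialComplex.faces h2
  rw [this] at h3
  exact h3.symm.trans h4

end GeneralizedGridPolygon
end GridBilliards

/-! ### Cohomology and the Euler characteristic. -/

namespace GridBilliards

section Cocycle

variable {V A : Type*} [AddCommGroup A]

/-- The sum of a function of pairs over the consecutive pairs of a list. -/
def pathSum (g : V → V → A) : List V → A
  | [] => 0
  | [_] => 0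
  | u :: v :: l => g u v + pathSum g (v :: l)

theorem pathSum_append (g : V → V → A) (p q : List V) (u : V) :
    pathSum g (p ++ u :: q) = pathSum g (p ++ [u]) + pathSum g (u :: q) := by
  induction p with
  | nil => simp [pathSum]
  | cons a p ih =>
    cases p with
    | nil => cases q <;> simp [pathSum]
    | cons b p =>
      simp only [List.cons_append, pathSum] at ih ⊢
      rw [ih, add_assoc]

variable [DecidableEq V] {K : PreAbstractSimplicialComplex V}

/-- The first cohomology of a simply connected complex is trivial. -/
theorem IsSimplyConnected.exists_potential (hK : IsSimplyConnected K) (g : V → V → A)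
    (hg : ∀ u v w, ({u, v, w} : Finset V) ∈ K.faces → g u v + g v w = g u w) :
    ∃ ψ : V → A, ∀ u v, ({u, v} : Finset V) ∈ K.faces → g u v = ψ v - ψ u := by
  -- The cocycle condition is invariance under an elementary homotopy, so sums over closed paths
  -- vanish. The potential at `v` is the sum along a chosen path from the base point.
  have inv : ∀ l l', Relation.EqvGen (EdgePathMove K) l l' → pathSum g l = pathSum g l' := by
    intro l l' h
    induction h with
    | rel l l' h =>
      obtain ⟨p, q, u, v, w, h⟩ := h
      rw [pathSum_append, pathSum_append g p (w :: q)]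
      simp only [pathSum]
      rw [← hg u v w h, add_assoc]
    | refl => rfl
    | symm _ _ _ ih => exact ih.symm
    | trans _ _ _ _ _ ih1 ih2 => exact ih1.trans ih2
  obtain ⟨o, ho⟩ := hK.nonempty
  have hoo : g o o = 0 := by
    have := hg o o o (by simpa using ho)
    simpa using this
  have closed : ∀ l, IsEdgePath K (o :: (l ++ [o])) → pathSum g (o :: (l ++ [o])) = 0 := by
    intro l hl
    rw [inv _ _ (hK.null_homotopic o l hl)]
    simp [pathSum, hoo]
  have hto : ∀ v, ∃ l, {v} ∈ K.faces → IsEdgePath K (o :: (l ++ [v])) := fun v => by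
    by_cases hv : {v} ∈ K.faces
    · obtain ⟨l, hl⟩ := hK.connected o v ho hv
      exact ⟨l, fun _ => hl⟩
    · exact ⟨[], fun h => absurd h hv⟩
  choose L hL using hto
  refine ⟨fun v => pathSum g (o :: (L v ++ [v])), fun u v huv => ?_⟩
  have hu : {u} ∈ K.faces := face_mono huv (by simp) (by simp)
  have hv : {v} ∈ K.faces := face_mono huv (by simp) (by simp)
  obtain ⟨l, hl⟩ := hK.connected v o hv ho
  have e1 := closed (L v ++ v :: l) (by
    have := List.isChain_split (l₁ := o :: L v).2 ⟨hL v hv, hl⟩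
    simpa [IsEdgePath] using this)
  have e2 := closed (L u ++ u :: v :: l) (by
    have := List.isChain_split (l₁ := o :: L u).2 ⟨hL u hu, List.isChain_cons_cons.2 ⟨huv, hl⟩⟩
    simpa [IsEdgePath] using this)
  have a1 := pathSum_append g (o :: L v) (l ++ [o]) v
  have a2 := pathSum_append g (o :: L u) (v :: (l ++ [o])) u
  simp only [List.cons_append, List.append_assoc, pathSum] at a1 a2 e1 e2
  rw [e1] at a1
  rw [e2] at a2
  have : pathSum g (o :: (L v ++ [v])) - pathSum g (o :: (L u ++ [u])) =
    (pathSum g (o :: (L v ++ [v])) + pathSum g (v :: (l ++ [o]))) -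
    (pathSum g (o :: (L u ++ [u])) + (g u v + pathSum g (v :: (l ++ [o])))) + g u v := by abel
  rw [this, ← a1, ← a2]; simp

theorem IsSimplyConnected.eq_of_edges (hK : IsSimplyConnected K) {B : Type*} (f : V → B)
    (hf : ∀ u v, ({u, v} : Finset V) ∈ K.faces → f u = f v) {u v : V} (hu : {u} ∈ K.faces)
    (hv : {v} ∈ K.faces) : f u = f v := by
  obtain ⟨l, hl⟩ := hK.connected u v hu hv
  clear hu
  induction l generalizing u with
  | nil => exact hf u v (by simpa [IsEdgePath] using hl)
  | cons a l ih =>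
    have h : {u, a} ∈ K.faces ∧ IsEdgePath K (a :: (l ++ [v])) := by simpa [IsEdgePath] using hl
    exact (hf u a h.1).trans (ih h.2)

open Classical in
/-- The Euler characteristic of a simply connected `2`-dimensional complex without closed
surfaces (modulo `2`). -/
theorem IsSimplyConnected.euler [Fintype V] (hK : IsSimplyConnected K)
    (hv : ∀ v, {v} ∈ K.faces)
    (hC : ∀ C : Set (Finset V), C.Nonempty → C ⊆ triangles K →
      ∃ t ∈ C, ∃ e ∈ edges K, e ⊆ t ∧ ∀ t' ∈ C, e ⊆ t' → t' = t) :
    (Fintype.card V : ℤ) - Fintype.card (edges K) + Fintype.card (triangles K) = 1 := by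
  -- The cochain complex over `ZMod 2`, where no orientations are needed. The formula follows by
  -- counting dimensions once the cohomology is known.
  let δ₀ : (V → (ZMod 2)) →ₗ[(ZMod 2)] (edges K → (ZMod 2)) :=
    { toFun := fun f e => ∑ v ∈ e.1, f v
      map_add' := fun f g => by ext e; simp [Finset.sum_add_distrib]
      map_smul' := fun c f => by ext e; simp [Finset.mul_sum] }
  let δ₁ : (edges K → (ZMod 2)) →ₗ[(ZMod 2)] (triangles K → (ZMod 2)) :=
    { toFun := fun g t => ∑ e, if e.1 ⊆ t.1 then g e else 0
      map_add' := fun f g => by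
        ext e
        simp only [Pi.add_apply, ← Finset.sum_add_distrib]
        refine Finset.sum_congr rfl fun x _ => ?_
        split_ifs <;> simp
      map_smul' := fun c f => by ext e; simp [Finset.mul_sum, mul_ite] }
  have dbl : ∀ a : (ZMod 2), a + a = 0 := fun a => CharTwo.add_self_eq_zero a
  have two : ∀ e ∈ edges K, ∃ u v, u ≠ v ∧ e = {u, v} := fun e he => Finset.card_eq_two.1 he.2
  -- A functional that vanishes on the coboundaries is a `2`-cycle. An edge lying in only one
  -- triangle of its support evaluates it to something nonzero.
  have h1 : LinearMap.range δ₁ = ⊤ := by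
    by_contra hne
    obtain ⟨φ, hφ, hle⟩ := Submodule.exists_le_ker_of_lt_top _ (lt_top_iff_ne_top.2 hne)
    have hex : ∃ t, φ (Pi.single t 1) ≠ 0 := by
      by_contra! hcon
      refine hφ (LinearMap.pi_ext fun t a => ?_)
      rw [← mul_one a, ← smul_eq_mul, Pi.single_smul, map_smul, hcon]; simp
    obtain ⟨t₀, ht₀⟩ := hex
    obtain ⟨t, ⟨htK, ht⟩, e, he, het, huniq⟩ := hC {t | ∃ h : t ∈ triangles K, φ (Pi.single ⟨t, h⟩ 1) ≠ 0}
      ⟨t₀.1, t₀.2, ht₀⟩ (fun t ht => ht.1)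
    have hz : φ (δ₁ (Pi.single ⟨e, he⟩ 1)) = 0 := hle ⟨_, rfl⟩
    have : δ₁ (Pi.single ⟨e, he⟩ 1) = ∑ s : triangles K, (if e ⊆ s.1 then Pi.single s 1 else 0) := by
      ext s
      have : δ₁ (Pi.single ⟨e, he⟩ 1) s = if e ⊆ s.1 then 1 else 0 := by
        change (∑ e', if e'.1 ⊆ s.1 then (Pi.single ⟨e, he⟩ 1 : edges K → (ZMod 2)) e' else 0) = _
        rw [Finset.sum_eq_single ⟨e, he⟩]
        · simp
        · intro b _ hb; simp [hb]
        · simp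
      rw [this, Finset.sum_apply, Finset.sum_eq_single s]
      · split_ifs <;> simp
      · intro b _ hb
        split_ifs <;> simp [hb.symm]
      · simp
    rw [this, map_sum, Finset.sum_eq_single ⟨t, htK⟩] at hz
    · rw [if_pos het] at hz; exact ht hz
    · intro s _ hs
      split_ifs with hes
      · by_contra hne'
        exact hs (Subtype.ext (huniq s.1 ⟨s.2, hne'⟩ hes))
      · simp
    · simp
  have sum3 : ∀ (g : edges K → (ZMod 2)) (a b c : V) (h : ({a, b, c} : Finset V) ∈ triangles K)
      (hab : ({a, b} : Finset V) ∈ edges K) (hbc : ({b, c} : Finset V) ∈ edges K)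
      (hac : ({a, c} : Finset V) ∈ edges K),
      δ₁ g ⟨_, h⟩ = g ⟨_, hab⟩ + g ⟨_, hbc⟩ + g ⟨_, hac⟩ := by
    intro g a b c h hab hbc hac
    have n1 : a ≠ b := fun e => by have := hab.2; rw [e] at this; simp at this
    have n2 : b ≠ c := fun e => by have := hbc.2; rw [e] at this; simp at this
    have n3 : a ≠ c := fun e => by have := hac.2; rw [e] at this; simp at this
    change (∑ e, if e.1 ⊆ ({a, b, c} : Finset V) then g e else 0) = _
    rw [← Finset.sum_filter]
    have : Finset.univ.filter (fun e : edges K => e.1 ⊆ ({a, b, c} : Finset V)) =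
        {⟨_, hab⟩, ⟨_, hbc⟩, ⟨_, hac⟩} := by
      ext ⟨e, he⟩
      obtain ⟨u, v, huv, rfl⟩ := two e he
      simp only [Finset.mem_filter, Finset.mem_univ, true_and, Finset.mem_insert,
        Finset.mem_singleton, Subtype.mk.injEq]
      constructor
      · intro hs
        have hu := hs (Finset.mem_insert_self u _)
        have hv := hs (Finset.mem_insert_of_mem (Finset.mem_singleton_self v))
        simp only [Finset.mem_insert, Finset.mem_singleton] at hu hv
        rcases hu with rfl | rfl | rfl <;> rcases hv with rfl | rfl | rfl <;>
          simp_all [Finset.pair_comm]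
      · rintro (h | h | h) <;> rw [h] <;> intro x <;> simp <;> tauto
    have m1 : ({a, b} : Finset V) ≠ {b, c} := fun e => by
      have : a ∈ ({b, c} : Finset V) := by rw [← e]; simp
      simp [n1, n3] at this
    have m2 : ({a, b} : Finset V) ≠ {a, c} := fun e => by
      have : b ∈ ({a, c} : Finset V) := by rw [← e]; simp
      simp [n1.symm, n2] at this
    have m3 : ({b, c} : Finset V) ≠ {a, c} := fun e => by
      have : a ∈ ({b, c} : Finset V) := by rw [e]; simp
      simp [n1, n3] at this
    rw [this, Finset.sum_insert (by simp [m1, m2]), Finset.sum_insert (by simp [m3]),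
      Finset.sum_singleton, add_assoc]
  have pair : ∀ (f : V → (ZMod 2)) (u v : V) (h : ({u, v} : Finset V) ∈ edges K),
      δ₀ f ⟨_, h⟩ = f u + f v := by
    intro f u v h
    refine Finset.sum_pair fun e => ?_
    have := h.2; rw [e] at this; simp at this
  have tri_edges : ∀ {a b c : V}, ({a, b, c} : Finset V) ∈ K.faces → a ≠ b →
      ({a, b} : Finset V) ∈ edges K := fun h hab =>
    ⟨face_mono h (by intro x; simp; tauto) (by simp), Finset.card_pair hab⟩
  -- Exactness in the middle: a cocycle on edges, extended by zero to equal pairs, has a potential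
  -- by simple connectivity.
  have h2 : LinearMap.ker δ₁ = LinearMap.range δ₀ := by
    ext g
    constructor
    · intro hg
      let G : V → V → (ZMod 2) := fun u v => if h : ({u, v} : Finset V) ∈ edges K then g ⟨_, h⟩ else 0
      have hG : ∀ u v (h : ({u, v} : Finset V) ∈ edges K), G u v = g ⟨_, h⟩ := fun u v h =>
        dif_pos h
      have hGG : ∀ u, G u u = 0 := fun u => dif_neg (fun h => by have := h.2; simp at this)
      have hGs : ∀ u v, G u v = G v u := fun u v => by simp only [G, Finset.pair_comm u v]
      obtain ⟨ψ, hψ⟩ := hK.exists_potential G (by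
        intro u v w h
        by_cases n1 : u = v
        · subst n1; simp [hGG]
        by_cases n2 : v = w
        · subst n2; simp [hGG]
        by_cases n3 : u = w
        · subst n3; rw [hGs v u, hGG]; exact dbl _
        have ht : ({u, v, w} : Finset V) ∈ triangles K :=
          ⟨h, Finset.card_eq_three.2 ⟨u, v, w, n1, n3, n2, rfl⟩⟩
        have b1 := tri_edges h n1
        have b2 : ({v, w} : Finset V) ∈ edges K := tri_edges (c := u) (by
          convert h using 1; ext a; simp; tauto) n2
        have b3 : ({u, w} : Finset V) ∈ edges K := tri_edges (c := v) (by
          convert h using 1; ext a; simp; tauto) n3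
        have := sum3 g u v w ht b1 b2 b3
        rw [LinearMap.mem_ker.1 hg] at this
        rw [hG _ _ b1, hG _ _ b2, hG _ _ b3]
        have := this.symm
        rw [Pi.zero_apply] at this
        rw [← add_zero (g _ + _), ← dbl (g ⟨{u, w}, b3⟩), ← add_assoc, this, zero_add])
      refine ⟨ψ, ?_⟩
      ext ⟨e, he⟩
      obtain ⟨u, v, huv, rfl⟩ := two e he
      rw [pair, ← hG, hψ u v he.1, CharTwo.sub_eq_add, add_comm]
    · rintro ⟨f, rfl⟩
      rw [LinearMap.mem_ker]
      ext ⟨t, ht⟩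
      obtain ⟨a, b, c, n1, n3, n2, rfl⟩ := Finset.card_eq_three.1 ht.2
      have h := ht.1
      have b1 := tri_edges h n1
      have b2 : ({b, c} : Finset V) ∈ edges K := tri_edges (c := a) (by
          convert h using 1; ext a; simp; tauto) n2
      have b3 : ({a, c} : Finset V) ∈ edges K := tri_edges (c := b) (by
          convert h using 1; ext a; simp; tauto) n3
      rw [sum3 _ a b c ht b1 b2 b3, pair, pair, pair]
      have := dbl (f a + f b + f c)
      rw [Pi.zero_apply, ← this]; ring
  obtain ⟨o, ho⟩ := hK.nonempty
  have h3 : Module.finrank (ZMod 2) (LinearMap.ker δ₀) = 1 := by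
    have : LinearMap.ker δ₀ = Submodule.span (ZMod 2) {fun _ => (1 : (ZMod 2))} := by
      ext f
      rw [Submodule.mem_span_singleton, LinearMap.mem_ker]
      constructor
      · intro hf
        refine ⟨f o, ?_⟩
        ext v
        have := hK.eq_of_edges f (u := o) (v := v) (fun u v huv => by
          by_cases h : u = v
          · rw [h]
          have := pair f u v ⟨huv, Finset.card_pair h⟩
          rw [hf, Pi.zero_apply] at this
          rw [← sub_eq_zero, CharTwo.sub_eq_add, ← this]) ho (hv v)
        simp [this]
      · rintro ⟨c, rfl⟩
        ext ⟨e, he⟩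
        obtain ⟨u, v, huv, rfl⟩ := two e he
        rw [pair]
        simpa using dbl c
    rw [this]
    exact finrank_span_singleton (fun h => by simpa using congrFun h o)
  have r0 := δ₀.finrank_range_add_finrank_ker
  have r1 := δ₁.finrank_range_add_finrank_ker
  rw [h1, h2, finrank_top, Module.finrank_fintype_fun_eq_card, Module.finrank_fintype_fun_eq_card] at r1
  rw [h3, Module.finrank_fintype_fun_eq_card] at r0
  omega

end Cocycle
end GridBilliards

/-! ### Curvature of flat sheets. -/

namespace GridBilliards

namespace Sheet

variable {W : Type*} {X : Sheet W}

theorem IsFlat.tri_ne (h : X.IsFlat) {u v w : W} (t : X.Tri u v w) : u ≠ v ∧ v ≠ w ∧ u ≠ w :=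
  ⟨h.ne (h.tri_edge t), h.ne (h.tri_edge (h.tri_rot t)),
    (h.ne (h.tri_edge (h.tri_rot (h.tri_rot t)))).symm⟩

theorem IsFlat.tri_dir (h : X.IsFlat) {u v w : W} (t : X.Tri u v w) :
    ∃ k, X.pos v - X.pos u = dirVec k ∧ X.pos w - X.pos u = dirVec (k - 1) := by
  obtain ⟨k, hk⟩ := h.dir (h.tri_edge t)
  exact ⟨k, hk, by rw [h.tri_pos t, hk, rotateCW_dirVec]⟩

theorem IsFlat.tri_opposite (h : X.IsFlat) {u v w w' : W} (t : X.Tri u v w) (t' : X.Tri v u w') :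
    X.pos w' + X.pos w = X.pos u + X.pos v := by
  obtain ⟨k, hk, hk'⟩ := h.tri_dir t
  have e := h.tri_pos t'
  rw [← neg_sub (X.pos v) (X.pos u), rotateCW_neg, hk, rotateCW_dirVec, ← hk'] at e
  rw [sub_eq_iff_eq_add] at e
  rw [e]; abel

theorem IsFlat.tri_asymm (h : X.IsFlat) {u v w w' : W} (t : X.Tri u v w) (t' : X.Tri v u w') :
    w ≠ w' := by
  rintro rfl
  obtain ⟨k, hk, hk'⟩ := h.tri_dir t
  have e := h.tri_opposite t t'
  have e4 := dirVec_sub k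
  have e3 : dirVec (k - 1) = dirVec k - dirVec (k - 1) := by
    rw [← hk, ← hk', ← sub_eq_zero]
    linear_combination (exp := 1) e
  rw [← e3, dirVec_inj] at e4
  omega

variable [DecidableEq W]

theorem IsFlat.tri_of_subset (h : X.IsFlat) {a b c u v : W} (t : X.Tri a b c) (huv : u ≠ v)
    (hs : ({u, v} : Finset W) ⊆ {a, b, c}) :
    ∃ d, ({a, b, c} : Finset W) = {u, v, d} ∧ (X.Tri u v d ∨ X.Tri v u d) := by
  have hu := hs (Finset.mem_insert_self u _)
  have hv := hs (Finset.mem_insert_of_mem (Finset.mem_singleton_self v))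
  have t1 := h.tri_rot t
  have t2 := h.tri_rot t1
  simp only [Finset.mem_insert, Finset.mem_singleton] at hu hv
  rcases hu with rfl | rfl | rfl <;> rcases hv with rfl | rfl | rfl
  · exact absurd rfl huv
  · exact ⟨c, rfl, Or.inl t⟩
  · exact ⟨b, by ext; simp; tauto, Or.inr t2⟩
  · exact ⟨c, by ext; simp; tauto, Or.inr t⟩
  · exact absurd rfl huv
  · exact ⟨a, by ext; simp; tauto, Or.inl t1⟩
  · exact ⟨b, by ext; simp; tauto, Or.inl t2⟩
  · exact ⟨a, by ext; simp; tauto, Or.inr t1⟩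
  · exact absurd rfl huv

theorem mem_triangles (h : X.IsFlat) {t : Finset W} :
    t ∈ triangles (X.complex h) ↔ ∃ u v w, X.Tri u v w ∧ t = {u, v, w} := by
  constructor
  · rintro ⟨⟨x, -, rfl⟩ | ⟨x, y, e, rfl⟩ | ⟨x, y, w, e, rfl⟩, hc⟩
    · simp at hc
    · rw [Finset.card_pair (h.ne e)] at hc; omega
    · exact ⟨x, y, w, e, rfl⟩
  · rintro ⟨u, v, w, e, rfl⟩
    obtain ⟨h1, h2, h3⟩ := h.tri_ne e
    exact ⟨Or.inr (Or.inr ⟨u, v, w, e, rfl⟩), Finset.card_eq_three.2 ⟨u, v, w, h1, h3, h2, rfl⟩⟩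

theorem mem_edges (h : X.IsFlat) {t : Finset W} :
    t ∈ edges (X.complex h) ↔ ∃ u v, X.Edge u v ∧ t = {u, v} := by
  constructor
  · rintro ⟨⟨x, -, rfl⟩ | ⟨x, y, e, rfl⟩ | ⟨x, y, w, e, rfl⟩, hc⟩
    · simp at hc
    · exact ⟨x, y, e, rfl⟩
    · obtain ⟨h1, h2, h3⟩ := h.tri_ne e
      rw [Finset.card_eq_three.2 ⟨x, y, w, h1, h3, h2, rfl⟩] at hc; omega
  · rintro ⟨u, v, e, rfl⟩
    exact ⟨Or.inr (Or.inl ⟨u, v, e, rfl⟩), Finset.card_pair (h.ne e)⟩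

/-- A nonempty set of triangles of a flat sheet has a boundary edge. -/
theorem IsFlat.exists_free_edge (h : X.IsFlat) {C : Set (Finset W)} (hfin : C.Finite)
    (hne : C.Nonempty) (hC : ∀ t ∈ C, ∃ u v w, X.Tri u v w ∧ t = {u, v, w}) :
    ∃ u v w, X.Tri u v w ∧ {u, v, w} ∈ C ∧
      ∀ t ∈ C, ({u, v} : Finset W) ⊆ t → t = {u, v, w} := by
  -- Take a triangle lying as far as possible in one direction, and its side opposite the vertex
  -- that lies least far. A triangle beyond that side would lie farther still.
  obtain ⟨t, htC, hmax⟩ := Set.exists_max_image C (fun t => ∑ x ∈ t, (X.pos x).1) hfin hne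
  have hsum : ∀ {u v w}, X.Tri u v w →
      ∑ x ∈ ({u, v, w} : Finset W), (X.pos x).1 = (X.pos u).1 + (X.pos v).1 + (X.pos w).1 := by
    intro u v w e
    obtain ⟨h1, h2, h3⟩ := h.tri_ne e
    rw [Finset.sum_insert (by simp [h1, h3]), Finset.sum_pair h2, add_assoc]
  have main : ∀ {u v w}, X.Tri u v w → t = {u, v, w} → (X.pos w).1 ≤ (X.pos u).1 →
      (X.pos w).1 ≤ (X.pos v).1 → ∃ u v w, X.Tri u v w ∧ {u, v, w} ∈ C ∧
      ∀ t ∈ C, ({u, v} : Finset W) ⊆ t → t = {u, v, w} := by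
    intro u v w e ht hu hv
    refine ⟨u, v, w, e, ht ▸ htC, fun t' ht' hs => ?_⟩
    obtain ⟨a, b, c, e', rfl⟩ := hC t' ht'
    obtain ⟨d, hd, e'' | e''⟩ := h.tri_of_subset e' (h.ne (h.tri_edge e)) hs
    · rw [hd, h.tri_unique e e'']
    · exfalso
      have h1 := hmax _ ht'
      rw [hd, ht, hsum e, Finset.insert_comm, hsum e''] at h1
      have h2 := congrArg Prod.fst (h.tri_opposite e e'')
      simp only [Prod.fst_add] at h2
      obtain ⟨k, hk, hk'⟩ := h.tri_dir e
      have h3 := congrArg Prod.fst hk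
      have h4 := congrArg Prod.fst hk'
      simp only [Prod.fst_sub] at h3 h4
      rcases dirVec_cases k with ⟨p, q⟩ | ⟨p, q⟩ | ⟨p, q⟩ | ⟨p, q⟩ | ⟨p, q⟩ | ⟨p, q⟩ <;>
      rcases dirVec_cases (k - 1) with ⟨r, s⟩ | ⟨r, s⟩ | ⟨r, s⟩ | ⟨r, s⟩ | ⟨r, s⟩ | ⟨r, s⟩ <;>
      rw [q] at h3 <;> rw [s] at h4 <;> simp only at h3 h4 <;> omega
  obtain ⟨u, v, w, e, ht⟩ := hC t htC
  have r1 : ({u, v, w} : Finset W) = {v, w, u} := by ext; simp; tauto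
  have r2 : ({u, v, w} : Finset W) = {w, u, v} := by ext; simp; tauto
  by_cases c1 : (X.pos w).1 ≤ (X.pos u).1 ∧ (X.pos w).1 ≤ (X.pos v).1
  · exact main e ht c1.1 c1.2
  by_cases c2 : (X.pos u).1 ≤ (X.pos v).1 ∧ (X.pos u).1 ≤ (X.pos w).1
  · exact main (h.tri_rot e) (ht.trans r1) c2.1 c2.2
  · exact main (h.tri_rot (h.tri_rot e)) (ht.trans r2) (by omega) (by omega)

open Classical in
/-- The number of triangles at a vertex. -/
theorem IsFlat.exists_deg (h : X.IsFlat) (v : W) :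
    ∃ m : ℕ, X.deg v = m ∧ {t | t ∈ triangles (X.complex h) ∧ v ∈ t}.encard = m := by
  let A := X.verts.filter fun a => ∃ b, X.Tri v a b
  refine ⟨A.card, by simp [A, Sheet.deg], ?_⟩
  have hb : ∀ a, ∃ b, a ∈ A → X.Tri v a b := fun a => by
    by_cases ha : a ∈ A
    · obtain ⟨b, hb⟩ := (Finset.mem_filter.1 ha).2
      exact ⟨b, fun _ => hb⟩
    · exact ⟨a, fun h => absurd h ha⟩
  choose b hb using hb
  have himg : {t | t ∈ triangles (X.complex h) ∧ v ∈ t} = (fun a => ({v, a, b a} : Finset W)) '' A := by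
    ext t
    rw [Set.mem_ofPred_eq, mem_triangles h]
    constructor
    · rintro ⟨⟨x, y, z, e, rfl⟩, hv⟩
      have key : ∃ y' z', X.Tri v y' z' ∧ ({x, y, z} : Finset W) = {v, y', z'} := by
        simp only [Finset.mem_insert, Finset.mem_singleton] at hv
        rcases hv with rfl | rfl | rfl
        · exact ⟨y, z, e, rfl⟩
        · exact ⟨z, x, h.tri_rot e, by ext; simp; tauto⟩
        · exact ⟨x, y, h.tri_rot (h.tri_rot e), by ext; simp; tauto⟩
      obtain ⟨y', z', e', heq⟩ := key
      have hA : y' ∈ A := Finset.mem_filter.2 ⟨h.mem' (h.tri_edge e'), z', e'⟩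
      refine ⟨y', hA, ?_⟩
      rw [heq, ← h.tri_unique (hb y' hA) e']
    · rintro ⟨a, ha, rfl⟩
      exact ⟨⟨v, a, b a, hb a ha, rfl⟩, by simp⟩
  rw [himg, Set.InjOn.encard_image, Set.encard_coe_eq_coe_finsetCard]
  intro a ha a' ha' heq
  by_contra hne
  have e1 := hb a ha
  have e2 := hb a' ha'
  obtain ⟨n1, n2, n3⟩ := h.tri_ne e1
  obtain ⟨m1, m2, m3⟩ := h.tri_ne e2
  have heq' : ({v, a, b a} : Finset W) = {v, a', b a'} := heq
  have q1 : a = b a' := by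
    have : a ∈ ({v, a', b a'} : Finset W) := by rw [← heq']; simp
    simpa [n1.symm, hne] using this
  have q2 : a' = b a := by
    have : a' ∈ ({v, a, b a} : Finset W) := by rw [heq']; simp
    simpa [m1.symm, Ne.symm hne] using this
  have e3 := h.tri_rot (h.tri_rot e2)
  rw [← q1] at e3
  exact h.tri_asymm e1 e3 q2.symm

open Classical in
/-- The total curvature of a simply connected flat sheet. -/
theorem IsFlat.sum_deg [Fintype W] (h : X.IsFlat) (hK : IsSimplyConnected (X.complex h))
    (hv : ∀ v, v ∈ X.verts) : ∑ v, (6 - X.deg v) =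
      3 * ((Finset.univ.filter fun p : W × W => X.Bdry p.1 p.2).card : ℤ) + 6 := by
  have hχ := hK.euler (fun v => Or.inl ⟨v, hv v, rfl⟩) (by
    intro C hne hC
    obtain ⟨u, v, w, e, ht, hu⟩ := h.exists_free_edge (C.toFinite) hne
      (fun t ht => (mem_triangles h).1 (hC ht))
    exact ⟨_, ht, {u, v}, (mem_edges h).2 ⟨u, v, h.tri_edge e, rfl⟩, fun a => by simp; tauto,
      hu⟩)
  -- Count ordered edges: `2E = 3F + B`, since each has a triangle on its right or is a reversed
  -- boundary edge. The degrees sum to `3F`, and `V - E + F = 1` gives the formula.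
  have hE : (Finset.univ.filter fun p : W × W => X.Edge p.1 p.2).card =
      Fintype.card (edges (X.complex h)) * 2 := by
    rw [← Set.toFinset_card, Finset.card_eq_sum_card_fiberwise (f := fun p : W × W => ({p.1, p.2} : Finset W))
      (t := (edges (X.complex h)).toFinset)]
    · refine Finset.sum_const_nat fun e he => ?_
      rw [Set.mem_toFinset, mem_edges h] at he
      obtain ⟨u, v, e, rfl⟩ := he
      have : ((Finset.univ.filter fun p : W × W => X.Edge p.1 p.2).filter
          fun p => ({p.1, p.2} : Finset W) = {u, v}) = {(u, v), (v, u)} := by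
        ext ⟨x, y⟩
        simp only [Finset.mem_filter, Finset.mem_univ, true_and, Finset.mem_insert,
          Finset.mem_singleton, Prod.mk.injEq]
        constructor
        · rintro ⟨e', heq⟩
          have h1 : x ∈ ({u, v} : Finset W) := by rw [← heq]; simp
          have h2 : y ∈ ({u, v} : Finset W) := by rw [← heq]; simp
          have h3 := h.ne e'
          simp only [Finset.mem_insert, Finset.mem_singleton] at h1 h2
          grind
        · rintro (⟨rfl, rfl⟩ | ⟨rfl, rfl⟩)
          · exact ⟨e, rfl⟩
          · exact ⟨h.symm e, Finset.pair_comm _ _⟩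
      rw [this, Finset.card_pair]
      simp [h.ne e]
    · intro p hp
      simp only [Finset.coe_filter, Finset.mem_univ, true_and, Set.mem_ofPred_eq] at hp
      simpa [mem_edges h] using ⟨p.1, p.2, hp, rfl⟩
  have hT : (Finset.univ.filter fun p : W × W => ∃ b, X.Tri p.1 p.2 b).card =
      Fintype.card (triangles (X.complex h)) * 3 := by
    have hb : ∀ p : W × W, ∃ b, (∃ b, X.Tri p.1 p.2 b) → X.Tri p.1 p.2 b := fun p => by
      by_cases ha : ∃ b, X.Tri p.1 p.2 b
      · obtain ⟨b, hb⟩ := ha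
        exact ⟨b, fun _ => hb⟩
      · exact ⟨p.1, fun h => absurd h ha⟩
    choose b hb using hb
    rw [← Set.toFinset_card, Finset.card_eq_sum_card_fiberwise
      (f := fun p : W × W => ({p.1, p.2, b p} : Finset W)) (t := (triangles (X.complex h)).toFinset)]
    · refine Finset.sum_const_nat fun e he => ?_
      rw [Set.mem_toFinset, mem_triangles h] at he
      obtain ⟨u, v, w, e, rfl⟩ := he
      have b1 : b (u, v) = w := h.tri_unique (hb (u, v) ⟨w, e⟩) e
      have b2 : b (v, w) = u := h.tri_unique (hb (v, w) ⟨u, h.tri_rot e⟩) (h.tri_rot e)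
      have b3 : b (w, u) = v := h.tri_unique (hb (w, u) ⟨v, h.tri_rot (h.tri_rot e)⟩)
        (h.tri_rot (h.tri_rot e))
      obtain ⟨n1, n2, n3⟩ := h.tri_ne e
      have : ((Finset.univ.filter fun p : W × W => ∃ b, X.Tri p.1 p.2 b).filter
          fun p => ({p.1, p.2, b p} : Finset W) = {u, v, w}) = {(u, v), (v, w), (w, u)} := by
        ext ⟨x, y⟩
        simp only [Finset.mem_filter, Finset.mem_univ, true_and, Finset.mem_insert,
          Finset.mem_singleton, Prod.mk.injEq]
        constructor
        · rintro ⟨e', heq⟩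
          have h1 : x ∈ ({u, v, w} : Finset W) := by rw [← heq]; simp
          have h2 : y ∈ ({u, v, w} : Finset W) := by rw [← heq]; simp
          have h4 : b (x, y) ∈ ({u, v, w} : Finset W) := by rw [← heq]; simp
          have e'' := hb (x, y) e'
          obtain ⟨m1, m2, m3⟩ := h.tri_ne e''
          simp only [Finset.mem_insert, Finset.mem_singleton] at h1 h2 h4
          have a1 := fun {c} => h.tri_asymm (w' := c) e
          have a2 := fun {c} => h.tri_asymm (w' := c) (h.tri_rot e)
          have a3 := fun {c} => h.tri_asymm (w' := c) (h.tri_rot (h.tri_rot e))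
          simp only at m1 m2 m3 e''
          rcases h1 with rfl | rfl | rfl <;> rcases h2 with rfl | rfl | rfl
          · exact absurd rfl m1
          · simp
          · refine absurd ?_ (a3 e''); symm; tauto
          · refine absurd ?_ (a1 e''); symm; tauto
          · exact absurd rfl m1
          · simp
          · simp
          · refine absurd ?_ (a2 e''); symm; tauto
          · exact absurd rfl m1
        · rintro (⟨rfl, rfl⟩ | ⟨rfl, rfl⟩ | ⟨rfl, rfl⟩)
          · exact ⟨⟨w, e⟩, by rw [b1]⟩
          · exact ⟨⟨_, h.tri_rot e⟩, by rw [b2]; ext; simp; tauto⟩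
          · exact ⟨⟨_, h.tri_rot (h.tri_rot e)⟩, by rw [b3]; ext; simp; tauto⟩
      rw [this, Finset.card_eq_three]
      exact ⟨_, _, _, by simp [n1], by simp [n3], by simp [n2], rfl⟩
    · intro p hp
      simp only [Finset.coe_filter, Finset.mem_univ, true_and, Set.mem_ofPred_eq] at hp
      simpa [mem_triangles h] using ⟨p.1, p.2, b p, hb p hp, rfl⟩
  have hS : (Finset.univ.filter fun p : W × W => X.Edge p.1 p.2).card =
      (Finset.univ.filter fun p : W × W => ∃ b, X.Tri p.1 p.2 b).card +
      (Finset.univ.filter fun p : W × W => X.Bdry p.1 p.2).card := by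
    rw [← Finset.card_filter_add_card_filter_not (fun p : W × W => ∃ b, X.Tri p.1 p.2 b),
      Finset.filter_filter, Finset.filter_filter]
    congr 1
    · congr 1
      ext p
      simp only [Finset.mem_filter, Finset.mem_univ, true_and, and_iff_right_iff_imp]
      rintro ⟨b, hb⟩
      exact h.tri_edge hb
    · refine Finset.card_bij (fun p _ => (p.2, p.1)) ?_ ?_ ?_
      · intro p hp
        simp only [Finset.mem_filter, Finset.mem_univ, true_and, not_exists] at hp ⊢
        exact ⟨h.symm hp.1, hp.2⟩
      · intro p _ q _ hpq
        simp only [Prod.mk.injEq] at hpq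
        exact Prod.ext hpq.2 hpq.1
      · intro p hp
        simp only [Finset.mem_filter, Finset.mem_univ, true_and] at hp
        exact ⟨(p.2, p.1), by simpa using ⟨h.symm hp.1, hp.2⟩, rfl⟩
  have hd : ∑ v, X.deg v = (Finset.univ.filter fun p : W × W => ∃ b, X.Tri p.1 p.2 b).card := by
    have huniv : X.verts = Finset.univ := by ext v; simp [hv]
    rw [Finset.card_filter, Fintype.sum_prod_type]
    push_cast
    simp only [Sheet.deg, huniv]
    exact Finset.sum_congr rfl fun _ _ => Finset.sum_congr rfl fun _ _ => by congr
  rw [Finset.sum_sub_distrib, hd, hT]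
  rw [hE, hT] at hS
  simp only [Finset.sum_const, Finset.card_univ, nsmul_eq_mul]
  push_cast
  omega

open Classical in
/-- The direction of the boundary at a vertex determines the number of triangles modulo `6`. -/
theorem IsFlat.deg_mod (h : X.IsFlat) (v : W) (δ : W → ℤ)
    (hδ : ∀ y, X.Edge v y → X.pos y - X.pos v = dirVec (δ y)) :
    ((X.deg v : ℤ) : ZMod 6) = ∑ y ∈ X.verts.filter (X.Bdry v), (δ y : ZMod 6) -
      ∑ y ∈ X.verts.filter (fun y => X.Bdry y v), (δ y : ZMod 6) := by
  let E := X.verts.filter (X.Edge v)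
  let A := X.verts.filter fun a => ∃ b, X.Tri v a b
  let B := X.verts.filter fun b => ∃ a, X.Tri v a b
  have hA : ∑ y ∈ E, (δ y : ZMod 6) = ∑ y ∈ A, (δ y : ZMod 6) +
      ∑ y ∈ X.verts.filter (fun y => X.Bdry y v), (δ y : ZMod 6) := by
    rw [← Finset.sum_filter_add_sum_filter_not E (fun a => ∃ b, X.Tri v a b)]
    congr 1 <;> refine Finset.sum_congr ?_ fun _ _ => rfl
    · ext a
      simp only [E, A, Finset.mem_filter]
      exact ⟨fun ⟨⟨h1, h2⟩, h3⟩ => ⟨h1, h3⟩, fun ⟨h1, b, h3⟩ => ⟨⟨h1, h.tri_edge h3⟩, b, h3⟩⟩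
    · ext a
      simp only [E, Finset.mem_filter, not_exists]
      exact ⟨fun ⟨⟨h1, h2⟩, h3⟩ => ⟨h1, h.symm h2, h3⟩,
        fun ⟨h1, h2, h3⟩ => ⟨⟨h1, h.symm h2⟩, h3⟩⟩
  have hB : ∑ y ∈ E, (δ y : ZMod 6) = ∑ y ∈ B, (δ y : ZMod 6) +
      ∑ y ∈ X.verts.filter (X.Bdry v), (δ y : ZMod 6) := by
    rw [← Finset.sum_filter_add_sum_filter_not E (fun b => ∃ a, X.Tri v a b)]
    congr 1 <;> refine Finset.sum_congr ?_ fun _ _ => rfl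
    · ext b
      simp only [E, B, Finset.mem_filter]
      refine ⟨fun ⟨⟨h1, h2⟩, h3⟩ => ⟨h1, h3⟩, fun ⟨h1, a, h3⟩ => ⟨⟨h1, ?_⟩, a, h3⟩⟩
      exact h.symm (h.tri_edge (h.tri_rot (h.tri_rot h3)))
    · ext b
      simp only [E, Finset.mem_filter, not_exists]
      refine ⟨fun ⟨⟨h1, h2⟩, h3⟩ => ⟨h1, h2, fun w hw => h3 w (h.tri_rot hw)⟩,
        fun ⟨h1, h2, h3⟩ => ⟨⟨h1, h2⟩, fun a ha => h3 a (h.tri_rot (h.tri_rot ha))⟩⟩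
  -- Across each triangle at `v` the direction drops by one, so the number of triangles is a
  -- difference of two sums over edges. These sums differ from the sum over all edges at `v` only by
  -- the boundary edges.
  have hAB : (X.deg v : ZMod 6) = ∑ y ∈ A, (δ y : ZMod 6) - ∑ y ∈ B, (δ y : ZMod 6) := by
    have hb : ∀ a, ∃ b, a ∈ A → X.Tri v a b := fun a => by
      by_cases ha : a ∈ A
      · obtain ⟨b, hb⟩ := (Finset.mem_filter.1 ha).2
        exact ⟨b, fun _ => hb⟩
      · exact ⟨a, fun h => absurd h ha⟩
    choose b hb using hb
    have e1 : ∑ y ∈ B, (δ y : ZMod 6) = ∑ a ∈ A, (δ (b a) : ZMod 6) := by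
      symm
      refine Finset.sum_bij (fun a _ => b a) ?_ ?_ ?_ (fun _ _ => rfl)
      · intro a ha
        have := hb a ha
        exact Finset.mem_filter.2 ⟨h.mem (h.tri_edge (h.tri_rot (h.tri_rot this))), a, this⟩
      · intro a ha a' ha' heq
        have e1 := h.tri_rot (h.tri_rot (hb a ha))
        have e2 := h.tri_rot (h.tri_rot (hb a' ha'))
        rw [← heq] at e2
        exact h.tri_unique e1 e2
      · intro c hc
        obtain ⟨-, a, ha⟩ := Finset.mem_filter.1 hc
        have hA : a ∈ A := Finset.mem_filter.2 ⟨h.mem' (h.tri_edge ha), c, ha⟩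
        exact ⟨a, hA, h.tri_unique (hb a hA) ha⟩
    have e2 : (X.deg v : ZMod 6) = ∑ a ∈ A, (1 : ZMod 6) := by
      simp [A, Sheet.deg]
    rw [e1, e2, ← Finset.sum_sub_distrib]
    refine Finset.sum_congr rfl fun a ha => ?_
    have t := hb a ha
    have h1 := hδ a (h.tri_edge t)
    have h2 := hδ (b a) (h.symm (h.tri_edge (h.tri_rot (h.tri_rot t))))
    rw [h.tri_pos t, h1, rotateCW_dirVec, dirVec_inj] at h2
    have h3 : (((δ a - 1 : ℤ)) : ZMod 6) = (δ (b a) : ZMod 6) :=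
      (ZMod.intCast_eq_intCast_iff' _ _ 6).2 (by exact_mod_cast h2)
    rw [← h3]; push_cast; ring
  rw [hAB]
  linear_combination hB - hA

end Sheet
end GridBilliards

/-! ### Lifting a boundary loop to a periodic diagram. -/

namespace GridBilliards

open IsChordDiagram (Cls cls_self cls_add cls_eq)

/-- The residue of an integer modulo `n`. -/
def cyc (n : ℕ) [NeZero n] (l : ℤ) : Fin n :=
  ⟨(l % n).toNat, by
    have h : (0 : ℤ) < n := by exact_mod_cast NeZero.pos n
    have := Int.emod_nonneg l h.ne'
    have := Int.emod_lt_of_pos l h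
    omega⟩

section cyc

variable {n : ℕ} [NeZero n]

theorem cyc_val (l : ℤ) : ((cyc n l).val : ℤ) = l % n := by
  have h : (0 : ℤ) < n := by exact_mod_cast NeZero.pos n
  exact Int.toNat_of_nonneg (Int.emod_nonneg l h.ne')

theorem cyc_eq_iff {l m : ℤ} : cyc n l = cyc n m ↔ l % n = m % n := by
  rw [← cyc_val, ← cyc_val, Fin.ext_iff, Nat.cast_inj]

theorem cyc_coe (i : Fin n) : cyc n (i.val : ℤ) = i := by
  rw [Fin.ext_iff, ← Nat.cast_inj (R := ℤ), cyc_val]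
  exact Int.emod_eq_of_lt (by omega) (by exact_mod_cast i.2)

theorem cyc_add (l : ℤ) : cyc n (l + n) = cyc n l := by
  rw [cyc_eq_iff]; simp

theorem cyc_cls {l m : ℤ} (h : cyc n l = cyc n m) : Cls n l m := by
  rw [cyc_eq_iff] at h
  obtain ⟨t, ht⟩ := Int.ModEq.dvd (show l ≡ m [ZMOD n] from h)
  exact ⟨t, by linear_combination ht⟩

theorem finRotate_cyc (l : ℤ) : finRotate n (cyc n l) = cyc n (l + 1) := by
  obtain ⟨k, rfl⟩ := Nat.exists_eq_succ_of_ne_zero (NeZero.ne n)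
  rw [Fin.ext_iff, coe_finRotate, ← Nat.cast_inj (R := ℤ), cyc_val]
  have h1 := cyc_val (n := k.succ) l
  have h2 := Int.emod_emod_of_dvd l (dvd_refl ((k.succ : ℕ) : ℤ))
  have h3 : ((l : ℤ) + 1) % (k.succ : ℕ) = (l % (k.succ : ℕ) + 1) % (k.succ : ℕ) := by simp
  split_ifs with h
  · rw [h, Fin.val_last] at h1
    rw [h3, ← h1]; simp
  · have h4 : (cyc k.succ l).val < k := by
      have := (cyc k.succ l).2
      have : (cyc k.succ l).val ≠ k := fun e => h (Fin.ext e)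
      omega
    rw [h3, ← h1, Int.emod_eq_of_lt (by omega) (by push_cast; omega)]
    push_cast; ring

theorem sum_Ico_int {A : Type*} [AddCommMonoid A] (f : ℤ → A) (n : ℕ) :
    ∑ l ∈ Finset.Ico (0 : ℤ) n, f l = ∑ k ∈ Finset.range n, f k := by
  symm
  refine Finset.sum_bij (fun k _ => (k : ℤ)) ?_ ?_ ?_ fun _ _ => rfl
  · intro k hk; rw [Finset.mem_range] at hk; simp [hk]
  · intro a _ b _ h; exact_mod_cast h
  · intro b hb
    rw [Finset.mem_Ico] at hb
    exact ⟨b.toNat, by rw [Finset.mem_range]; omega, by omega⟩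

theorem sum_range_cyc {A : Type*} [AddCommMonoid A] (f : Fin n → A) :
    ∑ k ∈ Finset.range n, f (cyc n k) = ∑ i, f i := by
  rw [Finset.sum_range]
  exact Finset.sum_congr rfl fun i _ => by rw [cyc_coe]

/-- Directions with prescribed turning angles that add up to a full turn. -/
theorem exists_directions (e : Fin n → ℤ) (a : ℤ) (he : ∑ i, e i = 3 * n + 6) :
    ∃ θ : ℤ → ℤ, θ 0 = a ∧ (∀ l, θ (l + n) = θ l - 6) ∧
      ∀ l, θ (l + 1) = θ l + 3 - e (cyc n l) := by
  have hn : (0 : ℤ) < n := by exact_mod_cast NeZero.pos n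
  -- Partial sums of the turning angles over one period. The hypothesis on the sum gives `T n = a -
  -- 6`, so they extend to the integers with a drop by `6` per period.
  let T : ℕ → ℤ := fun k => a + ∑ m ∈ Finset.range k, (3 - e (cyc n m))
  have hT : T n = a - 6 := by
    simp only [T, Finset.sum_sub_distrib, sum_range_cyc e, he]
    simp; ring
  have val : ∀ (k : ℕ) (t : ℤ), k < n → T (((k : ℤ) + t * n) % n).toNat - 6 * (((k : ℤ) + t * n) / n) =
      T k - 6 * t := by
    intro k t hk
    rw [Int.add_mul_emod_self_right, Int.add_mul_ediv_right _ _ hn.ne',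
      Int.emod_eq_of_lt (by omega) (by omega), Int.ediv_eq_zero_of_lt (by omega) (by omega)]
    simp
  refine ⟨fun l => T (l % n).toNat - 6 * (l / n), by simp [T], fun l => ?_, fun l => ?_⟩
  · simp only [Int.add_emod_right]
    rw [Int.add_ediv_of_dvd_right (dvd_refl _), Int.ediv_self hn.ne']; ring
  · obtain ⟨k, t, rfl, hk⟩ : ∃ (k : ℕ) (t : ℤ), l = k + t * n ∧ k < n := by
      obtain ⟨m, t, h1, h2, h3⟩ := IsPeriodic.exists_window hn 0 l
      exact ⟨m.toNat, t, by rw [h1, Int.toNat_of_nonneg h2], by omega⟩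
    have hc : cyc n (k + t * n) = cyc n k := by rw [cyc_eq_iff]; simp
    have hs : T (k + 1) = T k + 3 - e (cyc n k) := by
      simp only [T, Finset.sum_range_succ]; ring
    simp only
    rw [val k t hk, hc]
    rcases Nat.lt_or_ge (k + 1) n with h | h
    · have := val (k + 1) t h
      rw [show ((k : ℤ) + t * n + 1) = ((k + 1 : ℕ) : ℤ) + t * n by push_cast; ring, this, hs]; ring
    · have hk' : k + 1 = n := by omega
      have := val 0 (t + 1) (NeZero.pos n)
      rw [show ((k : ℤ) + t * n + 1) = ((0 : ℕ) : ℤ) + (t + 1) * n by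
        rw [← hk']; push_cast; ring, this]
      rw [hk', hT] at hs
      have h0 : T 0 = a := by simp [T]
      rw [h0]; linarith

end cyc

namespace GeneralizedGridPolygon

variable {V : Type*} [DecidableEq V] (P : GeneralizedGridPolygon V)

theorem sheet_connected : IsSimplyConnected (P.sheet.complex P.sheet_flat) := by
  rw [P.sheet_complex]; exact P.simply_connected

/-- A boundary edge of the complex is a boundary edge of the sheet in one of its orientations. So a
vertex on no boundary edge is interior, and its six triangles are those of the definition. -/
theorem deg_eq_six {v : V} (h : ∀ u, ¬ P.sheet.Bdry u v) (h' : ∀ u, ¬ P.sheet.Bdry v u) :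
    P.sheet.deg v = 6 := by
  obtain ⟨m, h1, h2⟩ := P.sheet_flat.exists_deg v
  rw [P.sheet_complex, P.interior_vertex v] at h2
  · have : m = 6 := by exact_mod_cast h2.symm
    rw [h1, this]; rfl
  · rintro ⟨e, he, hv⟩
    obtain ⟨a, b, hab, rfl⟩ := Finset.card_eq_two.1 he.1.2
    obtain ⟨t, ⟨ht, hs⟩, huniq⟩ := he.2
    have hE : P.sheet.Edge a b := ⟨hab, he.1.1⟩
    have hno : P.sheet.Bdry a b ∨ P.sheet.Bdry b a := by
      by_contra! hcon
      have h1 : ∃ w, P.sheet.Tri b a w := by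
        by_contra! h; exact hcon.1 ⟨hE, h⟩
      have h2 : ∃ w, P.sheet.Tri a b w := by
        by_contra! h; exact hcon.2 ⟨P.sheet_flat.symm hE, h⟩
      obtain ⟨w, hw⟩ := h1
      obtain ⟨w', hw'⟩ := h2
      have e1 := huniq _ ⟨P.tri_mem hw, fun c => by simp; tauto⟩
      have e2 := huniq _ ⟨P.tri_mem hw', fun c => by simp; tauto⟩
      exact P.tri_asymm hw hw' (e1.trans e2.symm)
    simp only [Finset.mem_insert, Finset.mem_singleton] at hv
    rcases hv with rfl | rfl <;> rcases hno with hno | hno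
    · exact h' _ hno
    · exact h _ hno
    · exact h _ hno
    · exact h' _ hno

variable {P} {n : ℕ} {x : Fin n → V}

theorem IsBoundaryLoop.bdry (hx : P.IsBoundaryLoop x) (i : Fin n) :
    P.sheet.Bdry (x i) (x (finRotate n i)) := (P.bdry_iff _ _).2 (hx.1 i)

open Classical in
theorem IsBoundaryLoop.sum_heads (hx : P.IsBoundaryLoop x) {A : Type*} [AddCommMonoid A]
    (f : V → A) (v : V) : ∑ y ∈ P.sheet.verts.filter (P.sheet.Bdry v), f y =
      ∑ i, if x i = v then f (x (finRotate n i)) else 0 := by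
  rw [← Finset.sum_filter]
  symm
  refine Finset.sum_bij (fun i _ => x (finRotate n i)) ?_ ?_ ?_ fun _ _ => rfl
  · intro i hi
    rw [Finset.mem_filter] at hi ⊢
    exact ⟨P.mem_verts _, hi.2 ▸ hx.bdry i⟩
  · intro i hi j hj h
    rw [Finset.mem_filter] at hi hj
    exact (hx.2 _ _ (hx.1 i)).unique ⟨rfl, rfl⟩ ⟨hj.2.trans hi.2.symm, h.symm⟩
  · intro y hy
    obtain ⟨i, ⟨h1, h2⟩, -⟩ := hx.2 _ _ ((P.bdry_iff _ _).1 (Finset.mem_filter.1 hy).2)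
    exact ⟨i, by simp [h1], h2⟩

open Classical in
theorem IsBoundaryLoop.sum_tails (hx : P.IsBoundaryLoop x) {A : Type*} [AddCommMonoid A]
    (f : V → A) (v : V) : ∑ y ∈ P.sheet.verts.filter (fun y => P.sheet.Bdry y v), f y =
      ∑ i, if x (finRotate n i) = v then f (x i) else 0 := by
  rw [← Finset.sum_filter]
  symm
  refine Finset.sum_bij (fun i _ => x i) ?_ ?_ ?_ fun _ _ => rfl
  · intro i hi
    rw [Finset.mem_filter] at hi ⊢
    exact ⟨P.mem_verts _, hi.2 ▸ hx.bdry i⟩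
  · intro i hi j hj h
    rw [Finset.mem_filter] at hi hj
    exact (hx.2 _ _ (hx.1 i)).unique ⟨rfl, rfl⟩ ⟨h.symm, hj.2.trans hi.2.symm⟩
  · intro y hy
    obtain ⟨i, ⟨h1, h2⟩, -⟩ := hx.2 _ _ ((P.bdry_iff _ _).1 (Finset.mem_filter.1 hy).2)
    exact ⟨i, Finset.mem_filter.2 ⟨Finset.mem_univ _, h2⟩, h1⟩

open Classical in
/-- Exterior angles of a boundary loop that are compatible with the numbers of triangles at the
vertices. -/
theorem IsBoundaryLoop.exists_angles (hx : P.IsBoundaryLoop x) {d : Fin n → ℤ}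
    (hd : ∀ i, P.vec (x i) (x (finRotate n i)) = dirVec (d i)) :
    ∃ e : Fin n → ℤ, (∀ i, (6 : ℤ) ∣ e i - (d i - d (finRotate n i) + 3)) ∧
      ∀ v, (∑ i, if x (finRotate n i) = v then e i else 0) = 6 - P.sheet.deg v := by
  -- The defect of the angle relation at `v` for arbitrarily chosen lifts of the directions; by
  -- `Sheet.IsFlat.deg_mod` it is a multiple of `6`.
  let D : V → ℤ := fun v => 6 - P.sheet.deg v -
    ∑ i, if x (finRotate n i) = v then d i - d (finRotate n i) + 3 else 0
  have hD : ∀ v, (6 : ℤ) ∣ D v := by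
    intro v
    have hδ : ∀ y, ∃ k, P.sheet.Edge v y → P.sheet.pos y - P.sheet.pos v = dirVec k := fun y => by
      by_cases h : P.sheet.Edge v y
      · obtain ⟨k, hk⟩ := P.sheet_dir h; exact ⟨k, fun _ => hk⟩
      · exact ⟨0, fun h' => absurd h' h⟩
    choose δ hδ using hδ
    have h1 := P.sheet_flat.deg_mod v δ hδ
    rw [hx.sum_heads, hx.sum_tails] at h1
    have cast : ∀ {a b : ℤ}, dirVec a = dirVec b → (a : ZMod 6) = b := fun h =>
      (ZMod.intCast_eq_intCast_iff' _ _ 6).2 (by exact_mod_cast dirVec_inj.1 h)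
    have h2 : (∑ i, if x i = v then (δ (x (finRotate n i)) : ZMod 6) else 0) =
        ∑ i, if x (finRotate n i) = v then (d (finRotate n i) : ZMod 6) else 0 := by
      rw [← Equiv.sum_comp (finRotate n)]
      refine Finset.sum_congr rfl fun i _ => ?_
      split_ifs with h
      · refine cast ?_
        rw [← hd, ← hδ _ (h ▸ (hx.bdry _).1), ← h]; rfl
      · rfl
    have h3 : (∑ i, if x (finRotate n i) = v then (δ (x i) : ZMod 6) else 0) =
        ∑ i, if x (finRotate n i) = v then (d i + 3 : ZMod 6) else 0 := by
      refine Finset.sum_congr rfl fun i _ => ?_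
      split_ifs with h
      · have := cast (a := δ (x i)) (b := d i + 3) (by
          rw [dirVec_add_three, ← hd, ← hδ _ (h ▸ P.sheet_flat.symm (hx.bdry i).1), ← h, vec]
          simp [sheet])
        rw [this]; push_cast; rfl
      · rfl
    rw [h2, h3, ← Finset.sum_sub_distrib] at h1
    have : ((D v : ℤ) : ZMod 6) = 0 := by
      simp only [D]
      push_cast
      rw [h1, sub_sub, ← Finset.sum_add_distrib, Finset.sum_eq_zero]
      · rfl
      · intro i _
        split_ifs <;> ring
    exact_mod_cast (ZMod.intCast_zmod_eq_zero_iff_dvd (D v) 6).1 this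
  have hf : ∀ i, ∃ j, x (finRotate n j) = x (finRotate n i) := fun i => ⟨i, rfl⟩
  -- Only the total of the exterior angles at a vertex is prescribed, so the whole defect is charged
  -- to one arbitrarily chosen visit.
  let first : V → Option (Fin n) := fun v =>
    if h : ∃ j, x (finRotate n j) = v then some h.choose else none
  refine ⟨fun i => d i - d (finRotate n i) + 3 +
    if first (x (finRotate n i)) = some i then D (x (finRotate n i)) else 0, fun i => ?_, fun v => ?_⟩
  · rw [add_sub_cancel_left]
    split_ifs
    · exact hD _
    · exact dvd_zero _
  · by_cases h : ∃ j, x (finRotate n j) = v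
    · have h1 : ∀ i, (if x (finRotate n i) = v then (d i - d (finRotate n i) + 3 +
          if first (x (finRotate n i)) = some i then D (x (finRotate n i)) else 0) else 0) =
          (if x (finRotate n i) = v then d i - d (finRotate n i) + 3 else 0) +
          if i = h.choose then D v else 0 := by
        intro i
        by_cases hi : x (finRotate n i) = v
        · have hfv : first v = some h.choose := dif_pos h
          simp only [hi, if_true, hfv, Option.some_inj, eq_comm]
        · have : i ≠ h.choose := fun e => hi (e ▸ h.choose_spec)
          rw [if_neg hi, if_neg hi, if_neg this, add_zero]
      rw [Finset.sum_congr rfl fun i _ => h1 i, Finset.sum_add_distrib, Finset.sum_ite_eq']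
      simp [D]
    · rw [Finset.sum_eq_zero, P.deg_eq_six]
      · rfl
      · intro u hu
        obtain ⟨i, ⟨h1, h2⟩, -⟩ := hx.2 _ _ ((P.bdry_iff _ _).1 hu)
        exact h ⟨i, h2⟩
      · intro u hu
        obtain ⟨i, ⟨h1, h2⟩, -⟩ := hx.2 _ _ ((P.bdry_iff _ _).1 hu)
        exact h ⟨(finRotate n).symm i, by rw [Equiv.apply_symm_apply]; exact h1⟩
      · intro i _
        exact if_neg fun e => h ⟨i, e⟩

open Classical in
theorem IsBoundaryLoop.sum_curvature [Fintype V] (hx : P.IsBoundaryLoop x) :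
    ∑ v, (6 - P.sheet.deg v) = 3 * n + 6 := by
  rw [P.sheet_flat.sum_deg P.sheet_connected P.mem_verts]
  congr 3
  have : (Finset.univ.filter fun p : V × V => P.sheet.Bdry p.1 p.2) =
      Finset.univ.image fun i => (x i, x (finRotate n i)) := by
    ext ⟨u, v⟩
    simp only [Finset.mem_filter, Finset.mem_univ, true_and, Finset.mem_image, Prod.mk.injEq]
    constructor
    · intro h
      obtain ⟨i, h, -⟩ := hx.2 _ _ ((P.bdry_iff _ _).1 h)
      exact ⟨i, h⟩
    · rintro ⟨i, rfl, rfl⟩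
      exact hx.bdry i
  rw [this, Finset.card_image_of_injective, Finset.card_univ, Fintype.card_fin]
  intro i j h
  simp only [Prod.mk.injEq] at h
  exact (hx.2 _ _ (hx.1 i)).unique ⟨rfl, rfl⟩ ⟨h.1.symm, h.2.symm⟩

/-- The exterior angles sum to the total curvature `3 * n + 6`, which is exactly the condition for a
lift `θ` that drops by `6` per period. Along the loop `θ` stays congruent modulo `6` to the true
directions, and the angle relation telescopes. -/
theorem IsBoundaryLoop.exists_diagram [NeZero n] (hx : P.IsBoundaryLoop x) :
    ∃ θ : ℤ → ℤ, IsDiagram P.sheet n Set.univ θ (fun l => x (cyc n l)) := by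
  classical
  have := P.finite
  have := Fintype.ofFinite V
  have hd : ∀ i, ∃ k, P.vec (x i) (x (finRotate n i)) = dirVec k := fun i =>
    P.sheet_dir (hx.bdry i).1
  choose d hd using hd
  obtain ⟨e, he, hv⟩ := hx.exists_angles hd
  have hn : (0 : ℤ) < n := by exact_mod_cast NeZero.pos n
  have hsum : ∑ i, e i = 3 * n + 6 := by
    rw [← hx.sum_curvature, ← Finset.sum_congr rfl fun v _ => hv v, Finset.sum_comm]
    simp
  obtain ⟨θ, h0, hN, hs⟩ := exists_directions e (d (cyc n 0)) hsum
  have hθ : ∀ k : ℕ, (6 : ℤ) ∣ θ k - d (cyc n k) := by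
    intro k
    induction k with
    | zero => simp [h0]
    | succ k ih =>
      have := he (cyc n k)
      rw [finRotate_cyc] at this
      push_cast
      rw [hs]
      have e1 : θ k + 3 - e (cyc n k) - d (cyc n (k + 1)) =
        (θ k - d (cyc n k)) - (e (cyc n k) - (d (cyc n k) - d (cyc n (k + 1)) + 3)) := by ring
      rw [e1]
      exact dvd_sub ih this
  have hP : IsPeriodic n Set.univ θ (fun l => x (cyc n l)) :=
    ⟨hn, fun _ => by simp, fun l _ => hN l, fun l => by rw [cyc_add]⟩
  refine ⟨θ, { hP with flat := P.sheet_flat, p_mem := fun _ => P.mem_verts _, stay := ?_, bdry := ?_, dir := ?_, surj := ?_, inj := ?_, vertex := ?_ }⟩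
  · intro l hl; exact absurd (Set.mem_univ l) hl
  · intro l _
    rw [← finRotate_cyc]; exact hx.bdry _
  · intro l _
    obtain ⟨m, t, rfl, h2, h3⟩ := IsPeriodic.exists_window hn 0 l
    obtain ⟨k, rfl⟩ := Int.eq_ofNat_of_zero_le h2
    rw [(hP.add_mul _ _).2.2 (Set.mem_univ _), ← finRotate_cyc]
    have : cyc n (k + t * n) = cyc n k := by rw [cyc_eq_iff]; simp
    rw [this]
    refine (hd (cyc n k)).trans (dirVec_congr ?_)
    have := hθ k
    omega
  · intro u v h
    obtain ⟨i, ⟨h1, h2⟩, -⟩ := hx.2 _ _ ((P.bdry_iff _ _).1 h)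
    exact ⟨i.val, Set.mem_univ _, by rw [cyc_coe]; exact h1, by
      rw [← finRotate_cyc, cyc_coe]; exact h2⟩
  · intro l _ m _ h1 h2
    rw [← finRotate_cyc, ← finRotate_cyc] at h2
    exact cyc_cls ((hx.2 _ _ (hx.1 (cyc n l))).unique ⟨rfl, rfl⟩ ⟨h1.symm, h2.symm⟩)
  · intro c v _
    refine vertex_of_one hP (fun l hl => absurd (Set.mem_univ l) hl) (c := 0) ?_ c
    rw [zero_add, sum_Ico_int]
    have h1 : ∀ k : ℕ, cornerTerm Set.univ θ (fun l => x (cyc n l)) v k =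
        (if x (finRotate n (cyc n k)) = v then e (cyc n k) else 0) +
        ((if x (cyc n ((k + 1 : ℕ) : ℤ)) = v then θ ((k + 1 : ℕ) : ℤ) else 0) -
          if x (cyc n k) = v then θ k else 0) := by
      intro k
      simp only [cornerTerm, Set.mem_univ, if_true, finRotate_cyc]
      push_cast
      rw [hs]
      split_ifs <;> ring
    rw [Finset.sum_congr rfl fun k _ => h1 k, Finset.sum_add_distrib,
      sum_range_cyc (fun i => if x (finRotate n i) = v then e i else 0), hv,
      Finset.sum_range_sub (fun k : ℕ => if x (cyc n k) = v then θ k else 0)]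
    have h2 : cyc n (n : ℤ) = cyc n 0 := by rw [cyc_eq_iff]; simp
    have h3 := hN 0
    rw [zero_add] at h3
    simp only [h2, h3, Nat.cast_zero]
    split_ifs <;> ring

end GeneralizedGridPolygon
end GridBilliards

/-! ### Planar complexes are wedges of disks. -/

namespace GridBilliards

theorem ne_singleton_of_mem_edges {V : Type*} {K : PreAbstractSimplicialComplex V} {e : Finset V}
    {x : V} (he : e ∈ edges K) : e ≠ {x} := fun h => by
  have := he.2; rw [h] at this; simp at this

section Wedge

variable {V W : Type*} [DecidableEq V] [DecidableEq W]

theorem IsEdgePath.singleton_mem {K : PreAbstractSimplicialComplex V} {v : V} {l : List V}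
    (h : IsEdgePath K (v :: l)) (hl : l ≠ []) : ∀ a ∈ v :: l, {a} ∈ K.faces := by
  induction l generalizing v with
  | nil => exact absurd rfl hl
  | cons b l ih =>
    have h' : {v, b} ∈ K.faces ∧ IsEdgePath K (b :: l) := by simpa [IsEdgePath] using h
    intro a ha
    rcases List.mem_cons.1 ha with rfl | ha
    · exact face_mono h'.1 (by simp) (by simp)
    · by_cases hl : l = []
      · subst hl
        rw [List.mem_singleton.1 ha]
        exact face_mono h'.1 (by simp) (by simp)
      · exact ih h'.2 hl a ha

/-- A retract of a simply connected complex is simply connected. -/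
theorem IsSimplyConnected.of_retract {K : PreAbstractSimplicialComplex V}
    {L : PreAbstractSimplicialComplex W} (h : IsSimplyConnected K) (r : V → W) (i : W → V)
    (hr : ∀ s ∈ K.faces, s.image r ∈ L.faces) (hi : ∀ s ∈ L.faces, s.image i ∈ K.faces)
    (hri : ∀ w, {w} ∈ L.faces → r (i w) = w) : IsSimplyConnected L := by
  refine ⟨?_, ?_, ?_⟩
  · obtain ⟨v, hv⟩ := h.nonempty
    exact ⟨r v, by simpa using hr _ hv⟩
  · intro u v hu hv
    obtain ⟨l, hl⟩ := h.connected (i u) (i v) (by simpa using hi _ hu) (by simpa using hi _ hv)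
    have := hl.map r hr
    simp only [List.map_cons, List.map_append, List.map_nil, hri u hu, hri v hv] at this
    exact ⟨_, this⟩
  · intro v l hl
    have hmem := hl.singleton_mem (by simp)
    have h1 := hl.map i hi
    simp only [List.map_cons, List.map_append, List.map_nil] at h1
    have h2 := EdgePathMove.map r hr (h.null_homotopic _ _ h1)
    have h3 : ∀ l' : List W, (∀ a ∈ l', {a} ∈ L.faces) → (l'.map i).map r = l' := by
      intro l' hl'
      rw [List.map_map]
      conv_rhs => rw [← List.map_id l']
      exact List.map_congr_left fun a ha => hri a (hl' a ha)
    have h4 := h3 _ hmem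
    have h5 := h3 [v, v] (fun a ha => hmem a (by simp at ha; simp [ha]))
    simp only [List.map_cons, List.map_append, List.map_nil] at h2 h4 h5
    rwa [h4, h5] at h2

/-- Two boundary edges with a common vertex. -/
def BoundaryStep (K : PreAbstractSimplicialComplex V) (e e' : Finset V) : Prop :=
  IsBoundaryEdge K e' ∧ ∃ v ∈ e, v ∈ e'

/-- Finite simply connected complexes of dimension two whose edges are in at most two triangles,
which do not contain closed surfaces, and which have a connected boundary. -/
structure IsPlanar (K : PreAbstractSimplicialComplex V) : Prop where
  finite : K.faces.Finite
  homogeneous : IsHomogeneousDimTwo K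
  edge_le_two : ∀ e ∈ edges K, {t | t ∈ triangles K ∧ e ⊆ t}.encard ≤ 2
  simply_connected : IsSimplyConnected K
  boundary_connected : ∀ e e', IsBoundaryEdge K e → IsBoundaryEdge K e' →
    Relation.ReflTransGen (BoundaryStep K) e e'
  free_edge : ∀ C ⊆ triangles K, C.Nonempty →
    ∃ t ∈ C, ∃ e ∈ edges K, e ⊆ t ∧ ∀ t' ∈ C, e ⊆ t' → t' = t

/-- The complex `K` is the union of `L` and `M`, which meet in the vertex `x`. -/
structure IsSplit (K L M : PreAbstractSimplicialComplex V) (x : V) : Prop where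
  le_left : L.faces ⊆ K.faces
  le_right : M.faces ⊆ K.faces
  cover : ∀ s ∈ K.faces, s ∈ L.faces ∨ s ∈ M.faces
  inter : L.faces ∩ M.faces = {{x}}
  up_left : ∀ s ∈ L.faces, s ≠ {x} → ∀ t ∈ K.faces, s ⊆ t → t ∈ L.faces
  up_right : ∀ s ∈ M.faces, s ≠ {x} → ∀ t ∈ K.faces, s ⊆ t → t ∈ M.faces
  retract_left : ∃ r : V → V, (∀ s ∈ K.faces, s.image r ∈ L.faces) ∧ ∀ v, {v} ∈ L.faces → r v = v
  retract_right : ∃ r : V → V, (∀ s ∈ K.faces, s.image r ∈ M.faces) ∧ ∀ v, {v} ∈ M.faces → r v = v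
  edge_left : ∃ e ∈ edges L, x ∈ e
  edge_right : ∃ e ∈ edges M, x ∈ e

namespace IsSplit

variable {K L M : PreAbstractSimplicialComplex V} {x : V}

theorem symm (h : IsSplit K L M x) : IsSplit K M L x :=
  ⟨h.le_right, h.le_left, fun s hs => (h.cover s hs).symm, by rw [Set.inter_comm]; exact h.inter,
    h.up_right, h.up_left, h.retract_right, h.retract_left, h.edge_right, h.edge_left⟩

theorem triangles_subset (h : IsSplit K L M x) : triangles L ⊆ triangles K :=
  fun _ ht => ⟨h.le_left ht.1, ht.2⟩

theorem homogeneous (h : IsSplit K L M x) (hK : IsHomogeneousDimTwo K) :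
    IsHomogeneousDimTwo L := by
  have main : ∀ s ∈ L.faces, s ≠ {x} → ∃ t ∈ triangles L, s ⊆ t := by
    intro s hs hne
    obtain ⟨t, ht, hst⟩ := hK.2 s (h.le_left hs)
    exact ⟨t, ⟨h.up_left s hs hne t ht.1 hst, ht.2⟩, hst⟩
  obtain ⟨e, he, hx⟩ := h.edge_left
  refine ⟨⟨e, he.1⟩, fun s hs => ?_⟩
  by_cases hne : s = {x}
  · obtain ⟨t, ht, het⟩ := main e he.1 (ne_singleton_of_mem_edges he)
    exact ⟨t, ht, by rw [hne, Finset.singleton_subset_iff]; exact het hx⟩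
  · exact main s hs hne

theorem isBoundaryEdge_iff (h : IsSplit K L M x) {e : Finset V} :
    IsBoundaryEdge L e ↔ e ∈ L.faces ∧ IsBoundaryEdge K e := by
  constructor
  · rintro ⟨he, t, ⟨ht, het⟩, hu⟩
    refine ⟨he.1, ⟨h.le_left he.1, he.2⟩, t, ⟨h.triangles_subset ht, het⟩, ?_⟩
    rintro t' ⟨ht', het'⟩
    exact hu t' ⟨⟨h.up_left e he.1 (ne_singleton_of_mem_edges he) t' ht'.1 het', ht'.2⟩, het'⟩
  · rintro ⟨heL, he, t, ⟨ht, het⟩, hu⟩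
    have he' : e ∈ edges L := ⟨heL, he.2⟩
    refine ⟨he', t, ⟨⟨h.up_left e heL (ne_singleton_of_mem_edges he') t ht.1 het, ht.2⟩, het⟩, ?_⟩
    rintro t' ⟨ht', het'⟩
    exact hu t' ⟨h.triangles_subset ht', het'⟩

theorem exists_boundaryEdge (h : IsSplit K L M x) (hK : IsPlanar K) :
    ∃ e, IsBoundaryEdge L e := by
  obtain ⟨⟨s, hs⟩, hh⟩ := h.homogeneous hK.homogeneous
  obtain ⟨t, ht, -⟩ := hh s hs
  obtain ⟨t, ht, e, he, het, hu⟩ := hK.free_edge _ h.triangles_subset ⟨t, ht⟩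
  refine ⟨e, ⟨face_mono ht.1 het ?_, he.2⟩, t, ⟨ht, het⟩, fun t' ht' => hu t' ht'.1 ht'.2⟩
  rw [← Finset.card_pos, he.2]; norm_num

/-- A chain of boundary edges can change sides only at `x`. An excursion into `M` therefore leaves
and returns at `x` and can be cut out. -/
theorem chain (h : IsSplit K L M x) {e f : Finset V} (he : IsBoundaryEdge L e)
    (hc : Relation.ReflTransGen (BoundaryStep K) e f) :
    (f ∈ L.faces → Relation.ReflTransGen (BoundaryStep L) e f) ∧
    (f ∉ L.faces → f ∈ M.faces → ∃ g, IsBoundaryEdge L g ∧ x ∈ g ∧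
      Relation.ReflTransGen (BoundaryStep L) e g) := by
  have common : ∀ {f f' : Finset V} {v : V}, f ∈ L.faces → f' ∈ M.faces → v ∈ f → v ∈ f' →
      v = x := by
    intro f f' v hf hf' hv hv'
    have : ({v} : Finset V) ∈ L.faces ∩ M.faces :=
      ⟨face_mono hf (by simpa using hv) (by simp), face_mono hf' (by simpa using hv') (by simp)⟩
    rw [h.inter] at this
    simpa using this
  have bl : ∀ {f}, Relation.ReflTransGen (BoundaryStep L) e f → IsBoundaryEdge L f := by
    intro f hf
    induction hf with
    | refl => exact he
    | tail _ hs _ => exact hs.1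
  induction hc with
  | refl => exact ⟨fun _ => .refl, fun hn _ => absurd he.1.1 hn⟩
  | @tail f f' hf hs ih =>
    obtain ⟨hb, v, hv, hv'⟩ := hs
    by_cases hfL : f ∈ L.faces
    · have h1 := ih.1 hfL
      refine ⟨fun hf' => h1.tail ⟨h.isBoundaryEdge_iff.2 ⟨hf', hb⟩, v, hv, hv'⟩, fun _ hM => ?_⟩
      have := common hfL hM hv hv'
      exact ⟨f, bl h1, this ▸ hv, h1⟩
    · have hfM : f ∈ M.faces := by
        have hfK : f ∈ K.faces := by
          cases hf with
          | refl => exact absurd he.1.1 hfL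
          | tail _ hs => exact hs.1.1.1
        exact (h.cover f hfK).resolve_left hfL
      obtain ⟨g, hg, hx, hc⟩ := ih.2 hfL hfM
      refine ⟨fun hf' => ?_, fun _ _ => ⟨g, hg, hx, hc⟩⟩
      have := common hf' hfM hv' hv
      exact hc.tail ⟨h.isBoundaryEdge_iff.2 ⟨hf', hb⟩, x, hx, this ▸ hv'⟩

theorem isPlanar (h : IsSplit K L M x) (hK : IsPlanar K) : IsPlanar L where
  finite := hK.finite.subset h.le_left
  homogeneous := h.homogeneous hK.homogeneous
  edge_le_two e he := by
    refine le_trans (Set.encard_le_encard ?_) (hK.edge_le_two e ⟨h.le_left he.1, he.2⟩)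
    exact fun t ht => ⟨h.triangles_subset ht.1, ht.2⟩
  simply_connected := by
    obtain ⟨r, hr, hr'⟩ := h.retract_left
    exact hK.simply_connected.of_retract r id hr
      (fun s hs => by rw [Finset.image_id]; exact h.le_left hs) hr'
  boundary_connected e e' he he' := by
    have h1 := (h.isBoundaryEdge_iff.1 he).2
    have h2 := (h.isBoundaryEdge_iff.1 he').2
    exact (h.chain he (hK.boundary_connected e e' h1 h2)).1 he'.1.1
  free_edge C hC hne := by
    obtain ⟨t, ht, e, he, het, hu⟩ := hK.free_edge C (hC.trans h.triangles_subset) hne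
    refine ⟨t, ht, e, ⟨face_mono (hC ht).1 het ?_, he.2⟩, het, hu⟩
    rw [← Finset.card_pos, he.2]; norm_num

/-- Both parts have boundary edges, and the boundary of `K` is connected; a chain from one part to
the other passes through `x`. -/
theorem isBoundaryVertex (h : IsSplit K L M x) (hK : IsPlanar K) : IsBoundaryVertex L x := by
  obtain ⟨e, he⟩ := h.exists_boundaryEdge hK
  obtain ⟨f, hf⟩ := h.symm.exists_boundaryEdge hK
  have hfL : f ∉ L.faces := fun hfL => by
    have : f ∈ L.faces ∩ M.faces := ⟨hfL, hf.1.1⟩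
    rw [h.inter] at this
    exact ne_singleton_of_mem_edges hf.1 this
  obtain ⟨g, hg, hx, -⟩ := (h.chain he (hK.boundary_connected e f (h.isBoundaryEdge_iff.1 he).2
    (h.symm.isBoundaryEdge_iff.1 hf).2)).2 hfL hf.1.1
  exact ⟨g, hg, hx⟩

end IsSplit

open Classical in
/-- A planar complex splits at a vertex with a disconnected link. -/
theorem IsPlanar.exists_split {K : PreAbstractSimplicialComplex V} (hK : IsPlanar K) {x a b : V}
    (ha : {x, a} ∈ edges K) (hb : {x, b} ∈ edges K)
    (hab : ¬ Relation.ReflTransGen (fun y z => {x, y, z} ∈ triangles K) a b) :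
    ∃ L M, IsSplit K L M x := by
  let A : Set V := {y | Relation.ReflTransGen (fun y z => {x, y, z} ∈ triangles K) a y}
  have hxA : x ∉ A := by
    intro h
    rcases Relation.ReflTransGen.cases_tail h with h | ⟨y, -, h⟩
    · have := ha.2; rw [h] at this; simp at this
    · have := h.2
      rw [Finset.pair_comm, Finset.insert_eq_of_mem (by simp)] at this
      have := Finset.card_le_two (a := x) (b := y)
      omega
  have hAt : ∀ {y z}, y ≠ x → z ≠ x → {x, y, z} ∈ K.faces → y ∈ A → z ∈ A := by
    intro y z hy hz h hyA
    by_cases hyz : y = z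
    · exact hyz ▸ hyA
    · exact Relation.ReflTransGen.tail hyA
        ⟨h, Finset.card_eq_three.2 ⟨x, y, z, hy.symm, hz.symm, hyz, rfl⟩⟩
  -- With `A` the component of `a` in the link of `x`, this cochain marks the edges from `x` into
  -- `A`. A triangle at `x` has both other vertices in `A` or neither, so `g` is a cocycle.
  let g : V → V → ZMod 2 := fun u v => if (u = x ∧ v ∈ A) ∨ (v = x ∧ u ∈ A) then 1 else 0
  obtain ⟨ψ, hψ⟩ := hK.simply_connected.exists_potential g (by
    intro u v w h
    have p1 : ({u, w, v} : Finset V) = {u, v, w} := by ext; simp; tauto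
    have p2 : ({v, u, w} : Finset V) = {u, v, w} := by ext; simp; tauto
    have p3 : ({v, w, u} : Finset V) = {u, v, w} := by ext; simp; tauto
    have p4 : ({w, u, v} : Finset V) = {u, v, w} := by ext; simp; tauto
    have p5 : ({w, v, u} : Finset V) = {u, v, w} := by ext; simp; tauto
    have two : (1 : ZMod 2) + 1 = 0 := CharTwo.add_self_eq_zero _
    by_cases hu : u = x
    · subst hu
      by_cases hv : v = u
      · subst hv; simp [g, hxA]
      by_cases hw : w = u
      · subst hw
        by_cases hvA : v ∈ A <;> simp [g, hxA, hv, hvA, two]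
      · have : v ∈ A ↔ w ∈ A := ⟨hAt hv hw h, hAt hw hv (p1 ▸ h)⟩
        simp [g, hv, hw, this]
    · by_cases hv : v = x
      · subst hv
        by_cases hw : w = v
        · subst hw; simp [g, hxA]
        · have : u ∈ A ↔ w ∈ A := ⟨hAt hu hw (p2 ▸ h), hAt hw hu (p3 ▸ h)⟩
          by_cases hwA : w ∈ A <;> simp [g, hu, hw, this, hwA, two]
      · by_cases hw : w = x
        · subst hw
          have : u ∈ A ↔ v ∈ A := ⟨hAt hu hv (p4 ▸ h), hAt hv hu (p5 ▸ h)⟩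
          simp [g, hu, hv, this]
        · simp [g, hu, hv, hw])
  -- The potential changes only along the marked edges. So `U` contains `a` but not `b`, and it is
  -- attached to the rest only at `x`: this is the global separation.
  let U : Set V := {v | ψ v ≠ ψ x}
  have hxU : x ∉ U := fun h => h rfl
  have aU : a ∈ U := by
    have h := hψ x a ha.1
    have haA : a ∈ A := Relation.ReflTransGen.refl
    intro e
    rw [e, sub_self] at h
    simp [g, haA] at h
  have bU : b ∉ U := by
    have h := hψ x b hb.1
    have hbA : b ∉ A := hab
    intro hbU
    apply hbU
    rw [← sub_eq_zero, ← h]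
    simp [g, hxA, hbA]
  have hbx : b ≠ x := fun e => by have := hb.2; rw [e] at this; simp at this
  have hax : a ≠ x := fun e => by have := ha.2; rw [e] at this; simp at this
  have cross : ∀ {u v}, {u, v} ∈ K.faces → u ∈ U → v ∉ U → v = x := by
    intro u v h hu hv
    by_contra hvx
    have hux : u ≠ x := fun e => hxU (e ▸ hu)
    have := hψ u v h
    simp only [g, hux, hvx, false_and, or_self, if_false] at this
    apply hu
    have hv' : ψ v = ψ x := not_not.1 hv
    rw [← hv', ← sub_eq_zero, ← neg_sub, ← this, neg_zero]
  have pair : ∀ {s : Finset V} {u v : V}, s ∈ K.faces → u ∈ s → v ∈ s → {u, v} ∈ K.faces := by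
    intro s u v hs hu hv
    exact face_mono hs (by intro c; simp; rintro (rfl | rfl) <;> assumption) (by simp)
  have upL : ∀ {s u}, s ∈ K.faces → u ∈ s → u ∈ U → ∀ v ∈ s, v ∈ U ∨ v = x := by
    intro s u hs hu huU v hv
    by_cases hvU : v ∈ U
    · exact Or.inl hvU
    · exact Or.inr (cross (pair hs hu hv) huU hvU)
  have upM : ∀ {s v}, s ∈ K.faces → v ∈ s → v ∉ U → v ≠ x → ∀ u ∈ s, u ∉ U := by
    intro s v hs hv hvU hvx u hu huU
    exact hvx (cross (pair hs hu hv) huU hvU)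
  let L : PreAbstractSimplicialComplex V :=
    { faces := {s | s ∈ K.faces ∧ ∀ v ∈ s, v ∈ U ∨ v = x}
      isRelLowerSet_faces := fun s hs => ⟨(K.isRelLowerSet_faces hs.1).1, fun t hts ht =>
        ⟨face_mono hs.1 hts ht, fun v hv => hs.2 v (hts hv)⟩⟩ }
  let M : PreAbstractSimplicialComplex V :=
    { faces := {s | s ∈ K.faces ∧ ∀ v ∈ s, v ∉ U}
      isRelLowerSet_faces := fun s hs => ⟨(K.isRelLowerSet_faces hs.1).1, fun t hts ht =>
        ⟨face_mono hs.1 hts ht, fun v hv => hs.2 v (hts hv)⟩⟩ }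
  have hxK : {x} ∈ K.faces := face_mono ha.1 (by simp) (by simp)
  have nonempty : ∀ s ∈ K.faces, s.Nonempty := fun s hs => (K.isRelLowerSet_faces hs).1
  have dich : ∀ s ∈ K.faces, s ∈ L.faces ∨ s ∈ M.faces := by
    intro s hs
    by_cases h : ∃ u ∈ s, u ∈ U
    · obtain ⟨u, hu, huU⟩ := h
      exact Or.inl ⟨hs, upL hs hu huU⟩
    · push Not at h
      exact Or.inr ⟨hs, h⟩
  have ne_x : ∀ s ∈ K.faces, s ≠ {x} → ∃ u ∈ s, u ≠ x := by
    intro s hs hne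
    by_contra! hcon
    exact hne (Finset.eq_singleton_iff_nonempty_unique_mem.2 ⟨nonempty s hs, hcon⟩)
  have imgx : ∀ (s : Finset V) (r : V → V), s ∈ K.faces → (∀ v ∈ s, r v = x) → s.image r = {x} := by
    intro s r hs h
    rw [Finset.image_congr (g := fun _ => x) (fun v hv => h v hv), Finset.image_const (nonempty s hs)]
  have imgid : ∀ (s : Finset V) (r : V → V), (∀ v ∈ s, r v = v) → s.image r = s := by
    intro s r h
    rw [Finset.image_congr (g := id) (fun v hv => h v hv), Finset.image_id]
  refine ⟨L, M, fun s hs => hs.1, fun s hs => hs.1, dich, ?_, ?_, ?_, ?_, ?_, ?_, ?_⟩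
  · ext s
    constructor
    · rintro ⟨⟨hs, h1⟩, -, h2⟩
      by_contra hne
      obtain ⟨u, hu, hux⟩ := ne_x s hs hne
      exact h2 u hu ((h1 u hu).resolve_right hux)
    · rintro rfl
      exact ⟨⟨hxK, fun v hv => Or.inr (by simpa using hv)⟩, hxK, fun v hv => by
        rw [Finset.mem_singleton.1 hv]; exact hxU⟩
  · intro s hs hne t ht hst
    obtain ⟨u, hu, hux⟩ := ne_x s hs.1 hne
    exact ⟨ht, upL ht (hst hu) ((hs.2 u hu).resolve_right hux)⟩
  · intro s hs hne t ht hst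
    obtain ⟨u, hu, hux⟩ := ne_x s hs.1 hne
    exact ⟨ht, upM ht (hst hu) (hs.2 u hu) hux⟩
  · refine ⟨fun v => if v ∈ U then v else x, fun s hs => ?_, fun v hv => ?_⟩
    · rcases dich s hs with h | h
      · rw [imgid]
        · exact h
        · intro v hv
          rcases h.2 v hv with h | h
          · simp [h]
          · simp [h]
      · rw [imgx s _ hs]
        · exact ⟨hxK, fun v hv => Or.inr (by simpa using hv)⟩
        · intro v hv; simp [h.2 v hv]
    · rcases hv.2 v (by simp) with h | h <;> simp [h]
  · refine ⟨fun v => if v ∈ U then x else v, fun s hs => ?_, fun v hv => ?_⟩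
    · rcases dich s hs with h | h
      · rw [imgx s _ hs]
        · exact ⟨hxK, fun v hv => by rw [Finset.mem_singleton.1 hv]; exact hxU⟩
        · intro v hv
          rcases h.2 v hv with h | h <;> simp [h]
      · rw [imgid]
        · exact h
        · intro v hv; simp [h.2 v hv]
    · simp [hv.2 v (by simp)]
  · refine ⟨{x, a}, ⟨⟨ha.1, fun v hv => ?_⟩, ha.2⟩, by simp⟩
    rcases Finset.mem_insert.1 hv with h | h
    · exact Or.inr h
    · exact Or.inl (Finset.mem_singleton.1 h ▸ aU)
  · refine ⟨{x, b}, ⟨⟨hb.1, fun v hv => ?_⟩, hb.2⟩, by simp⟩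
    rcases Finset.mem_insert.1 hv with h | h
    · exact h ▸ hxU
    · exact Finset.mem_singleton.1 h ▸ bU

/-- If all links are connected, the complex is a disk. Otherwise it splits at a vertex with
disconnected link into two planar complexes with fewer faces. -/
theorem IsPlanar.isWedgeOfDisks {K : PreAbstractSimplicialComplex V} (hK : IsPlanar K) :
    IsWedgeOfDisks K := by
  induction hn : K.faces.ncard using Nat.strong_induction_on generalizing K with
  | _ n ih =>
    by_cases hlink : ∀ v a b, {v, a} ∈ edges K → {v, b} ∈ edges K →
        Relation.ReflTransGen (fun x y => {v, x, y} ∈ triangles K) a b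
    · refine .disk K ⟨hK.finite, hK.homogeneous, hK.edge_le_two, hlink, hK.simply_connected, ?_⟩
      obtain ⟨s, hs⟩ := hK.homogeneous.1
      obtain ⟨t, ht, -⟩ := hK.homogeneous.2 s hs
      obtain ⟨t, ht, e, he, het, hu⟩ := hK.free_edge _ subset_rfl ⟨t, ht⟩
      exact ⟨e, he, t, ⟨ht, het⟩, fun t' ht' => hu t' ht'.1 ht'.2⟩
    · push Not at hlink
      obtain ⟨x, a, b, ha, hb, hab⟩ := hlink
      obtain ⟨L, M, h⟩ := hK.exists_split ha hb hab
      have lt : ∀ {L M : PreAbstractSimplicialComplex V}, IsSplit K L M x → L.faces.ncard < n := by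
        intro L M h
        rw [← hn]
        refine Set.ncard_lt_ncard ⟨h.le_left, fun hle => ?_⟩ hK.finite
        obtain ⟨e, he, -⟩ := h.edge_right
        have : e ∈ L.faces ∩ M.faces := ⟨hle (h.le_right he.1), he.1⟩
        rw [h.inter] at this
        exact ne_singleton_of_mem_edges he this
      have heq : K = L ⊔ M := by
        apply PreAbstractSimplicialComplex.ext
        ext s
        exact ⟨fun hs => h.cover s hs, fun hs => hs.elim (fun h' => h.le_left h')
          fun h' => h.le_right h'⟩
      rw [heq]
      exact .wedge L M x (ih _ (lt h) (h.isPlanar hK) rfl) (ih _ (lt h.symm) (h.symm.isPlanar hK) rfl)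
        h.inter (h.isBoundaryVertex hK) (h.symm.isBoundaryVertex hK)

end Wedge
end GridBilliards

/-! ### From pure sheets to polygons. -/

namespace GridBilliards

open IsChordDiagram (Cls cls_self cls_add cls_eq)

namespace Sheet

variable {W : Type*} {X : Sheet W}

/-- The sheet with all vertices in the type. -/
def onVerts (X : Sheet W) : Sheet {x // x ∈ X.verts} where
  verts := X.verts.attach
  Edge x y := X.Edge x y
  Tri x y w := X.Tri x y w
  pos x := X.pos x

theorem IsFlat.onVerts (h : X.IsFlat) : X.onVerts.IsFlat where
  mem _ := Finset.mem_attach _ _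
  symm e := h.symm e
  dir e := h.dir e
  tri_edge e := h.tri_edge e
  tri_rot e := h.tri_rot e
  tri_pos e := h.tri_pos e
  tri_unique e e' := Subtype.ext (h.tri_unique e e')

theorem IsFlat.tri_mem (h : X.IsFlat) {x y w : W} (e : X.Tri x y w) : w ∈ X.verts :=
  h.mem (h.tri_edge (h.tri_rot (h.tri_rot e)))

theorem IsFlat.onVerts_bdry (h : X.IsFlat) (x y : {x // x ∈ X.verts}) :
    X.onVerts.Bdry x y ↔ X.Bdry x y :=
  ⟨fun e => ⟨e.1, fun w hw => e.2 ⟨w, h.tri_mem hw⟩ hw⟩, fun e => ⟨e.1, fun w => e.2 w.1⟩⟩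

open Classical in
theorem IsFlat.onVerts_deg (h : X.IsFlat) (x : {x // x ∈ X.verts}) :
    X.onVerts.deg x = X.deg x := by
  unfold deg
  rw [← Finset.sum_attach X.verts]
  refine Finset.sum_congr rfl fun a _ => ?_
  have : (∃ b, X.onVerts.Tri x a b) ↔ ∃ b, X.Tri x a b := ⟨fun ⟨b, hb⟩ => ⟨b.1, hb⟩, fun ⟨b, hb⟩ => ⟨⟨b, h.tri_mem hb⟩, hb⟩⟩
  simp only [this]

theorem IsFlat.onVerts_reach (h : X.IsFlat) {a b c d : W} (hr : X.Reach (a, b) (c, d))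
    (ha : a ∈ X.verts) (hb : b ∈ X.verts) (hc : c ∈ X.verts) (hd : d ∈ X.verts) :
    X.onVerts.Reach (⟨a, ha⟩, ⟨b, hb⟩) (⟨c, hc⟩, ⟨d, hd⟩) := by
  suffices H : ∀ e, X.Reach (a, b) e → ∃ c d : {x // x ∈ X.verts}, e = (c.1, d.1) ∧
      X.onVerts.Reach (⟨a, ha⟩, ⟨b, hb⟩) (c, d) by
    obtain ⟨c', d', h1, h2⟩ := H _ hr
    obtain ⟨rfl, rfl⟩ := Prod.mk.inj h1
    exact h2
  intro e he
  induction he with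
  | refl => exact ⟨_, _, rfl, .refl⟩
  | tail _ hs ih =>
    obtain ⟨c, d, rfl, h2⟩ := ih
    obtain ⟨w, k, h3, h4, ⟨h5, rfl⟩ | ⟨h5, rfl⟩⟩ := hs
    · exact ⟨⟨w, h.tri_mem h3⟩, d, rfl, h2.tail ⟨⟨w, h.tri_mem h3⟩, k, h3, h4, Or.inl ⟨h5, rfl⟩⟩⟩
    · exact ⟨c, ⟨w, h.tri_mem h3⟩, rfl, h2.tail ⟨⟨w, h.tri_mem h3⟩, k, h3, h4, Or.inr ⟨h5, rfl⟩⟩⟩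

open Classical in
theorem IsFlat.onVerts_simplyConnected [DecidableEq W] (h : X.IsFlat)
    (hs : IsSimplyConnected (X.complex h)) : IsSimplyConnected (X.onVerts.complex h.onVerts) := by
  have hmem : ∀ {v}, {v} ∈ (X.complex h).faces → v ∈ X.verts := by
    rintro v (⟨x, hx, e⟩ | ⟨x, y, e', e⟩ | ⟨x, y, w, e', e⟩)
    · rw [Finset.singleton_inj.1 e]; exact hx
    · have := congrArg Finset.card e
      rw [Finset.card_singleton, Finset.card_pair (h.ne e')] at this; omega
    · have := congrArg Finset.card e
      obtain ⟨h1, h2, h3⟩ := h.tri_ne e'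
      rw [Finset.card_singleton, Finset.card_eq_three.2 ⟨x, y, w, h1, h3, h2, rfl⟩] at this; omega
  obtain ⟨o, ho⟩ := hs.nonempty
  let r : W → {x // x ∈ X.verts} := fun v => if hv : v ∈ X.verts then ⟨v, hv⟩ else ⟨o, hmem ho⟩
  have hr : ∀ {v} (hv : v ∈ X.verts), r v = ⟨v, hv⟩ := fun hv => dif_pos hv
  refine hs.of_retract r Subtype.val ?_ ?_ fun w _ => hr w.2
  · rintro s (⟨x, hx, rfl⟩ | ⟨x, y, e, rfl⟩ | ⟨x, y, w, e, rfl⟩)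
    · left
      exact ⟨r x, by simp [Sheet.onVerts], by simp⟩
    · right; left
      refine ⟨r x, r y, ?_, by simp [Finset.image_insert]⟩
      rw [hr (h.mem e), hr (h.mem' e)]; exact e
    · right; right
      refine ⟨r x, r y, r w, ?_, by simp [Finset.image_insert]⟩
      rw [hr (h.mem (h.tri_edge e)), hr (h.mem' (h.tri_edge e)), hr (h.tri_mem e)]; exact e
  · rintro s (⟨x, hx, rfl⟩ | ⟨x, y, e, rfl⟩ | ⟨x, y, w, e, rfl⟩)
    · left
      exact ⟨x, x.2, by simp⟩
    · right; left
      exact ⟨x, y, e, by simp [Finset.image_insert]⟩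
    · right; right
      exact ⟨x, y, w, e, by simp [Finset.image_insert]⟩

section Boundary

/-- No edge is a boundary edge on both sides. -/
def IsPure (X : Sheet W) : Prop := ∀ x y, X.Bdry x y → ¬ X.Bdry y x

theorem IsPure.exists_tri (hp : X.IsPure) (h : X.IsFlat) {x y : W} (hb : X.Bdry x y) : ∃ w, X.Tri x y w := by
  by_contra! hcon
  exact hp x y hb ⟨h.symm hb.1, hcon⟩

theorem IsPure.tri_or (hp : X.IsPure) (h : X.IsFlat) {x y : W} (e : X.Edge x y) : ∃ w, X.Tri x y w ∨ X.Tri y x w := by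
  by_cases hb : ∃ w, X.Tri y x w
  · exact ⟨_, Or.inr hb.choose_spec⟩
  · obtain ⟨w, hw⟩ := hp.exists_tri h ⟨e, fun w hw => hb ⟨w, hw⟩⟩
    exact ⟨w, Or.inl hw⟩

variable [DecidableEq W]

theorem IsPure.isBoundaryEdge (hp : X.IsPure) (h : X.IsFlat) {x y : W} (hb : X.Bdry x y) :
    IsBoundaryEdge (X.complex h) {x, y} := by
  obtain ⟨w, hw⟩ := hp.exists_tri h hb
  refine ⟨(mem_edges h).2 ⟨x, y, hb.1, rfl⟩, _, ⟨(mem_triangles h).2 ⟨x, y, w, hw, rfl⟩,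
    fun a => by simp; tauto⟩, ?_⟩
  rintro t ⟨ht, hs⟩
  obtain ⟨a, b, c, e, rfl⟩ := (mem_triangles h).1 ht
  obtain ⟨d, hd, e' | e'⟩ := h.tri_of_subset e (h.ne hb.1) hs
  · rw [hd, h.tri_unique e' hw]
  · exact absurd e' (hb.2 d)

theorem IsPure.isBoundaryEdge_iff (hp : X.IsPure) (h : X.IsFlat) {x y : W} (e : X.Edge x y) :
    IsBoundaryEdge (X.complex h) {x, y} ↔ X.Bdry x y ∨ X.Bdry y x := by
  constructor
  · rintro ⟨-, t, -, hu⟩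
    by_contra! hcon
    have h1 : ∃ w, X.Tri y x w := by
      by_contra! h'; exact hcon.1 ⟨e, h'⟩
    have h2 : ∃ w, X.Tri x y w := by
      by_contra! h'; exact hcon.2 ⟨h.symm e, h'⟩
    obtain ⟨w, hw⟩ := h1
    obtain ⟨w', hw'⟩ := h2
    have e1 := hu _ ⟨(mem_triangles h).2 ⟨_, _, _, hw, rfl⟩, fun c => by simp; tauto⟩
    have e2 := hu _ ⟨(mem_triangles h).2 ⟨_, _, _, hw', rfl⟩, fun c => by simp; tauto⟩
    have e3 : w ∈ ({x, y, w'} : Finset W) := by rw [e2, ← e1]; simp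
    obtain ⟨n1, n2, n3⟩ := h.tri_ne hw
    have : w = w' := by simpa [n2.symm, n3.symm] using e3
    exact h.tri_asymm hw hw' this
  · rintro (hb | hb)
    · exact hp.isBoundaryEdge h hb
    · rw [Finset.pair_comm]; exact hp.isBoundaryEdge h hb

theorem IsPure.exists_tris (hp : X.IsPure) (h : X.IsFlat) {x y : W} (e : X.Edge x y)
    (hn : ¬ IsBoundaryEdge (X.complex h) {x, y}) : ∃ w w', X.Tri x y w ∧ X.Tri y x w' := by
  rw [hp.isBoundaryEdge_iff h e] at hn
  push Not at hn
  by_contra hcon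
  by_cases h1 : ∃ w, X.Tri y x w
  · refine hn.2 ⟨h.symm e, fun w hw => hcon ⟨w, h1.choose, hw, h1.choose_spec⟩⟩
  · exact hn.1 ⟨e, fun w hw => h1 ⟨w, hw⟩⟩

end Boundary

theorem IsFlat.edge_le_two [DecidableEq W] (h : X.IsFlat) {e : Finset W}
    (he : e ∈ edges (X.complex h)) : {t | t ∈ triangles (X.complex h) ∧ e ⊆ t}.encard ≤ 2 := by
  obtain ⟨u, v, e, rfl⟩ := (mem_edges h).1 he
  have one : ∀ x y : W, {t : Finset W | ∃ d, X.Tri x y d ∧ t = {u, v, d}}.encard ≤ 1 := by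
    intro x y
    rw [Set.encard_le_one_iff]
    rintro a b ⟨d, hd, rfl⟩ ⟨d', hd', rfl⟩
    rw [h.tri_unique hd hd']
  have hs : {t | t ∈ triangles (X.complex h) ∧ {u, v} ⊆ t} ⊆
      {t : Finset W | ∃ d, X.Tri u v d ∧ t = {u, v, d}} ∪ {t | ∃ d, X.Tri v u d ∧ t = {u, v, d}} := by
    rintro t ⟨ht, hs⟩
    obtain ⟨a, b, c, e', rfl⟩ := (mem_triangles h).1 ht
    obtain ⟨d, hd, e' | e'⟩ := h.tri_of_subset e' (h.ne e) hs
    · exact Or.inl ⟨d, e', hd⟩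
    · exact Or.inr ⟨d, e', hd⟩
  refine (Set.encard_le_encard hs).trans ((Set.encard_union_le _ _).trans ?_)
  calc _ ≤ (1 : ℕ∞) + 1 := add_le_add (one u v) (one v u)
    _ = 2 := by norm_num

end Sheet

section

variable {W : Type*} {X : Sheet W} {N : ℤ} {S : Set ℤ} {θ : ℤ → ℤ} {p : ℤ → W}

theorem IsDiagram.onVerts (D : IsDiagram X N S θ p) :
    IsDiagram X.onVerts N S θ (fun l => ⟨p l, D.p_mem l⟩) where
  pos := D.pos
  mem_add := D.mem_add
  dir_add := D.dir_add
  p_add l := Subtype.ext (D.p_add l)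
  flat := D.flat.onVerts
  p_mem l := Finset.mem_attach _ _
  stay l hl := Subtype.ext (D.stay l hl)
  bdry l hl := (D.flat.onVerts_bdry _ _).2 (D.bdry l hl)
  dir l hl := D.dir l hl
  surj x y h := by
    obtain ⟨l, hl, h1, h2⟩ := D.surj x y ((D.flat.onVerts_bdry _ _).1 h)
    exact ⟨l, hl, Subtype.ext h1, Subtype.ext h2⟩
  inj l hl m hm h1 h2 := D.inj l hl m hm (congrArg Subtype.val h1) (congrArg Subtype.val h2)
  vertex c x _ := by
    have := D.vertex c x x.2
    have corner : ∀ l, cornerTerm S θ (fun l => (⟨p l, D.p_mem l⟩ : {x // x ∈ X.verts})) x l =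
        cornerTerm S θ p x l := fun l => by
      unfold cornerTerm
      congr 2 <;> congr 1 <;> exact propext Subtype.ext_iff
    rw [D.flat.onVerts_deg, Finset.sum_congr rfl fun l _ => corner l, this]
    congr 2
    exact propext (Subtype.ext_iff (a1 := ⟨p c, D.p_mem c⟩) (a2 := x)).symm

theorem Strands.onVerts {π : ℤ → ℤ} (h : Strands X S p π) (D : IsDiagram X N S θ p) :
    Strands X.onVerts S (fun l => ⟨p l, D.p_mem l⟩) π :=
  fun l hl => D.flat.onVerts_reach (h l hl) _ _ _ _

theorem IsDiagram.exists_pane (D : IsDiagram X N S θ p) (hS : S.Nonempty) (l : ℤ) :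
    ∃ m ∈ S, p m = p l := by
  obtain ⟨s, hs⟩ := hS
  obtain ⟨m, t, rfl, h1, h2⟩ := IsPeriodic.exists_window D.pos l s
  have hm : m ∈ S := (D.toIsPeriodic.add_mul m t).1.1 hs
  by_contra! hcon
  have key : ∀ k, l ≤ k → p k = p l := by
    intro k hk
    induction k, hk using Int.leInduction with
    | base => rfl
    | succ k hk ih => rw [D.stay k fun h => hcon k h ih, ih]
  exact hcon m hm (key m h1)

variable [DecidableEq W]

/-- The boundary is traced by one closed walk, and consecutive panes share a vertex; trivial steps
do not move. -/
theorem IsDiagram.boundary_connected (D : IsDiagram X N S θ p) (hp : X.IsPure)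
    {e e' : Finset W} (he : IsBoundaryEdge (X.complex D.flat) e)
    (he' : IsBoundaryEdge (X.complex D.flat) e') :
    Relation.ReflTransGen (BoundaryStep (X.complex D.flat)) e e' := by
  have pane : ∀ {e}, IsBoundaryEdge (X.complex D.flat) e → ∃ l ∈ S, e = {p l, p (l + 1)} := by
    intro e he
    obtain ⟨x, y, hxy, rfl⟩ := (Sheet.mem_edges D.flat).1 he.1
    rcases (hp.isBoundaryEdge_iff D.flat hxy).1 he with h | h
    · obtain ⟨l, hl, rfl, rfl⟩ := D.surj _ _ h
      exact ⟨l, hl, rfl⟩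
    · obtain ⟨l, hl, rfl, rfl⟩ := D.surj _ _ h
      exact ⟨l, hl, Finset.pair_comm _ _⟩
  have bd : ∀ l ∈ S, IsBoundaryEdge (X.complex D.flat) {p l, p (l + 1)} := fun l hl =>
    hp.isBoundaryEdge D.flat (D.bdry l hl)
  obtain ⟨l, hl, rfl⟩ := pane he
  obtain ⟨m, hm, rfl⟩ := pane he'
  obtain ⟨m, t, rfl, h1, h2⟩ := IsPeriodic.exists_window D.pos l m
  rw [D.toIsPeriodic.p_succ, (D.toIsPeriodic.add_mul m t).2.1]
  have hm : m ∈ S := (D.toIsPeriodic.add_mul m t).1.1 hm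
  have key : ∀ k, l ≤ k → ∃ l' ∈ S, p k ∈ ({p l', p (l' + 1)} : Finset W) ∧
      Relation.ReflTransGen (BoundaryStep (X.complex D.flat)) {p l, p (l + 1)}
        {p l', p (l' + 1)} := by
    intro k hk
    induction k, hk using Int.leInduction with
    | base => exact ⟨l, hl, by simp, .refl⟩
    | succ k hk ih =>
      obtain ⟨l', hl', h3, h4⟩ := ih
      by_cases hkS : k ∈ S
      · exact ⟨k, hkS, by simp, h4.tail ⟨bd k hkS, p k, h3, by simp⟩⟩
      · exact ⟨l', hl', by rw [D.stay k hkS]; exact h3, h4⟩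
  obtain ⟨l', hl', h3, h4⟩ := key m h1
  exact h4.tail ⟨bd m hm, p m, h3, by simp⟩

/-- Purity gives every edge a triangle. A vertex without edges would be a component by itself, but
the complex is connected and contains a pane. -/
theorem IsDiagram.homogeneous (D : IsDiagram X N S θ p) (hp : X.IsPure) (hS : S.Nonempty)
    (hs : IsSimplyConnected (X.complex D.flat)) : IsHomogeneousDimTwo (X.complex D.flat) := by
  have hE : ∀ {x y}, X.Edge x y → ∃ t ∈ triangles (X.complex D.flat), {x, y} ⊆ t := by
    intro x y e
    obtain ⟨w, hw | hw⟩ := hp.tri_or D.flat e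
    · exact ⟨_, (Sheet.mem_triangles D.flat).2 ⟨_, _, _, hw, rfl⟩, fun a => by simp; tauto⟩
    · exact ⟨_, (Sheet.mem_triangles D.flat).2 ⟨_, _, _, hw, rfl⟩, fun a => by simp; tauto⟩
  have hV : ∀ x ∈ X.verts, ∃ y, X.Edge x y := by
    intro x hx
    by_contra! hcon
    obtain ⟨l, hl⟩ := hS
    have hf : ∀ u v, ({u, v} : Finset W) ∈ (X.complex D.flat).faces → (u = x) = (v = x) := by
      intro u v huv
      by_cases hne : u = v
      · rw [hne]
      obtain ⟨a, b, hab, heq⟩ := (Sheet.mem_edges D.flat).1 ⟨huv, Finset.card_pair hne⟩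
      have hax : a ≠ x := fun e => hcon b (e ▸ hab)
      have hbx : b ≠ x := fun e => hcon a (e ▸ D.flat.symm hab)
      have hu : u ∈ ({a, b} : Finset W) := by rw [← heq]; simp
      have hv : v ∈ ({a, b} : Finset W) := by rw [← heq]; simp
      simp only [Finset.mem_insert, Finset.mem_singleton] at hu hv
      rcases hu with rfl | rfl <;> rcases hv with rfl | rfl <;> simp [hax, hbx]
    have h1 := hs.eq_of_edges (fun u => u = x) hf (Or.inl ⟨x, hx, rfl⟩)
      (Or.inl ⟨p l, D.p_mem l, rfl⟩)
    have h2 : p l = x := h1 ▸ rfl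
    exact hcon _ (h2 ▸ (D.bdry l hl).1)
  refine ⟨⟨{p 0}, Or.inl ⟨p 0, D.p_mem 0, rfl⟩⟩, ?_⟩
  rintro s (⟨x, hx, rfl⟩ | ⟨x, y, e, rfl⟩ | ⟨x, y, w, e, rfl⟩)
  · obtain ⟨y, e⟩ := hV x hx
    obtain ⟨t, ht, hs⟩ := hE e
    exact ⟨t, ht, (by simp : ({x} : Finset W) ⊆ {x, y}).trans hs⟩
  · exact hE e
  · exact ⟨_, (Sheet.mem_triangles D.flat).2 ⟨_, _, _, e, rfl⟩, subset_rfl⟩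

theorem IsDiagram.isPlanar [Finite W] (D : IsDiagram X N S θ p) (hp : X.IsPure) (hS : S.Nonempty)
    (hs : IsSimplyConnected (X.complex D.flat)) : IsPlanar (X.complex D.flat) where
  finite := Set.toFinite _
  homogeneous := D.homogeneous hp hS hs
  edge_le_two _ he := D.flat.edge_le_two he
  simply_connected := hs
  boundary_connected _ _ he he' := D.boundary_connected hp he he'
  free_edge C hC hne := by
    obtain ⟨u, v, w, e, ht, hu⟩ := D.flat.exists_free_edge (C.toFinite) hne
      (fun t ht => (Sheet.mem_triangles D.flat).1 (hC ht))
    exact ⟨_, ht, {u, v}, (Sheet.mem_edges D.flat).2 ⟨u, v, D.flat.tri_edge e, rfl⟩,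
      fun a => by simp; tauto, hu⟩

/-- The generalized grid polygon of a diagram. -/
def IsDiagram.polygon [Finite W] (D : IsDiagram X N S θ p) (hp : X.IsPure) (hS : S.Nonempty)
    (hs : IsSimplyConnected (X.complex D.flat)) (hv : ∀ v, v ∈ X.verts) :
    GeneralizedGridPolygon W where
  complex := { X.complex D.flat with singleton_mem := fun v => Or.inl ⟨v, hv v, rfl⟩ }
  toGrid := X.pos
  finite := inferInstance
  homogeneous := D.homogeneous hp hS hs
  simply_connected := hs
  wedge_of_disks := (D.isPlanar hp hS hs).isWedgeOfDisks
  map_simplex := by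
    have hT : ∀ {x y w}, X.Tri x y w →
        ({X.pos x, X.pos y, X.pos w} : Finset (ℤ × ℤ)) ∈ triangularGrid.faces := by
      intro x y w e
      obtain ⟨k, h1, h2⟩ := D.flat.tri_dir e
      rw [← sub_add_cancel (X.pos y) (X.pos x), ← sub_add_cancel (X.pos w) (X.pos x), h1, h2,
        add_comm, add_comm (dirVec (k - 1))]
      exact dirVec_grid _ _
    have ne : ∀ {x y}, X.Edge x y → X.pos x ≠ X.pos y := by
      intro x y e h
      obtain ⟨k, hk⟩ := D.flat.dir e
      rw [h, sub_self] at hk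
      exact dirVec_ne_zero k hk.symm
    rintro s (⟨x, hx, rfl⟩ | ⟨x, y, e, rfl⟩ | ⟨x, y, w, e, rfl⟩)
    · simpa using triangularGrid.singleton_mem _
    · simp only [Finset.image_insert, Finset.image_singleton]
      refine ⟨?_, by rw [Finset.card_pair (ne e), Finset.card_pair (D.flat.ne e)]⟩
      obtain ⟨w, hw | hw⟩ := hp.tri_or D.flat e
      · exact face_mono (K := triangularGrid.toPreAbstractSimplicialComplex) (hT hw)
          (fun a => by simp; tauto) (by simp)
      · exact face_mono (K := triangularGrid.toPreAbstractSimplicialComplex) (hT hw)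
          (fun a => by simp; tauto) (by simp)
    · simp only [Finset.image_insert, Finset.image_singleton]
      refine ⟨hT e, ?_⟩
      have e1 := D.flat.tri_edge e
      have e2 := D.flat.tri_edge (D.flat.tri_rot e)
      have e3 := D.flat.symm (D.flat.tri_edge (D.flat.tri_rot (D.flat.tri_rot e)))
      rw [Finset.card_eq_three.2 ⟨_, _, _, ne e1, ne e3, ne e2, rfl⟩,
        Finset.card_eq_three.2 ⟨_, _, _, D.flat.ne e1, D.flat.ne e3, D.flat.ne e2, rfl⟩]
  interior_vertex v hb := by
    obtain ⟨m, h1, h2⟩ := D.flat.exists_deg v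
    have hpv : ∀ l, p l ≠ v := by
      intro l hl
      obtain ⟨m, hm, hml⟩ := D.exists_pane hS l
      exact hb ⟨_, hp.isBoundaryEdge D.flat (D.bdry m hm), by simp [hml, hl]⟩
    -- At a vertex not visited by the walk there are no exterior sectors, so the angle relation
    -- reads `X.deg v = 6`.
    have h3 := D.vertex 0 v (hv v)
    rw [Finset.sum_eq_zero (fun l _ => by simp [cornerTerm, hpv]), if_neg (hpv 0), h1] at h3
    have : m = 6 := by omega
    rw [this] at h2
    exact h2
  interior_edge e he hb := by
    obtain ⟨x, y, exy, rfl⟩ := (Sheet.mem_edges D.flat).1 he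
    obtain ⟨w, w', hw, hw'⟩ := hp.exists_tris D.flat exy hb
    obtain ⟨n1, n2, n3⟩ := D.flat.tri_ne hw
    refine ⟨{x, y, w}, {y, x, w'}, fun heq => ?_, ?_, ?_⟩
    · have : w ∈ ({y, x, w'} : Finset W) := by rw [← heq]; simp
      exact D.flat.tri_asymm hw hw' (by simpa [n2.symm, n3.symm] using this)
    · ext t
      constructor
      · rintro ⟨ht, hs⟩
        obtain ⟨a, b, c, e', rfl⟩ := (Sheet.mem_triangles D.flat).1 ht
        obtain ⟨d, hd, e' | e'⟩ := D.flat.tri_of_subset e' n1 hs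
        · left; rw [hd, D.flat.tri_unique e' hw]
        · right; rw [hd, D.flat.tri_unique e' hw', Finset.insert_comm]; rfl
      · rintro (rfl | rfl)
        · exact ⟨(Sheet.mem_triangles D.flat).2 ⟨_, _, _, hw, rfl⟩, fun a => by simp; tauto⟩
        · exact ⟨(Sheet.mem_triangles D.flat).2 ⟨_, _, _, hw', rfl⟩, fun a => by simp; tauto⟩
    · obtain ⟨k, h1, h2⟩ := D.flat.tri_dir hw
      have h3 := D.flat.tri_opposite hw hw'
      have h4 : X.pos w' - X.pos x = dirVec (k + 1) := by
        rw [← dirVec_sub, ← h1, ← h2]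
        linear_combination (exp := 1) h3
      rw [Finset.image_insert, Finset.image_insert, Finset.image_singleton, Finset.image_insert,
        Finset.image_insert, Finset.image_singleton]
      have hset : ({X.pos x, X.pos y, X.pos w} ∪ {X.pos y, X.pos x, X.pos w'} : Finset (ℤ × ℤ)) =
          ({0, dirVec k, dirVec (k - 1), dirVec (k + 1)} : Finset (ℤ × ℤ)).image
            (fun a => a + X.pos x) := by
        rw [← h1, ← h2, ← h4]
        ext a
        simp only [Finset.image_insert, Finset.image_singleton, sub_add_cancel, zero_add,
          Finset.mem_union, Finset.mem_insert, Finset.mem_singleton]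
        tauto
      rw [hset, Finset.card_image_of_injective _ (add_left_injective _)]
      have d1 : dirVec k ≠ dirVec (k - 1) := fun h => by rw [dirVec_inj] at h; omega
      have d2 : dirVec k ≠ dirVec (k + 1) := fun h => by rw [dirVec_inj] at h; omega
      have d3 : dirVec (k - 1) ≠ dirVec (k + 1) := fun h => by rw [dirVec_inj] at h; omega
      rw [Finset.card_insert_of_notMem, Finset.card_insert_of_notMem, Finset.card_pair d3]
      · simp [d1, d2]
      · simp [(dirVec_ne_zero _).symm]

end

end GridBilliards

/-! ### Light in a polygon and beams in its sheet. -/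

namespace GridBilliards

open IsChordDiagram (Cls cls_self cls_add cls_eq)

namespace GeneralizedGridPolygon

variable {V : Type*} [DecidableEq V] (P : GeneralizedGridPolygon V)

theorem sheet_pure : P.sheet.IsPure := by
  intro u v h h'
  obtain ⟨hb, w, ht, hw⟩ := (P.bdry_iff u v).1 h
  exact h'.2 w ⟨h.1.1, ht.1, hw⟩

theorem isBoundaryEdge_iff {u v : V} (e : P.sheet.Edge u v) :
    P.IsBoundaryEdge {u, v} ↔ P.sheet.Bdry u v ∨ P.sheet.Bdry v u := by
  rw [← P.sheet_pure.isBoundaryEdge_iff P.sheet_flat e, P.sheet_complex]; rfl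

theorem twiceMidpoint_pair {u v : V} (h : u ≠ v) :
    P.twiceMidpoint {u, v} = P.sheet.pos u + P.sheet.pos v := Finset.sum_pair h

theorem mem_edges {u v : V} (e : P.sheet.Edge u v) : {u, v} ∈ P.edges :=
  ⟨e.2, Finset.card_pair e.1⟩

variable {P}

theorem tri_crosses {u v w : V} (t : P.sheet.Tri u v w) :
    P.CrossesTriangle (P.sheet.pos w - P.sheet.pos u) {u, v} {w, v} ∧
    P.CrossesTriangle (P.sheet.pos w - P.sheet.pos v) {u, v} {u, w} := by
  have e1 := P.sheet_flat.tri_edge t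
  have e2 := P.sheet_flat.symm (P.sheet_flat.tri_edge (P.sheet_flat.tri_rot t))
  have e3 := P.sheet_flat.symm (P.sheet_flat.tri_edge (P.sheet_flat.tri_rot (P.sheet_flat.tri_rot t)))
  refine ⟨⟨P.mem_edges e1, P.mem_edges e2, ⟨_, P.tri_mem t, ?_, ?_⟩, ?_⟩,
    P.mem_edges e1, P.mem_edges e3, ⟨_, P.tri_mem t, ?_, ?_⟩, ?_⟩
  · intro a; simp; tauto
  · intro a; simp; tauto
  · rw [P.twiceMidpoint_pair e1.1, P.twiceMidpoint_pair e2.1]; abel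
  · intro a; simp; tauto
  · intro a; simp; tauto
  · rw [P.twiceMidpoint_pair e1.1, P.twiceMidpoint_pair e3.1]; abel

theorem tri_dirs {u v w : V} (t : P.sheet.Tri u v w) {k : ℤ}
    (hk : P.sheet.pos v - P.sheet.pos u = dirVec k) :
    P.sheet.pos w - P.sheet.pos u = dirVec (k - 1) ∧
    P.sheet.pos w - P.sheet.pos v = dirVec (k - 2) := by
  have h1 : P.sheet.pos w - P.sheet.pos u = dirVec (k - 1) := by
    rw [P.sheet_flat.tri_pos t, hk, rotateCW_dirVec]
  refine ⟨h1, ?_⟩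
  have h2 := dirVec_sub k
  have h3 := dirVec_add_three (k - 2)
  rw [show k - 2 + 3 = k + 1 by ring, ← h2, ← h1, ← hk] at h3
  rw [← neg_inj, ← h3]; abel

/-- A step of a beam crosses a triangle. -/
theorem step_crosses {x y : V} {e : V × V} (h : P.sheet.Step (x, y) e) {a k : ℤ}
    (hk : P.sheet.pos y - P.sheet.pos x = dirVec k) (ha : k / 2 = a) :
    P.CrossesTriangle (dirVec (2 * a - 1)) {x, y} {e.1, e.2} ∧
    (∃ t, P.sheet.Tri x y t) ∧ (∃ t, P.sheet.Tri e.2 e.1 t) ∧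
    ∃ k, P.sheet.pos e.2 - P.sheet.pos e.1 = dirVec k ∧ k / 2 = a := by
  obtain ⟨w, m, t, hm, h⟩ := h
  have hkm : m % 6 = k % 6 := dirVec_inj.1 (hm.symm.trans hk)
  obtain ⟨c1, c2⟩ := tri_crosses t
  obtain ⟨d1, d2⟩ := tri_dirs t hk
  rw [d1] at c1
  rw [d2] at c2
  simp only at c1 c2 d1 d2 hm t
  rcases h with ⟨h, rfl⟩ | ⟨h, rfl⟩
  · refine ⟨by rwa [show 2 * a - 1 = k - 1 by omega], ⟨w, t⟩, ⟨x, P.sheet_flat.tri_rot t⟩,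
      k + 1, ?_, by omega⟩
    rw [← dirVec_sub, ← d1, ← hk]; simp
  · refine ⟨by rwa [show 2 * a - 1 = k - 2 by omega], ⟨w, t⟩,
      ⟨y, P.sheet_flat.tri_rot (P.sheet_flat.tri_rot t)⟩, k - 1, d1, by omega⟩

theorem dirVec_mem_beamDirections (a : ℤ) : dirVec (2 * a - 1) ∈ beamDirections := by
  simp only [beamDirections, Set.mem_insert_iff, Set.mem_singleton_iff]
  rcases dirVec_cases (2 * a - 1) with ⟨h, e⟩ | ⟨h, e⟩ | ⟨h, e⟩ | ⟨h, e⟩ | ⟨h, e⟩ | ⟨h, e⟩ <;>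
    first
    | (exfalso; omega)
    | simp [e]

theorem odd_of_mem_beamDirections {k : ℤ} (h : dirVec k ∈ beamDirections) : k % 2 = 1 := by
  simp only [beamDirections, Set.mem_insert_iff, Set.mem_singleton_iff] at h
  rcases dirVec_cases k with ⟨h', e⟩ | ⟨h', e⟩ | ⟨h', e⟩ | ⟨h', e⟩ | ⟨h', e⟩ | ⟨h', e⟩ <;>
    rw [e] at h <;> simp at h <;> omega

/-- Every step preserves half the direction of the crossed edge, rounded down, so the whole path has
one beam direction. Each edge it passes has a triangle on both sides; the path is nonempty because
no edge is boundary on both sides. -/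
theorem lightHits_of_reach {u v a b : V} (h : P.sheet.Bdry u v) (h' : P.sheet.Bdry a b)
    (hr : P.sheet.Reach (u, v) (b, a)) : P.LightHits {u, v} {a, b} := by
  obtain ⟨k, hk⟩ := P.sheet_flat.dir h.1
  refine ⟨((P.bdry_iff _ _).1 h).1, ((P.bdry_iff _ _).1 h').1, dirVec (2 * (k / 2) - 1),
    dirVec_mem_beamDirections _, ?_⟩
  have key : ∀ e, P.sheet.Reach (u, v) e →
      (∃ m, P.sheet.pos e.2 - P.sheet.pos e.1 = dirVec m ∧ m / 2 = k / 2) ∧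
      (e = (u, v) ∨ (∃ t, P.sheet.Tri e.2 e.1 t) ∧
        P.Beam (dirVec (2 * (k / 2) - 1)) {u, v} {e.1, e.2}) := by
    intro e he
    induction he with
    | refl => exact ⟨⟨k, hk, rfl⟩, Or.inl rfl⟩
    | @tail d e _ hs ih =>
      obtain ⟨x, y⟩ := d
      obtain ⟨⟨m, hm, hm'⟩, ih⟩ := ih
      obtain ⟨c, ⟨t, ht⟩, ⟨t', ht'⟩, hm2⟩ := step_crosses hs hm hm'
      refine ⟨hm2, Or.inr ⟨⟨t', ht'⟩, ?_⟩⟩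
      rcases ih with ih | ⟨⟨s, hs⟩, ih⟩
      · obtain ⟨rfl, rfl⟩ := Prod.mk.inj ih
        exact .start _ c
      · refine .next _ _ ih ?_ c
        rw [P.isBoundaryEdge_iff (P.sheet_flat.tri_edge ht)]
        rintro (hb | hb)
        · exact hb.2 _ hs
        · exact hb.2 _ ht
  rcases (key _ hr).2 with e | ⟨-, hb⟩
  · obtain ⟨rfl, rfl⟩ := Prod.mk.inj e
    exact absurd h' (P.sheet_pure _ _ h)
  · rw [Finset.pair_comm a b]; exact hb

/-- The direction modulo `6` excludes the triangle on the left of the edge, and on the right it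
selects the exit side according to the parity of `k`. -/
theorem step_of_crosses {x y : V} {e : Finset V} {k : ℤ} (hE : P.sheet.Edge x y)
    (hk : P.sheet.pos y - P.sheet.pos x = dirVec k)
    (h : P.CrossesTriangle (dirVec (2 * (k / 2) - 1)) {x, y} e) :
    ∃ d, P.sheet.Step (x, y) d ∧ e = {d.1, d.2} := by
  obtain ⟨-, he, ⟨t, ht, h1, h2⟩, h3⟩ := h
  have sides : ∀ {u v w : V}, P.sheet.Tri u v w → ({x, y} : Finset V) = {u, v} → e ⊆ {u, v, w} →
      e = {w, v} ∧ P.sheet.pos w - P.sheet.pos u = dirVec (2 * (k / 2) - 1) ∨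
      e = {u, w} ∧ P.sheet.pos w - P.sheet.pos v = dirVec (2 * (k / 2) - 1) := by
    intro u v w t huv hs
    obtain ⟨n1, n2, n3⟩ := P.tri_ne t
    rw [huv] at h3
    have hne : e ≠ {u, v} := fun h => by
      rw [h, sub_self] at h3
      exact dirVec_ne_zero _ h3.symm
    obtain ⟨a, b, hab, rfl⟩ := Finset.card_eq_two.1 he.2
    have ha := hs (Finset.mem_insert_self a _)
    have hb := hs (Finset.mem_insert_of_mem (Finset.mem_singleton_self b))
    have q1 : ({a, b} : Finset V) = {w, v} → P.sheet.pos w - P.sheet.pos u = dirVec (2 * (k / 2) - 1) := by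
      intro h
      rw [h, P.twiceMidpoint_pair n1, P.twiceMidpoint_pair n2.symm] at h3
      rw [← h3]; abel
    have q2 : ({a, b} : Finset V) = {u, w} → P.sheet.pos w - P.sheet.pos v = dirVec (2 * (k / 2) - 1) := by
      intro h
      rw [h, P.twiceMidpoint_pair n1, P.twiceMidpoint_pair n3] at h3
      rw [← h3]; abel
    suffices ({a, b} : Finset V) = {w, v} ∨ ({a, b} : Finset V) = {u, w} from
      this.imp (fun h => ⟨h, q1 h⟩) (fun h => ⟨h, q2 h⟩)
    simp only [Finset.mem_insert, Finset.mem_singleton] at ha hb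
    rcases ha with rfl | rfl | rfl <;> rcases hb with rfl | rfl | rfl <;>
      first
      | exact absurd rfl hab
      | exact absurd rfl hne
      | exact absurd (Finset.pair_comm _ _) hne
      | exact Or.inl rfl
      | exact Or.inr rfl
      | exact Or.inl (Finset.pair_comm _ _)
      | exact Or.inr (Finset.pair_comm _ _)
  obtain ⟨w, rfl, t | t⟩ := P.exists_third hE ht h1
  · obtain ⟨d1, d2⟩ := tri_dirs t hk
    rcases sides t rfl h2 with ⟨rfl, hd⟩ | ⟨rfl, hd⟩
    · rw [d1, dirVec_inj] at hd
      exact ⟨(w, y), ⟨w, k, t, hk, Or.inl ⟨by omega, rfl⟩⟩, rfl⟩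
    · rw [d2, dirVec_inj] at hd
      exact ⟨(x, w), ⟨w, k, t, hk, Or.inr ⟨by omega, rfl⟩⟩, rfl⟩
  · have hk' : P.sheet.pos x - P.sheet.pos y = dirVec (k + 3) := by
      rw [dirVec_add_three, ← hk]; abel
    obtain ⟨d1, d2⟩ := tri_dirs t hk'
    rcases sides t (Finset.pair_comm _ _) (by rwa [Finset.insert_comm]) with ⟨rfl, hd⟩ | ⟨rfl, hd⟩
    · rw [d1, dirVec_inj] at hd; omega
    · rw [d2, dirVec_inj] at hd; omega

theorem step_unique {d e e' : V × V} (h : P.sheet.Step d e) (h' : P.sheet.Step d e') : e = e' := by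
  obtain ⟨w, k, t, hk, h⟩ := h
  obtain ⟨w', k', t', hk', h'⟩ := h'
  have := P.sheet_flat.tri_unique t t'
  subst this
  have : k % 6 = k' % 6 := dirVec_inj.1 (hk.symm.trans hk')
  rcases h with ⟨h, rfl⟩ | ⟨h, rfl⟩ <;> rcases h' with ⟨h', rfl⟩ | ⟨h', rfl⟩ <;>
    first
    | rfl
    | (exfalso; omega)

theorem reach_of_lightHits {u v : V} {e : Finset V} (h : P.sheet.Bdry u v)
    (hl : P.LightHits {u, v} e) :
    ∃ d, P.sheet.Reach (u, v) d ∧ e = {d.1, d.2} ∧ ∀ d', ¬ P.sheet.Step d d' := by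
  obtain ⟨k, hk⟩ := P.sheet_flat.dir h.1
  obtain ⟨-, heb, D, hD, hb⟩ := hl
  -- From a boundary pane of direction `k` the candidates are `k - 1` and `k - 2`; beam directions
  -- are odd, which leaves one.
  have hfirst : ∀ e', P.CrossesTriangle D {u, v} e' → D = dirVec (2 * (k / 2) - 1) := by
    rintro e' ⟨-, he', ⟨t, ht, h1, h2⟩, h3⟩
    obtain ⟨w, rfl, t | t⟩ := P.exists_third h.1 ht h1
    · obtain ⟨n1, n2, n3⟩ := P.tri_ne t
      obtain ⟨d1, d2⟩ := tri_dirs t hk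
      obtain ⟨a, b, hab, rfl⟩ := Finset.card_eq_two.1 he'.2
      have ha := h2 (Finset.mem_insert_self a _)
      have hb := h2 (Finset.mem_insert_of_mem (Finset.mem_singleton_self b))
      rw [P.twiceMidpoint_pair hab, P.twiceMidpoint_pair n1] at h3
      have hD0 : D ≠ 0 := by
        rintro rfl
        simp [beamDirections, Prod.ext_iff] at hD
      have c1 : D = P.sheet.pos w - P.sheet.pos u → D = dirVec (2 * (k / 2) - 1) := by
        intro e
        rw [d1] at e
        rw [e] at hD ⊢
        have := odd_of_mem_beamDirections hD
        exact congrArg dirVec (by omega)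
      have c2 : D = P.sheet.pos w - P.sheet.pos v → D = dirVec (2 * (k / 2) - 1) := by
        intro e
        rw [d2] at e
        rw [e] at hD ⊢
        have := odd_of_mem_beamDirections hD
        exact congrArg dirVec (by omega)
      simp only [Finset.mem_insert, Finset.mem_singleton] at ha hb
      rcases ha with rfl | rfl | rfl <;> rcases hb with rfl | rfl | rfl <;>
        first
        | exact absurd rfl hab
        | exact absurd (h3.symm.trans (by abel1)) hD0
        | exact c1 (h3.symm.trans (by abel1))
        | exact c2 (h3.symm.trans (by abel1))
    · exact absurd t (h.2 w)
  have hDk : D = dirVec (2 * (k / 2) - 1) := by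
    clear heb
    induction hb with
    | start e' h => exact hfirst e' h
    | next e' e'' _ _ _ ih => exact ih
  subst hDk
  have key : ∃ d, P.sheet.Reach (u, v) d ∧ e = {d.1, d.2} ∧ (∃ t, P.sheet.Tri d.2 d.1 t) ∧
      ∃ m, P.sheet.pos d.2 - P.sheet.pos d.1 = dirVec m ∧ m / 2 = k / 2 := by
    clear heb
    induction hb with
    | start e' hc =>
      obtain ⟨d, hs, he⟩ := step_of_crosses h.1 hk hc
      obtain ⟨-, -, h1, h2⟩ := step_crosses hs hk rfl
      exact ⟨d, .single hs, he, h1, h2⟩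
    | next e' e'' _ _ hc ih =>
      obtain ⟨d, hr, rfl, ⟨t, ht⟩, m, hm, hm'⟩ := ih
      rw [← hm'] at hc
      obtain ⟨d', hs, he⟩ := step_of_crosses (P.sheet_flat.symm (P.sheet_flat.tri_edge ht)) hm hc
      obtain ⟨-, -, h1, h2⟩ := step_crosses hs hm hm'
      exact ⟨d', hr.tail hs, he, h1, h2⟩
  obtain ⟨d, hr, rfl, ⟨t, ht⟩, -⟩ := key
  refine ⟨d, hr, rfl, ?_⟩
  rintro d' ⟨w, m, hw, -⟩
  rcases (P.isBoundaryEdge_iff (P.sheet_flat.tri_edge hw)).1 heb with hb | hb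
  · exact hb.2 _ ht
  · exact hb.2 _ hw

/-- A pane emits only one beam. -/
theorem lightHits_unique {u v : V} {e e' : Finset V} (h : P.sheet.Bdry u v)
    (hl : P.LightHits {u, v} e) (hl' : P.LightHits {u, v} e') : e = e' := by
  obtain ⟨d, hr, rfl, hd⟩ := reach_of_lightHits h hl
  obtain ⟨d', hr', rfl, hd'⟩ := reach_of_lightHits h hl'
  have halt : ∀ {d d' : V × V}, (∀ e, ¬ P.sheet.Step d e) → P.sheet.Reach d d' → d' = d := by
    intro d d' hd hr
    rcases Relation.ReflTransGen.cases_head hr with h | ⟨c, h, -⟩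
    · exact h.symm
    · exact absurd h (hd c)
  have huniq : Relator.RightUnique P.sheet.Step := fun _ _ _ h h' => step_unique h h'
  rcases Relation.ReflTransGen.total_of_right_unique huniq hr hr'
    with h | h
  · rw [halt hd h]
  · rw [halt hd' h]

/-- A beam is not reflected back along itself. -/
theorem not_lightHits_symm {e e' : Finset V} (h : P.LightHits e e') : ¬ P.LightHits e' e := by
  intro h'
  -- A beam displaces midpoints by a positive multiple of its direction. Positive multiples of two
  -- of the three beam directions never cancel, so there is no way back.
  have key : ∀ {d : ℤ × ℤ} {e e' : Finset V}, P.Beam d e e' →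
      ∃ j : ℤ, 0 < j ∧ P.twiceMidpoint e' - P.twiceMidpoint e = j • d := by
    intro d e e' hb
    induction hb with
    | start e' h => exact ⟨1, one_pos, by rw [h.2.2.2, one_smul]⟩
    | next e' e'' _ _ h ih =>
      obtain ⟨j, hj, hje⟩ := ih
      refine ⟨j + 1, by omega, ?_⟩
      rw [add_smul, one_smul, ← hje, ← h.2.2.2]; abel
  obtain ⟨-, -, d, hd, hb⟩ := h
  obtain ⟨-, -, d', hd', hb'⟩ := h'
  obtain ⟨j, hj, h1⟩ := key hb
  obtain ⟨j', hj', h2⟩ := key hb'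
  have h3 : j • d + j' • d' = 0 := by rw [← h1, ← h2]; abel
  simp only [beamDirections, Set.mem_insert_iff, Set.mem_singleton_iff] at hd hd'
  rcases hd with rfl | rfl | rfl <;> rcases hd' with rfl | rfl | rfl <;>
    simp [Prod.ext_iff] at h3 <;> omega

end GeneralizedGridPolygon

section

variable {W : Type*} [DecidableEq W] [Finite W] {X : Sheet W} {N : ℤ} {S : Set ℤ} {θ : ℤ → ℤ}
  {p : ℤ → W} (D : IsDiagram X N S θ p) (hp : X.IsPure) (hS : S.Nonempty)
  (hs : IsSimplyConnected (X.complex D.flat)) (hv : ∀ v, v ∈ X.verts)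

theorem IsDiagram.polygon_edge (x y : W) :
    (D.polygon hp hS hs hv).sheet.Edge x y ↔ X.Edge x y := by
  constructor
  · rintro ⟨h1, h2⟩
    obtain ⟨a, b, hab, heq⟩ := (Sheet.mem_edges D.flat).1 ⟨h2, Finset.card_pair h1⟩
    have hx : x ∈ ({a, b} : Finset W) := by rw [← heq]; simp
    have hy : y ∈ ({a, b} : Finset W) := by rw [← heq]; simp
    simp only [Finset.mem_insert, Finset.mem_singleton] at hx hy
    rcases hx with rfl | rfl <;> rcases hy with rfl | rfl
    · exact absurd rfl h1
    · exact hab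
    · exact D.flat.symm hab
    · exact absurd rfl h1
  · intro h
    exact ⟨D.flat.ne h, Or.inr (Or.inl ⟨x, y, h, rfl⟩)⟩

theorem IsDiagram.polygon_tri (x y w : W) :
    (D.polygon hp hS hs hv).sheet.Tri x y w ↔ X.Tri x y w := by
  constructor
  · intro h
    obtain ⟨a, b, c, t, heq⟩ := (Sheet.mem_triangles D.flat).1 ((D.polygon hp hS hs hv).tri_mem h)
    have n := (D.polygon hp hS hs hv).tri_ne h
    have hw : ∀ {d}, ({a, b, c} : Finset W) = {x, y, d} → d = w := by
      intro d hd
      have : w ∈ ({x, y, d} : Finset W) := by rw [← hd, ← heq]; simp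
      simpa [n.2.1.symm, n.2.2.symm, eq_comm] using this
    obtain ⟨d, hd, t' | t'⟩ := D.flat.tri_of_subset t h.1 (by
      rw [← heq]; intro a; simp; tauto)
    · rwa [← hw hd]
    · rw [hw hd] at t'
      exfalso
      have h' : (D.polygon hp hS hs hv).sheet.Tri y x w :=
        ⟨h.1.symm, Or.inr (Or.inr ⟨_, _, _, t', rfl⟩), D.flat.tri_pos t'⟩
      exact (D.polygon hp hS hs hv).sheet_flat.tri_asymm h h' rfl
  · intro h
    exact ⟨(D.flat.tri_ne h).1, Or.inr (Or.inr ⟨_, _, _, h, rfl⟩), D.flat.tri_pos h⟩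

theorem IsDiagram.polygon_bdry (x y : W) :
    (D.polygon hp hS hs hv).sheet.Bdry x y ↔ X.Bdry x y := by
  simp only [Sheet.Bdry, D.polygon_edge, D.polygon_tri]

theorem IsDiagram.polygon_reach {d e : W × W} (h : X.Reach d e) :
    (D.polygon hp hS hs hv).sheet.Reach d e := by
  refine Relation.ReflTransGen.mono ?_ _ _ h
  rintro d e ⟨w, k, h1, h2, h3⟩
  exact ⟨w, k, (D.polygon_tri hp hS hs hv _ _ _).2 h1, h2, h3⟩

theorem IsDiagram.polygon_strands {π : ℤ → ℤ} (hπ : Strands X S p π) {l : ℤ} (hl : l ∈ S)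
    (hl' : π l ∈ S) :
    (D.polygon hp hS hs hv).LightHits {p l, p (l + 1)} {p (π l), p (π l + 1)} :=
  GeneralizedGridPolygon.lightHits_of_reach ((D.polygon_bdry hp hS hs hv _ _).2 (D.bdry l hl))
    ((D.polygon_bdry hp hS hs hv _ _).2 (D.bdry _ hl')) (D.polygon_reach hp hS hs hv (hπ l hl))

end

end GridBilliards

/-! ### Assembling the new polygon. -/

namespace GridBilliards

open IsChordDiagram (Cls cls_self cls_add cls_eq)

section

variable {W : Type*} {X : Sheet W} {n : ℕ} [NeZero n] {T : Finset (Fin n)} {θ : ℤ → ℤ}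
  {p : ℤ → W}

theorem cyc_eq_coe {l : ℤ} {i : Fin n} (h0 : 0 ≤ l) (hn : l < n) (h : cyc n l = i) :
    l = (i.val : ℤ) := by
  rw [← h, cyc_val, Int.emod_eq_of_lt h0 hn]

theorem cyc_eq_coe_add {l : ℤ} {i : Fin n} (h0 : n ≤ l) (hn : l < 2 * n) (h : cyc n l = i) :
    l = (i.val : ℤ) + n := by
  have := cyc_eq_coe (l := l - n) (i := i) (by omega) (by omega) (by
    rw [← h, ← cyc_add (l - n), sub_add_cancel])
  omega

/-- The panes of a diagram, enumerated in increasing order, form a closed walk. -/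
theorem IsDiagram.p_finRotate (D : IsDiagram X n {l | cyc n l ∈ T} θ p) (k : Fin T.card) :
    p (T.orderEmbOfFin rfl (finRotate _ k)) = p ((T.orderEmbOfFin rfl k).val + 1) := by
  set σ := T.orderEmbOfFin rfl with hσ
  have hidx : ∀ l, cyc n l ∈ T → ∃ j, cyc n l = σ j := by
    intro l hl
    have : cyc n l ∈ Set.range σ := by rw [hσ, Finset.range_orderEmbOfFin]; exact hl
    obtain ⟨j, hj⟩ := this
    exact ⟨j, hj.symm⟩
  have hlt : ∀ {i j : Fin T.card}, ((σ i).val : ℤ) < (σ j).val ↔ i < j := by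
    intro i j
    rw [Nat.cast_lt, Fin.val_fin_lt, σ.lt_iff_lt]
  obtain ⟨m, hm⟩ : ∃ m, T.card = m + 1 := ⟨T.card - 1, by have := k.2; omega⟩
  have hrot : ((finRotate _ k).val = k.val + 1 ∧ k.val + 1 < T.card) ∨
      ((finRotate _ k).val = 0 ∧ k.val + 1 = T.card) := by
    clear_value σ
    clear hlt hidx hσ σ
    generalize T.card = c at k hm
    subst hm
    rw [coe_finRotate]
    by_cases h : k = Fin.last m
    · right; simp [h]
    · left
      rw [if_neg h]
      have : k.val ≠ m := fun e => h (Fin.ext e)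
      exact ⟨rfl, by omega⟩
  have hs := (σ k).2
  -- No pane lies between consecutive elements of `T`, or between the last element and the first one
  -- of the next period, so the walk is constant there.
  rcases hrot with ⟨h1, h2⟩ | ⟨h1, h2⟩
  · have hk : k < finRotate _ k := by rw [Fin.lt_def, h1]; omega
    refine D.const (a := (σ k).val + 1) (b := (σ (finRotate _ k)).val) (fun l hl1 hl2 hl => ?_) _ ?_ le_rfl
    · obtain ⟨j, hj⟩ := hidx l hl
      have hb := (σ (finRotate _ k)).2
      have := cyc_eq_coe (by omega) (by omega) hj
      have a1 := hlt.1 (show ((σ k).val : ℤ) < (σ j).val by omega)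
      have a2 := hlt.1 (show ((σ j).val : ℤ) < (σ (finRotate _ k)).val by omega)
      rw [Fin.lt_def] at a1 a2
      omega
    · have := hlt.2 hk
      omega
  · rw [← D.p_add]
    refine D.const (a := (σ k).val + 1) (b := (σ (finRotate _ k)).val + n) (fun l hl1 hl2 hl => ?_) _ ?_ le_rfl
    · obtain ⟨j, hj⟩ := hidx l hl
      have hb := (σ (finRotate _ k)).2
      have hj2 := j.2
      by_cases hln : l < n
      · have := cyc_eq_coe (by omega) hln hj
        have a1 := hlt.1 (show ((σ k).val : ℤ) < (σ j).val by omega)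
        rw [Fin.lt_def] at a1
        omega
      · have := cyc_eq_coe_add (by omega) (by omega) hj
        have a1 := hlt.1 (show ((σ j).val : ℤ) < (σ (finRotate _ k)).val by omega)
        rw [Fin.lt_def] at a1
        omega
    · omega

variable [DecidableEq W] [Finite W]

/-- The boundary walk of a diagram is a boundary loop of its polygon. -/
theorem IsDiagram.isBoundaryLoop (D : IsDiagram X n {l | cyc n l ∈ T} θ p) (hp : X.IsPure)
    (hS : {l | cyc n l ∈ T}.Nonempty) (hs : IsSimplyConnected (X.complex D.flat))
    (hv : ∀ v, v ∈ X.verts) :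
    (D.polygon hp hS hs hv).IsBoundaryLoop (fun k => p (T.orderEmbOfFin rfl k)) := by
  have hT : ∀ k, ((T.orderEmbOfFin rfl k).val : ℤ) ∈ {l | cyc n l ∈ T} := fun k => by
    change cyc n _ ∈ T
    rw [cyc_coe]
    exact Finset.orderEmbOfFin_mem _ _ _
  refine ⟨fun k => ?_, fun u v h => ?_⟩
  · simp only [D.p_finRotate]
    rw [← GeneralizedGridPolygon.bdry_iff, D.polygon_bdry]
    exact D.bdry _ (hT k)
  · rw [← GeneralizedGridPolygon.bdry_iff, D.polygon_bdry] at h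
    simp only [D.p_finRotate]
    obtain ⟨l, hl, rfl, rfl⟩ := D.surj _ _ h
    have : cyc n l ∈ Set.range (T.orderEmbOfFin rfl) := by
      rw [Finset.range_orderEmbOfFin]; exact hl
    obtain ⟨k, hk⟩ := this
    have hc : Cls n l (T.orderEmbOfFin rfl k).val := cyc_cls (by rw [cyc_coe, hk])
    obtain ⟨e1, e2⟩ := D.toIsPeriodic.p_cls hc
    refine ⟨k, ⟨e1, e2⟩, fun k' ⟨e3, e4⟩ => ?_⟩
    obtain ⟨t, ht⟩ := D.inj _ (hT k') _ (hT k) (e3.trans e1.symm) (e4.trans e2.symm)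
    have h3 : cyc n (T.orderEmbOfFin rfl k').val = cyc n (T.orderEmbOfFin rfl k).val := by
      rw [ht, cyc_eq_iff]; simp
    rw [cyc_coe, cyc_coe] at h3
    exact (T.orderEmbOfFin rfl).injective h3

end

/-- The complement of the support of a cycle factor is invariant. -/
theorem notMem_support_apply_iff {α : Type*} [DecidableEq α] [Fintype α] {π c : Equiv.Perm α}
    (hc : c ∈ π.cycleFactorsFinset) (j : α) : π j ∉ c.support ↔ j ∉ c.support := by
  obtain ⟨-, hf⟩ := Equiv.Perm.mem_cycleFactorsFinset_iff.1 hc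
  rw [not_iff_not]
  constructor
  · intro h
    have h1 : c⁻¹ (π j) ∈ c.support := by
      rw [← Equiv.Perm.apply_mem_support, Equiv.Perm.inv_def, Equiv.apply_symm_apply]; exact h
    have h2 := hf _ h1
    rw [Equiv.Perm.inv_def, Equiv.apply_symm_apply] at h2
    rw [π.injective h2]
    exact h1
  · intro h
    rw [← hf j h]
    exact Equiv.Perm.apply_mem_support.2 h

/-- A pane emits one beam, so chord and permutation lead to the same unoriented edge. Purity rules
out the opposite orientation, and an oriented boundary edge occurs once in the loop. -/
theorem GeneralizedGridPolygon.IsBoundaryLoop.cyc_strand {V : Type*} [DecidableEq V] {P : GeneralizedGridPolygon V} {n : ℕ}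
    [NeZero n] {x : Fin n → V} (hx : P.IsBoundaryLoop x) {π : Equiv.Perm (Fin n)}
    (hπ : P.IsBilliardsPermutation x π) {ρ : ℤ → ℤ}
    (hρ : Strands P.sheet Set.univ (fun l => x (cyc n l)) ρ) (l : ℤ) :
    cyc n (ρ l) = π (cyc n l) := by
  have b : ∀ l, P.sheet.Bdry (x (cyc n l)) (x (cyc n (l + 1))) := fun l => by
    rw [← finRotate_cyc]; exact hx.bdry _
  have h1 := GeneralizedGridPolygon.lightHits_of_reach (b l) (b (ρ l)) (hρ l (Set.mem_univ l))
  have h2 := hπ (cyc n l)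
  rw [finRotate_cyc] at h2
  have h3 := GeneralizedGridPolygon.lightHits_unique (b l) h1 h2
  have b2 := hx.bdry (π (cyc n l))
  have hr := hx.bdry (cyc n (ρ l))
  rw [← finRotate_cyc] at h3
  have hu : x (cyc n (ρ l)) ∈ ({x (π (cyc n l)), x (finRotate n (π (cyc n l)))} : Finset V) := by
    rw [← h3]; simp
  have hv : x (finRotate n (cyc n (ρ l))) ∈
      ({x (π (cyc n l)), x (finRotate n (π (cyc n l)))} : Finset V) := by
    rw [← h3]; simp
  have hne := hr.1.1
  simp only [Finset.mem_insert, Finset.mem_singleton] at hu hv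
  rcases hu with hu | hu <;> rcases hv with hv | hv
  · exact absurd (hu.trans hv.symm) hne
  · exact (hx.2 _ _ (hx.1 (cyc n (ρ l)))).unique ⟨rfl, rfl⟩ ⟨hu.symm, hv.symm⟩
  · rw [hu, hv] at hr
    exact absurd b2 (P.sheet_pure _ _ hr)
  · exact absurd (hu.trans hv.symm) hne

/-- A diagram is pure if its chord diagram has no two mutually inverse chords. -/
theorem IsDiagram.isPure {W : Type*} {X : Sheet W} {N : ℤ} {S : Set ℤ} {θ π : ℤ → ℤ} {p : ℤ → W}
    (D : IsDiagram X N S θ p) (hπ : Strands X S p π) (hS : ∀ l ∈ S, π l ∈ S)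
    (h : ∀ l ∈ S, ∀ m ∈ S, Cls N m (π l) → ¬ Cls N l (π m)) : X.IsPure := by
  intro x y hxy hyx
  -- If both sides of an edge are free, the beam from either side stops immediately, so the two
  -- panes hit each other. The hypothesis forbids this.
  have halt : ∀ {x y : W} {e : W × W}, X.Bdry y x → X.Reach (x, y) e → e = (x, y) := by
    intro x y e hb hr
    rcases Relation.ReflTransGen.cases_head hr with h | ⟨c, ⟨w, k, hw, -⟩, -⟩
    · exact h.symm
    · exact absurd hw (hb.2 w)
  obtain ⟨l, hl, rfl, rfl⟩ := D.surj _ _ hxy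
  obtain ⟨m, hm, h1, h2⟩ := D.surj _ _ hyx
  obtain ⟨e1, e2⟩ := Prod.mk.inj (halt hyx (hπ l hl))
  have hr := hπ m hm
  rw [h1, h2] at hr
  obtain ⟨e3, e4⟩ := Prod.mk.inj (halt hxy hr)
  exact h l hl m hm (D.inj m hm _ (hS l hl) (h1.trans e2.symm) (h2.trans e1.symm))
    (D.inj l hl _ (hS m hm) e4.symm e3.symm)

end GridBilliards

theorem theorem2p4 {V : Type*} [DecidableEq V]
    (P : GridBilliards.GeneralizedGridPolygon V)
    (n : ℕ) (x : Fin n → V) (hx : P.IsBoundaryLoop x)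
    (π : Equiv.Perm (Fin n)) (hπ : P.IsBilliardsPermutation x π)
    (c : Equiv.Perm (Fin n)) (hc : c ∈ π.cycleFactorsFinset)
    (hne : ∃ j, j ∉ c.support) :
    ∃ (W : Type) (_ : DecidableEq W) (Q : GridBilliards.GeneralizedGridPolygon W)
      (m : ℕ) (y : Fin m → W) (π' : Equiv.Perm (Fin m)) (σ : Fin m ↪o Fin n),
      Set.range σ = {j | j ∉ c.support} ∧
      Q.IsBoundaryLoop y ∧
      Q.IsBilliardsPermutation y π' ∧
      (∀ k, Q.vec (y k) (y (finRotate m k)) = P.vec (x (σ k)) (x (finRotate n (σ k)))) ∧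
      ∀ k, σ (π' k) = π (σ k) := by
  classical
  obtain ⟨j, hj⟩ := hne
  have : NeZero n := ⟨fun h => by subst h; exact j.elim0⟩
  obtain ⟨θ, D₀⟩ := hx.exists_diagram
  obtain ⟨ρ, hρ, hst⟩ := D₀.exists_chordDiagram
  have hcyc : ∀ l, GridBilliards.cyc n (ρ l) = π (GridBilliards.cyc n l) :=
    GridBilliards.GeneralizedGridPolygon.IsBoundaryLoop.cyc_strand hx hπ hst
  let T : Finset (Fin n) := Finset.univ.filter (· ∉ c.support)
  have hT : ∀ j, j ∈ T ↔ j ∉ c.support := fun j => by simp [T]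
  have hTπ : ∀ j, π j ∈ T ↔ j ∈ T := fun j => by
    rw [hT, hT, GridBilliards.notMem_support_apply_iff hc]
  -- The indices outside the cycle are invariant under `π`, so deleting the cycle leaves a chord
  -- diagram with the same `θ` and the same chords.
  have hρ' : GridBilliards.IsChordDiagram n {l | GridBilliards.cyc n l ∈ T} θ ρ :=
    hρ.restrict (Set.subset_univ _) (fun l => by
      change GridBilliards.cyc n _ ∈ T ↔ GridBilliards.cyc n _ ∈ T
      rw [GridBilliards.cyc_add]) (fun l _ => by
      change GridBilliards.cyc n _ ∈ T ↔ GridBilliards.cyc n _ ∈ T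
      rw [hcyc, hTπ])
  have hS : {l | GridBilliards.cyc n l ∈ T}.Nonempty := ⟨j.val, by
    change GridBilliards.cyc n _ ∈ T
    rw [GridBilliards.cyc_coe, hT]; exact hj⟩
  obtain ⟨X, p, D, hstr, hs⟩ := hρ'.realize
  -- Two remaining chords that hit each other would already be two beams of `P` travelling back and
  -- forth between the same panes.
  have hpure : X.IsPure := by
    refine D.isPure hstr hρ'.map_mem fun l _ m _ h1 h2 => ?_
    have b : ∀ l, P.sheet.Bdry (x (GridBilliards.cyc n l)) (x (GridBilliards.cyc n (l + 1))) :=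
      fun l => D₀.bdry l (Set.mem_univ l)
    have hit := fun l => GridBilliards.GeneralizedGridPolygon.lightHits_of_reach (b l) (b (ρ l))
      (hst l (Set.mem_univ l))
    have k1 := hit l
    have k2 := hit m
    obtain ⟨a1, a2⟩ := D₀.toIsPeriodic.p_cls h1
    obtain ⟨a3, a4⟩ := D₀.toIsPeriodic.p_cls h2
    rw [a1, a2] at k1
    rw [a3, a4] at k2
    exact GridBilliards.GeneralizedGridPolygon.not_lightHits_symm k1 k2
  -- The sheet uses finitely many elements of `ℕ`, while every element of the type of a polygon is a
  -- vertex; hence the restriction to the vertices.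
  have D' := D.onVerts
  have hstr' := hstr.onVerts D
  have hpure' : X.onVerts.IsPure := fun u v h h' => hpure u v
    ((D.flat.onVerts_bdry u v).1 h) ((D.flat.onVerts_bdry v u).1 h')
  have hv : ∀ v, v ∈ X.onVerts.verts := fun v => Finset.mem_attach _ v
  have hs' := D.flat.onVerts_simplyConnected hs
  set σ := T.orderEmbOfFin rfl with hσ
  have hσT : ∀ k, σ k ∈ T := fun k => Finset.orderEmbOfFin_mem _ _ _
  have hf : ∀ k, ∃ k', σ k' = π (σ k) := fun k => by
    have : π (σ k) ∈ Set.range σ := by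
      rw [hσ, Finset.range_orderEmbOfFin]; exact (hTπ _).2 (hσT k)
    exact this
  choose f hf using hf
  have hfi : Function.Injective f := fun k k' h => by
    apply σ.injective
    apply π.injective
    rw [← hf, ← hf, h]
  have hmem : ∀ k, ((σ k).val : ℤ) ∈ {l | GridBilliards.cyc n l ∈ T} := fun k => by
    change GridBilliards.cyc n _ ∈ T
    rw [GridBilliards.cyc_coe]; exact hσT k
  refine ⟨{v // v ∈ X.verts}, inferInstance, D'.polygon hpure' hS hs' hv, T.card,
    fun k => ⟨p (σ k), D.p_mem _⟩, Equiv.ofBijective f (Finite.injective_iff_bijective.1 hfi), σ,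
    ?_, D'.isBoundaryLoop hpure' hS hs' hv, fun k => ?_, fun k => ?_, hf⟩
  · rw [hσ, Finset.range_orderEmbOfFin]
    ext j; simp [T]
  · have h1 := D'.polygon_strands hpure' hS hs' hv hstr' (hmem k) (hρ'.map_mem _ (hmem k))
    have hc : GridBilliards.IsChordDiagram.Cls n (σ (f k)).val (ρ (σ k).val) :=
      GridBilliards.cyc_cls (by rw [hcyc, GridBilliards.cyc_coe, GridBilliards.cyc_coe, hf])
    obtain ⟨a1, a2⟩ := D'.toIsPeriodic.p_cls hc
    rw [a1, a2, ← D'.p_finRotate, ← D'.p_finRotate] at h1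
    exact h1
  -- Both diagrams have the same direction function, so the boundary vectors agree.
  · have h1 := D'.dir _ (hmem k)
    have h2 := D₀.dir (σ k).val (Set.mem_univ _)
    rw [← D'.p_finRotate] at h1
    rw [← GridBilliards.finRotate_cyc, GridBilliards.cyc_coe] at h2
    exact h1.trans h2.symm
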